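/- **Setting.** Let $M$ be a smooth manifold (finite-dimensional, Hausdorff, $\sigma$-compact, without boundary), let $A,E,C\to M$ be smooth vector bundles of finite rank, and let $A$ carry a Lie algebroid structure with anchor $\rho_A$ and bracket $[\cdot,\cdot]_A$. Let $D$ be a double vector bundle with side bundles $A$ and $E$ and core $C$: a commutative square of vector bundles $D\to E\to M$, $D\to A\to M$ in which $q_A(d_1+_Ed_2)=q_A(d_1)+q_A(d_2)$, $q_E(d_1+_Ad_3)=q_E(d_1)+q_E(d_3)$ and $(d_1+_Ed_2)+_A(d_3+_Ed_4)=(d_1+_Ad_3)+_E(d_2+_Ad_4)$ whenever the sums on the left are defined (and, in the last equation, also those on the right); the core $C$ is the intersection of the kernels of the projections $q_E,q_A$ of $D$ to $E$ and $A$, with embedding $\iota:C\to D$. A section $X\in\Gamma(D,E)$ is *linear* if it is a bundle morphism from $E\to M$ to $D\to A$; it then projects to a section of $A$. The *core section* of $D\to E$ given by $\alpha\in\Gamma(C)$ is $e\mapsto\iota(\alpha)+_A\tilde 0_e$; it is again denoted by $\alpha$. Write $\Gamma_\ell$, $\Gamma_C$ for the spaces of linear and core sections. A *$\mathcal{VB}$-algebroid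 structure* on $D$ is a Lie algebroid structure on $D\to E$ with bracket $[\cdot,\cdot]_D$ whose anchor $\rho_D:D\to TE$ is a bundle morphism from $D\to A$ to $TE\to TM$, and such that $[\Gamma_\ell,\Gamma_\ell]_D\subseteq\Gamma_\ell$, $[\Gamma_\ell,\Gamma_C]_D\subseteq\Gamma_C$, $[\Gamma_C,\Gamma_C]_D=0$. It *induces* the given structure on $A$ if $Tq\circ\rho_D=\rho_A\circ q_A$ (with $q:E\to M$ the projection) and $[X,Y]_D$ projects to $[X_0,Y_0]_A$ for linear $X,Y$ projecting to $X_0,Y_0$. Below, "$\mathcal{VB}$-algebroid structure" always means one that induces the given Lie algebroid structure on $A$. A *horizontal lift* is a $C^\infty(M)$-linear map $h:\Gamma(A)\to\Gamma_\ell(D,E)$, $X\mapsto\hat X$, such that $\hat X$ projects to $X$. A *decomposition* of $D$ is an isomorphism of double vector bundles $D\cong A\oplus E\oplus C$ inducing the identity on $A$, $E$ and $C$. On $A\oplus E\oplus C$ there is the natural horizontal lift $\hat X(e)=(X,e,0)$. Let $\Omega(A;C[1]\oplus E)=\bigwedge\Gamma(A^*)\otimes_{C^\infty(M)}\Gamma(C\oplus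 E)$, graded by form degree plus the degree of the bundle, where $C$ has degree $-1$ and $E$ has degree $0$. An *$A$-superconnection* on $C[1]\oplus E$ is an additive operator $\mathcal D$ of degree $1$ on this space with $\mathcal D(\omega s)=(d_A\omega)s+(-1)^p\omega\wedge\mathcal D(s)$ for $\omega\in\Omega^p(A)$; it is *flat* if $\mathcal D^2=0$. Given $A$-connections $\nabla^c$ on $C$ and $\nabla^s$ on $E$, a bundle map $\partial:C\to E$ and $\Omega\in\Omega^2(A;\mathrm{Hom}(E,C))$, let $D^c$ and $D^s$ be the covariant differentials of $\nabla^c$ and $\nabla^s$, extended by zero to $\Omega(A;C\oplus E)$, and regard $\partial$ and $\Omega$ as operators by $\partial(\omega\alpha)=(-1)^p\omega\,\partial\alpha$, $\partial(\omega\varepsilon)=0$, $\Omega(\omega\alpha)=0$, $\Omega(\omega\varepsilon)=(-1)^p\omega\wedge\Omega(\varepsilon)$ for $\omega\in\Omega^p(A)$, $\alpha\in\Gamma(C)$, $\varepsilon\in\Gamma(E)$. A $\mathcal{VB}$-algebroid structure on $D$ and a horizontal lift $h$ determine *the associated data* by $$\langle\partial\alpha,f\rangle=-\rho_D(\alpha)f,\qquad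 \nabla^c_X\alpha=[\hat X,\alpha]_D,\qquad \langle\nabla^s_X\varepsilon,f\rangle=\rho_A(X)\langle\varepsilon,f\rangle-\langle\varepsilon,\rho_D(\hat X)f\rangle,\qquad \Omega_{X,Y}=\widehat{[X,Y]_A}-[\hat X,\hat Y]_D$$ for $X,Y\in\Gamma(A)$, $\alpha\in\Gamma(C)$, $\varepsilon\in\Gamma(E)$ and $f\in\Gamma(E^*)$, viewed as a fibrewise linear function on $E$. (Here a core section is identified with the section of $C$ that gives it, and a linear section of $D\to E$ projecting to $0$ with a bundle map $E\to C$.) **Theorem.** 1. For the decomposed double vector bundle $A\oplus E\oplus C$ with its natural horizontal lift there is a one-to-one correspondence between $\mathcal{VB}$-algebroid structures on $A\oplus E\oplus C$ and flat $A$-superconnections on $C[1]\oplus E$, which assigns to a $\mathcal{VB}$-algebroid structure the superconnection $\partial+D^c+D^s+\Omega$ formed from the associated data. 2. For every double vector bundle $D$ as above, horizontal lifts correspond one-to-one to decompositions: each horizontal lift is induced from the natural horizontal lift of $A\oplus E\oplus C$ by exactly one decomposition, and each decomposition induces exactly one horizontal lift. For every $\mathcal{VB}$-algebroid structure on $D$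 and every horizontal lift, the associated data exist and are unique, and the operator $\mathcal D=\partial+D^c+D^s+\Omega$ formed from them is flat, $\mathcal D^2=0$. For every horizontal lift, the assignment to a $\mathcal{VB}$-algebroid structure on $D$ of this superconnection $\mathcal D$ is a one-to-one correspondence between $\mathcal{VB}$-algebroid structures on $D$ and flat $A$-superconnections on $C[1]\oplus E$. 3. The map $(\partial,\nabla^c,\nabla^s,\Omega)\mapsto\partial+D^c+D^s+\Omega$ is a one-to-one correspondence between quadruples as above and $A$-superconnections on $C[1]\oplus E$, and the superconnection is flat if and only if, for all $X,Y\in\Gamma(A)$, $$\partial\circ\nabla^c_X=\nabla^s_X\circ\partial,\qquad F^c_{X,Y}=-\,\Omega_{X,Y}\circ\partial,\qquad F^s_{X,Y}=-\,\partial\circ\Omega_{X,Y},\qquad D^c\Omega+\Omega D^s=0,$$ where $F_{X,Y}=\nabla_X\nabla_Y-\nabla_Y\nabla_X-\nabla_{[X,Y]}$ is the curvature of a connection. -/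

import Mathlib

open Bundle Manifold ContDiff

noncomputable section
namespace VBAlgebroids

section Sections
variable {EM HM : Type*} [NormedAddCommGroup EM] [NormedSpace ℝ EM] [TopologicalSpace HM]
  (I : ModelWithCorners ℝ EM HM) {M : Type*} [TopologicalSpace M] [ChartedSpace HM M]
  (F : Type*) [NormedAddCommGroup F] [NormedSpace ℝ F]
  (V : M → Type*) [TopologicalSpace (TotalSpace F V)] [∀ m, AddCommGroup (V m)]
  [∀ m, Module ℝ (V m)] [∀ m, TopologicalSpace (V m)] [FiberBundle F V] [VectorBundle ℝ F V]

variable (M) in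
/-- The algebra `C^∞(M)` of smooth real functions. -/
abbrev Fun : Type _ := C^∞⟮I, M; 𝓘(ℝ), ℝ⟯

/-- The space `Γ(V)` of smooth sections. -/
abbrev Sec : Type _ := Cₛ^∞⟮I; F, V⟯

/-- `Γ(V)` is a module over `C^∞(M)` under pointwise multiplication. -/
instance : Module (Fun I M) (Sec I F V) where
  smul f s := ⟨fun m => f m • s m, f.contMDiff.smul_section s.contMDiff⟩
  one_smul s := by ext m; exact one_smul ℝ (s m)
  mul_smul f g s := by ext m; exact mul_smul (f m) (g m) (s m)
  smul_zero f := by ext m; exact smul_zero (f m)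
  smul_add f s t := by ext m; exact smul_add (f m) (s m) (t m)
  add_smul f g s := by ext m; exact add_smul (f m) (g m) (s m)
  zero_smul s := by ext m; exact zero_smul ℝ (s m)

variable {I F V} in
@[simp] theorem smul_sec_apply (f : Fun I M) (s : Sec I F V) (m : M) : (f • s) m = f m • s m := rfl

end Sections

section LieAlgebroid
variable {EM HM : Type*} [NormedAddCommGroup EM] [NormedSpace ℝ EM] [TopologicalSpace HM]
  (I : ModelWithCorners ℝ EM HM) {M : Type*} [TopologicalSpace M] [ChartedSpace HM M]
  [IsManifold I ∞ M]
  (F : Type*) [NormedAddCommGroup F] [NormedSpace ℝ F]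
  (V : M → Type*) [TopologicalSpace (TotalSpace F V)] [∀ m, AddCommGroup (V m)]
  [∀ m, Module ℝ (V m)] [∀ m, TopologicalSpace (V m)] [FiberBundle F V] [VectorBundle ℝ F V]

/-- A Lie algebroid structure on the vector bundle `V → M`. -/
@[ext] structure LieAlgebroid where
  anchor : ∀ m, V m →ₗ[ℝ] TangentSpace I m
  anchor_smooth : ContMDiff (I.prod 𝓘(ℝ, F)) I.tangent ∞
    (fun v : TotalSpace F V => (⟨v.proj, anchor v.proj v.snd⟩ : TangentBundle I M))
  bracket : Sec I F V → Sec I F V → Sec I F V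
  bracket_add_left : ∀ X Y Z, bracket (X + Y) Z = bracket X Z + bracket Y Z
  bracket_smul_left : ∀ (c : ℝ) X Y, bracket (c • X) Y = c • bracket X Y
  bracket_skew : ∀ X Y, bracket X Y = - bracket Y X
  jacobi : ∀ X Y Z, bracket X (bracket Y Z) + bracket Y (bracket Z X)
    + bracket Z (bracket X Y) = 0
  leibniz : ∀ X (f : Fun I M) Y m, bracket X (f • Y) m =
    f m • bracket X Y m + (mvfderiv I f m (anchor m (X m))) • Y m
  anchor_bracket : ∀ X Y m, anchor m (bracket X Y m) =
    VectorField.mlieBracket I (fun x => anchor x (X x)) (fun x => anchor x (Y x)) m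

end LieAlgebroid

namespace LieAlgebroid
variable {EM HM : Type*} [NormedAddCommGroup EM] [NormedSpace ℝ EM] [TopologicalSpace HM]
  {I : ModelWithCorners ℝ EM HM} {M : Type*} [TopologicalSpace M] [ChartedSpace HM M]
  [IsManifold I ∞ M]
  {F : Type*} [NormedAddCommGroup F] [NormedSpace ℝ F]
  {V : M → Type*} [TopologicalSpace (TotalSpace F V)] [∀ m, AddCommGroup (V m)]
  [∀ m, Module ℝ (V m)] [∀ m, TopologicalSpace (V m)] [FiberBundle F V] [VectorBundle ℝ F V]

/-- The anchor as a map of total spaces. -/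
def anchorMap (L : LieAlgebroid I F V) (v : TotalSpace F V) : TangentBundle I M :=
  ⟨v.proj, L.anchor v.proj v.snd⟩

/-- `ρ(X) f`, the derivative of the function `f` along the vector field `ρ(X)`. -/
def deriv (L : LieAlgebroid I F V) (X : Sec I F V) (f : Fun I M) : Fun I M :=
  ⟨fun m => mvfderiv I f m (L.anchor m (X m)), by
    have h1 : ContMDiff I I.tangent ∞ (fun m => L.anchorMap ⟨m, X m⟩) :=
      L.anchor_smooth.comp X.contMDiff
    have h2 := (f.contMDiff.contMDiff_tangentMap (m := ∞) (by simp)).comp h1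
    exact (contMDiff_snd_tangentBundle_modelSpace ℝ 𝓘(ℝ)).comp h2⟩

variable (L : LieAlgebroid I F V)

@[simp] theorem deriv_apply (X : Sec I F V) (f : Fun I M) (m : M) :
    L.deriv X f m = mvfderiv I f m (L.anchor m (X m)) := rfl

theorem deriv_add_left (X Y : Sec I F V) (f : Fun I M) :
    L.deriv (X + Y) f = L.deriv X f + L.deriv Y f := by
  ext m; simp

theorem deriv_smul_left (g : Fun I M) (X : Sec I F V) (f : Fun I M) :
    L.deriv (g • X) f = g * L.deriv X f := by
  ext m; simp

theorem deriv_add_right (X : Sec I F V) (f g : Fun I M) :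
    L.deriv X (f + g) = L.deriv X f + L.deriv X g := by
  ext m
  have hf : MDifferentiableAt I 𝓘(ℝ) f m := f.contMDiff.mdifferentiableAt (by simp)
  have hg : MDifferentiableAt I 𝓘(ℝ) g m := g.contMDiff.mdifferentiableAt (by simp)
  simp [mvfderiv_add hf hg]

theorem deriv_mul (X : Sec I F V) (f g : Fun I M) :
    L.deriv X (f * g) = f * L.deriv X g + L.deriv X f * g := by
  ext m
  have hf : MDifferentiableAt I 𝓘(ℝ) f m := f.contMDiff.mdifferentiableAt (by simp)
  have hg : MDifferentiableAt I 𝓘(ℝ) g m := g.contMDiff.mdifferentiableAt (by simp)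
  simp [mvfderiv_mul hf hg]
  ring

end LieAlgebroid

section Forms
set_option linter.unusedSectionVars false
variable {EM HM : Type*} [NormedAddCommGroup EM] [NormedSpace ℝ EM] [TopologicalSpace HM]
  {I : ModelWithCorners ℝ EM HM} {M : Type*} [TopologicalSpace M] [ChartedSpace HM M]
  [IsManifold I ∞ M]
  {F : Type*} [NormedAddCommGroup F] [NormedSpace ℝ F]
  {V : M → Type*} [TopologicalSpace (TotalSpace F V)] [∀ m, AddCommGroup (V m)]
  [∀ m, Module ℝ (V m)] [∀ m, TopologicalSpace (V m)] [FiberBundle F V] [VectorBundle ℝ F V]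

/-- An `A`-connection on the `C^∞(M)`-module `N` (`N = Γ(W)` for a vector bundle `W`, or
`N = C^∞(M)`). Linearity over `ℝ` in the second argument is the Leibniz rule for constant
functions. -/
@[ext] structure Connection (L : LieAlgebroid I F V) (N : Type*) [AddCommGroup N]
    [Module (Fun I M) N] where
  nabla : Sec I F V → N → N
  add_left : ∀ X Y s, nabla (X + Y) s = nabla X s + nabla Y s
  smul_left : ∀ (f : Fun I M) X s, nabla (f • X) s = f • nabla X s
  add_right : ∀ X s t, nabla X (s + t) = nabla X s + nabla X t
  leibniz : ∀ X (f : Fun I M) s, nabla X (f • s) = f • nabla X s + L.deriv X f • s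

variable (I F V) in
/-- `Ω^p(A; N)`: alternating `C^∞(M)`-multilinear maps `Γ(A)^p → N`. -/
abbrev Form (N : Type*) [AddCommGroup N] [Module (Fun I M) N] (p : ℕ) : Type _ :=
  Sec I F V [⋀^Fin p]→ₗ[Fun I M] N

variable {N : Type*} [AddCommGroup N] [Module (Fun I M) N]

/-- The constant function `1/2`. -/
def half : Fun I M := ContMDiffMap.const 2⁻¹

theorem half_add_half : (half : Fun I M) + half = 1 := by
  ext m
  change (2⁻¹ : ℝ) + 2⁻¹ = 1
  norm_num

namespace LieAlgebroid
variable (L : LieAlgebroid I F V)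

theorem bracket_add_right (X Y Z : Sec I F V) :
    L.bracket X (Y + Z) = L.bracket X Y + L.bracket X Z := by
  rw [L.bracket_skew, L.bracket_add_left, L.bracket_skew X Y, L.bracket_skew X Z]; abel

theorem bracket_smul_right (X : Sec I F V) (f : Fun I M) (Y : Sec I F V) :
    L.bracket X (f • Y) = f • L.bracket X Y + L.deriv X f • Y := by
  ext m; exact L.leibniz X f Y m

/-- The trivial connection `X ↦ ρ(X)` on `C^∞(M)`. -/
def trivialConnection : Connection L (Fun I M) where
  nabla := L.deriv
  add_left := L.deriv_add_left
  smul_left := fun f X s => L.deriv_smul_left f X s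
  add_right := L.deriv_add_right
  leibniz := fun X f s => L.deriv_mul X f s

end LieAlgebroid


/-- A form regarded as an additive alternating map. -/
def formInt {p : ℕ} (η : Form I F V N p) : Sec I F V [⋀^Fin p]→ₗ[ℤ] N :=
  { η.toMultilinearMap.restrictScalars ℤ with map_eq_zero_of_eq' := η.map_eq_zero_of_eq' }

@[simp] theorem formInt_apply {p : ℕ} (η : Form I F V N p) (v : Fin p → Sec I F V) :
    formInt η v = η v := rfl

/-- The extension of an additive endomorphism `φ` of `Γ(A)` to forms as a derivation:
`v ↦ ∑ i, η(v_0, …, φ(v_i), …, v_{p-1})`. -/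
def derivForm {p : ℕ} (η : Form I F V N p) (φ : Sec I F V →ₗ[ℤ] Sec I F V) :
    Sec I F V [⋀^Fin p]→ₗ[ℤ] N where
  toMultilinearMap := ∑ i, (formInt η).toMultilinearMap.compLinearMap
    (Function.update (fun _ => LinearMap.id) i φ)
  map_eq_zero_of_eq' := by
    intro v a b hab hne
    have key : ∀ i, ((formInt η).toMultilinearMap.compLinearMap
        (Function.update (fun _ => LinearMap.id) i φ)) v = η (Function.update v i (φ (v i))) := by
      intro i
      simp only [MultilinearMap.compLinearMap_apply]
      change η _ = η _
      congr 1
      funext k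
      by_cases h : k = i
      · subst h; simp
      · simp [h]
    change (∑ i, (formInt η).toMultilinearMap.compLinearMap
        (Function.update (fun _ => LinearMap.id) i φ)) v = 0
    rw [sum_apply]
    simp only [key]
    rw [Fintype.sum_eq_add a b hne]
    · have : Function.update v b (φ (v b)) =
          Function.update v a (φ (v a)) ∘ Equiv.swap a b := by
        funext k
        by_cases hk : k = a
        · subst hk; simp [hne, hne.symm, hab]
        · by_cases hk' : k = b
          · subst hk'; simp [hab]
          · simp [Equiv.swap_apply_of_ne_of_ne hk hk', hk, hk']
      rw [this, η.map_swap _ hne, add_neg_cancel]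
    · rintro i ⟨hia, hib⟩
      exact η.map_eq_zero_of_eq _ (by simp [hia.symm, hib.symm, hab]) hne

theorem derivForm_apply {p : ℕ} (η : Form I F V N p) (φ : Sec I F V →ₗ[ℤ] Sec I F V)
    (v : Fin p → Sec I F V) :
    derivForm η φ v = ∑ i, η (Function.update v i (φ (v i))) := by
  change (∑ i, (formInt η).toMultilinearMap.compLinearMap
        (Function.update (fun _ => LinearMap.id) i φ)) v = _
  rw [sum_apply]
  refine Finset.sum_congr rfl fun i _ => ?_
  simp only [MultilinearMap.compLinearMap_apply]
  change η _ = η _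
  congr 1
  funext k
  by_cases h : k = i
  · subst h; simp
  · simp [h]

namespace Connection
variable {L : LieAlgebroid I F V} (D : Connection L N)

@[simp] theorem nabla_zero (X : Sec I F V) : D.nabla X 0 = 0 := by
  have := D.add_right X 0 0
  simpa using this

/-- `Y ↦ [Y, X]` as an additive map. -/
def bracketMap (L : LieAlgebroid I F V) (X : Sec I F V) : Sec I F V →ₗ[ℤ] Sec I F V :=
  (AddMonoidHom.mk' (fun Y => L.bracket Y X) (fun Y Z => L.bracket_add_left Y Z X)).toIntLinearMap

/-- `X ↦ (v ↦ ∇_X (η(v)) + 1/2 ∑ i, η(v_0, …, [v_i, X], …, v_{p-1}))`. -/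
def dAux {p : ℕ} (η : Form I F V N p) :
    Sec I F V →ₗ[ℤ] Sec I F V [⋀^Fin p]→ₗ[ℤ] N :=
  (AddMonoidHom.mk' (fun X =>
    ((AddMonoidHom.mk' (D.nabla X) (D.add_right X)).toIntLinearMap).compAlternatingMap
      (formInt η) + (half : Fun I M) • derivForm η (bracketMap L X)) (by
    intro X Y
    ext v
    have h : ∀ i, η (Function.update v i (L.bracket (v i) (X + Y))) =
        η (Function.update v i (L.bracket (v i) X)) +
        η (Function.update v i (L.bracket (v i) Y)) := fun i => by
      rw [L.bracket_add_right, η.map_update_add]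
    simp [derivForm_apply, bracketMap, D.add_left, h, Finset.sum_add_distrib]
    abel)).toIntLinearMap

theorem dAux_apply {p : ℕ} (η : Form I F V N p) (X : Sec I F V) (v : Fin p → Sec I F V) :
    D.dAux η X v = D.nabla X (η v) +
      (half : Fun I M) • ∑ i, η (Function.update v i (L.bracket (v i) X)) := by
  simp [dAux, derivForm_apply, bracketMap]

/-- The additive map underlying the covariant differential. -/
def dInt {p : ℕ} (η : Form I F V N p) : Sec I F V [⋀^Fin (p + 1)]→ₗ[ℤ] N :=
  AlternatingMap.alternatizeUncurryFin (D.dAux η)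

theorem dInt_apply {p : ℕ} (η : Form I F V N p) (v : Fin (p + 1) → Sec I F V) :
    D.dInt η v = ∑ j : Fin (p + 1), (-1 : ℤ) ^ (j : ℕ) • (D.nabla (v j) (η (j.removeNth v)) +
      (half : Fun I M) • ∑ i, η (Function.update (j.removeNth v) i
        (L.bracket (j.removeNth v i) (v j)))) := by
  rw [dInt, AlternatingMap.alternatizeUncurryFin_apply]
  simp only [dAux_apply]

theorem map_update_eq {p : ℕ} (η : Form I F V N (p + 1)) (w : Fin (p + 1) → Sec I F V)
    (i : Fin (p + 1)) (X : Sec I F V) :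
    η (Function.update w i X) = (-1 : ℤ) ^ (i : ℕ) • η (Fin.cons X (i.removeNth w)) := by
  have h := η.map_insertNth i X (i.removeNth w)
  rw [Fin.insertNth_removeNth] at h
  rw [h]; rfl

theorem dInt_smul_zero {p : ℕ} (η : Form I F V N p) (f : Fun I M) (X : Sec I F V)
    (w : Fin p → Sec I F V) :
    D.dInt η (Fin.cons (f • X) w) = f • D.dInt η (Fin.cons X w) := by
  rw [dInt_apply, dInt_apply]
  cases p with
  | zero => simp [D.smul_left]
  | succ p =>
    have hr : ∀ (Y : Sec I F V) (k : Fin (p + 1)),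
        Fin.removeNth k.succ (Fin.cons Y w : Fin (p + 2) → Sec I F V) =
          Fin.cons Y (k.removeNth w) := by
      intro Y k
      funext i
      refine Fin.cases ?_ (fun i => ?_) i
      · simp [Fin.removeNth_apply]
      · simp [Fin.removeNth_apply, Fin.succ_succAbove_succ]
    have hs : ∀ (Z : Sec I F V) (i : Fin p) (u : Fin p → Sec I F V) (Y : Sec I F V),
        Function.update (Fin.cons Y u : Fin (p + 1) → Sec I F V) i.succ Z =
          Fin.cons Y (Function.update u i Z) := fun Z i u Y => by
      rw [Fin.cons_update]
    have h0 : ∀ (Z Y : Sec I F V) (u : Fin p → Sec I F V),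
        Function.update (Fin.cons Y u : Fin (p + 1) → Sec I F V) 0 Z = Fin.cons Z u :=
      fun Z Y u => by rw [Fin.update_cons_zero]
    have hsm : ∀ (g : Fun I M) (Y : Sec I F V) (u : Fin p → Sec I F V),
        η (Fin.cons (g • Y) u) = g • η (Fin.cons Y u) := fun g Y u => η.map_vecCons_smul u g Y
    have hadd : ∀ (Y Z : Sec I F V) (u : Fin p → Sec I F V),
        η (Fin.cons (Y + Z) u) = η (Fin.cons Y u) + η (Fin.cons Z u) :=
      fun Y Z u => η.map_vecCons_add u Y Z
    have hneg : ∀ (Y : Sec I F V) (u : Fin p → Sec I F V),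
        η (Fin.cons (-Y) u) = - η (Fin.cons Y u) := fun Y u => by
      have := hsm (-1) Y u
      simpa using this
    have hbl : ∀ (g : Fun I M) (Y Z : Sec I F V), L.bracket (g • Y) Z =
        g • L.bracket Y Z + -(L.deriv Z g • Y) := fun g Y Z => by
      rw [L.bracket_skew, L.bracket_smul_right, L.bracket_skew Z Y]; simp [add_comm]
    have hhalf : ∀ x : N, x = (half : Fun I M) • x + (half : Fun I M) • x := fun x => by
      rw [← add_smul, half_add_half, one_smul]
    have e0 : D.nabla (f • X) (η w) + (half : Fun I M) • ∑ i, η (Function.update w i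
          (L.bracket (w i) (f • X))) =
        f • (D.nabla X (η w) + (half : Fun I M) • ∑ i, η (Function.update w i
          (L.bracket (w i) X))) + (half : Fun I M) • ∑ k : Fin (p + 1), (-1 : ℤ) ^ (k : ℕ) •
            L.deriv (w k) f • η (Fin.cons X (k.removeNth w)) := by
      have : ∀ i, η (Function.update w i (L.bracket (w i) (f • X))) =
          f • η (Function.update w i (L.bracket (w i) X)) +
            (-1 : ℤ) ^ (i : ℕ) • L.deriv (w i) f • η (Fin.cons X (i.removeNth w)) := fun i => by
        rw [L.bracket_smul_right, η.map_update_add, η.map_update_smul, η.map_update_smul,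
          map_update_eq η w i X, smul_comm (L.deriv (w i) f)]
      simp only [this, Finset.sum_add_distrib, smul_add, D.smul_left, ← Finset.smul_sum,
        smul_comm f (half : Fun I M)]
      abel
    have ek : ∀ k : Fin (p + 1),
        (-1 : ℤ) ^ ((k : ℕ) + 1) • (D.nabla (w k) (η (Fin.cons (f • X) (k.removeNth w))) +
          (half : Fun I M) • (η (Fin.cons (L.bracket (f • X) (w k)) (k.removeNth w)) +
            ∑ i, η (Fin.cons (f • X) (Function.update (k.removeNth w) i
              (L.bracket (k.removeNth w i) (w k)))))) =
        f • ((-1 : ℤ) ^ ((k : ℕ) + 1) • (D.nabla (w k) (η (Fin.cons X (k.removeNth w))) +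
          (half : Fun I M) • (η (Fin.cons (L.bracket X (w k)) (k.removeNth w)) +
            ∑ i, η (Fin.cons X (Function.update (k.removeNth w) i
              (L.bracket (k.removeNth w i) (w k))))))) -
        (half : Fun I M) • (-1 : ℤ) ^ (k : ℕ) •
          L.deriv (w k) f • η (Fin.cons X (k.removeNth w)) := fun k => by
      simp only [hsm, hbl, hadd, hneg, D.leibniz, ← Finset.smul_sum]
      have hQ := hhalf ((-1 : ℤ) ^ (k : ℕ) • L.deriv (w k) f • η (Fin.cons X (k.removeNth w)))
      rw [smul_comm (half : Fun I M)] at hQ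
      simp only [pow_succ, smul_add, smul_neg, mul_neg, mul_one, neg_smul,
        smul_comm f ((-1 : ℤ) ^ (k : ℕ)), smul_comm (half : Fun I M) ((-1 : ℤ) ^ (k : ℕ)),
        smul_comm f (half : Fun I M)]
      rw [hQ]
      abel
    have hin : ∀ (k : Fin (p + 1)) (Y : Sec I F V),
        ∑ i, η (Function.update (Fin.cons Y (k.removeNth w) : Fin (p + 1) → Sec I F V) i
          (L.bracket ((Fin.cons Y (k.removeNth w) : Fin (p + 1) → Sec I F V) i) (w k))) =
        η (Fin.cons (L.bracket Y (w k)) (k.removeNth w)) +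
            ∑ i, η (Fin.cons Y (Function.update (k.removeNth w) i
              (L.bracket (k.removeNth w i) (w k)))) := fun k Y => by
      rw [Fin.sum_univ_succ]
      simp only [h0, hs, Fin.cons_zero, Fin.cons_succ]
    rw [Fin.sum_univ_succ, Fin.sum_univ_succ (n := p + 1)]
    simp only [hr, Fin.removeNth_zero, Fin.tail_cons, Fin.cons_zero, Fin.cons_succ,
      hin, Fin.val_zero, pow_zero, one_smul, Fin.val_succ]
    rw [e0]
    simp only [ek]
    have hfin : ∀ a b S : N, f • a + (half : Fun I M) • S + (f • b - (half : Fun I M) • S) =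
        f • (a + b) := fun a b S => by rw [smul_add]; abel
    rw [Finset.sum_sub_distrib, ← Finset.smul_sum, ← Finset.smul_sum]
    exact hfin _ _ _

theorem dInt_smul {p : ℕ} (η : Form I F V N p) (f : Fun I M) (v : Fin (p + 1) → Sec I F V)
    (k : Fin (p + 1)) (X : Sec I F V) :
    D.dInt η (Function.update v k (f • X)) = f • D.dInt η (Function.update v k X) := by
  have h : ∀ Y, D.dInt η (Function.update v k Y) =
      (-1 : ℤ) ^ (k : ℕ) • D.dInt η (Fin.cons Y (k.removeNth v)) := fun Y => by
    have h := (D.dInt η).map_insertNth k Y (k.removeNth v)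
    rw [Fin.insertNth_removeNth] at h
    rw [h]; rfl
  rw [h, h, dInt_smul_zero, smul_comm]

/-- The covariant differential `d_∇ : Ω^p(A; N) → Ω^{p+1}(A; N)`. -/
def d {p : ℕ} : Form I F V N p →+ Form I F V N (p + 1) where
  toFun η :=
    { D.dInt η with
      map_update_add' := fun v k X Y => by
        rename_i inst
        have : inst = instDecidableEqFin _ := Subsingleton.elim _ _
        subst this
        exact (D.dInt η).map_update_add v k X Y
      map_update_smul' := fun v k f X => by
        rename_i inst
        have : inst = instDecidableEqFin _ := Subsingleton.elim _ _
        subst this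
        exact D.dInt_smul η f v k X }
  map_zero' := by
    ext v
    change D.dInt 0 v = 0
    simp [dInt_apply]
  map_add' η θ := by
    ext v
    change D.dInt (η + θ) v = D.dInt η v + D.dInt θ v
    simp only [dInt_apply, AlternatingMap.add_apply, D.add_right, Finset.sum_add_distrib, smul_add]
    abel

end Connection

/-- Curvature `F_{X,Y} = ∇_X ∇_Y - ∇_Y ∇_X - ∇_{[X,Y]}` of a connection. -/
def Connection.curvature {L : LieAlgebroid I F V} (D : Connection L N) (X Y : Sec I F V) (s : N) :
    N :=
  D.nabla X (D.nabla Y s) - D.nabla Y (D.nabla X s) - D.nabla (L.bracket X Y) s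

section Wedge
variable {N₁ N₂ N₃ : Type*} [AddCommGroup N₁] [Module (Fun I M) N₁]
  [AddCommGroup N₂] [Module (Fun I M) N₂] [AddCommGroup N₃] [Module (Fun I M) N₃]

/-- The wedge product (sum over shuffles) of forms with values in `N₁` and `N₂`, their values
being multiplied by the pairing `B`. -/
def wedge (B : N₁ →ₗ[Fun I M] N₂ →ₗ[Fun I M] N₃) {p q : ℕ} (x : Form I F V N₁ p)
    (y : Form I F V N₂ q) : Form I F V N₃ (p + q) :=
  ((TensorProduct.lift B).compAlternatingMap (x.domCoprod y)).domDomCongr finSumFinEquiv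

theorem wedge_add_right (B : N₁ →ₗ[Fun I M] N₂ →ₗ[Fun I M] N₃) {p q : ℕ} (x : Form I F V N₁ p)
    (y z : Form I F V N₂ q) : wedge B x (y + z) = wedge B x y + wedge B x z := by
  simp only [wedge, ← AlternatingMap.domCoprod'_apply, TensorProduct.tmul_add, map_add,
    LinearMap.compAlternatingMap_add, AlternatingMap.domDomCongr_add]

theorem wedge_add_left (B : N₁ →ₗ[Fun I M] N₂ →ₗ[Fun I M] N₃) {p q : ℕ} (x y : Form I F V N₁ p)
    (z : Form I F V N₂ q) : wedge B (x + y) z = wedge B x z + wedge B y z := by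
  simp only [wedge, ← AlternatingMap.domCoprod'_apply, TensorProduct.add_tmul, map_add,
    LinearMap.compAlternatingMap_add, AlternatingMap.domDomCongr_add]

end Wedge

section Superconnections

variable (I F V N) in
/-- `Ω(A; N) = ⨁_p Ω^p(A; N)`. -/
abbrev Forms : Type _ := DirectSum ℕ (fun p => Form I F V N p)

/-- The operator on `Ω(A; N)` given by a family of maps raising the form degree by `k`. -/
def operator (k : ℕ) (T : ∀ p, Form I F V N p →+ Form I F V N (p + k)) :
    AddMonoid.End (Forms I F V N) :=
  DirectSum.toAddMonoid fun p =>
    (DirectSum.of (fun p => Form I F V N p) (p + k)).comp (T p)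

/-- Left multiplication `x ↦ η ∧ x` on `Ω(A; N)` by a scalar form `η ∈ Ω^p(A)`. -/
def wedgeOp {p : ℕ} (η : Form I F V (Fun I M) p) : AddMonoid.End (Forms I F V N) :=
  DirectSum.toAddMonoid fun q =>
    (DirectSum.of (fun p => Form I F V N p) (p + q)).comp
      (AddMonoidHom.mk' (fun x : Form I F V N q => wedge (LinearMap.lsmul (Fun I M) N) η x)
        (wedge_add_right _ η))

/-- Composition of a form with a `C^∞(M)`-linear map of values. -/
def mapForm {N₁ N₂ : Type*} [AddCommGroup N₁] [Module (Fun I M) N₁]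
    [AddCommGroup N₂] [Module (Fun I M) N₂] (g : N₁ →ₗ[Fun I M] N₂) {p : ℕ} :
    Form I F V N₁ p →+ Form I F V N₂ p :=
  AddMonoidHom.mk' (fun x => g.compAlternatingMap x) (fun x y => g.compAlternatingMap_add x y)

variable (L : LieAlgebroid I F V) (NC NE : Type*) [AddCommGroup NC] [Module (Fun I M) NC]
  [AddCommGroup NE] [Module (Fun I M) NE]

variable {NC NE} in
/-- An element of `Ω(A; C[1] ⊕ E)` has total degree `k` if its `C`-components have form degree
`k + 1` and its `E`-components have form degree `k`. -/
def HasTotalDegree (k : ℤ) (x : Forms I F V (NC × NE)) : Prop :=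
  ∀ p : ℕ, ((p : ℤ) ≠ k + 1 → mapForm (LinearMap.fst (Fun I M) NC NE) (x p) = 0) ∧
    ((p : ℤ) ≠ k → mapForm (LinearMap.snd (Fun I M) NC NE) (x p) = 0)

/-- A degree `1` `A`-superconnection on the graded module `C[1] ⊕ E`. -/
@[ext] structure Superconnection where
  op : AddMonoid.End (Forms I F V (NC × NE))
  degree_one : ∀ k x, HasTotalDegree k x → HasTotalDegree (k + 1) (op x)
  leibniz : ∀ (p : ℕ) (η : Form I F V (Fun I M) p) (x : Forms I F V (NC × NE)),
    op (wedgeOp η x) = wedgeOp (L.trivialConnection.d η) x + (-1 : ℤ) ^ p • wedgeOp η (op x)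

variable {L NC NE} in
/-- Flatness: `𝒟² = 0`. -/
def Superconnection.IsFlat (D : Superconnection L NC NE) : Prop := D.op * D.op = 0

/-- The component data of a superconnection on `C[1] ⊕ E`: a map `∂ : C → E`, `A`-connections
`∇^c` on `C` and `∇^s` on `E`, and a form `Ω ∈ Ω²(A; Hom(E, C))`. -/
@[ext] structure SuperData where
  bd : NC →ₗ[Fun I M] NE
  nablaC : Connection L NC
  nablaE : Connection L NE
  curv : Form I F V (NE →ₗ[Fun I M] NC) 2

namespace SuperData
variable {L NC NE} (Q : SuperData L NC NE)

/-- `∂(η α) = (-1)^p η ∂(α)`, `∂(η ε) = 0`. -/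
def bdOp : AddMonoid.End (Forms I F V (NC × NE)) :=
  operator 0 fun p => (-1 : ℤ) ^ p •
    mapForm (LinearMap.inr (Fun I M) NC NE ∘ₗ Q.bd ∘ₗ LinearMap.fst (Fun I M) NC NE)

/-- `D^c`, the covariant differential of `∇^c`, extended by zero to `E`-valued forms. -/
def DcOp : AddMonoid.End (Forms I F V (NC × NE)) :=
  operator 1 fun _ => (mapForm (LinearMap.inl (Fun I M) NC NE)).comp
    (Q.nablaC.d.comp (mapForm (LinearMap.fst (Fun I M) NC NE)))

/-- `D^s`, the covariant differential of `∇^s`, extended by zero to `C`-valued forms. -/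
def DsOp : AddMonoid.End (Forms I F V (NC × NE)) :=
  operator 1 fun _ => (mapForm (LinearMap.inr (Fun I M) NC NE)).comp
    (Q.nablaE.d.comp (mapForm (LinearMap.snd (Fun I M) NC NE)))

/-- `Ω(η α) = 0`, `Ω(η ε) = (-1)^p η ∧ Ω(ε)`. -/
def curvOp : AddMonoid.End (Forms I F V (NC × NE)) :=
  operator 2 fun p => (-1 : ℤ) ^ p • (mapForm (LinearMap.inl (Fun I M) NC NE)).comp
    ((AddMonoidHom.mk' (fun x : Form I F V NE p =>
      wedge (LinearMap.id (R := Fun I M) (M := NE →ₗ[Fun I M] NC)).flip x Q.curv)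
        (fun x y => wedge_add_left _ x y Q.curv)).comp
      (mapForm (LinearMap.snd (Fun I M) NC NE)))

/-- `𝒟 = ∂ + D^c + D^s + Ω`. -/
def op : AddMonoid.End (Forms I F V (NC × NE)) := Q.bdOp + Q.DcOp + Q.DsOp + Q.curvOp

/-- The compatibility equations. -/
structure Compatible : Prop where
  bd_nabla : ∀ X α, Q.bd (Q.nablaC.nabla X α) = Q.nablaE.nabla X (Q.bd α)
  curvature_C : ∀ X Y α, Q.nablaC.curvature X Y α = - Q.curv ![X, Y] (Q.bd α)
  curvature_E : ∀ X Y ε, Q.nablaE.curvature X Y ε = - Q.bd (Q.curv ![X, Y] ε)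
  closed : Q.DcOp * Q.curvOp + Q.curvOp * Q.DsOp = 0

end SuperData
end Superconnections
end Forms

section Geometry

/-- A map of total spaces of vector bundles is a *bundle morphism* if it maps every fibre linearly
into some fibre. -/
def IsBundleMorphism {B₁ B₂ : Type*} {F₁ F₂ : Type*} {V₁ : B₁ → Type*} {V₂ : B₂ → Type*}
    [∀ b, AddCommGroup (V₁ b)] [∀ b, Module ℝ (V₁ b)]
    [∀ b, AddCommGroup (V₂ b)] [∀ b, Module ℝ (V₂ b)]
    (f : TotalSpace F₁ V₁ → TotalSpace F₂ V₂) : Prop :=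
  ∀ b, ∃ b' : B₂, ∃ l : V₁ b →ₗ[ℝ] V₂ b', ∀ v, f ⟨b, v⟩ = ⟨b', l v⟩

/-- `IsSum x y z`: the points `x`, `y`, `z` of a vector bundle lie in one fibre and `z = x + y`. -/
def IsSum {B F : Type*} {V : B → Type*} [∀ b, AddCommGroup (V b)] (x y z : TotalSpace F V) :
    Prop :=
  ∃ b, ∃ u v : V b, x = ⟨b, u⟩ ∧ y = ⟨b, v⟩ ∧ z = ⟨b, u + v⟩

/-- Multiplication by a scalar in the fibres of a vector bundle. -/
def scale {B F : Type*} {V : B → Type*} [∀ b, AddCommGroup (V b)] [∀ b, Module ℝ (V b)] (c : ℝ)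
    (x : TotalSpace F V) : TotalSpace F V := ⟨x.proj, c • x.snd⟩

variable {EM HM : Type*} [NormedAddCommGroup EM] [NormedSpace ℝ EM] [TopologicalSpace HM]
  (I : ModelWithCorners ℝ EM HM) {M : Type*} [TopologicalSpace M] [ChartedSpace HM M]
  [IsManifold I ∞ M]
  -- the side bundle `A → M`
  (FA : Type*) [NormedAddCommGroup FA] [NormedSpace ℝ FA]
  (A : M → Type*) [TopologicalSpace (TotalSpace FA A)] [∀ m, AddCommGroup (A m)]
  [∀ m, Module ℝ (A m)] [∀ m, TopologicalSpace (A m)] [FiberBundle FA A] [VectorBundle ℝ FA A]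
  [ContMDiffVectorBundle ∞ FA A I]
  -- the side bundle `E → M`
  (FE : Type*) [NormedAddCommGroup FE] [NormedSpace ℝ FE]
  (E : M → Type*) [TopologicalSpace (TotalSpace FE E)] [∀ m, AddCommGroup (E m)]
  [∀ m, Module ℝ (E m)] [∀ m, TopologicalSpace (E m)] [FiberBundle FE E] [VectorBundle ℝ FE E]
  [ContMDiffVectorBundle ∞ FE E I]
  -- the core bundle `C → M`
  (FC : Type*) [NormedAddCommGroup FC] [NormedSpace ℝ FC]
  (C : M → Type*) [TopologicalSpace (TotalSpace FC C)] [∀ m, AddCommGroup (C m)]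
  [∀ m, Module ℝ (C m)] [∀ m, TopologicalSpace (C m)] [FiberBundle FC C] [VectorBundle ℝ FC C]
  [ContMDiffVectorBundle ∞ FC C I]
  -- the bundle `D → E`
  (FDE : Type*) [NormedAddCommGroup FDE] [NormedSpace ℝ FDE]
  (DE : TotalSpace FE E → Type*) [TopologicalSpace (TotalSpace FDE DE)]
  [∀ e, AddCommGroup (DE e)] [∀ e, Module ℝ (DE e)] [∀ e, TopologicalSpace (DE e)]
  [FiberBundle FDE DE] [VectorBundle ℝ FDE DE]
  -- the bundle `D → A`
  (FDA : Type*) [NormedAddCommGroup FDA] [NormedSpace ℝ FDA]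
  (DA : TotalSpace FA A → Type*) [TopologicalSpace (TotalSpace FDA DA)]
  [∀ a, AddCommGroup (DA a)] [∀ a, Module ℝ (DA a)] [∀ a, TopologicalSpace (DA a)]
  [FiberBundle FDA DA] [VectorBundle ℝ FDA DA]

/-- A double vector bundle with side bundles `A` and `E`. Its total space `D` is the total space of
the vector bundle `D → E` with fibres `DE`, identified by the diffeomorphism `toA` with
the total space of the vector bundle `D → A` with fibres `DA`. The projections to `E` and `A` are
`d ↦ d.proj` and `d ↦ (toA d).proj`. -/
structure DoubleVectorBundle where
  toA : TotalSpace FDE DE ≃ₘ^∞⟮(I.prod 𝓘(ℝ, FE)).prod 𝓘(ℝ, FDE), (I.prod 𝓘(ℝ, FA)).prod 𝓘(ℝ, FDA)⟯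
    TotalSpace FDA DA
  square : ∀ d, (toA d).proj.proj = d.proj.proj
  projA_add : ∀ d₁ d₂ d, IsSum d₁ d₂ d → IsSum (toA d₁).proj (toA d₂).proj (toA d).proj
  projE_add : ∀ d₁ d₂ d, IsSum (toA d₁) (toA d₂) (toA d) → IsSum d₁.proj d₂.proj d.proj
  interchange : ∀ d₁ d₂ d₃ d₄ d₁₂ d₃₄ d₁₃ d₂₄,
    IsSum d₁ d₂ d₁₂ → IsSum d₃ d₄ d₃₄ →
    IsSum (toA d₁) (toA d₃) (toA d₁₃) → IsSum (toA d₂) (toA d₄) (toA d₂₄) →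
    ∃ d, IsSum (toA d₁₂) (toA d₃₄) (toA d) ∧ IsSum d₁₃ d₂₄ d

namespace DoubleVectorBundle
variable {I FA A FE E FDE DE FDA DA} (D : DoubleVectorBundle I FA A FE E FDE DE FDA DA)

/-- An identification of the vector bundle `C → M` with the core of `D`, the intersection of the
kernels of the two projections. -/
structure Core where
  ι : TotalSpace FC C → TotalSpace FDE DE
  smooth : ContMDiff (I.prod 𝓘(ℝ, FC)) ((I.prod 𝓘(ℝ, FE)).prod 𝓘(ℝ, FDE)) ∞ ι
  injective : Function.Injective ι
  linear : IsBundleMorphism ι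
  overBase : ∀ c, (ι c).proj.proj = c.proj
  range : ∀ d, d ∈ Set.range ι ↔ d.proj = ⟨d.proj.proj, 0⟩ ∧ (D.toA d).proj = ⟨d.proj.proj, 0⟩

/-- The section `X` of `D → E` is linear: a bundle morphism from `E → M` to `D → A`. -/
def IsLinear (X : Sec (I.prod 𝓘(ℝ, FE)) FDE DE) : Prop :=
  IsBundleMorphism (fun e : TotalSpace FE E => D.toA ⟨e, X e⟩)

/-- The section `X` of `D → E` projects to the section `X₀` of `A → M`. -/
def ProjectsTo (X : Sec (I.prod 𝓘(ℝ, FE)) FDE DE) (X₀ : Sec I FA A) : Prop :=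
  ∀ e, (D.toA ⟨e, X e⟩).proj = ⟨e.proj, X₀ e.proj⟩

variable {D FC C} (κ : D.Core FC C)

/-- `d = c +_A 0_e`, the point over `e ∈ E` and `0 ∈ A` determined by the core element `c`. -/
def Core.IsPoint (c : TotalSpace FC C) (e : TotalSpace FE E) (d : TotalSpace FDE DE) : Prop :=
  IsSum (D.toA (κ.ι c)) (D.toA ⟨e, 0⟩) (D.toA d)

/-- `X` is the core section of `D → E` given by the section `α` of `C`. -/
def Core.IsCoreSection (α : Sec I FC C) (X : Sec (I.prod 𝓘(ℝ, FE)) FDE DE) : Prop :=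
  ∀ e, κ.IsPoint ⟨e.proj, α e.proj⟩ e ⟨e, X e⟩

/-- A horizontal lift: a `C^∞(M)`-linear right inverse `Γ(A) → Γ_ℓ(D, E)` of the projection, where
`f ∈ C^∞(M)` acts on sections of `D → E` through the function `e ↦ f (e.proj)` on `E`. -/
@[ext] structure HorizontalLift (D : DoubleVectorBundle I FA A FE E FDE DE FDA DA) where
  lift : Sec I FA A → Sec (I.prod 𝓘(ℝ, FE)) FDE DE
  map_add : ∀ X Y, lift (X + Y) = lift X + lift Y
  map_smul : ∀ (f : Fun I M) X e, lift (f • X) e = f e.proj • lift X e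
  linear : ∀ X, D.IsLinear (lift X)
  projects : ∀ X, D.ProjectsTo (lift X) X

end DoubleVectorBundle

/-- Addition in the vector bundle `TE → TM`, the derivative of the addition `E ×_M E → E`:
`w = u + v` if `u`, `v`, `w` are the images of one tangent vector of `E ×_M E` under the derivatives
of the two projections and of the addition. -/
def TangentSum (u v w : TangentBundle (I.prod 𝓘(ℝ, FE)) (TotalSpace FE E)) : Prop :=
  ∃ z : TangentBundle (I.prod 𝓘(ℝ, FE × FE)) (TotalSpace (FE × FE) (E ×ᵇ E)),
    tangentMap (I.prod 𝓘(ℝ, FE × FE)) (I.prod 𝓘(ℝ, FE))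
      (fun p => (⟨p.proj, p.snd.1⟩ : TotalSpace FE E)) z = u ∧
    tangentMap (I.prod 𝓘(ℝ, FE × FE)) (I.prod 𝓘(ℝ, FE))
      (fun p => (⟨p.proj, p.snd.2⟩ : TotalSpace FE E)) z = v ∧
    tangentMap (I.prod 𝓘(ℝ, FE × FE)) (I.prod 𝓘(ℝ, FE))
      (fun p => (⟨p.proj, p.snd.1 + p.snd.2⟩ : TotalSpace FE E)) z = w

variable {I FA A FE E FC C FDE DE FDA DA}
variable {D : DoubleVectorBundle I FA A FE E FDE DE FDA DA}

/-- A VB-algebroid structure on `D`: a Lie algebroid structure on `D → E` whose anchor is also a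
bundle morphism from `D → A` to `TE → TM`, and whose bracket is compatible with linear and core
sections. -/
@[ext] structure VBAlgebroid (κ : D.Core FC C) extends LieAlgebroid (I.prod 𝓘(ℝ, FE)) FDE DE where
  anchor_over : ∃ r : TotalSpace FA A → TangentBundle I M, ∀ d,
    tangentMap (I.prod 𝓘(ℝ, FE)) I TotalSpace.proj (toLieAlgebroid.anchorMap d) = r (D.toA d).proj
  anchor_add : ∀ d₁ d₂ d, IsSum (D.toA d₁) (D.toA d₂) (D.toA d) →
    TangentSum I FE E (toLieAlgebroid.anchorMap d₁) (toLieAlgebroid.anchorMap d₂)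
      (toLieAlgebroid.anchorMap d)
  anchor_scale : ∀ (c : ℝ) d d', D.toA d' = scale c (D.toA d) →
    toLieAlgebroid.anchorMap d' = tangentMap (I.prod 𝓘(ℝ, FE)) (I.prod 𝓘(ℝ, FE)) (scale c)
      (toLieAlgebroid.anchorMap d)
  bracket_linear_linear : ∀ X Y, D.IsLinear X → D.IsLinear Y → D.IsLinear (bracket X Y)
  bracket_linear_core : ∀ X Y α, D.IsLinear X → κ.IsCoreSection α Y →
    ∃ β, κ.IsCoreSection β (bracket X Y)
  bracket_core_core : ∀ X Y α β, κ.IsCoreSection α X → κ.IsCoreSection β Y → bracket X Y = 0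

/-- The Lie algebroid structure on `A → M` induced by the VB-algebroid structure `S` is `L`. -/
structure VBAlgebroid.Induces {κ : D.Core FC C} (S : VBAlgebroid κ) (L : LieAlgebroid I FA A) :
    Prop where
  anchor : ∀ d, tangentMap (I.prod 𝓘(ℝ, FE)) I TotalSpace.proj (S.anchorMap d) =
    L.anchorMap (D.toA d).proj
  bracket : ∀ X Y X₀ Y₀, D.IsLinear X → D.IsLinear Y → D.ProjectsTo X X₀ → D.ProjectsTo Y Y₀ →
    D.ProjectsTo (S.bracket X Y) (L.bracket X₀ Y₀)

/-- `f : E → ℝ` is linear on the fibres, i.e. a section of `E^*`. -/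
def IsFiberLinear (f : Fun (I.prod 𝓘(ℝ, FE)) (TotalSpace FE E)) : Prop :=
  ∀ m, IsLinearMap ℝ (fun u : E m => f ⟨m, u⟩)

/-- `Q = (∂, ∇^c, ∇^s, Ω)` is the data obtained from the VB-algebroid structure `S` and the
horizontal lift `X ↦ h X`:
* `⟨∂ α, f⟩ = - ρ_D(α) f`,
* `∇^c_X α = [h X, α]_D`,
* `⟨∇^s_X ε, f⟩ = ρ_A(X) ⟨ε, f⟩ - ⟨ε, ρ_D(h X) f⟩`,
* `Ω_{X,Y} = h [X, Y] - [h X, h Y]`,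
for `α ∈ Γ(C)`, `ε ∈ Γ(E)` and `f ∈ Γ(E^*)`, viewed as a function on `E`. -/
structure VBAlgebroid.HasData {κ : D.Core FC C} (S : VBAlgebroid κ) (h : D.HorizontalLift)
    {L : LieAlgebroid I FA A} (Q : SuperData L (Sec I FC C) (Sec I FE E)) : Prop where
  bd : ∀ α Y, κ.IsCoreSection α Y → ∀ f, IsFiberLinear f → ∀ e : TotalSpace FE E,
    f ⟨e.proj, Q.bd α e.proj⟩ = - S.deriv Y f e
  nablaC : ∀ X α Y, κ.IsCoreSection α Y →
    κ.IsCoreSection (Q.nablaC.nabla X α) (S.bracket (h.lift X) Y)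
  nablaE : ∀ X (ε : Sec I FE E) f, IsFiberLinear f → ∀ m,
    f ⟨m, Q.nablaE.nabla X ε m⟩ =
      mvfderiv I (fun x => f ⟨x, ε x⟩) m (L.anchor m (X m)) - S.deriv (h.lift X) f ⟨m, ε m⟩
  curv : ∀ X Y (ε : Sec I FE E) m,
    κ.IsPoint ⟨m, Q.curv ![X, Y] ε m⟩ ⟨m, ε m⟩
      ⟨⟨m, ε m⟩, h.lift (L.bracket X Y) ⟨m, ε m⟩ - S.bracket (h.lift X) (h.lift Y) ⟨m, ε m⟩⟩

end Geometry

section Decomposed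
variable {EM HM : Type*} [NormedAddCommGroup EM] [NormedSpace ℝ EM] [TopologicalSpace HM]
  (I : ModelWithCorners ℝ EM HM) {M : Type*} [TopologicalSpace M] [ChartedSpace HM M]
  [IsManifold I ∞ M]
  (FA : Type*) [NormedAddCommGroup FA] [NormedSpace ℝ FA]
  (A : M → Type*) [TopologicalSpace (TotalSpace FA A)] [∀ m, AddCommGroup (A m)]
  [∀ m, Module ℝ (A m)] [∀ m, TopologicalSpace (A m)] [FiberBundle FA A] [VectorBundle ℝ FA A]
  [ContMDiffVectorBundle ∞ FA A I]
  (FE : Type*) [NormedAddCommGroup FE] [NormedSpace ℝ FE]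
  (E : M → Type*) [TopologicalSpace (TotalSpace FE E)] [∀ m, AddCommGroup (E m)]
  [∀ m, Module ℝ (E m)] [∀ m, TopologicalSpace (E m)] [FiberBundle FE E] [VectorBundle ℝ FE E]
  [ContMDiffVectorBundle ∞ FE E I]
  (FC : Type*) [NormedAddCommGroup FC] [NormedSpace ℝ FC]
  (C : M → Type*) [TopologicalSpace (TotalSpace FC C)] [∀ m, AddCommGroup (C m)]
  [∀ m, Module ℝ (C m)] [∀ m, TopologicalSpace (C m)] [FiberBundle FC C] [VectorBundle ℝ FC C]
  [ContMDiffVectorBundle ∞ FC C I]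

instance {B B' : Type*} (f : B' → B) (V : B → Type*) [∀ b, AddCommGroup (V b)] (b : B') :
    AddCommGroup ((f *ᵖ V) b) :=
  inferInstanceAs (AddCommGroup (V (f b)))

/-- The projection of a vector bundle as a smooth map. -/
def projMap : C^∞⟮I.prod 𝓘(ℝ, FE), TotalSpace FE E; I, M⟯ := ⟨TotalSpace.proj, contMDiff_proj E⟩

/-- The pullback of `A ⊕ C` to the total space of `E`. -/
abbrev PullbackSum : TotalSpace FE E → Type _ :=
  (⇑(projMap I FE E) *ᵖ A) ×ᵇ (⇑(projMap I FE E) *ᵖ C)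

section Smooth
set_option linter.unusedSectionVars false
variable {I FA A FE E FC C}
variable {EN HN : Type*} [NormedAddCommGroup EN] [NormedSpace ℝ EN] [TopologicalSpace HN]
  {J : ModelWithCorners ℝ EN HN} {N : Type*} [TopologicalSpace N] [ChartedSpace HN N]

theorem contMDiff_pullbackSum_iff {f : N → TotalSpace (FA × FC) (PullbackSum I A FE E C)} :
    ContMDiff J ((I.prod 𝓘(ℝ, FE)).prod 𝓘(ℝ, FA × FC)) ∞ f ↔
      ContMDiff J (I.prod 𝓘(ℝ, FE)) ∞ (fun x => (f x).proj) ∧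
      ContMDiff J (I.prod 𝓘(ℝ, FA)) ∞
        (fun x => (⟨(f x).proj.proj, (f x).snd.1⟩ : TotalSpace FA A)) ∧
      ContMDiff J (I.prod 𝓘(ℝ, FC)) ∞
        (fun x => (⟨(f x).proj.proj, (f x).snd.2⟩ : TotalSpace FC C)) := by
  have key : ∀ x₀ x, (trivializationAt (FA × FC) (PullbackSum I A FE E C) (f x₀).proj (f x)).2 =
      ((trivializationAt FA A (f x₀).proj.proj ⟨(f x).proj.proj, (f x).snd.1⟩).2,
       (trivializationAt FC C (f x₀).proj.proj ⟨(f x).proj.proj, (f x).snd.2⟩).2) :=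
    fun _ _ => rfl
  constructor
  · intro hf
    have h0 : ContMDiff J (I.prod 𝓘(ℝ, FE)) ∞ (fun x => (f x).proj) := fun x₀ =>
      (contMDiffAt_totalSpace.1 (hf x₀)).1
    have h1 : ContMDiff J I ∞ (fun x => (f x).proj.proj) := (contMDiff_proj E).comp h0
    refine ⟨h0, fun x₀ => contMDiffAt_totalSpace.2 ⟨h1 x₀, ?_⟩,
      fun x₀ => contMDiffAt_totalSpace.2 ⟨h1 x₀, ?_⟩⟩
    · have := (contMDiffAt_totalSpace.1 (hf x₀)).2
      simp only [key] at this
      exact ((contDiff_fst (𝕜 := ℝ) (E := FA) (F := FC) (n := ∞)).contMDiff.contMDiffAt).comp x₀ this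
    · have := (contMDiffAt_totalSpace.1 (hf x₀)).2
      simp only [key] at this
      exact ((contDiff_snd (𝕜 := ℝ) (E := FA) (F := FC) (n := ∞)).contMDiff.contMDiffAt).comp x₀ this
  · rintro ⟨h0, h1, h2⟩ x₀
    refine contMDiffAt_totalSpace.2 ⟨h0 x₀, ?_⟩
    simp only [key]
    exact (contMDiffAt_totalSpace.1 (h1 x₀)).2.prodMk_space
      (contMDiffAt_totalSpace.1 (h2 x₀)).2

variable (I FA A FE E FC C) in
/-- The two bundle structures of `A ⊕ E ⊕ C` are identified by a smooth map. -/
theorem contMDiff_swap : ContMDiff ((I.prod 𝓘(ℝ, FE)).prod 𝓘(ℝ, FA × FC))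
    ((I.prod 𝓘(ℝ, FA)).prod 𝓘(ℝ, FE × FC)) ∞
    (fun d : TotalSpace (FA × FC) (PullbackSum I A FE E C) =>
      (⟨⟨d.proj.proj, d.snd.1⟩, (d.proj.snd, d.snd.2)⟩ :
        TotalSpace (FE × FC) (PullbackSum I E FA A C))) := by
  have h := contMDiff_pullbackSum_iff.1
    (contMDiff_id (I := (I.prod 𝓘(ℝ, FE)).prod 𝓘(ℝ, FA × FC)) (n := ∞)
      (M := TotalSpace (FA × FC) (PullbackSum I A FE E C)))
  exact contMDiff_pullbackSum_iff.2 ⟨h.2.1, h.1, h.2.2⟩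

end Smooth

/-- The decomposed double vector bundle `A ⊕ E ⊕ C`. -/
def decomposed : DoubleVectorBundle I FA A FE E (FA × FC) (PullbackSum I A FE E C)
    (FE × FC) (PullbackSum I E FA A C) where
  toA :=
    { toFun := fun d => ⟨⟨d.proj.proj, d.snd.1⟩, (d.proj.snd, d.snd.2)⟩
      invFun := fun d => ⟨⟨d.proj.proj, d.snd.1⟩, (d.proj.snd, d.snd.2)⟩
      left_inv := fun _ => rfl
      right_inv := fun _ => rfl
      contMDiff_toFun := contMDiff_swap I FA A FE E FC C
      contMDiff_invFun := contMDiff_swap I FE E FA A FC C }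
  square _ := rfl
  projA_add := by
    rintro _ _ _ ⟨b, u, v, rfl, rfl, rfl⟩
    exact ⟨b.proj, u.1, v.1, rfl, rfl, rfl⟩
  projE_add := by
    rintro ⟨⟨m₁, e₁⟩, a₁, c₁⟩ ⟨⟨m₂, e₂⟩, a₂, c₂⟩ ⟨⟨m, e⟩, a, c⟩ ⟨⟨n, b⟩, ⟨u, x⟩, ⟨v, y⟩, h₁, h₂, h₃⟩
    cases h₁; cases h₂; cases h₃
    exact ⟨_, _, _, rfl, rfl, rfl⟩
  interchange := by
    rintro d₁ d₂ d₃ d₄ d₁₂ d₃₄ d₁₃ d₂₄ ⟨⟨m, e⟩, ⟨a₁, c₁⟩, ⟨a₂, c₂⟩, rfl, rfl, rfl⟩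
      ⟨⟨m', e'⟩, ⟨a₃, c₃⟩, ⟨a₄, c₄⟩, rfl, rfl, rfl⟩ ⟨⟨n, b⟩, ⟨u, x⟩, ⟨v, y⟩, h₁, h₂, h₃⟩
      ⟨⟨n', b'⟩, ⟨u', x'⟩, ⟨v', y'⟩, h₄, h₅, h₆⟩
    obtain ⟨⟨m₁₃, e₁₃⟩, a₁₃, c₁₃⟩ := d₁₃
    obtain ⟨⟨m₂₄, e₂₄⟩, a₂₄, c₂₄⟩ := d₂₄
    cases h₁; cases h₂; cases h₃; cases h₄; cases h₅; cases h₆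
    let add : C m → C m → C m := fun c c' => c + c'
    refine ⟨⟨⟨m, e + e'⟩, (a₁ + a₂, add (add c₁ c₃) (add c₂ c₄))⟩, ⟨⟨m, a₁ + a₂⟩, (e, add c₁ c₂),
      (e', add c₃ c₄), rfl, rfl, ?_⟩,
      ⟨⟨m, e + e'⟩, (a₁, add c₁ c₃), (a₂, add c₂ c₄), rfl, rfl, rfl⟩⟩
    have : add (add c₁ c₃) (add c₂ c₄) = add (add c₁ c₂) (add c₃ c₄) :=
      add_add_add_comm (G := C m) c₁ c₃ c₂ c₄
    exact congrArg (fun z : C m => (⟨⟨m, a₁ + a₂⟩, (e + e', z)⟩ :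
      TotalSpace (FE × FC) (PullbackSum I E FA A C))) this

/-- The core of `A ⊕ E ⊕ C` is `C`. -/
def decomposedCore : (decomposed I FA A FE E FC C).Core FC C where
  ι := fun c => ⟨⟨c.proj, 0⟩, (0, c.snd)⟩
  smooth := contMDiff_pullbackSum_iff.2
    ⟨(contMDiff_zeroSection ℝ E).comp (contMDiff_proj C),
     (contMDiff_zeroSection ℝ A).comp (contMDiff_proj C), contMDiff_id⟩
  injective := by
    rintro ⟨m, c⟩ ⟨m', c'⟩ h
    cases h
    rfl
  linear := fun m => ⟨⟨m, 0⟩, LinearMap.inr ℝ (A m) (C m), fun _ => rfl⟩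
  overBase := fun _ => rfl
  range := by
    rintro ⟨⟨m, e⟩, a, c⟩
    constructor
    · rintro ⟨⟨n, x⟩, h⟩
      cases h
      exact ⟨rfl, rfl⟩
    · rintro ⟨h₁, h₂⟩
      have he : e = 0 := eq_of_heq (TotalSpace.mk.inj h₁).2
      have ha : a = (0 : A m) := eq_of_heq (TotalSpace.mk.inj h₂).2
      subst he ha
      exact ⟨⟨m, c⟩, rfl⟩

/-- The natural horizontal lift `h X (e) = (X, e, 0)` of `A ⊕ E ⊕ C`. -/
def decomposedLift : (decomposed I FA A FE E FC C).HorizontalLift where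
  lift := fun X => ⟨fun e => (X e.proj, 0), contMDiff_pullbackSum_iff.2
    ⟨contMDiff_id, X.contMDiff.comp (contMDiff_proj E),
      (contMDiff_zeroSection ℝ C).comp (contMDiff_proj E)⟩⟩
  map_add := fun X Y => by
    refine ContMDiffSection.ext fun e => ?_
    refine Prod.ext (rfl : (X + Y) e.proj = X e.proj + Y e.proj) ?_
    exact (add_zero (0 : C e.proj)).symm
  map_smul := fun f X e =>
    Prod.ext (rfl : (f • X) e.proj = f e.proj • X e.proj) (smul_zero (A := C e.proj) (f e.proj)).symm
  linear := fun X m => ⟨⟨m, X m⟩, LinearMap.inl ℝ (E m) (C m), fun _ => rfl⟩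
  projects := fun _ _ => rfl

end Decomposed

section Decomposition
variable {EM HM : Type*} [NormedAddCommGroup EM] [NormedSpace ℝ EM] [TopologicalSpace HM]
  {I : ModelWithCorners ℝ EM HM} {M : Type*} [TopologicalSpace M] [ChartedSpace HM M]
  [IsManifold I ∞ M]
  {FA : Type*} [NormedAddCommGroup FA] [NormedSpace ℝ FA]
  {A : M → Type*} [TopologicalSpace (TotalSpace FA A)] [∀ m, AddCommGroup (A m)]
  [∀ m, Module ℝ (A m)] [∀ m, TopologicalSpace (A m)] [FiberBundle FA A] [VectorBundle ℝ FA A]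
  [ContMDiffVectorBundle ∞ FA A I]
  {FE : Type*} [NormedAddCommGroup FE] [NormedSpace ℝ FE]
  {E : M → Type*} [TopologicalSpace (TotalSpace FE E)] [∀ m, AddCommGroup (E m)]
  [∀ m, Module ℝ (E m)] [∀ m, TopologicalSpace (E m)] [FiberBundle FE E] [VectorBundle ℝ FE E]
  [ContMDiffVectorBundle ∞ FE E I]
  {FC : Type*} [NormedAddCommGroup FC] [NormedSpace ℝ FC]
  {C : M → Type*} [TopologicalSpace (TotalSpace FC C)] [∀ m, AddCommGroup (C m)]
  [∀ m, Module ℝ (C m)] [∀ m, TopologicalSpace (C m)] [FiberBundle FC C] [VectorBundle ℝ FC C]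
  [ContMDiffVectorBundle ∞ FC C I]
  {FDE : Type*} [NormedAddCommGroup FDE] [NormedSpace ℝ FDE]
  {DE : TotalSpace FE E → Type*} [TopologicalSpace (TotalSpace FDE DE)]
  [∀ e, AddCommGroup (DE e)] [∀ e, Module ℝ (DE e)] [∀ e, TopologicalSpace (DE e)]
  [FiberBundle FDE DE] [VectorBundle ℝ FDE DE]
  {FDA : Type*} [NormedAddCommGroup FDA] [NormedSpace ℝ FDA]
  {DA : TotalSpace FA A → Type*} [TopologicalSpace (TotalSpace FDA DA)]
  [∀ a, AddCommGroup (DA a)] [∀ a, Module ℝ (DA a)] [∀ a, TopologicalSpace (DA a)]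
  [FiberBundle FDA DA] [VectorBundle ℝ FDA DA]
  {D : DoubleVectorBundle I FA A FE E FDE DE FDA DA}

/-- A decomposition of `D`: an isomorphism of double vector bundles `D ≅ A ⊕ E ⊕ C` inducing the
identity on `A`, `E` and `C`. -/
structure Decomposition (κ : D.Core FC C) where
  iso : TotalSpace FDE DE ≃ₘ^∞⟮(I.prod 𝓘(ℝ, FE)).prod 𝓘(ℝ, FDE),
    (I.prod 𝓘(ℝ, FE)).prod 𝓘(ℝ, FA × FC)⟯ TotalSpace (FA × FC) (PullbackSum I A FE E C)
  projE : ∀ d, (iso d).proj = d.proj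
  projA : ∀ d, ((decomposed I FA A FE E FC C).toA (iso d)).proj = (D.toA d).proj
  linearE : IsBundleMorphism iso
  linearA : IsBundleMorphism
    (fun d : TotalSpace FDA DA => (decomposed I FA A FE E FC C).toA (iso (D.toA.symm d)))
  core : ∀ c, iso (κ.ι c) = (decomposedCore I FA A FE E FC C).ι c

/-- The horizontal lift `h` is the one determined by the decomposition: it corresponds to the
natural horizontal lift of `A ⊕ E ⊕ C`. -/
def Decomposition.Induces {κ : D.Core FC C} (Ψ : Decomposition κ) (h : D.HorizontalLift) : Prop :=
  ∀ X e, Ψ.iso ⟨e, h.lift X e⟩ = ⟨e, (decomposedLift I FA A FE E FC C).lift X e⟩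

variable (L : LieAlgebroid I FA A)

/-- The VB-algebroid structures on `D` inducing the given Lie algebroid structure on `A`. -/
abbrev VBAlgebroidOver (κ : D.Core FC C) : Type _ := {S : VBAlgebroid κ // S.Induces L}

/-- The flat superconnections on `C[1] ⊕ E`. -/
abbrev FlatSuperconnection (NC NE : Type*) [AddCommGroup NC] [Module (Fun I M) NC]
    [AddCommGroup NE] [Module (Fun I M) NE] : Type _ :=
  {𝒟 : Superconnection L NC NE // 𝒟.IsFlat}

/-- `Θ` assigns to a VB-algebroid structure the superconnection `∂ + D^c + D^s + Ω` formed from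
the data obtained from it by means of the horizontal lift `h`. -/
def IsCanonical {κ : D.Core FC C} (h : D.HorizontalLift)
    (Θ : VBAlgebroidOver L κ ≃ FlatSuperconnection L (Sec I FC C) (Sec I FE E)) : Prop :=
  ∀ (S : VBAlgebroidOver L κ) (Q : SuperData L (Sec I FC C) (Sec I FE E)),
    S.1.HasData h Q ↔ (Θ S).1.op = Q.op

end Decomposition

end VBAlgebroids
end

open VBAlgebroids

open Bundle Manifold ContDiff

noncomputable section
namespace VBAlgebroids

section Shuffles
set_option linter.unusedSectionVars false
open Equiv TensorProduct
variable {R S N N₁ N₂ N₃ : Type*} [CommRing R] [AddCommGroup S] [Module R S]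
  [AddCommGroup N] [Module R N] [AddCommGroup N₁] [Module R N₁] [AddCommGroup N₂] [Module R N₂]
  [AddCommGroup N₃] [Module R N₃]

/-- The permutations of `Fin (n + 1)` that map `k` to `0`, as `k` varies. -/
theorem bijective_decomposeFin_cycleRange (n : ℕ) : Function.Bijective
    (fun x : Fin (n + 1) × Perm (Fin n) => Perm.decomposeFin.symm (0, x.2) * x.1.cycleRange) := by
  rw [Fintype.bijective_iff_injective_and_card]
  refine ⟨?_, by
    rw [Fintype.card_prod, Fintype.card_perm, Fintype.card_perm, Fintype.card_fin,
      Fintype.card_fin, Nat.factorial_succ]⟩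
  have h0 : ∀ (k : Fin (n + 1)) (τ : Perm (Fin n)),
      (Perm.decomposeFin.symm (0, τ) * k.cycleRange) k = 0 := fun k τ => by
    rw [Perm.mul_apply, Fin.cycleRange_self, Perm.decomposeFin_symm_apply_zero]
  rintro ⟨k, τ⟩ ⟨l, τ'⟩ h
  replace h : Perm.decomposeFin.symm (0, τ) * k.cycleRange =
    Perm.decomposeFin.symm (0, τ') * l.cycleRange := h
  have hk : k = l := by
    have h1 := h0 k τ
    rw [h] at h1
    exact (Perm.decomposeFin.symm (0, τ') * l.cycleRange).injective (h1.trans (h0 l τ').symm)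
  subst hk
  exact Prod.ext rfl (Prod.ext_iff.1 (Perm.decomposeFin.symm.injective (mul_right_cancel h))).2

theorem alternatization_cons {n : ℕ} (T : MultilinearMap R (fun _ : Fin (n + 1) => S) N)
    (X : S) (w : Fin n → S) :
    MultilinearMap.alternatization T (Fin.cons X w : Fin (n + 1) → S) =
      ∑ k : Fin (n + 1), ∑ τ : Perm (Fin n), (-1 : ℤ) ^ (k : ℕ) •
        Perm.sign τ • T (k.insertNth X (fun i => w (τ i))) := by
  rw [MultilinearMap.alternatization_apply, ← Fintype.sum_prod_type',
    ← (bijective_decomposeFin_cycleRange n).sum_comp]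
  refine Finset.sum_congr rfl fun x _ => ?_
  obtain ⟨k, τ⟩ := x
  have hs : Perm.sign (Perm.decomposeFin.symm (0, τ) * k.cycleRange) =
      (-1) ^ (k : ℕ) * Perm.sign τ := by
    rw [Perm.sign_mul, Perm.decomposeFin.symm_sign, Fin.sign_cycleRange]
    simp [mul_comm]
  have hv : (fun i => (Fin.cons X w : Fin (n + 1) → S)
      ((Perm.decomposeFin.symm (0, τ) * k.cycleRange) i)) = k.insertNth X (fun i => w (τ i)) := by
    funext i
    refine Fin.succAboveCases k ?_ (fun j => ?_) i
    · simp
    · simp [Fin.cycleRange_succAbove]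
  rw [MultilinearMap.domDomCongr_apply, hs, hv, mul_smul]
  rw [Units.smul_def]
  simp

/-- `u ↦ B(x(u_0, …, u_{p-1}), y(u_p, …, u_{n-1}))`. -/
def juxtapose (B : N₁ →ₗ[R] N₂ →ₗ[R] N₃) {p q n : ℕ} (h : p + q = n)
    (x : S [⋀^Fin p]→ₗ[R] N₁) (y : S [⋀^Fin q]→ₗ[R] N₂) : MultilinearMap R (fun _ : Fin n => S) N₃ :=
  ((TensorProduct.lift B).compMultilinearMap
    (MultilinearMap.domCoprod (x : MultilinearMap R (fun _ : Fin p => S) N₁)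
      (y : MultilinearMap R (fun _ : Fin q => S) N₂))).domDomCongr
    (finSumFinEquiv.trans (finCongr h))

theorem juxtapose_apply (B : N₁ →ₗ[R] N₂ →ₗ[R] N₃) {p q n : ℕ} (h : p + q = n)
    (x : S [⋀^Fin p]→ₗ[R] N₁) (y : S [⋀^Fin q]→ₗ[R] N₂) (u : Fin n → S) :
    juxtapose B h x y u = B (x fun i => u (Fin.cast h (Fin.castAdd q i)))
      (y fun j => u (Fin.cast h (Fin.natAdd p j))) := by
  rfl

/-- The shuffle product. -/
def shuffle (B : N₁ →ₗ[R] N₂ →ₗ[R] N₃) {p q : ℕ} (x : S [⋀^Fin p]→ₗ[R] N₁)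
    (y : S [⋀^Fin q]→ₗ[R] N₂) : S [⋀^Fin (p + q)]→ₗ[R] N₃ :=
  ((TensorProduct.lift B).compAlternatingMap (x.domCoprod y)).domDomCongr finSumFinEquiv

theorem factorial_smul_shuffle (B : N₁ →ₗ[R] N₂ →ₗ[R] N₃) {p q n : ℕ} (h : p + q = n)
    (x : S [⋀^Fin p]→ₗ[R] N₁) (y : S [⋀^Fin q]→ₗ[R] N₂) (v : Fin n → S) :
    (p.factorial * q.factorial) • shuffle B x y (fun i => v (Fin.cast h i)) =
      MultilinearMap.alternatization (juxtapose B h x y) v := by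
  subst h
  have h1 := MultilinearMap.domCoprod_alternization_eq (R' := R) x y
  have h2 := congrArg (fun z => TensorProduct.lift B (z (fun i => v (finSumFinEquiv i)))) h1
  simp only [AlternatingMap.smul_apply, map_nsmul, Fintype.card_fin,
    MultilinearMap.alternatization_apply, map_sum] at h2
  refine Eq.trans h2.symm ?_
  rw [MultilinearMap.alternatization_apply, ← (finSumFinEquiv (m := p) (n := q)).permCongr.sum_comp]
  refine Finset.sum_congr rfl fun σ _ => ?_
  rw [Perm.sign_permCongr, Units.smul_def, Units.smul_def, map_zsmul]
  congr 1
  simp only [MultilinearMap.domDomCongr_apply]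
  rw [juxtapose_apply]
  simp only [MultilinearMap.domCoprod_apply, TensorProduct.lift.tmul, Equiv.permCongr_apply]
  have e₁ : ∀ i, finSumFinEquiv.symm (Fin.cast rfl (Fin.castAdd q i)) = (Sum.inl i : Fin p ⊕ Fin q) :=
    fun i => finSumFinEquiv_symm_apply_castAdd i
  have e₂ : ∀ i, finSumFinEquiv.symm (Fin.cast rfl (Fin.natAdd p i)) = (Sum.inr i : Fin p ⊕ Fin q) :=
    fun i => finSumFinEquiv_symm_apply_natAdd i
  simp only [e₁, e₂]
  rfl

theorem insertNth_castAdd {p q n : ℕ} (h : p + q = n) (h' : p + 1 + q = n + 1) (i : Fin (p + 1))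
    (X : S) (u : Fin n → S) :
    (fun a => (Fin.cast h' (Fin.castAdd q i)).insertNth (α := fun _ => S) X u
      (Fin.cast h' (Fin.castAdd q a))) =
        i.insertNth X (fun a => u (Fin.cast h (Fin.castAdd q a))) ∧
    (fun b : Fin q => (Fin.cast h' (Fin.castAdd q i)).insertNth (α := fun _ => S) X u
      (Fin.cast h' (Fin.natAdd (p + 1) b))) = fun b => u (Fin.cast h (Fin.natAdd p b)) := by
  subst h
  constructor
  · funext a
    refine Fin.succAboveCases i ?_ (fun j => ?_) a
    · simp
    · have : Fin.cast h' (Fin.castAdd q (i.succAbove j)) =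
          (Fin.cast h' (Fin.castAdd q i)).succAbove (Fin.castAdd q j) := by
        ext; simp [Fin.succAbove, Fin.lt_def]; split_ifs <;> simp
      rw [this]
      simp
  · funext b
    have : Fin.cast h' (Fin.natAdd (p + 1) b) =
        (Fin.cast h' (Fin.castAdd q i)).succAbove (Fin.natAdd p b) := by
      ext; simp [Fin.succAbove, Fin.lt_def]; split_ifs <;> simp <;> omega
    rw [this]
    simp

theorem insertNth_natAdd {p q n : ℕ} (h : p + q = n) (h' : p + (q + 1) = n + 1) (i : Fin (q + 1))
    (X : S) (u : Fin n → S) :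
    (fun a => (Fin.cast h' (Fin.natAdd p i)).insertNth (α := fun _ => S) X u
      (Fin.cast h' (Fin.castAdd (q + 1) a))) = (fun a => u (Fin.cast h (Fin.castAdd q a))) ∧
    (fun b : Fin (q + 1) => (Fin.cast h' (Fin.natAdd p i)).insertNth (α := fun _ => S) X u
      (Fin.cast h' (Fin.natAdd p b))) = i.insertNth X fun b => u (Fin.cast h (Fin.natAdd p b)) := by
  subst h
  constructor
  · funext a
    have : Fin.cast h' (Fin.castAdd (q + 1) a) =
        (Fin.cast h' (Fin.natAdd p i)).succAbove (Fin.castAdd q a) := by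
      ext; simp [Fin.succAbove, Fin.lt_def]; split_ifs; simp; omega
    rw [this]
    simp
  · funext b
    refine Fin.succAboveCases i ?_ (fun j => ?_) b
    · simp
    · have : Fin.cast h' (Fin.natAdd p (i.succAbove j)) =
          (Fin.cast h' (Fin.natAdd p i)).succAbove (Fin.natAdd p j) := by
        ext; simp [Fin.succAbove, Fin.lt_def]; split_ifs <;> simp <;> omega
      rw [this]
      simp

/-- The interior product, `0` on forms of degree `0`. -/
def interior (X : S) : ∀ {p : ℕ}, S [⋀^Fin p]→ₗ[R] N → S [⋀^Fin (p - 1)]→ₗ[R] N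
  | 0, _ => 0
  | _ + 1, x => x.curryLeft X

theorem map_insertNth_eq {p : ℕ} (x : S [⋀^Fin (p + 1)]→ₗ[R] N) (i : Fin (p + 1)) (X : S)
    (u : Fin p → S) : x (i.insertNth X u) = (-1 : ℤ) ^ (i : ℕ) • x (Fin.cons X u) := by
  rw [AlternatingMap.map_insertNth]; rfl

theorem neg_one_pow_smul_smul {M : Type*} [AddCommGroup M] (k : ℕ) (x : M) :
    (-1 : ℤ) ^ k • (-1 : ℤ) ^ k • x = x := by
  rw [← mul_smul, ← mul_pow]; simp

theorem sum_castAdd (B : N₁ →ₗ[R] N₂ →ₗ[R] N₃) {p q n : ℕ} (h : p + 1 + q = n + 1)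
    (h₁ : p + q = n) (x : S [⋀^Fin (p + 1)]→ₗ[R] N₁) (y : S [⋀^Fin q]→ₗ[R] N₂) (X : S)
    (w : Fin n → S) :
    ∑ i : Fin (p + 1), ∑ τ : Perm (Fin n), (-1 : ℤ) ^ (i : ℕ) • Perm.sign τ •
      juxtapose B h x y ((Fin.cast h (Fin.castAdd q i)).insertNth X (fun i => w (τ i))) =
    ((p + 1).factorial * q.factorial) •
      shuffle B (x.curryLeft X) y (fun i => w (Fin.cast h₁ i)) := by
  have key : ∀ i : Fin (p + 1), ∑ τ : Perm (Fin n), (-1 : ℤ) ^ (i : ℕ) • Perm.sign τ •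
      juxtapose B h x y ((Fin.cast h (Fin.castAdd q i)).insertNth X (fun i => w (τ i))) =
      MultilinearMap.alternatization (juxtapose B h₁ (x.curryLeft X) y) w := fun i => by
    rw [MultilinearMap.alternatization_apply]
    refine Finset.sum_congr rfl fun τ _ => ?_
    rw [juxtapose_apply, (insertNth_castAdd h₁ h i X _).1, (insertNth_castAdd h₁ h i X _).2,
      map_insertNth_eq, map_zsmul, LinearMap.smul_apply, Units.smul_def,
      smul_comm ((Perm.sign τ : ℤˣ) : ℤ), neg_one_pow_smul_smul]
    rfl
  simp only [key, Finset.sum_const, Finset.card_univ, Fintype.card_fin]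
  rw [← factorial_smul_shuffle B h₁, ← mul_smul, Nat.factorial_succ, mul_assoc]

theorem sum_natAdd (B : N₁ →ₗ[R] N₂ →ₗ[R] N₃) {p q n : ℕ} (h : p + (q + 1) = n + 1)
    (h₁ : p + q = n) (x : S [⋀^Fin p]→ₗ[R] N₁) (y : S [⋀^Fin (q + 1)]→ₗ[R] N₂) (X : S)
    (w : Fin n → S) :
    ∑ i : Fin (q + 1), ∑ τ : Perm (Fin n), (-1 : ℤ) ^ (p + i : ℕ) • Perm.sign τ •
      juxtapose B h x y ((Fin.cast h (Fin.natAdd p i)).insertNth X (fun i => w (τ i))) =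
    (p.factorial * (q + 1).factorial) • (-1 : ℤ) ^ p •
      shuffle B x (y.curryLeft X) (fun i => w (Fin.cast h₁ i)) := by
  have key : ∀ i : Fin (q + 1), ∑ τ : Perm (Fin n), (-1 : ℤ) ^ (p + i : ℕ) • Perm.sign τ •
      juxtapose B h x y ((Fin.cast h (Fin.natAdd p i)).insertNth X (fun i => w (τ i))) =
      (-1 : ℤ) ^ p • MultilinearMap.alternatization (juxtapose B h₁ x (y.curryLeft X)) w :=
        fun i => by
    rw [MultilinearMap.alternatization_apply, Finset.smul_sum]
    refine Finset.sum_congr rfl fun τ _ => ?_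
    rw [juxtapose_apply, (insertNth_natAdd h₁ h i X _).1, (insertNth_natAdd h₁ h i X _).2,
      map_insertNth_eq, map_zsmul, Units.smul_def,
      smul_comm ((Perm.sign τ : ℤˣ) : ℤ), pow_add, mul_smul, neg_one_pow_smul_smul]
    rfl
  simp only [key, Finset.sum_const, Finset.card_univ, Fintype.card_fin]
  rw [← factorial_smul_shuffle B h₁, smul_comm ((-1 : ℤ) ^ p), ← mul_smul, Nat.factorial_succ,
    mul_left_comm]

theorem factorial_smul_shuffle_cons (B : N₁ →ₗ[R] N₂ →ₗ[R] N₃) {p q n : ℕ} (h : p + q = n + 1)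
    (x : S [⋀^Fin p]→ₗ[R] N₁) (y : S [⋀^Fin q]→ₗ[R] N₂) (X : S) (w : Fin n → S) :
    (p.factorial * q.factorial) •
      shuffle B x y (fun i => (Fin.cons X w : Fin (n + 1) → S) (Fin.cast h i)) =
    ∑ i : Fin p, ∑ τ : Perm (Fin n), (-1 : ℤ) ^ (i : ℕ) • Perm.sign τ •
      juxtapose B h x y ((Fin.cast h (Fin.castAdd q i)).insertNth X (fun i => w (τ i))) +
    ∑ i : Fin q, ∑ τ : Perm (Fin n), (-1 : ℤ) ^ (p + i : ℕ) • Perm.sign τ •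
      juxtapose B h x y ((Fin.cast h (Fin.natAdd p i)).insertNth X (fun i => w (τ i))) := by
  rw [factorial_smul_shuffle, alternatization_cons, ← (finCongr h).sum_comp, Fin.sum_univ_add]
  rfl

theorem eq_of_factorial_smul_eq [IsAddTorsionFree N] {p q : ℕ} {x y : N}
    (h : (p.factorial * q.factorial) • x = (p.factorial * q.factorial) • y) : x = y :=
  nsmul_right_injective (Nat.mul_ne_zero p.factorial_ne_zero q.factorial_ne_zero) h

theorem shuffle_cons [IsAddTorsionFree N₃] (B : N₁ →ₗ[R] N₂ →ₗ[R] N₃) {p q n : ℕ}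
    (h : p + 1 + (q + 1) = n + 1) (h₁ : p + (q + 1) = n) (h₂ : p + 1 + q = n)
    (x : S [⋀^Fin (p + 1)]→ₗ[R] N₁) (y : S [⋀^Fin (q + 1)]→ₗ[R] N₂) (X : S) (w : Fin n → S) :
    shuffle B x y (fun i => (Fin.cons X w : Fin (n + 1) → S) (Fin.cast h i)) =
      shuffle B (x.curryLeft X) y (fun i => w (Fin.cast h₁ i)) +
      (-1 : ℤ) ^ (p + 1) • shuffle B x (y.curryLeft X) (fun i => w (Fin.cast h₂ i)) := by
  refine eq_of_factorial_smul_eq (p := p + 1) (q := q + 1) ?_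
  rw [factorial_smul_shuffle_cons, sum_castAdd B h h₁, sum_natAdd B h h₂, smul_add]

theorem shuffle_zero_cons [IsAddTorsionFree N₃] (B : N₁ →ₗ[R] N₂ →ₗ[R] N₃) {q n : ℕ}
    (h : 0 + (q + 1) = n + 1) (h₂ : 0 + q = n)
    (x : S [⋀^Fin 0]→ₗ[R] N₁) (y : S [⋀^Fin (q + 1)]→ₗ[R] N₂) (X : S) (w : Fin n → S) :
    shuffle B x y (fun i => (Fin.cons X w : Fin (n + 1) → S) (Fin.cast h i)) =
      shuffle B x (y.curryLeft X) (fun i => w (Fin.cast h₂ i)) := by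
  refine eq_of_factorial_smul_eq (p := 0) (q := q + 1) ?_
  rw [factorial_smul_shuffle_cons, sum_natAdd B h h₂]
  simp

theorem shuffle_cons_zero [IsAddTorsionFree N₃] (B : N₁ →ₗ[R] N₂ →ₗ[R] N₃) {p n : ℕ}
    (h : p + 1 + 0 = n + 1) (h₁ : p + 0 = n)
    (x : S [⋀^Fin (p + 1)]→ₗ[R] N₁) (y : S [⋀^Fin 0]→ₗ[R] N₂) (X : S) (w : Fin n → S) :
    shuffle B x y (fun i => (Fin.cons X w : Fin (n + 1) → S) (Fin.cast h i)) =
      shuffle B (x.curryLeft X) y (fun i => w (Fin.cast h₁ i)) := by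
  refine eq_of_factorial_smul_eq (p := p + 1) (q := 0) ?_
  rw [factorial_smul_shuffle_cons, sum_castAdd B h h₁]
  simp

theorem shuffle_zero_zero [IsAddTorsionFree N₃] (B : N₁ →ₗ[R] N₂ →ₗ[R] N₃)
    (x : S [⋀^Fin 0]→ₗ[R] N₁) (y : S [⋀^Fin 0]→ₗ[R] N₂) (v : Fin (0 + 0) → S) :
    shuffle B x y v = B (x ![]) (y ![]) := by
  refine eq_of_factorial_smul_eq (p := 0) (q := 0) ?_
  have := factorial_smul_shuffle B (n := 0) rfl x y v
  refine Eq.trans this ?_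
  rw [MultilinearMap.alternatization_apply]
  simp [juxtapose_apply]
  congr 2
  congr 1
  all_goals subsingleton

end Shuffles

section Calculus
set_option linter.unusedSectionVars false
variable {EM HM : Type*} [NormedAddCommGroup EM] [NormedSpace ℝ EM] [TopologicalSpace HM]
  {I : ModelWithCorners ℝ EM HM} {M : Type*} [TopologicalSpace M] [ChartedSpace HM M]
  [IsManifold I ∞ M]
  {F : Type*} [NormedAddCommGroup F] [NormedSpace ℝ F]
  {V : M → Type*} [TopologicalSpace (TotalSpace F V)] [∀ m, AddCommGroup (V m)]
  [∀ m, Module ℝ (V m)] [∀ m, TopologicalSpace (V m)] [FiberBundle F V] [VectorBundle ℝ F V]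
  {N N₁ N₂ N₃ : Type*} [AddCommGroup N] [Module (Fun I M) N] [AddCommGroup N₁] [Module (Fun I M) N₁]
  [AddCommGroup N₂] [Module (Fun I M) N₂] [AddCommGroup N₃] [Module (Fun I M) N₃]

theorem isAddTorsionFree_of_module {N : Type*} [AddCommGroup N] (_ : Module (Fun I M) N) :
    IsAddTorsionFree N where
  nsmul_right_injective n hn x y h := by
    have key : algebraMap ℝ (Fun I M) (n : ℝ)⁻¹ * (n : Fun I M) = 1 := by
      rw [← map_natCast (algebraMap ℝ (Fun I M)), ← map_mul, inv_mul_cancel₀ (by exact_mod_cast hn),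
        map_one]
    have h' : n • x = n • y := h
    rw [← Nat.cast_smul_eq_nsmul (Fun I M), ← Nat.cast_smul_eq_nsmul (Fun I M) n y] at h'
    have := congrArg (fun z => algebraMap ℝ (Fun I M) (n : ℝ)⁻¹ • z) h'
    simpa only [← mul_smul, key, one_smul] using this

abbrev Form.instAddCommGroup (p : ℕ) : AddCommGroup (Form I F V N p) := inferInstance
abbrev Form.instAddCommMonoid (p : ℕ) : AddCommMonoid (Form I F V N p) := inferInstance
abbrev Form.instAddMonoid (p : ℕ) : AddMonoid (Form I F V N p) := inferInstance
abbrev Form.instAddZeroClass (p : ℕ) : AddZeroClass (Form I F V N p) := inferInstance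
abbrev Forms.instAddCommGroup : AddCommGroup (Forms I F V N) := inferInstance
abbrev Forms.instAddCommMonoid : AddCommMonoid (Forms I F V N) := inferInstance
abbrev Forms.instAddMonoid : AddMonoid (Forms I F V N) := inferInstance
abbrev Forms.instAddZeroClass : AddZeroClass (Forms I F V N) := inferInstance

attribute [local instance] Form.instAddCommGroup Form.instAddCommMonoid Form.instAddMonoid Form.instAddZeroClass
  Forms.instAddCommGroup Forms.instAddCommMonoid Forms.instAddMonoid Forms.instAddZeroClass

/-- A homogeneous element of `Ω(A; N)`. -/
abbrev Form.of {p : ℕ} (x : Form I F V N p) : Forms I F V N :=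
  DirectSum.of (fun p => Form I F V N p) p x

theorem Form.of_congr {p q : ℕ} (h : p = q) {x : Form I F V N p} {y : Form I F V N q}
    (hxy : ∀ v : Fin q → Sec I F V, x (fun i => v (Fin.cast h i)) = y v) :
    Form.of x = Form.of y := by
  subst h
  congr 1
  ext v
  exact hxy v

theorem Forms.induction {P : Forms I F V N → Prop} (z : Forms I F V N)
    (of : ∀ p (x : Form I F V N p), P (Form.of x)) (add : ∀ a b, P a → P b → P (a + b)) : P z := by
  induction z using DirectSum.induction_on with
  | zero =>
    have := of 0 0
    rwa [Form.of, map_zero] at this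
  | of p x => exact of p x
  | add a b ha hb => exact add a b ha hb

namespace Forms

/-- The interior product with `X`. -/
def iota (X : Sec I F V) : AddMonoid.End (Forms I F V N) :=
  DirectSum.toAddMonoid fun p => (DirectSum.of (fun p => Form I F V N p) (p - 1)).comp
    (AddMonoidHom.mk' (fun x => interior X x) (by
      intro x y
      cases p with
      | zero => exact (add_zero 0).symm
      | succ p => rfl))

@[simp] theorem iota_of_zero (X : Sec I F V) (x : Form I F V N 0) : iota X (Form.of x) = 0 := by
  exact (DirectSum.toAddMonoid_of _ 0 x).trans
    (map_zero (DirectSum.of (fun p => Form I F V N p) (0 - 1)))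

@[simp] theorem iota_of_succ (X : Sec I F V) {p : ℕ} (x : Form I F V N (p + 1)) :
    iota X (Form.of x) = Form.of (x.curryLeft X) := by
  exact DirectSum.toAddMonoid_of _ (p + 1) x

theorem iota_of_eq (X : Sec I F V) {n m : ℕ} (h : n = m + 1) (x : Form I F V N n)
    (y : Form I F V N m) (hxy : ∀ w : Fin m → Sec I F V,
      x (fun i => (Fin.cons X w : Fin (m + 1) → Sec I F V) (Fin.cast h i)) = y w) :
    iota X (Form.of x) = Form.of y := by
  subst h
  rw [iota_of_succ]
  congr 1
  ext w
  exact hxy w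

theorem iota_apply (X : Sec I F V) (z : Forms I F V N) (p : ℕ) :
    iota X z p = (z (p + 1)).curryLeft X := by
  induction z using Forms.induction with
  | of q x =>
    cases q with
    | zero =>
      rw [iota_of_zero, Form.of, DirectSum.of_eq_of_ne _ _ _ (Nat.succ_ne_zero p)]
      rfl
    | succ q =>
      rw [iota_of_succ]
      by_cases h : p = q
      · subst h
        rw [Form.of, Form.of, DirectSum.of_eq_same, DirectSum.of_eq_same]
      · rw [Form.of, Form.of, DirectSum.of_eq_of_ne _ _ _ h,
          DirectSum.of_eq_of_ne _ _ _ (by omega)]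
        rfl
  | add a b ha hb =>
    rw [map_add, DirectSum.add_apply, DirectSum.add_apply, ha, hb]
    rfl

/-- The component of degree `0`. -/
def aug : Forms I F V N →+ N :=
  AddMonoidHom.mk' (fun z => z 0 ![]) (fun _ _ => rfl)

@[simp] theorem aug_of_zero (x : Form I F V N 0) : aug (Form.of x) = x ![] := by
  change (Form.of x) 0 ![] = _
  rw [Form.of, DirectSum.of_eq_same]

@[simp] theorem aug_of_succ {p : ℕ} (x : Form I F V N (p + 1)) : aug (Form.of x) = 0 := by
  change (Form.of x) 0 ![] = _
  rw [Form.of, DirectSum.of_eq_of_ne _ _ _ (Nat.succ_ne_zero p).symm]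
  rfl

theorem eq_zero_of_iota {z : Forms I F V N} (h : aug z = 0) (h' : ∀ X, iota X z = 0) : z = 0 := by
  refine DFinsupp.ext fun p => ?_
  cases p with
  | zero =>
    ext v
    rw [Subsingleton.elim v ![]]
    exact h
  | succ p =>
    ext v
    have := congrArg (fun z => z p (Fin.tail v)) (h' (v 0))
    simp only [iota_apply, AlternatingMap.curryLeft_apply_apply] at this
    rw [← Fin.cons_self_tail v]
    exact this

theorem ext_iota {z w : Forms I F V N} (h : aug z = aug w) (h' : ∀ X, iota X z = iota X w) :
    z = w := by
  rw [← sub_eq_zero]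
  exact eq_zero_of_iota (by rw [map_sub, h, sub_self]) fun X => by rw [map_sub, h', sub_self]

/-- The grading involution. -/
def eps : AddMonoid.End (Forms I F V N) :=
  DirectSum.toAddMonoid fun p => (-1 : ℤ) ^ p • DirectSum.of (fun p => Form I F V N p) p

@[simp] theorem eps_of {p : ℕ} (x : Form I F V N p) :
    eps (Form.of x) = (-1 : ℤ) ^ p • Form.of x := by
  exact DirectSum.toAddMonoid_of _ p x

theorem eps_eps (z : Forms I F V N) : eps (eps z) = z := by
  induction z using Forms.induction with
  | of p x => rw [eps_of, map_zsmul, eps_of, neg_one_pow_smul_smul]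
  | add a b ha hb => rw [map_add, map_add, ha, hb]

theorem iota_eps (X : Sec I F V) (z : Forms I F V N) : iota X (eps z) = - eps (iota X z) := by
  induction z using Forms.induction with
  | of p x =>
    cases p with
    | zero => simp
    | succ p => rw [eps_of, map_zsmul, iota_of_succ, eps_of, pow_succ]; simp
  | add a b ha hb => simp only [map_add, ha, hb, neg_add]

theorem aug_eps (z : Forms I F V N) : aug (eps z) = aug z := by
  induction z using Forms.induction with
  | of p x => cases p <;> simp
  | add a b ha hb => simp only [map_add, ha, hb]

/-- Composition with a linear map of values. -/
def map (g : N₁ →ₗ[Fun I M] N₂) : Forms I F V N₁ →+ Forms I F V N₂ :=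
  DirectSum.toAddMonoid fun p => (DirectSum.of (fun p => Form I F V N₂ p) p).comp (mapForm g)

@[simp] theorem map_of (g : N₁ →ₗ[Fun I M] N₂) {p : ℕ} (x : Form I F V N₁ p) :
    map g (Form.of x) = Form.of (mapForm g x) := by
  simp only [map, Form.of, DirectSum.toAddMonoid_of]
  rfl

theorem iota_map (g : N₁ →ₗ[Fun I M] N₂) (X : Sec I F V) (z : Forms I F V N₁) :
    iota X (map g z) = map g (iota X z) := by
  induction z using Forms.induction with
  | of p x => cases p <;> simp; rfl
  | add a b ha hb => simp only [map_add, ha, hb]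

theorem aug_map (g : N₁ →ₗ[Fun I M] N₂) (z : Forms I F V N₁) : aug (map g z) = g (aug z) := by
  induction z using Forms.induction with
  | of p x => cases p <;> simp [mapForm]
  | add a b ha hb => simp only [map_add, ha, hb]

theorem eps_map (g : N₁ →ₗ[Fun I M] N₂) (z : Forms I F V N₁) :
    eps (map g z) = map g (eps z) := by
  induction z using Forms.induction with
  | of p x => simp
  | add a b ha hb => simp only [map_add, ha, hb]

theorem map_map (g : N₂ →ₗ[Fun I M] N₃) (g' : N₁ →ₗ[Fun I M] N₂) (z : Forms I F V N₁) :
    map g (map g' z) = map (g ∘ₗ g') z := by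
  induction z using Forms.induction with
  | of p x => simp; rfl
  | add a b ha hb => simp only [map_add, ha, hb]

theorem map_id (z : Forms I F V N) : map LinearMap.id z = z := by
  induction z using Forms.induction with
  | of p x => simp; rfl
  | add a b ha hb => simp only [map_add, ha, hb]

theorem map_zero_left (z : Forms I F V N₁) : map (0 : N₁ →ₗ[Fun I M] N₂) z = 0 := by
  induction z using Forms.induction with
  | of p x => rw [map_of]; exact map_zero _
  | add a b ha hb => simp only [map_add, ha, hb, add_zero]

/-- The wedge product. -/
def wedge (B : N₁ →ₗ[Fun I M] N₂ →ₗ[Fun I M] N₃) :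
    Forms I F V N₁ →+ Forms I F V N₂ →+ Forms I F V N₃ :=
  DirectSum.toAddMonoid fun p => AddMonoidHom.mk' (fun x => DirectSum.toAddMonoid fun q =>
    (DirectSum.of (fun p => Form I F V N₃ p) (p + q)).comp
      (AddMonoidHom.mk' (fun y => VBAlgebroids.wedge B x y) (wedge_add_right B x))) (by
    intro x x'
    refine DirectSum.addHom_ext fun q y => ?_
    simp only [DirectSum.toAddMonoid_of, AddMonoidHom.add_apply, AddMonoidHom.comp_apply,
      AddMonoidHom.mk'_apply, wedge_add_left, map_add])

@[simp] theorem wedge_of_of (B : N₁ →ₗ[Fun I M] N₂ →ₗ[Fun I M] N₃) {p q : ℕ}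
    (x : Form I F V N₁ p) (y : Form I F V N₂ q) :
    wedge B (Form.of x) (Form.of y) = Form.of (VBAlgebroids.wedge B x y) := by
  simp only [wedge, Form.of, DirectSum.toAddMonoid_of, AddMonoidHom.mk'_apply,
    AddMonoidHom.comp_apply]

theorem wedgeOp_eq {p : ℕ} (η : Form I F V (Fun I M) p) (z : Forms I F V N) :
    wedgeOp η z = wedge (LinearMap.lsmul (Fun I M) N) (Form.of η) z := by
  induction z using Forms.induction with
  | of q x =>
    rw [wedge_of_of]
    exact DirectSum.toAddMonoid_of _ q x
  | add a b ha hb => rw [map_add, map_add, ha, hb]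

theorem iota_wedge (B : N₁ →ₗ[Fun I M] N₂ →ₗ[Fun I M] N₃) (X : Sec I F V)
    (a : Forms I F V N₁) (b : Forms I F V N₂) :
    iota X (wedge B a b) = wedge B (iota X a) b + wedge B (eps a) (iota X b) := by
  have inst := isAddTorsionFree_of_module (inferInstance : Module (Fun I M) N₃)
  induction a using Forms.induction with
  | add a a' ha ha' => simp only [map_add, AddMonoidHom.add_apply, ha, ha']; abel
  | of p x =>
  induction b using Forms.induction with
  | add b b' hb hb' => simp only [map_add, hb, hb']; abel
  | of q y =>
  rw [wedge_of_of, eps_of]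
  cases p with
  | zero =>
    cases q with
    | zero => simp
    | succ q =>
      rw [iota_of_zero, iota_of_succ X y, map_zero, AddMonoidHom.zero_apply, pow_zero,
        one_smul, wedge_of_of]
      refine Eq.trans ?_ (zero_add _).symm
      exact iota_of_eq X (by omega) _ _ fun w => shuffle_zero_cons B (by omega) rfl x y X w
  | succ p =>
    cases q with
    | zero =>
      rw [iota_of_zero, iota_of_succ X x, map_zero, wedge_of_of]
      refine Eq.trans ?_ (add_zero _).symm
      exact iota_of_eq X (by omega) _ _ fun w => shuffle_cons_zero B (by omega) rfl x y X w
    | succ q =>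
      rw [iota_of_succ X y, iota_of_succ X x, wedge_of_of, map_zsmul, AddMonoidHom.zsmul_apply,
        wedge_of_of]
      have e : Form.of (VBAlgebroids.wedge B x (y.curryLeft X)) = Form.of
          ((VBAlgebroids.wedge B x (y.curryLeft X)).domDomCongr
            (finCongr (show p + 1 + q = p + (q + 1) by omega))) :=
        Form.of_congr (by omega) fun v => rfl
      rw [e, Form.of, Form.of, Form.of, ← map_zsmul, ← map_add]
      exact iota_of_eq X (by omega) _ _ fun w =>
        shuffle_cons B (by omega) rfl (by omega) x y X w

theorem aug_wedge (B : N₁ →ₗ[Fun I M] N₂ →ₗ[Fun I M] N₃)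
    (a : Forms I F V N₁) (b : Forms I F V N₂) : aug (wedge B a b) = B (aug a) (aug b) := by
  have inst := isAddTorsionFree_of_module (inferInstance : Module (Fun I M) N₃)
  induction a using Forms.induction with
  | add a a' ha ha' => simp only [map_add, AddMonoidHom.add_apply, ha, ha', LinearMap.add_apply]
  | of p x =>
  induction b using Forms.induction with
  | add b b' hb hb' => simp only [map_add, hb, hb']
  | of q y =>
  rw [wedge_of_of]
  cases p with
  | zero =>
    cases q with
    | zero =>
      rw [aug_of_zero, aug_of_zero]
      refine (aug_of_zero (VBAlgebroids.wedge B x y)).trans ?_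
      exact shuffle_zero_zero B x y ![]
    | succ q => rw [aug_of_succ y, map_zero]; exact aug_of_succ (p := 0 + q) _
  | succ p =>
    rw [aug_of_succ x, map_zero, LinearMap.zero_apply]
    cases q with
    | zero => exact aug_of_succ (p := p) _
    | succ q => exact aug_of_succ (p := p + 1 + q) _

theorem eps_wedge (B : N₁ →ₗ[Fun I M] N₂ →ₗ[Fun I M] N₃)
    (a : Forms I F V N₁) (b : Forms I F V N₂) :
    eps (wedge B a b) = wedge B (eps a) (eps b) := by
  induction a using Forms.induction with
  | add a a' ha ha' => simp only [map_add, AddMonoidHom.add_apply, ha, ha']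
  | of p x =>
  induction b using Forms.induction with
  | add b b' hb hb' => simp only [map_add, hb, hb']
  | of q y =>
  simp only [wedge_of_of, eps_of, map_zsmul, AddMonoidHom.zsmul_apply, pow_add, mul_smul]
  rw [smul_comm]

/-- Induction on the degree by means of interior products. -/
theorem induction_iota {P : Forms I F V N → Prop} (zero : P 0)
    (add : ∀ a b, P a → P b → P (a + b)) (h : ∀ a, (∀ X, P (iota X a)) → P a)
    (a : Forms I F V N) : P a := by
  have key : ∀ p (x : Form I F V N p), P (Form.of x) := by
    intro p
    induction p with
    | zero => exact fun x => h _ fun X => by rw [iota_of_zero]; exact zero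
    | succ p ih => exact fun x => h _ fun X => by rw [iota_of_succ]; exact ih _
  induction a using Forms.induction with
  | of p x => exact key p x
  | add a b ha hb => exact add a b ha hb

theorem induction_iota₂ {P : Forms I F V N₁ → Forms I F V N₂ → Prop} (zero_left : ∀ b, P 0 b)
    (zero_right : ∀ a, P a 0) (add_left : ∀ a a' b, P a b → P a' b → P (a + a') b)
    (add_right : ∀ a b b', P a b → P a b' → P a (b + b')) (neg_left : ∀ a b, P a b → P (-a) b)
    (h : ∀ a b, (∀ X, P (iota X a) b) → (∀ X, P (eps a) (iota X b)) →
      (∀ X, P a (iota X b)) → P a b) (a : Forms I F V N₁) (b : Forms I F V N₂) : P a b := by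
  have key : ∀ n p q, p + q = n → ∀ (x : Form I F V N₁ p) (y : Form I F V N₂ q),
      P (Form.of x) (Form.of y) := by
    intro n
    induction n with
    | zero =>
      rintro p q h' x y
      obtain rfl : p = 0 := by omega
      obtain rfl : q = 0 := by omega
      refine h _ _ ?_ ?_ ?_ <;> intro X <;> rw [iota_of_zero]
      exacts [zero_left _, zero_right _, zero_right _]
    | succ n ih =>
      intro p q h' x y
      have h2 : ∀ X, P (Form.of x) (iota X (Form.of y)) := by
        intro X
        cases q with
        | zero => rw [iota_of_zero]; exact zero_right _
        | succ q => rw [iota_of_succ]; exact ih p q (by omega) _ _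
      refine h _ _ ?_ ?_ h2 <;> intro X
      · cases p with
        | zero => rw [iota_of_zero]; exact zero_left _
        | succ p => rw [iota_of_succ]; exact ih p q (by omega) _ _
      · rw [eps_of]
        obtain h1 | h1 := neg_one_pow_eq_or ℤ p <;> rw [h1]
        · rw [one_smul]; exact h2 X
        · rw [neg_one_smul]; exact neg_left _ _ (h2 X)
  induction a using Forms.induction with
  | add a a' ha ha' => exact add_left _ _ _ ha ha'
  | of p x =>
  induction b using Forms.induction with
  | add b b' hb hb' => exact add_right _ _ _ hb hb'
  | of q y => exact key _ p q rfl x y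

end Forms

namespace Connection
open Forms
variable {L : LieAlgebroid I F V} (D : Connection L N)

/-- The covariant differential on `Ω(A; N)`. -/
def dF : AddMonoid.End (Forms I F V N) := operator 1 fun _ => D.d

@[simp] theorem dF_of {p : ℕ} (x : Form I F V N p) : D.dF (Form.of x) = Form.of (D.d x) := by
  exact DirectSum.toAddMonoid_of _ p x

/-- The Lie derivative on `Ω(A; N)`. -/
def lieF (X : Sec I F V) : AddMonoid.End (Forms I F V N) := iota X * D.dF + D.dF * iota X

theorem lieF_apply (X : Sec I F V) (z : Forms I F V N) :
    D.lieF X z = iota X (D.dF z) + D.dF (iota X z) := rfl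

theorem iota_dF (X : Sec I F V) (z : Forms I F V N) :
    iota X (D.dF z) = D.lieF X z - D.dF (iota X z) := by rw [lieF_apply]; abel

theorem aug_dF (z : Forms I F V N) : aug (D.dF z) = 0 := by
  induction z using Forms.induction with
  | of p x => rw [dF_of, aug_of_succ]
  | add a b ha hb => rw [map_add, map_add, ha, hb, add_zero]

theorem eps_dF (z : Forms I F V N) : eps (D.dF z) = - D.dF (eps z) := by
  induction z using Forms.induction with
  | of p x => rw [dF_of, eps_of, eps_of, map_zsmul, dF_of, pow_succ]; simp
  | add a b ha hb => simp only [map_add, ha, hb, neg_add]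

/-- The Lie derivative of a form. -/
def lieForm (X : Sec I F V) : ∀ {p : ℕ}, Form I F V N p → Form I F V N p
  | 0, x => (D.d x).curryLeft X
  | _ + 1, x => (D.d x).curryLeft X + D.d (x.curryLeft X)

theorem lieF_of (X : Sec I F V) {p : ℕ} (x : Form I F V N p) :
    D.lieF X (Form.of x) = Form.of (D.lieForm X x) := by
  cases p with
  | zero => rw [lieF_apply, iota_of_zero, map_zero, add_zero, dF_of, iota_of_succ]; rfl
  | succ p => rw [lieF_apply, iota_of_succ, dF_of, dF_of, iota_of_succ, ← map_add]; rfl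

theorem d_apply {p : ℕ} (η : Form I F V N p) (v : Fin (p + 1) → Sec I F V) :
    D.d η v = ∑ j : Fin (p + 1), (-1 : ℤ) ^ (j : ℕ) • (D.nabla (v j) (η (j.removeNth v)) +
      (half : Fun I M) • ∑ i, η (Function.update (j.removeNth v) i
        (L.bracket (j.removeNth v i) (v j)))) :=
  D.dInt_apply η v

theorem half_smul_add (x : N) : (half : Fun I M) • x + (half : Fun I M) • x = x := by
  rw [← add_smul, half_add_half, one_smul]

/-- Cartan's formula. -/
theorem lieForm_apply (X : Sec I F V) {p : ℕ} (η : Form I F V N p) (w : Fin p → Sec I F V) :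
    D.lieForm X η w = D.nabla X (η w) + ∑ i, η (Function.update w i (L.bracket (w i) X)) := by
  cases p with
  | zero =>
    change D.d η (Fin.cons X w) = _
    rw [d_apply]
    simp
  | succ p =>
    change D.d η (Fin.cons X w) + D.d (η.curryLeft X) w = _
    rw [d_apply, d_apply, Fin.sum_univ_succ, add_assoc, ← Finset.sum_add_distrib]
    have hr : ∀ k : Fin (p + 1), Fin.removeNth k.succ (Fin.cons X w : Fin (p + 2) → Sec I F V) =
          Fin.cons X (k.removeNth w) := by
      intro k
      funext i
      refine Fin.cases ?_ (fun i => ?_) i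
      · simp [Fin.removeNth_apply]
      · simp [Fin.removeNth_apply, Fin.succ_succAbove_succ]
    have hs : ∀ (Z : Sec I F V) (i : Fin p) (u : Fin p → Sec I F V) (Y : Sec I F V),
        Function.update (Fin.cons Y u : Fin (p + 1) → Sec I F V) i.succ Z =
          Fin.cons Y (Function.update u i Z) := fun Z i u Y => by
      rw [Fin.cons_update]
    have h0 : ∀ (Z Y : Sec I F V) (u : Fin p → Sec I F V),
        Function.update (Fin.cons Y u : Fin (p + 1) → Sec I F V) 0 Z = Fin.cons Z u :=
      fun Z Y u => by rw [Fin.update_cons_zero]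
    have hneg : ∀ (Y : Sec I F V) (u : Fin p → Sec I F V),
        η (Fin.cons (-Y) u) = - η (Fin.cons Y u) := fun Y u => by
      have := η.map_vecCons_smul u (-1) Y
      simpa [Matrix.vecCons] using this
    have e : ∀ k : Fin (p + 1), η (Function.update w k (L.bracket (w k) X)) =
        (half : Fun I M) • η (Function.update w k (L.bracket (w k) X)) +
        (half : Fun I M) • (-1 : ℤ) ^ ((k : ℕ) + 1) •
          η (Fin.cons (L.bracket X (w k)) (k.removeNth w)) := fun k => by
      rw [map_update_eq, L.bracket_skew X (w k), hneg, pow_succ, mul_smul, neg_smul, one_smul,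
        neg_neg, half_smul_add]
    simp only [hr, Fin.removeNth_zero, Fin.tail_cons, Fin.cons_zero, Fin.cons_succ,
      Fin.val_zero, pow_zero, one_smul, Fin.val_succ, AlternatingMap.curryLeft_apply_apply]
    rw [add_assoc]
    congr 1
    rw [Finset.smul_sum, ← Finset.sum_add_distrib]
    refine Finset.sum_congr rfl fun k _ => ?_
    rw [Fin.sum_univ_succ]
    simp only [h0, hs, Fin.cons_zero, Fin.cons_succ]
    conv_rhs => rw [e]
    congr 1
    rw [smul_comm (half : Fun I M) ((-1 : ℤ) ^ ((k : ℕ) + 1)), pow_succ, mul_neg_one, neg_smul,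
      neg_smul, ← neg_one_smul ℤ, ← smul_comm]
    simp only [Matrix.vecCons, smul_add, neg_smul, one_smul, smul_neg]
    abel

theorem iota_lieF (X Y : Sec I F V) (z : Forms I F V N) :
    iota Y (D.lieF X z) = D.lieF X (iota Y z) + iota (L.bracket Y X) z := by
  induction z using Forms.induction with
  | add a b ha hb => simp only [map_add, ha, hb]; abel
  | of p x =>
  cases p with
  | zero => rw [lieF_of]; simp
  | succ p =>
    rw [lieF_of, iota_of_succ, iota_of_succ, iota_of_succ, lieF_of, ← map_add]
    congr 1
    ext v
    rw [AlternatingMap.add_apply, AlternatingMap.curryLeft_apply_apply, lieForm_apply,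
      lieForm_apply, Fin.sum_univ_succ]
    simp only [AlternatingMap.curryLeft_apply_apply, Matrix.vecCons, Fin.update_cons_zero,
      Fin.cons_zero, Fin.cons_succ, ← Fin.cons_update]
    abel

theorem aug_lieF (X : Sec I F V) (z : Forms I F V N) :
    aug (D.lieF X z) = D.nabla X (aug z) := by
  induction z using Forms.induction with
  | add a b ha hb => simp only [map_add, ha, hb, D.add_right]
  | of p x =>
  rw [lieF_of]
  cases p with
  | zero => simp [lieForm_apply]
  | succ p => simp

end Connection
end Calculus

section Calculus
attribute [local instance] Form.instAddCommGroup Form.instAddCommMonoid Form.instAddMonoid Form.instAddZeroClass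
  Forms.instAddCommGroup Forms.instAddCommMonoid Forms.instAddMonoid Forms.instAddZeroClass
set_option linter.unusedSectionVars false
variable {EM HM : Type*} [NormedAddCommGroup EM] [NormedSpace ℝ EM] [TopologicalSpace HM]
  {I : ModelWithCorners ℝ EM HM} {M : Type*} [TopologicalSpace M] [ChartedSpace HM M]
  [IsManifold I ∞ M]
  {F : Type*} [NormedAddCommGroup F] [NormedSpace ℝ F]
  {V : M → Type*} [TopologicalSpace (TotalSpace F V)] [∀ m, AddCommGroup (V m)]
  [∀ m, Module ℝ (V m)] [∀ m, TopologicalSpace (V m)] [FiberBundle F V] [VectorBundle ℝ F V]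
  {N N₁ N₂ N₃ : Type*} [AddCommGroup N] [Module (Fun I M) N] [AddCommGroup N₁] [Module (Fun I M) N₁]
  [AddCommGroup N₂] [Module (Fun I M) N₂] [AddCommGroup N₃] [Module (Fun I M) N₃]

namespace Forms

/-- An element of the module of values as a form of degree `0`. -/
def const (s : N) : Forms I F V N :=
  Form.of (AlternatingMap.constOfIsEmpty (Fun I M) (Sec I F V) (Fin 0) s)

@[simp] theorem aug_const (s : N) : aug (const s : Forms I F V N) = s := by
  simp [const]

@[simp] theorem iota_const (X : Sec I F V) (s : N) : iota X (const s : Forms I F V N) = 0 := by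
  simp [const]

@[simp] theorem eps_const (s : N) : eps (const s : Forms I F V N) = const s := by
  simp [const]

theorem const_add (s t : N) : (const (s + t) : Forms I F V N) = const s + const t :=
  ext_iota (by simp) (by simp)

@[simp] theorem map_const (g : N₁ →ₗ[Fun I M] N₂) (s : N₁) :
    map g (const s : Forms I F V N₁) = const (g s) :=
  ext_iota (by simp [aug_map]) (by simp [iota_map])

@[simp] theorem const_zero : (const (0 : N) : Forms I F V N) = 0 :=
  ext_iota (by simp) (by simp)

theorem wedge_const_left (B : N₁ →ₗ[Fun I M] N₂ →ₗ[Fun I M] N₃) (s : N₁) (z : Forms I F V N₂) :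
    wedge B (const s) z = map (B s) z :=
  induction_iota (P := fun z => wedge B (const s) z = map (B s) z) (by simp)
    (fun a b ha hb => by rw [map_add, map_add, ha, hb])
    (fun a h => ext_iota (by rw [aug_wedge, aug_map, aug_const]) fun X => by
      rw [iota_wedge, iota_map, ← h X]; simp) z

theorem wedge_const_right (B : N₁ →ₗ[Fun I M] N₂ →ₗ[Fun I M] N₃) (s : N₂) (z : Forms I F V N₁) :
    wedge B z (const s) = map (B.flip s) z :=
  induction_iota (P := fun z => wedge B z (const s) = map (B.flip s) z) (by simp)
    (fun a b ha hb => by rw [map_add, map_add, AddMonoidHom.add_apply, ha, hb])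
    (fun a h => ext_iota (by rw [aug_wedge, aug_map, aug_const]; rfl) fun X => by
      rw [iota_wedge, iota_map, ← h X]; simp) z

theorem map_wedge (g : N₃ →ₗ[Fun I M] N) (B : N₁ →ₗ[Fun I M] N₂ →ₗ[Fun I M] N₃)
    (a : Forms I F V N₁) (b : Forms I F V N₂) :
    map g (wedge B a b) = wedge (B.compr₂ g) a b :=
  induction_iota₂ (P := fun a b => map g (wedge B a b) = wedge (B.compr₂ g) a b)
    (by simp) (by simp) (fun a a' b h h' => by simp [h, h']) (fun a b b' h h' => by simp [h, h'])
    (fun a b h => by simp [h]) (fun a b h h' _ => ext_iota (by simp [aug_wedge, aug_map])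
      fun X => by rw [iota_map, iota_wedge, iota_wedge, map_add, h, h']) a b

theorem wedge_map_right {N' : Type*} [AddCommGroup N'] [Module (Fun I M) N']
    (g : N' →ₗ[Fun I M] N₂) (B : N₁ →ₗ[Fun I M] N₂ →ₗ[Fun I M] N₃)
    (a : Forms I F V N₁) (b : Forms I F V N') :
    wedge B a (map g b) = wedge (B.compl₂ g) a b :=
  induction_iota₂ (P := fun a b => wedge B a (map g b) = wedge (B.compl₂ g) a b)
    (by simp) (by simp) (fun a a' b h h' => by simp [h, h']) (fun a b b' h h' => by simp [h, h'])
    (fun a b h => by simp [h]) (fun a b h h' _ => ext_iota (by simp [aug_wedge, aug_map])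
      fun X => by rw [iota_wedge, iota_wedge, iota_map, h, h']) a b

/-- Scalar forms act on forms with values in `N`. -/
def act : Forms I F V (Fun I M) →+ Forms I F V N →+ Forms I F V N :=
  wedge (LinearMap.lsmul (Fun I M) N)

theorem map_act (g : N₁ →ₗ[Fun I M] N₂) (a : Forms I F V (Fun I M)) (z : Forms I F V N₁) :
    map g (act a z) = act a (map g z) := by
  have e : (LinearMap.lsmul (Fun I M) N₁).compr₂ g = (LinearMap.lsmul (Fun I M) N₂).compl₂ g := by
    refine LinearMap.ext fun f => LinearMap.ext fun x => ?_
    simp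
  rw [act, act, map_wedge, wedge_map_right, e]

theorem eps_act (a : Forms I F V (Fun I M)) (z : Forms I F V N) :
    eps (act a z) = act (eps a) (eps z) := eps_wedge _ a z

theorem act_const (f : Fun I M) (z : Forms I F V N) : act (const f) z = map (f • LinearMap.id) z :=
  wedge_const_left _ f z

theorem act_const_right (a : Forms I F V (Fun I M)) (s : N) :
    act a (const s) = map (LinearMap.toSpanSingleton (Fun I M) N s) a := by
  rw [act, wedge_const_right]
  rfl

/-- Associativity of the wedge product of a scalar form with two other forms. -/
theorem act_wedge (B : N₁ →ₗ[Fun I M] N₂ →ₗ[Fun I M] N₃) (a : Forms I F V (Fun I M))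
    (b : Forms I F V N₁) (c : Forms I F V N₂) : wedge B (act a b) c = act a (wedge B b c) := by
  have key : ∀ n p q r, p + q + r = n → ∀ (x : Form I F V (Fun I M) p) (y : Form I F V N₁ q)
      (z : Form I F V N₂ r), wedge B (act (Form.of x) (Form.of y)) (Form.of z) =
        act (Form.of x) (wedge B (Form.of y) (Form.of z)) := by
    intro n
    induction n with
    | zero =>
      rintro p q r h x y z
      obtain rfl : p = 0 := by omega
      obtain rfl : q = 0 := by omega
      obtain rfl : r = 0 := by omega
      refine ext_iota ?_ fun X => ?_
      · simp only [aug_wedge, act, LinearMap.lsmul_apply, map_smul, LinearMap.smul_apply]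
      · simp only [iota_wedge, act, iota_of_zero, map_zero, AddMonoidHom.zero_apply, add_zero]
    | succ n ih =>
      intro p q r h x y z
      have e1 : ∀ X, wedge B (act (iota X (Form.of x)) (Form.of y)) (Form.of z) =
          act (iota X (Form.of x)) (wedge B (Form.of y) (Form.of z)) := fun X => by
        cases p with
        | zero => rw [iota_of_zero]; simp
        | succ p => rw [iota_of_succ]; exact ih _ _ _ (by omega) _ _ _
      have e2 : ∀ X, wedge B (act (Form.of x) (iota X (Form.of y))) (Form.of z) =
          act (Form.of x) (wedge B (iota X (Form.of y)) (Form.of z)) := fun X => by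
        cases q with
        | zero => rw [iota_of_zero]; simp
        | succ q => rw [iota_of_succ]; exact ih _ _ _ (by omega) _ _ _
      have e3 : ∀ X, wedge B (act (Form.of x) (Form.of y)) (iota X (Form.of z)) =
          act (Form.of x) (wedge B (Form.of y) (iota X (Form.of z))) := fun X => by
        cases r with
        | zero => rw [iota_of_zero]; simp
        | succ r => rw [iota_of_succ]; exact ih _ _ _ (by omega) _ _ _
      refine ext_iota (by simp only [aug_wedge, act, LinearMap.lsmul_apply, map_smul,
        LinearMap.smul_apply]) fun X => ?_
      have f2 := congrArg (fun w => (-1 : ℤ) ^ p • w) (e2 X)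
      have f3 := congrArg (fun w => (-1 : ℤ) ^ p • (-1 : ℤ) ^ q • w) (e3 X)
      simp only [act] at e1 f2 f3 ⊢
      simp only [iota_wedge, map_add, AddMonoidHom.add_apply, eps_wedge]
      simp only [eps_of, map_zsmul, AddMonoidHom.zsmul_apply] at f2 f3 ⊢
      rw [smul_comm ((-1 : ℤ) ^ q), f3, e1 X, f2, smul_comm ((-1 : ℤ) ^ q)]
      abel
  induction a using Forms.induction with
  | add a a' ha ha' => simp only [map_add, AddMonoidHom.add_apply, ha, ha']
  | of p x =>
  induction b using Forms.induction with
  | add b b' hb hb' => simp only [map_add, AddMonoidHom.add_apply, hb, hb']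
  | of q y =>
  induction c using Forms.induction with
  | add c c' hc hc' => simp only [map_add, hc, hc']
  | of r z => exact key _ p q r rfl x y z

/-- `z` is homogeneous of degree `k`. -/
def IsHom (k : ℤ) (z : Forms I F V N) : Prop := ∀ p : ℕ, (p : ℤ) ≠ k → z p = 0

theorem IsHom.eq_zero_or {k : ℤ} {z : Forms I F V N} (h : IsHom k z) :
    z = 0 ∨ ∃ (p : ℕ) (x : Form I F V N p), (p : ℤ) = k ∧ z = Form.of x := by
  by_cases hk : 0 ≤ k
  · obtain ⟨p, rfl⟩ := Int.eq_ofNat_of_zero_le hk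
    refine Or.inr ⟨p, z p, rfl, DFinsupp.ext fun q => ?_⟩
    by_cases hq : q = p
    · subst hq
      exact (DirectSum.of_eq_same q (z q)).symm
    · rw [h q (by exact_mod_cast hq)]
      exact (DirectSum.of_eq_of_ne p q (z p) hq).symm
  · exact Or.inl (DFinsupp.ext fun q => h q (by omega))

theorem isHom_of {p : ℕ} {k : ℤ} (h : (p : ℤ) = k) (x : Form I F V N p) : IsHom k (Form.of x) :=
  fun q hq => DirectSum.of_eq_of_ne p q x (by rintro rfl; exact hq h)

theorem isHom_zero (k : ℤ) : IsHom k (0 : Forms I F V N) := fun _ _ => rfl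

theorem IsHom.add {k : ℤ} {z w : Forms I F V N} (h : IsHom k z) (h' : IsHom k w) :
    IsHom k (z + w) := fun p hp => by
  rw [DirectSum.add_apply, h p hp, h' p hp, add_zero]

theorem IsHom.zsmul {k : ℤ} {z : Forms I F V N} (h : IsHom k z) (c : ℤ) : IsHom k (c • z) :=
  fun p hp => by
    change c • z p = 0
    rw [h p hp, smul_zero]

theorem isHom_const (s : N) : IsHom 0 (const s : Forms I F V N) := isHom_of rfl _

theorem IsHom.eps {k : ℤ} {z : Forms I F V N} (h : IsHom k z) : IsHom k (eps z) := by
  obtain rfl | ⟨p, x, hp, rfl⟩ := h.eq_zero_or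
  · rw [map_zero]; exact isHom_zero k
  · rw [eps_of]; exact (isHom_of hp x).zsmul _

theorem IsHom.map {k : ℤ} {z : Forms I F V N₁} (h : IsHom k z) (g : N₁ →ₗ[Fun I M] N₂) :
    IsHom k (map g z) := by
  obtain rfl | ⟨p, x, hp, rfl⟩ := h.eq_zero_or
  · rw [map_zero]; exact isHom_zero k
  · rw [map_of]; exact isHom_of hp _

theorem IsHom.wedge {k l : ℤ} {a : Forms I F V N₁} {b : Forms I F V N₂} (h : IsHom k a)
    (h' : IsHom l b) (B : N₁ →ₗ[Fun I M] N₂ →ₗ[Fun I M] N₃) : IsHom (k + l) (wedge B a b) := by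
  obtain rfl | ⟨p, x, hp, rfl⟩ := h.eq_zero_or
  · rw [map_zero]; exact isHom_zero _
  obtain rfl | ⟨q, y, hq, rfl⟩ := h'.eq_zero_or
  · rw [map_zero]; exact isHom_zero _
  rw [wedge_of_of]; exact isHom_of (by push_cast; rw [hp, hq]) _

theorem IsHom.dF {L : LieAlgebroid I F V} {k : ℤ} {z : Forms I F V N} (h : IsHom k z)
    (D : Connection L N) : IsHom (k + 1) (D.dF z) := by
  obtain rfl | ⟨p, x, hp, rfl⟩ := h.eq_zero_or
  · rw [map_zero]; exact isHom_zero _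
  · rw [D.dF_of]; exact isHom_of (by push_cast; rw [hp]) _

theorem IsHom.iota {k l : ℤ} {z : Forms I F V N} (h : IsHom k z) (hl : l + 1 = k)
    (X : Sec I F V) : IsHom l (iota X z) := by
  intro p hp
  rw [iota_apply, h (p + 1) (by push_cast; omega)]
  rfl

theorem IsHom.aug_eq_zero {k : ℤ} {z : Forms I F V N} (h : IsHom k z) (hk : k ≠ 0) :
    aug z = 0 := by
  change z 0 ![] = 0
  rw [h 0 (by simpa using hk.symm)]
  rfl

theorem IsHom.eq_zero {k : ℤ} {z : Forms I F V N} (h : IsHom k z) (hk : k < 0) : z = 0 :=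
  DFinsupp.ext fun q => h q (by omega)

theorem IsHom.iota_eq_zero {z : Forms I F V N} (h : IsHom 0 z) (X : Sec I F V) :
    Forms.iota X z = 0 :=
  (IsHom.iota (l := -1) h rfl X).eq_zero (by decide)

theorem IsHom.ext_zero {z w : Forms I F V N} (h : IsHom 0 z) (h' : IsHom 0 w)
    (e : aug z = aug w) : z = w :=
  ext_iota e fun X => by rw [IsHom.iota_eq_zero h, IsHom.iota_eq_zero h']

theorem IsHom.ext_one {z w : Forms I F V N} (h : IsHom 1 z) (h' : IsHom 1 w)
    (e : ∀ X, aug (Forms.iota X z) = aug (Forms.iota X w)) : z = w :=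
  ext_iota (by rw [h.aug_eq_zero one_ne_zero, h'.aug_eq_zero one_ne_zero]) fun X =>
    (h.iota (l := 0) rfl X).ext_zero (h'.iota rfl X) (e X)

theorem IsHom.ext_two {z w : Forms I F V N} (h : IsHom 2 z) (h' : IsHom 2 w)
    (e : ∀ X Y, aug (Forms.iota Y (Forms.iota X z)) = aug (Forms.iota Y (Forms.iota X w))) :
    z = w :=
  ext_iota (by rw [h.aug_eq_zero two_ne_zero, h'.aug_eq_zero two_ne_zero]) fun X =>
    (h.iota (l := 1) rfl X).ext_one (h'.iota rfl X) (e X)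

theorem IsHom.ext_three {z w : Forms I F V N} (h : IsHom 3 z) (h' : IsHom 3 w)
    (e : ∀ X Y Z, aug (Forms.iota Z (Forms.iota Y (Forms.iota X z))) =
      aug (Forms.iota Z (Forms.iota Y (Forms.iota X w)))) : z = w :=
  ext_iota (by rw [h.aug_eq_zero three_ne_zero, h'.aug_eq_zero three_ne_zero]) fun X =>
    (h.iota (l := 2) rfl X).ext_two (h'.iota rfl X) (e X)

end Forms

namespace Connection
open Forms
variable {L : LieAlgebroid I F V} (D : Connection L N)

theorem eps_lieF (X : Sec I F V) (z : Forms I F V N) : eps (D.lieF X z) = D.lieF X (eps z) := by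
  rw [lieF_apply, lieF_apply, map_add, eps_dF, ← neg_eq_iff_eq_neg.2 (iota_eps X _), eps_dF,
    iota_eps]
  simp

theorem lieF_act (X : Sec I F V) (a : Forms I F V (Fun I M)) (z : Forms I F V N) :
    D.lieF X (act a z) = act (L.trivialConnection.lieF X a) z + act a (D.lieF X z) := by
  refine induction_iota₂ (P := fun a z => D.lieF X (act a z) =
      act (L.trivialConnection.lieF X a) z + act a (D.lieF X z)) (by simp) (by simp)
    (fun a a' b h h' => ?_) (fun a b b' h h' => ?_) (fun a b h => ?_)
    (fun a b h h' _ => ext_iota ?_ fun Y => ?_) a z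
  · simp only [map_add, AddMonoidHom.add_apply, h, h']; abel
  · simp only [map_add, h, h']; abel
  · simp only [map_neg, AddMonoidHom.neg_apply, h, neg_add]
  · simp only [aug_lieF, map_add, act, aug_wedge, LinearMap.lsmul_apply, D.leibniz]
    exact add_comm _ _
  · have h1 := h Y
    have h2 := h' Y
    simp only [act] at h1 h2 ⊢
    simp only [iota_lieF, iota_wedge, map_add, AddMonoidHom.add_apply, eps_lieF, h1, h2]
    abel

/-- The Leibniz rule for the covariant differential. -/
theorem dF_act (a : Forms I F V (Fun I M)) (z : Forms I F V N) :
    D.dF (act a z) = act (L.trivialConnection.dF a) z + act (eps a) (D.dF z) := by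
  refine induction_iota₂ (P := fun a z => D.dF (act a z) =
      act (L.trivialConnection.dF a) z + act (eps a) (D.dF z)) (by simp) (by simp)
    (fun a a' b h h' => ?_) (fun a b b' h h' => ?_) (fun a b h => ?_)
    (fun a b h h' _ => ext_iota ?_ fun X => ?_) a z
  · simp only [map_add, AddMonoidHom.add_apply, h, h']; abel
  · simp only [map_add, h, h']; abel
  · simp only [map_neg, AddMonoidHom.neg_apply, h, neg_add]
  · simp only [aug_dF, map_add, act, aug_wedge, map_zero, LinearMap.zero_apply, add_zero]
  · have h1 := h X
    have h2 := h' X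
    have h3 := D.lieF_act X a b
    simp only [act] at h1 h2 h3 ⊢
    simp only [iota_dF, iota_wedge, map_add, map_sub, AddMonoidHom.sub_apply, eps_dF, iota_eps,
      map_neg, AddMonoidHom.neg_apply, eps_eps, h1, h2, h3]
    abel

theorem lieF_lieF (hD : ∀ X Y s, D.curvature X Y s = 0) (X Y : Sec I F V) (z : Forms I F V N) :
    D.lieF X (D.lieF Y z) = D.lieF Y (D.lieF X z) + D.lieF (L.bracket X Y) z := by
  refine induction_iota (P := fun z => D.lieF X (D.lieF Y z) =
      D.lieF Y (D.lieF X z) + D.lieF (L.bracket X Y) z) (by simp)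
    (fun a b ha hb => by simp only [map_add, ha, hb]; abel)
    (fun a h => ext_iota ?_ fun Z => ?_) z
  · simp only [map_add, aug_lieF]
    have := hD X Y (aug a)
    rw [curvature, sub_sub, sub_eq_zero] at this
    exact this
  · have h1 := h Z
    have hj : L.bracket Z (L.bracket X Y) = L.bracket (L.bracket Z X) Y -
        L.bracket (L.bracket Z Y) X := by
      have := L.jacobi Z X Y
      rw [L.bracket_skew X (L.bracket Y Z), L.bracket_skew Y (L.bracket Z X),
        L.bracket_skew Y Z] at this
      have hn : ∀ U W : Sec I F V, L.bracket (-U) W = - L.bracket U W := fun U W => by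
        have := L.bracket_smul_left (-1) U W
        simpa using this
      rw [hn, neg_neg] at this
      rw [← sub_eq_zero, ← this]
      abel
    have hi : ∀ U W : Sec I F V, iota (U - W) a = iota U a - iota W a := fun U W => by
      refine DFinsupp.ext fun p => ?_
      change iota (U - W) a p = iota U a p - iota W a p
      rw [iota_apply, iota_apply, iota_apply, map_sub]
    simp only [map_add, iota_lieF, hj, hi, h1]
    abel

theorem lieF_dF (hD : ∀ X Y s, D.curvature X Y s = 0) (X : Sec I F V) (z : Forms I F V N) :
    D.lieF X (D.dF z) = D.dF (D.lieF X z) := by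
  refine induction_iota (P := fun z => D.lieF X (D.dF z) = D.dF (D.lieF X z)) (by simp)
    (fun a b ha hb => by simp only [map_add, ha, hb])
    (fun a h => ext_iota ?_ fun Y => ?_) z
  · rw [aug_lieF, aug_dF, aug_dF, nabla_zero]
  · have h1 := h Y
    have h2 := D.lieF_lieF hD X Y a
    have hi : ∀ w : Forms I F V N, iota (L.bracket X Y) w = - iota (L.bracket Y X) w :=
        fun w => by
      rw [L.bracket_skew]
      refine DFinsupp.ext fun p => ?_
      change iota (-L.bracket Y X) w p = - iota (L.bracket Y X) w p
      rw [iota_apply, iota_apply, map_neg]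
    have h3 : D.lieF (L.bracket X Y) a = - D.lieF (L.bracket Y X) a := by
      rw [lieF_apply, hi, hi, map_neg, lieF_apply]
      abel
    rw [iota_lieF, iota_dF, iota_dF, iota_dF, iota_lieF, map_sub, map_add, h1, h2, h3]
    abel

theorem dF_dF (hD : ∀ X Y s, D.curvature X Y s = 0) (z : Forms I F V N) : D.dF (D.dF z) = 0 :=
  induction_iota (P := fun z => D.dF (D.dF z) = 0) (by simp)
    (fun a b ha hb => by simp only [map_add, ha, hb, add_zero])
    (fun a h => eq_zero_of_iota (D.aug_dF _) fun X => by
      rw [iota_dF, D.lieF_dF hD, ← map_sub, iota_dF, sub_sub_cancel, h X]) z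

theorem aug_iota_dF (X : Sec I F V) (s : N) : aug (iota X (D.dF (const s))) = D.nabla X s := by
  rw [iota_dF, iota_const, map_zero, sub_zero, aug_lieF, aug_const]

theorem iota_iota_dF (X Y : Sec I F V) (z : Forms I F V N) :
    iota Y (iota X (D.dF z)) = D.lieF X (iota Y z) + iota (L.bracket Y X) z -
      D.lieF Y (iota X z) + D.dF (iota Y (iota X z)) := by
  rw [iota_dF, map_sub, iota_lieF, iota_dF]; abel

theorem aug_iota_iota_dF_dF (X Y : Sec I F V) (s : N) :
    aug (iota Y (iota X (D.dF (D.dF (const s))))) = D.curvature X Y s := by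
  have h : aug (iota (L.bracket Y X) (D.dF (const s))) = - D.nabla (L.bracket X Y) s := by
    have hn := D.smul_left (-1) (L.bracket X Y) s
    rw [aug_iota_dF, L.bracket_skew]
    simpa using hn
  rw [iota_iota_dF]
  simp only [map_add, map_sub, aug_lieF, aug_dF, aug_iota_dF, h, curvature]
  abel

end Connection
end Calculus

section Super
attribute [local instance] Form.instAddCommGroup Form.instAddCommMonoid Form.instAddMonoid Form.instAddZeroClass
  Forms.instAddCommGroup Forms.instAddCommMonoid Forms.instAddMonoid Forms.instAddZeroClass
set_option linter.unusedSectionVars false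
variable {EM HM : Type*} [NormedAddCommGroup EM] [NormedSpace ℝ EM] [TopologicalSpace HM]
  {I : ModelWithCorners ℝ EM HM} {M : Type*} [TopologicalSpace M] [ChartedSpace HM M]
  [IsManifold I ∞ M]
  {F : Type*} [NormedAddCommGroup F] [NormedSpace ℝ F]
  {V : M → Type*} [TopologicalSpace (TotalSpace F V)] [∀ m, AddCommGroup (V m)]
  [∀ m, Module ℝ (V m)] [∀ m, TopologicalSpace (V m)] [FiberBundle F V] [VectorBundle ℝ F V]
  {N N₁ N₂ N₃ : Type*} [AddCommGroup N] [Module (Fun I M) N] [AddCommGroup N₁] [Module (Fun I M) N₁]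
  [AddCommGroup N₂] [Module (Fun I M) N₂] [AddCommGroup N₃] [Module (Fun I M) N₃]

/-- A property of the modules of sections of vector bundles: near every point there are dual
bases, and an element that vanishes locally is `0`. -/
structure HasLocalBases (I : ModelWithCorners ℝ EM HM) (M : Type*) [TopologicalSpace M]
    [ChartedSpace HM M] (N : Type*) [AddCommGroup N] [Module (Fun I M) N] : Prop where
  basis : ∀ m₀ : M, ∃ (φ : Fun I M) (n : ℕ) (l : Fin n → N →ₗ[Fun I M] Fun I M) (s : Fin n → N),
    φ m₀ = 1 ∧ ∀ x, φ • x = ∑ i, l i x • s i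
  eq_zero : ∀ x : N, (∀ m₀ : M, ∃ φ : Fun I M, φ m₀ = 1 ∧ φ • x = 0) → x = 0

theorem HasLocalBases.prod (h₁ : HasLocalBases I M N₁) (h₂ : HasLocalBases I M N₂) :
    HasLocalBases I M (N₁ × N₂) where
  basis m₀ := by
    obtain ⟨φ, n, l, s, hφ, h⟩ := h₁.basis m₀
    obtain ⟨ψ, k, r, t, hψ, h'⟩ := h₂.basis m₀
    refine ⟨φ * ψ, n + k, Fin.append (fun i => ψ • l i ∘ₗ LinearMap.fst _ _ _)
      (fun i => φ • r i ∘ₗ LinearMap.snd _ _ _), Fin.append (fun i => (s i, 0)) (fun i => (0, t i)),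
      ?_, fun x => ?_⟩
    · change φ m₀ * ψ m₀ = 1
      rw [hφ, hψ, one_mul]
    · simp only [Fin.sum_univ_add, Fin.append_left, Fin.append_right]
      refine Prod.ext ?_ ?_
      · simp only [Prod.smul_fst, Prod.fst_add, Prod.fst_sum, LinearMap.smul_apply,
          LinearMap.comp_apply, LinearMap.fst_apply, smul_zero, Finset.sum_const_zero, add_zero]
        rw [mul_comm, mul_smul, h, Finset.smul_sum]
        simp only [smul_eq_mul, mul_smul]
      · simp only [Prod.smul_snd, Prod.snd_add, Prod.snd_sum, LinearMap.smul_apply,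
          LinearMap.comp_apply, LinearMap.snd_apply, smul_zero, Finset.sum_const_zero, zero_add]
        rw [mul_smul, h', Finset.smul_sum]
        simp only [smul_eq_mul, mul_smul]
  eq_zero x h := by
    refine Prod.ext (h₁.eq_zero _ fun m₀ => ?_) (h₂.eq_zero _ fun m₀ => ?_) <;>
    obtain ⟨φ, hφ, h⟩ := h m₀
    · exact ⟨φ, hφ, congrArg Prod.fst h⟩
    · exact ⟨φ, hφ, congrArg Prod.snd h⟩

namespace Forms

theorem map_sum_left {ι : Type*} (s : Finset ι) (g : ι → N₁ →ₗ[Fun I M] N₂)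
    (z : Forms I F V N₁) : map (∑ i ∈ s, g i) z = ∑ i ∈ s, map (g i) z := by
  induction z using Forms.induction with
  | of p x =>
    simp only [map_of, Form.of, ← map_sum]
    congr 1
    induction s using Finset.cons_induction with
    | empty => simp only [Finset.sum_empty]; rfl
    | cons a s ha ih => rw [Finset.sum_cons, Finset.sum_cons, ← ih]; rfl
  | add a b ha hb => simp only [map_add, ha, hb, Finset.sum_add_distrib]

theorem eq_zero_of_local (h : HasLocalBases I M N) (z : Forms I F V N)
    (hz : ∀ m₀ : M, ∃ φ : Fun I M, φ m₀ = 1 ∧ act (const φ) z = 0) : z = 0 := by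
  refine DFinsupp.ext fun p => AlternatingMap.ext fun v => h.eq_zero _ fun m₀ => ?_
  obtain ⟨φ, hφ, h⟩ := hz m₀
  refine ⟨φ, hφ, ?_⟩
  have key : ∀ w : Forms I F V N, (act (const φ) w) p v = φ • w p v := by
    intro w
    rw [act_const]
    induction w using Forms.induction with
    | add a b ha hb =>
      rw [map_add, DirectSum.add_apply, AlternatingMap.add_apply, ha, hb, DirectSum.add_apply,
        AlternatingMap.add_apply, smul_add]
    | of q x =>
      rw [map_of]
      by_cases hq : p = q
      · subst hq
        rw [Form.of, Form.of, DirectSum.of_eq_same, DirectSum.of_eq_same]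
        rfl
      · rw [Form.of, Form.of, DirectSum.of_eq_of_ne _ _ _ hq, DirectSum.of_eq_of_ne _ _ _ hq]
        exact (smul_zero φ).symm
  rw [← key, h]
  rfl

/-- Operators that are linear over the scalar forms are determined by their values on the
module `N`. -/
theorem eq_zero_of_const (h : HasLocalBases I M N) (T : AddMonoid.End (Forms I F V N))
    (c : ℤ) (hT : ∀ p (η : Form I F V (Fun I M) p) z,
      T (act (Form.of η) z) = c ^ p • act (Form.of η) (T z))
    (h0 : ∀ s : N, T (const s) = 0) (z : Forms I F V N) : T z = 0 := by
  refine eq_zero_of_local h _ fun m₀ => ?_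
  obtain ⟨φ, n, l, s, hφ, hl⟩ := h.basis m₀
  refine ⟨φ, hφ, ?_⟩
  have h1 : T (act (const φ) z) = act (const φ) (T z) := by
    have := hT 0 (AlternatingMap.constOfIsEmpty (Fun I M) (Sec I F V) (Fin 0) φ) z
    rwa [pow_zero, one_smul] at this
  have h2 : ∀ (a : Forms I F V (Fun I M)) (t : N), T (act a (const t)) = 0 := by
    intro a t
    induction a using Forms.induction with
    | of p x => rw [hT, h0, map_zero, smul_zero]
    | add a b ha hb => rw [map_add, AddMonoidHom.add_apply, map_add, ha, hb, add_zero]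
  rw [← h1, act_const]
  have h3 : (φ • LinearMap.id : N →ₗ[Fun I M] N) =
      ∑ i, LinearMap.toSpanSingleton (Fun I M) N (s i) ∘ₗ l i := by
    refine LinearMap.ext fun x => ?_
    rw [LinearMap.smul_apply, LinearMap.id_apply, hl]
    simp [LinearMap.sum_apply]
  rw [h3, map_sum_left, map_sum]
  refine Finset.sum_eq_zero fun i _ => ?_
  rw [← map_map, ← act_const_right, h2]

theorem operator_of (k : ℕ) (T : ∀ p, Form I F V N p →+ Form I F V N (p + k)) {p : ℕ}
    (x : Form I F V N p) : operator k T (Form.of x) = Form.of (T p x) :=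
  DirectSum.toAddMonoid_of _ p x

/-- The component with values in the first factor. -/
def fst (z : Forms I F V (N₁ × N₂)) : Forms I F V N₁ := map (LinearMap.fst _ N₁ N₂) z

/-- The component with values in the second factor. -/
def snd (z : Forms I F V (N₁ × N₂)) : Forms I F V N₂ := map (LinearMap.snd _ N₁ N₂) z

/-- A form with values in the first factor. -/
def inl (z : Forms I F V N₁) : Forms I F V (N₁ × N₂) := map (LinearMap.inl _ N₁ N₂) z

/-- A form with values in the second factor. -/
def inr (z : Forms I F V N₂) : Forms I F V (N₁ × N₂) := map (LinearMap.inr _ N₁ N₂) z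

@[simp] theorem fst_inl (z : Forms I F V N₁) : fst (inl z : Forms I F V (N₁ × N₂)) = z := by
  rw [fst, inl, map_map]; exact map_id z

@[simp] theorem snd_inr (z : Forms I F V N₂) : snd (inr z : Forms I F V (N₁ × N₂)) = z := by
  rw [snd, inr, map_map]; exact map_id z

@[simp] theorem snd_inl (z : Forms I F V N₁) : snd (inl z : Forms I F V (N₁ × N₂)) = 0 := by
  rw [snd, inl, map_map]; exact map_zero_left z

@[simp] theorem fst_inr (z : Forms I F V N₂) : fst (inr z : Forms I F V (N₁ × N₂)) = 0 := by
  rw [fst, inr, map_map]; exact map_zero_left z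

@[simp] theorem fst_add (z w : Forms I F V (N₁ × N₂)) : fst (z + w) = fst z + fst w := map_add _ z w

@[simp] theorem snd_add (z w : Forms I F V (N₁ × N₂)) : snd (z + w) = snd z + snd w := map_add _ z w

@[simp] theorem fst_const (s : N₁ × N₂) : fst (const s : Forms I F V (N₁ × N₂)) = const s.1 :=
  map_const _ s

@[simp] theorem snd_const (s : N₁ × N₂) : snd (const s : Forms I F V (N₁ × N₂)) = const s.2 :=
  map_const _ s

theorem inl_add_inr (z : Forms I F V (N₁ × N₂)) : inl (fst z) + inr (snd z) = z := by
  rw [inl, inr, fst, snd, map_map, map_map]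
  induction z using Forms.induction with
  | of p x =>
    rw [map_of, map_of, Form.of, Form.of, Form.of, ← map_add]
    congr 1
    ext v : 1
    change ((x v).1, 0) + (0, (x v).2) = x v
    simp
  | add a b ha hb =>
    rw [map_add, map_add, add_add_add_comm, ha, hb]

theorem ext_prod {z w : Forms I F V (N₁ × N₂)} (h : fst z = fst w) (h' : snd z = snd w) : z = w := by
  rw [← inl_add_inr z, h, h', inl_add_inr]

theorem fst_act (a : Forms I F V (Fun I M)) (z : Forms I F V (N₁ × N₂)) :
    fst (act a z) = act a (fst z) := map_act _ a z

theorem snd_act (a : Forms I F V (Fun I M)) (z : Forms I F V (N₁ × N₂)) :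
    snd (act a z) = act a (snd z) := map_act _ a z

theorem map_apply (g : N₁ →ₗ[Fun I M] N₂) (z : Forms I F V N₁) (p : ℕ) :
    map g z p = mapForm g (z p) := by
  induction z using Forms.induction with
  | of q x =>
    rw [map_of]
    by_cases hq : p = q
    · subst hq
      rw [Form.of, Form.of, DirectSum.of_eq_same, DirectSum.of_eq_same]
    · rw [Form.of, Form.of, DirectSum.of_eq_of_ne _ _ _ hq, DirectSum.of_eq_of_ne _ _ _ hq, map_zero]
  | add a b ha hb => rw [map_add, DirectSum.add_apply, ha, hb, DirectSum.add_apply, map_add]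

theorem hasTotalDegree_iff (k : ℤ) (z : Forms I F V (N₁ × N₂)) :
    HasTotalDegree k z ↔ IsHom (k + 1) (fst z) ∧ IsHom k (snd z) := by
  simp only [HasTotalDegree, IsHom, fst, snd, map_apply]
  exact ⟨fun h => ⟨fun p => (h p).1, fun p => (h p).2⟩, fun h p => ⟨h.1 p, h.2 p⟩⟩

end Forms

open Forms
variable {L : LieAlgebroid I F V} {NC NE : Type*} [AddCommGroup NC] [Module (Fun I M) NC]
  [AddCommGroup NE] [Module (Fun I M) NE]

namespace SuperData
variable (Q : SuperData L NC NE)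

theorem bdOp_apply (z : Forms I F V (NC × NE)) :
    Q.bdOp z = inr (Forms.map Q.bd (eps (fst z))) := by
  rw [inr, Forms.fst, eps_map, Forms.map_map, Forms.map_map]
  induction z using Forms.induction with
  | of p x =>
    rw [bdOp, operator_of, eps_of, map_zsmul, map_of]
    exact map_zsmul (DirectSum.of (fun p => Form I F V (NC × NE) p) p) _ _
  | add a b ha hb => simp only [map_add, ha, hb]

theorem DcOp_apply (z : Forms I F V (NC × NE)) : Q.DcOp z = inl (Q.nablaC.dF (fst z)) := by
  rw [inl, Forms.fst]
  induction z using Forms.induction with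
  | of p x => rw [DcOp, operator_of, map_of, Q.nablaC.dF_of, map_of]; rfl
  | add a b ha hb => simp only [map_add, ha, hb]

theorem DsOp_apply (z : Forms I F V (NC × NE)) : Q.DsOp z = inr (Q.nablaE.dF (snd z)) := by
  rw [inr, Forms.snd]
  induction z using Forms.induction with
  | of p x => rw [DsOp, operator_of, map_of, Q.nablaE.dF_of, map_of]; rfl
  | add a b ha hb => simp only [map_add, ha, hb]

/-- `x ↦ x ∧ Ω`. -/
def wedgeCurv (z : Forms I F V NE) : Forms I F V NC :=
  Forms.wedge (LinearMap.id (R := Fun I M) (M := NE →ₗ[Fun I M] NC)).flip z (Form.of Q.curv)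

theorem curvOp_apply (z : Forms I F V (NC × NE)) :
    Q.curvOp z = inl (Q.wedgeCurv (eps (snd z))) := by
  rw [inl, Forms.snd, wedgeCurv]
  induction z using Forms.induction with
  | of p x =>
    rw [curvOp, operator_of, map_of, eps_of, map_zsmul]
    change _ = Forms.map _ ((-1 : ℤ) ^ p • Forms.wedge _ (Form.of _) (Form.of _))
    rw [wedge_of_of, map_zsmul, map_of]
    exact map_zsmul (DirectSum.of (fun p => Form I F V (NC × NE) p) (p + 2)) _ _
  | add a b ha hb => simp only [map_add, AddMonoidHom.add_apply, ha, hb]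

theorem fst_op (z : Forms I F V (NC × NE)) :
    fst (Q.op z) = Q.nablaC.dF (fst z) + Q.wedgeCurv (eps (snd z)) := by
  change fst (Q.bdOp z + Q.DcOp z + Q.DsOp z + Q.curvOp z) = _
  rw [bdOp_apply, DcOp_apply, DsOp_apply, curvOp_apply]
  simp

theorem snd_op (z : Forms I F V (NC × NE)) :
    snd (Q.op z) = Forms.map Q.bd (eps (fst z)) + Q.nablaE.dF (snd z) := by
  change snd (Q.bdOp z + Q.DcOp z + Q.DsOp z + Q.curvOp z) = _
  rw [bdOp_apply, DcOp_apply, DsOp_apply, curvOp_apply]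
  simp

theorem op_act (a : Forms I F V (Fun I M)) (z : Forms I F V (NC × NE)) :
    Q.op (act a z) = act (L.trivialConnection.dF a) z + act (eps a) (Q.op z) := by
  refine ext_prod ?_ ?_
  · rw [fst_op, fst_add, fst_act, fst_act, fst_act, fst_op, snd_act, Connection.dF_act, eps_act,
      wedgeCurv, wedgeCurv, act_wedge, map_add, add_assoc]
  · rw [snd_op, snd_add, snd_act, snd_act, snd_act, snd_op, fst_act, Connection.dF_act, eps_act,
      map_act, map_add]
    abel

/-- The superconnection with the given components. -/
def superconnection : Superconnection L NC NE where
  op := Q.op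
  degree_one k x hx := by
    rw [hasTotalDegree_iff] at hx ⊢
    rw [fst_op, snd_op]
    refine ⟨(hx.1.dF _).add ?_, ?_⟩
    · have := (IsHom.eps hx.2).wedge (isHom_of (k := 2) rfl Q.curv)
        (LinearMap.id (R := Fun I M) (M := NE →ₗ[Fun I M] NC)).flip
      rw [wedgeCurv]
      convert this using 1
      ring
    · exact ((IsHom.eps hx.1).map _).add (hx.2.dF _)
  leibniz p η x := by
    rw [wedgeOp_eq, wedgeOp_eq, wedgeOp_eq]
    have := Q.op_act (Form.of η) x
    rw [eps_of, map_zsmul, Connection.dF_of] at this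
    exact this

theorem wedgeCurv_const (ε : NE) (X Y : Sec I F V) :
    aug (iota Y (iota X (Q.wedgeCurv (const ε)))) = Q.curv ![X, Y] ε := by
  rw [wedgeCurv, wedge_const_left, iota_map, iota_map, aug_map, iota_of_succ, iota_of_succ,
    aug_of_zero]
  rfl

theorem isHom_wedgeCurv {k : ℤ} {z : Forms I F V NE} (h : IsHom k z) :
    IsHom (k + 2) (Q.wedgeCurv z) := h.wedge (isHom_of (k := 2) rfl Q.curv) _

theorem bd_eq (α : NC) : Q.bd α = aug (snd (Q.op (const (α, 0)))) := by
  rw [snd_op, map_add, aug_map, aug_eps, fst_const, aug_const, Connection.aug_dF, add_zero]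

theorem nablaC_eq (X : Sec I F V) (α : NC) :
    Q.nablaC.nabla X α = aug (iota X (fst (Q.op (const (α, 0))))) := by
  rw [fst_op, fst_const, snd_const, const_zero, map_zero, map_add, map_add, Connection.aug_iota_dF,
    wedgeCurv]
  simp

theorem nablaE_eq (X : Sec I F V) (ε : NE) :
    Q.nablaE.nabla X ε = aug (iota X (snd (Q.op (const (0, ε))))) := by
  rw [snd_op, fst_const, snd_const, const_zero, map_zero, map_zero, map_add, map_add,
    Connection.aug_iota_dF]
  simp

theorem curv_eq (X Y : Sec I F V) (ε : NE) :
    Q.curv ![X, Y] ε = aug (iota Y (iota X (fst (Q.op (const (0, ε)))))) := by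
  rw [fst_op, fst_const, snd_const, const_zero, map_zero, zero_add, eps_const, wedgeCurv_const]

theorem ext_curv {Q Q' : SuperData L NC NE} (h₁ : ∀ α, Q.bd α = Q'.bd α)
    (h₂ : ∀ X α, Q.nablaC.nabla X α = Q'.nablaC.nabla X α)
    (h₃ : ∀ X ε, Q.nablaE.nabla X ε = Q'.nablaE.nabla X ε)
    (h₄ : ∀ X Y ε, Q.curv ![X, Y] ε = Q'.curv ![X, Y] ε) : Q = Q' := by
  refine SuperData.ext (LinearMap.ext h₁) (Connection.ext (funext fun X => funext fun α => h₂ X α))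
    (Connection.ext (funext fun X => funext fun α => h₃ X α))
    (AlternatingMap.ext fun v => LinearMap.ext fun ε => ?_)
  have : v = ![v 0, v 1] := by
    funext i
    fin_cases i <;> rfl
  rw [this]
  exact h₄ _ _ ε

theorem op_injective : Function.Injective (SuperData.op : SuperData L NC NE → _) := by
  intro Q Q' h
  refine ext_curv (fun α => ?_) (fun X α => ?_) (fun X ε => ?_) (fun X Y ε => ?_)
  · rw [bd_eq, bd_eq, h]
  · rw [nablaC_eq, nablaC_eq, h]
  · rw [nablaE_eq, nablaE_eq, h]
  · rw [curv_eq, curv_eq, h]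

/-- The sum that vanishes if `D^c Ω + Ω D^s = 0`, evaluated on three sections. -/
def closedSum (X Y Z : Sec I F V) (ε : NE) : NC :=
  Q.nablaC.nabla X (Q.curv ![Y, Z] ε) - Q.nablaC.nabla Y (Q.curv ![X, Z] ε) +
    Q.nablaC.nabla Z (Q.curv ![X, Y] ε) + Q.curv ![Y, L.bracket Z X] ε +
    Q.curv ![L.bracket Y X, Z] ε - Q.curv ![X, L.bracket Z Y] ε -
    (Q.curv ![Y, Z] (Q.nablaE.nabla X ε) - Q.curv ![X, Z] (Q.nablaE.nabla Y ε) +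
      Q.curv ![X, Y] (Q.nablaE.nabla Z ε))

theorem aug_closed (X Y Z : Sec I F V) (ε : NE) :
    aug (iota Z (iota Y (iota X (Q.nablaC.dF (Q.wedgeCurv (const ε)) +
      Q.wedgeCurv (eps (Q.nablaE.dF (const ε))))))) = Q.closedSum X Y Z ε := by
  have h3 : iota Z (iota Y (iota X (Q.wedgeCurv (const ε)))) = 0 := by
    have h := Q.isHom_wedgeCurv (isHom_const (I := I) (F := F) (V := V) ε)
    exact ((h.iota (l := 1) rfl X).iota (l := 0) rfl Y).iota_eq_zero Z
  have hE : ∀ X Y, iota Y (iota X (Q.nablaE.dF (const ε))) = 0 := fun X Y =>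
    (((isHom_const (I := I) (F := F) (V := V) ε).dF Q.nablaE).iota (l := 0) rfl X).iota_eq_zero Y
  have hC : iota Z (iota Y (iota X (Form.of Q.curv))) = 0 :=
    (((isHom_of (k := 2) rfl Q.curv).iota (l := 1) rfl X).iota (l := 0) rfl Y).iota_eq_zero Z
  have hc : ∀ X Y, aug (iota Y (iota X (Form.of Q.curv))) = Q.curv ![X, Y] := fun X Y => by
    rw [iota_of_succ, iota_of_succ, aug_of_zero]
    rfl
  have e2 : aug (iota Z (iota Y (iota X (Q.wedgeCurv (eps (Q.nablaE.dF (const ε))))))) =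
      -(Q.curv ![Y, Z] (Q.nablaE.nabla X ε) - Q.curv ![X, Z] (Q.nablaE.nabla Y ε) +
      Q.curv ![X, Y] (Q.nablaE.nabla Z ε)) := by
    rw [wedgeCurv]
    simp only [iota_wedge, iota_eps, map_neg, map_add, AddMonoidHom.neg_apply, eps_eps, aug_wedge,
      hE, hC, map_zero, AddMonoidHom.zero_apply, aug_eps, Connection.aug_iota_dF, hc,
      neg_zero, zero_add, add_zero, LinearMap.flip_apply, LinearMap.id_apply]
    abel
  have h4 : aug (iota Z (Q.nablaC.dF (iota Y (iota X (Q.wedgeCurv (const ε)))))) =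
      Q.nablaC.nabla Z (Q.curv ![X, Y] ε) := by
    rw [Connection.iota_dF, map_sub, Connection.aug_lieF, Connection.aug_dF, sub_zero,
      wedgeCurv_const]
  rw [map_add, map_add, map_add, map_add, e2, Connection.iota_iota_dF]
  simp only [map_add, map_sub, Connection.iota_lieF, h4, Connection.aug_lieF, wedgeCurv_const,
    closedSum]
  abel

theorem act_op_op (hL : ∀ X Y f, L.trivialConnection.curvature X Y f = 0)
    (a : Forms I F V (Fun I M)) (z : Forms I F V (NC × NE)) :
    Q.op (Q.op (act a z)) = act a (Q.op (Q.op z)) := by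
  rw [op_act, map_add, op_act, op_act, L.trivialConnection.dF_dF hL, eps_eps, Connection.eps_dF]
  simp

theorem closed_iff (hN : HasLocalBases I M (NC × NE))
    (hL : ∀ X Y f, L.trivialConnection.curvature X Y f = 0) :
    Q.DcOp * Q.curvOp + Q.curvOp * Q.DsOp = 0 ↔ ∀ X Y Z ε, Q.closedSum X Y Z ε = 0 := by
  have e : ∀ z, (Q.DcOp * Q.curvOp + Q.curvOp * Q.DsOp) z =
      inl (Q.nablaC.dF (Q.wedgeCurv (eps (snd z))) +
        Q.wedgeCurv (eps (Q.nablaE.dF (snd z)))) := fun z => by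
    change Q.DcOp (Q.curvOp z) + Q.curvOp (Q.DsOp z) = _
    rw [DcOp_apply, curvOp_apply, curvOp_apply, DsOp_apply, fst_inl, snd_inr]
    exact (map_add _ _ _).symm
  have ec : ∀ s : NC × NE, (Q.DcOp * Q.curvOp + Q.curvOp * Q.DsOp) (const s) =
      inl (Q.nablaC.dF (Q.wedgeCurv (const s.2)) +
        Q.wedgeCurv (eps (Q.nablaE.dF (const s.2)))) := fun s => by
    rw [e, snd_const, eps_const]
  constructor
  · intro h X Y Z ε
    have h1 := congrArg Forms.fst (ec (0, ε))
    rw [h, fst_inl] at h1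
    rw [← aug_closed, ← h1]
    change aug (iota Z (iota Y (iota X (Forms.map _ 0)))) = 0
    simp
  · intro h
    refine AddMonoidHom.ext fun z => ?_
    refine eq_zero_of_const hN (Q.DcOp * Q.curvOp + Q.curvOp * Q.DsOp) 1 (fun p η z => ?_)
      (fun s => ?_) z
    · have h1 := Q.act_op_op hL (Form.of η) (inr (snd z))
      have h2 : ∀ w, inl (fst (Q.op (Q.op (inr (snd w))))) =
          (Q.DcOp * Q.curvOp + Q.curvOp * Q.DsOp) w := fun w => by
        rw [e, fst_op, fst_op, snd_op, fst_inr, snd_inr]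
        simp
      have h3 : act (Form.of η) (inr (snd z) : Forms I F V (NC × NE)) =
          inr (snd (act (Form.of η) z)) := by
        rw [snd_act]
        exact (map_act _ _ _).symm
      rw [h3] at h1
      have h4 := congrArg (fun w => (inl (fst w) : Forms I F V (NC × NE))) h1
      simp only [fst_act] at h4
      rw [h2] at h4
      rw [one_pow, one_smul]
      refine h4.trans ?_
      rw [← h2 z]
      exact map_act _ _ _
    · rw [ec]
      have : Q.nablaC.dF (Q.wedgeCurv (const s.2)) +
          Q.wedgeCurv (eps (Q.nablaE.dF (const s.2))) = 0 := by
        have h1 := (Q.isHom_wedgeCurv (isHom_const (I := I) (F := F) (V := V) s.2)).dF Q.nablaC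
        have h2 := Q.isHom_wedgeCurv
          (IsHom.eps ((isHom_const (I := I) (F := F) (V := V) s.2).dF Q.nablaE))
        refine IsHom.ext_three (h1.add h2) (isHom_zero 3) fun X Y Z => ?_
        rw [aug_closed, h]
        simp
      rw [this]
      exact map_zero _

theorem flat_iff_compatible (hN : HasLocalBases I M (NC × NE))
    (hL : ∀ X Y f, L.trivialConnection.curvature X Y f = 0) :
    Q.op * Q.op = 0 ↔ Q.Compatible := by
  have fC : ∀ α : NC, fst (Q.op (Q.op (const (α, 0)))) =
      Q.nablaC.dF (Q.nablaC.dF (const α)) + Q.wedgeCurv (const (Q.bd α)) := fun α => by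
    rw [fst_op, fst_op, snd_op, fst_const, snd_const, const_zero, wedgeCurv]
    simp
  have sC : ∀ α : NC, snd (Q.op (Q.op (const (α, 0)))) =
      - Forms.map Q.bd (Q.nablaC.dF (const α)) + Q.nablaE.dF (const (Q.bd α)) := fun α => by
    rw [snd_op, fst_op, snd_op, fst_const, snd_const, const_zero, wedgeCurv]
    simp [Connection.eps_dF]
  have fE : ∀ ε : NE, fst (Q.op (Q.op (const (0, ε)))) =
      Q.nablaC.dF (Q.wedgeCurv (const ε)) + Q.wedgeCurv (eps (Q.nablaE.dF (const ε))) := fun ε => by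
    rw [fst_op, fst_op, snd_op, fst_const, snd_const, const_zero]
    simp
  have sE : ∀ ε : NE, snd (Q.op (Q.op (const (0, ε)))) =
      Forms.map Q.bd (eps (Q.wedgeCurv (const ε))) + Q.nablaE.dF (Q.nablaE.dF (const ε)) :=
      fun ε => by
    rw [snd_op, fst_op, snd_op, fst_const, snd_const, const_zero]
    simp
  have dC : ∀ α, IsHom 1 (Q.nablaC.dF (const α)) := fun α => (isHom_const α).dF _
  have dE : ∀ ε, IsHom 1 (Q.nablaE.dF (const ε)) := fun ε => (isHom_const ε).dF _
  have d2C : ∀ α, IsHom 2 (Q.nablaC.dF (Q.nablaC.dF (const α))) := fun α => (dC α).dF _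
  have d2E : ∀ ε, IsHom 2 (Q.nablaE.dF (Q.nablaE.dF (const ε))) := fun ε => (dE ε).dF _
  have w : ∀ ε, IsHom 2 (Q.wedgeCurv (const ε)) := fun ε =>
    Q.isHom_wedgeCurv (k := 0) (isHom_const ε)
  have eps2 : ∀ ε, eps (Q.wedgeCurv (const ε)) = Q.wedgeCurv (const ε) := fun ε => by
    rw [wedgeCurv, eps_wedge, eps_const, eps_of]
    simp
  constructor
  · intro h
    have hz : ∀ z, Q.op (Q.op z) = 0 := fun z => DFunLike.congr_fun h z
    have z1 : fst (0 : Forms I F V (NC × NE)) = 0 := map_zero _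
    have z2 : snd (0 : Forms I F V (NC × NE)) = 0 := map_zero _
    refine ⟨fun X α => ?_, fun X Y α => ?_, fun X Y ε => ?_, ?_⟩
    · have := congrArg (fun z => aug (iota X z)) (sC α)
      rw [hz, z2] at this
      simp only [map_add, map_neg, iota_map, aug_map, Connection.aug_iota_dF, map_zero] at this
      rw [eq_comm, neg_add_eq_zero] at this
      exact this
    · have := congrArg (fun z => aug (iota Y (iota X z))) (fC α)
      rw [hz, z1] at this
      simp only [map_add, Connection.aug_iota_iota_dF_dF, wedgeCurv_const, map_zero] at this
      exact eq_neg_of_add_eq_zero_left this.symm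
    · have := congrArg (fun z => aug (iota Y (iota X z))) (sE ε)
      rw [hz, z2, eps2] at this
      simp only [map_add, Connection.aug_iota_iota_dF_dF, iota_map, aug_map, wedgeCurv_const,
        map_zero] at this
      exact eq_neg_of_add_eq_zero_right this.symm
    · rw [Q.closed_iff hN hL]
      intro X Y Z ε
      rw [← aug_closed, ← fE, hz, z1]
      simp
  · intro h
    refine AddMonoidHom.ext fun z => ?_
    refine eq_zero_of_const hN (Q.op * Q.op) 1 (fun p η z => ?_) (fun s => ?_) z
    · rw [one_pow, one_smul]
      exact Q.act_op_op hL _ z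
    · have hs : (const s : Forms I F V (NC × NE)) = const (s.1, 0) + const (0, s.2) := by
        rw [← const_add]
        simp
      change Q.op (Q.op (const s)) = 0
      have z1 : fst (0 : Forms I F V (NC × NE)) = 0 := map_zero _
      have z2 : snd (0 : Forms I F V (NC × NE)) = 0 := map_zero _
      have e1 : Q.op (Q.op (const (s.1, 0))) = 0 := by
        refine ext_prod ?_ ?_
        · rw [fC, z1]
          refine IsHom.ext_two ((d2C _).add (w _)) (isHom_zero 2) fun X Y => ?_
          simp only [map_add, Connection.aug_iota_iota_dF_dF, wedgeCurv_const, map_zero,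
            h.curvature_C, neg_add_cancel]
        · rw [sC, z2]
          refine IsHom.ext_one (z := - Forms.map Q.bd (Q.nablaC.dF (const s.1)) + _)
            (IsHom.add ?_ (dE _)) (isHom_zero 1) fun X => ?_
          · rw [← neg_one_zsmul]
            exact ((dC _).map _).zsmul _
          · simp only [map_add, map_neg, iota_map, aug_map, Connection.aug_iota_dF, map_zero,
              h.bd_nabla, neg_add_cancel]
      have e2 : Q.op (Q.op (const (0, s.2))) = 0 := by
        refine ext_prod ?_ ?_
        · rw [fE, z1]
          have h1 := (Q.isHom_wedgeCurv (isHom_const (I := I) (F := F) (V := V) s.2)).dF Q.nablaC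
          have h2 := Q.isHom_wedgeCurv
            (IsHom.eps ((isHom_const (I := I) (F := F) (V := V) s.2).dF Q.nablaE))
          refine IsHom.ext_three (h1.add h2) (isHom_zero 3) fun X Y Z => ?_
          rw [aug_closed, (Q.closed_iff hN hL).1 h.closed]
          simp
        · rw [sE, z2, eps2]
          refine IsHom.ext_two (((w _).map _).add (d2E _)) (isHom_zero 2) fun X Y => ?_
          simp only [map_add, Connection.aug_iota_iota_dF_dF, iota_map, aug_map, wedgeCurv_const,
            map_zero, h.curvature_E, add_neg_cancel]
      rw [hs, map_add, map_add, e1, e2, add_zero]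

end SuperData
end Super

section Super
attribute [local instance] Form.instAddCommGroup Form.instAddCommMonoid Form.instAddMonoid Form.instAddZeroClass
  Forms.instAddCommGroup Forms.instAddCommMonoid Forms.instAddMonoid Forms.instAddZeroClass
set_option linter.unusedSectionVars false
variable {EM HM : Type*} [NormedAddCommGroup EM] [NormedSpace ℝ EM] [TopologicalSpace HM]
  {I : ModelWithCorners ℝ EM HM} {M : Type*} [TopologicalSpace M] [ChartedSpace HM M]
  [IsManifold I ∞ M]
  {F : Type*} [NormedAddCommGroup F] [NormedSpace ℝ F]
  {V : M → Type*} [TopologicalSpace (TotalSpace F V)] [∀ m, AddCommGroup (V m)]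
  [∀ m, Module ℝ (V m)] [∀ m, TopologicalSpace (V m)] [FiberBundle F V] [VectorBundle ℝ F V]
  {N N₁ N₂ N₃ : Type*} [AddCommGroup N] [Module (Fun I M) N] [AddCommGroup N₁] [Module (Fun I M) N₁]
  [AddCommGroup N₂] [Module (Fun I M) N₂] [AddCommGroup N₃] [Module (Fun I M) N₃]

namespace Forms

theorem aug_act (a : Forms I F V (Fun I M)) (z : Forms I F V N) : aug (act a z) = aug a • aug z :=
  aug_wedge _ a z

theorem iota_act (X : Sec I F V) (a : Forms I F V (Fun I M)) (z : Forms I F V N) :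
    iota X (act a z) = act (iota X a) z + act (eps a) (iota X z) := iota_wedge _ X a z

theorem aug_iota_add_left (X Y : Sec I F V) (z : Forms I F V N) :
    aug (iota (X + Y) z) = aug (iota X z) + aug (iota Y z) := by
  change iota (X + Y) z 0 ![] = iota X z 0 ![] + iota Y z 0 ![]
  simp only [iota_apply, map_add]
  rfl

theorem aug_iota_smul_left (f : Fun I M) (X : Sec I F V) (z : Forms I F V N) :
    aug (iota (f • X) z) = f • aug (iota X z) := by
  change iota (f • X) z 0 ![] = f • iota X z 0 ![]
  simp only [iota_apply, map_smul]
  rfl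

theorem act_const_apply (f : Fun I M) (z : Forms I F V N) (p : ℕ) (v : Fin p → Sec I F V) :
    act (const f) z p v = f • z p v := by
  rw [act_const, map_apply]
  rfl

theorem const_smul (f : Fun I M) (s : N) :
    (const (f • s) : Forms I F V N) = act (const f) (const s) := by
  rw [act_const, map_const]
  rfl

theorem aug_iota_iota (X Y : Sec I F V) (z : Forms I F V N) :
    aug (iota Y (iota X z)) = z 2 ![X, Y] := by
  change iota Y (iota X z) 0 ![] = _
  simp only [iota_apply]
  rfl

theorem const_inl_smul (f : Fun I M) (s : N₁) : (const (f • s, 0) : Forms I F V (N₁ × N₂)) =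
    act (const f) (const (s, 0)) := by
  rw [← const_smul]
  congr 1
  exact Prod.ext rfl (smul_zero f).symm

theorem const_inr_smul (f : Fun I M) (s : N₂) : (const (0, f • s) : Forms I F V (N₁ × N₂)) =
    act (const f) (const (0, s)) := by
  rw [← const_smul]
  congr 1
  exact Prod.ext (smul_zero f).symm rfl

theorem const_inl_add (s t : N₁) : (const (s + t, 0) : Forms I F V (N₁ × N₂)) =
    const (s, 0) + const (t, 0) := by
  rw [← const_add]
  simp

theorem const_inr_add (s t : N₂) : (const (0, s + t) : Forms I F V (N₁ × N₂)) =
    const (0, s) + const (0, t) := by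
  rw [← const_add]
  simp

end Forms

open Forms
variable {L : LieAlgebroid I F V} {NC NE : Type*} [AddCommGroup NC] [Module (Fun I M) NC]
  [AddCommGroup NE] [Module (Fun I M) NE]

namespace Superconnection
variable (𝒟 : Superconnection L NC NE)

theorem op_act (a : Forms I F V (Fun I M)) (z : Forms I F V (NC × NE)) :
    𝒟.op (act a z) = act (L.trivialConnection.dF a) z + act (eps a) (𝒟.op z) := by
  induction a using Forms.induction with
  | of p η =>
    have := 𝒟.leibniz p η z
    rw [wedgeOp_eq, wedgeOp_eq, wedgeOp_eq] at this
    rw [eps_of, map_zsmul, Connection.dF_of]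
    exact this
  | add a b ha hb =>
    rw [map_add, AddMonoidHom.add_apply, map_add, ha, hb, map_add, map_add, map_add, map_add,
      AddMonoidHom.add_apply, AddMonoidHom.add_apply]
    abel

theorem op_act_const (f : Fun I M) (z : Forms I F V (NC × NE)) :
    𝒟.op (act (const f) z) = act (L.trivialConnection.dF (const f)) z +
      act (const f) (𝒟.op z) := by
  rw [op_act, eps_const]

theorem isHom_inl (α : NC) : IsHom 1 (fst (𝒟.op (const (α, 0)))) ∧
    IsHom 0 (snd (𝒟.op (const (α, 0)))) := by
  have := 𝒟.degree_one (-1) (const (α, 0)) ((hasTotalDegree_iff _ _).2 ?_)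
  · exact (hasTotalDegree_iff _ _).1 this
  · rw [fst_const, snd_const, const_zero]
    exact ⟨isHom_const α, isHom_zero _⟩

theorem isHom_inr (ε : NE) : IsHom 2 (fst (𝒟.op (const (0, ε)))) ∧
    IsHom 1 (snd (𝒟.op (const (0, ε)))) := by
  have := 𝒟.degree_one 0 (const (0, ε)) ((hasTotalDegree_iff _ _).2 ?_)
  · exact (hasTotalDegree_iff _ _).1 this
  · rw [fst_const, snd_const, const_zero]
    exact ⟨isHom_zero _, isHom_const ε⟩

/-- The components of a superconnection. -/
def superData : SuperData L NC NE where
  bd :=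
    { toFun := fun α => aug (snd (𝒟.op (const (α, 0))))
      map_add' := fun α β => by rw [const_inl_add, map_add, snd_add, map_add]
      map_smul' := fun f α => by
        rw [const_inl_smul, op_act_const, snd_add, snd_act, snd_act, snd_const, const_zero,
          map_zero, zero_add, aug_act, aug_const]
        rfl }
  nablaC :=
    { nabla := fun X α => aug (iota X (fst (𝒟.op (const (α, 0)))))
      add_left := fun X Y α => aug_iota_add_left X Y _
      smul_left := fun f X α => aug_iota_smul_left f X _
      add_right := fun X α β => by rw [const_inl_add, map_add, fst_add, map_add, map_add]
      leibniz := fun X f α => by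
        rw [const_inl_smul, op_act_const, fst_add, fst_act, fst_act, fst_const, map_add, map_add,
          iota_act, iota_act, iota_const, iota_const, map_zero, map_zero, add_zero,
          AddMonoidHom.zero_apply, zero_add, aug_act, aug_act, Connection.aug_iota_dF, eps_const,
          aug_const, aug_const, add_comm]
        rfl }
  nablaE :=
    { nabla := fun X ε => aug (iota X (snd (𝒟.op (const (0, ε)))))
      add_left := fun X Y ε => aug_iota_add_left X Y _
      smul_left := fun f X ε => aug_iota_smul_left f X _
      add_right := fun X ε ε' => by rw [const_inr_add, map_add, snd_add, map_add, map_add]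
      leibniz := fun X f ε => by
        rw [const_inr_smul, op_act_const, snd_add, snd_act, snd_act, snd_const, map_add, map_add,
          iota_act, iota_act, iota_const, iota_const, map_zero, map_zero, add_zero,
          AddMonoidHom.zero_apply, zero_add, aug_act, aug_act, Connection.aug_iota_dF, eps_const,
          aug_const, aug_const, add_comm]
        rfl }
  curv :=
    { toFun := fun v =>
        { toFun := fun ε => fst (𝒟.op (const (0, ε))) 2 v
          map_add' := fun ε ε' => by
            rw [const_inr_add, map_add, fst_add]
            rfl
          map_smul' := fun f ε => by
            rw [const_inr_smul, op_act_const, fst_add, fst_act, fst_act, fst_const, const_zero,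
              map_zero, zero_add, act_const_apply]
            rfl }
      map_update_add' := fun v i X Y => LinearMap.ext fun ε => by
        exact (fst (𝒟.op (const (0, ε))) 2).toMultilinearMap.map_update_add' v i X Y
      map_update_smul' := fun v i f X => LinearMap.ext fun ε => by
        exact (fst (𝒟.op (const (0, ε))) 2).toMultilinearMap.map_update_smul' v i f X
      map_eq_zero_of_eq' := fun v i j h hij => LinearMap.ext fun ε =>
        (fst (𝒟.op (const (0, ε))) 2).map_eq_zero_of_eq v h hij }

theorem op_superData (hN : HasLocalBases I M (NC × NE)) : 𝒟.superData.op = 𝒟.op := by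
  have key : ∀ z, (𝒟.superData.op - 𝒟.op) z = 𝒟.superData.op z - 𝒟.op z := fun z => rfl
  have h1 : ∀ α : NC, 𝒟.superData.op (const (α, 0)) = 𝒟.op (const (α, 0)) := fun α => by
    have a := 𝒟.isHom_inl α
    have b := 𝒟.superData.superconnection.isHom_inl α
    refine ext_prod (b.1.ext_one a.1 fun X => ?_) (b.2.ext_zero a.2 ?_)
    · exact (𝒟.superData.nablaC_eq X α).symm
    · exact (𝒟.superData.bd_eq α).symm
  have h2 : ∀ ε : NE, 𝒟.superData.op (const (0, ε)) = 𝒟.op (const (0, ε)) := fun ε => by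
    have a := 𝒟.isHom_inr ε
    have b := 𝒟.superData.superconnection.isHom_inr ε
    refine ext_prod (b.1.ext_two a.1 fun X Y => ?_) (b.2.ext_one a.2 fun X => ?_)
    · refine (𝒟.superData.curv_eq X Y ε).symm.trans ?_
      rw [aug_iota_iota]
      rfl
    · exact (𝒟.superData.nablaE_eq X ε).symm
  refine AddMonoidHom.ext fun z => sub_eq_zero.1 ((key z).symm.trans ?_)
  refine eq_zero_of_const hN (𝒟.superData.op - 𝒟.op) (-1) (fun p η z => ?_) (fun s => ?_) z
  · rw [key, key, op_act, SuperData.op_act, add_sub_add_left_eq_sub, ← map_sub, eps_of, map_zsmul]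
    rfl
  · have hs : (const s : Forms I F V (NC × NE)) = const (s.1, 0) + const (0, s.2) := by
      rw [← const_add]
      simp
    rw [key, hs, map_add, map_add, h1, h2, sub_self]

end Superconnection

/-- The quadruples `(∂, ∇^c, ∇^s, Ω)` correspond to the superconnections. -/
def superEquiv (hN : HasLocalBases I M (NC × NE)) :
    SuperData L NC NE ≃ Superconnection L NC NE :=
  Equiv.ofBijective SuperData.superconnection
    ⟨fun _ _ h => SuperData.op_injective (congrArg Superconnection.op h),
     fun 𝒟 => ⟨𝒟.superData, Superconnection.ext (𝒟.op_superData hN)⟩⟩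

end Super

section CommutatorOfFields
variable {EN HN : Type*} [NormedAddCommGroup EN] [NormedSpace ℝ EN] [TopologicalSpace HN] {J : ModelWithCorners ℝ EN HN} {N : Type*} [TopologicalSpace N]
  [ChartedSpace HN N] [IsManifold J ∞ N]

open VectorField

/-- The derivative of a function along a vector field. -/
def fieldDeriv (J : ModelWithCorners ℝ EN HN) (U : ∀ x : N, TangentSpace J x) (f : N → ℝ) (x : N) :
    ℝ := mvfderiv J f x (U x)

theorem contMDiff_fieldDeriv {U : ∀ x : N, TangentSpace J x} {f : N → ℝ}
    (hU : ContMDiff J J.tangent ∞ (fun x => (⟨x, U x⟩ : TangentBundle J N)))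
    (hf : ContMDiff J 𝓘(ℝ) ∞ f) : ContMDiff J 𝓘(ℝ) ∞ (fieldDeriv J U f) := by
  have h2 := (hf.contMDiff_tangentMap (m := ∞) (by simp)).comp hU
  exact (contMDiff_snd_tangentBundle_modelSpace ℝ 𝓘(ℝ)).comp h2

variable [CompleteSpace EN]

/-- The Lie bracket of vector fields acts on functions as the commutator. -/
theorem mvfderiv_mlieBracket {U V : ∀ x : N, TangentSpace J x} {f : N → ℝ}
    (hU : ContMDiff J J.tangent ∞ (fun x => (⟨x, U x⟩ : TangentBundle J N)))
    (hV : ContMDiff J J.tangent ∞ (fun x => (⟨x, V x⟩ : TangentBundle J N)))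
    (hf : ContMDiff J 𝓘(ℝ) ∞ f) (x : N) :
    mvfderiv J f x (mlieBracket J U V x) =
      fieldDeriv J U (fieldDeriv J V f) x - fieldDeriv J V (fieldDeriv J U f) x := by
  rcases subsingleton_or_nontrivial EN with hE | hE
  · have hz : ∀ (y : N) (v : TangentSpace J y), v = 0 := fun y v => Subsingleton.elim (α := EN) _ _
    rw [hz x (mlieBracket J U V x)]
    simp only [fieldDeriv, hz x (U x), hz x (V x), map_zero, sub_zero]
  obtain ⟨w, hw⟩ := exists_ne (0 : EN)
  let e := trivializationAt EN (TangentSpace J : N → Type _) x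
  have hx : x ∈ e.baseSet := mem_baseSet_trivializationAt _ _ _
  have m1 : IsManifold J (minSmoothness ℝ 3) N := IsManifold.of_le (n := ∞) (by
    rw [minSmoothness_of_isRCLikeNormedField]; exact WithTop.coe_le_coe.2 le_top)
  have m2 : IsManifold J (minSmoothness ℝ 2) N := IsManifold.of_le (n := ∞) (by
    rw [minSmoothness_of_isRCLikeNormedField]; exact WithTop.coe_le_coe.2 le_top)
  have m4 : IsManifold J (((⊤ : ℕ∞) : WithTop ℕ∞) + 1) N := ‹IsManifold J ∞ N›
  let W : ∀ y : N, TangentSpace J y := fun y => e.symm y w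
  have hWs : ∀ᶠ y in nhds x,
      ContMDiffAt J J.tangent ∞ (fun y => (⟨y, W y⟩ : TangentBundle J N)) y := by
    filter_upwards [e.open_baseSet.mem_nhds hx] with y hy
    refine (e.contMDiffAt_section_iff hy).2 ?_
    refine (contMDiffAt_const (c := w)).congr_of_eventuallyEq ?_
    filter_upwards [e.open_baseSet.mem_nhds hy] with z hz
    rw [e.apply_mk_symm hz]
  have hW0 : W x ≠ 0 := fun h => hw (by
    have h1 := congrArg Prod.snd (e.apply_mk_symm hx w)
    have h2 := (e.linear ℝ hx).map_zero
    change e.symm x w = 0 at h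
    rw [h] at h1
    exact h1.symm.trans h2)
  have ne : (∞ : WithTop ℕ∞) ≠ 0 := by simp
  have hms : ∀ {U : ∀ x : N, TangentSpace J x} {y},
      ContMDiffAt J J.tangent ∞ (fun y => (⟨y, U y⟩ : TangentBundle J N)) y →
      ContMDiffAt J J.tangent (minSmoothness ℝ 2) (fun y => (⟨y, U y⟩ : TangentBundle J N)) y := by
    intro U y h
    refine h.of_le ?_
    rw [minSmoothness_of_isRCLikeNormedField]; exact WithTop.coe_le_coe.2 le_top
  have hbr : ∀ {A B : ∀ x : N, TangentSpace J x} {y},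
      ContMDiffAt J J.tangent ∞ (fun y => (⟨y, A y⟩ : TangentBundle J N)) y →
      ContMDiffAt J J.tangent ∞ (fun y => (⟨y, B y⟩ : TangentBundle J N)) y →
      ContMDiffAt J J.tangent ∞ (fun y => (⟨y, mlieBracket J A B y⟩ : TangentBundle J N)) y := by
    intro A B y hA hB
    exact ContMDiffAt.mlieBracket_vectorField (m := ⊤) (n := ⊤) hA hB (by
      rw [minSmoothness_of_isRCLikeNormedField]; exact le_of_eq rfl)
  have hsm : ∀ (A : ∀ x : N, TangentSpace J x) {g : N → ℝ} {B : ∀ x : N, TangentSpace J x} {y},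
      ContMDiff J 𝓘(ℝ) ∞ g → ContMDiffAt J J.tangent ∞ (fun y => (⟨y, B y⟩ : TangentBundle J N)) y →
      mlieBracket J A (g • B) y = fieldDeriv J A g y • B y + g y • mlieBracket J A B y :=
    fun A _ _ _ hg hB => mlieBracket_smul_right (hg.contMDiffAt.mdifferentiableAt ne)
      (hB.mdifferentiableAt ne)
  have expand : ∀ {A B : ∀ x : N, TangentSpace J x},
      ContMDiff J J.tangent ∞ (fun x => (⟨x, A x⟩ : TangentBundle J N)) →
      ContMDiff J J.tangent ∞ (fun x => (⟨x, B x⟩ : TangentBundle J N)) →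
      mlieBracket J A (mlieBracket J B (f • W)) x =
        fieldDeriv J A (fieldDeriv J B f) x • W x + fieldDeriv J B f x • mlieBracket J A W x +
        (fieldDeriv J A f x • mlieBracket J B W x +
          f x • mlieBracket J A (mlieBracket J B W) x) := by
    intro A B hA hB
    have h1 : mlieBracket J B (f • W) =ᶠ[nhds x] fieldDeriv J B f • W + f • mlieBracket J B W := by
      filter_upwards [hWs] with y hy
      exact hsm B hf hy
    have hWx := hWs.self_of_nhds
    rw [Filter.EventuallyEq.mlieBracket_vectorField_eq (Filter.EventuallyEq.refl _ A) h1,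
      mlieBracket_add_right, hsm A (contMDiff_fieldDeriv hB hf) hWx, hsm A hf (hbr (hB x) hWx)]
    · exact ((contMDiff_fieldDeriv hB hf).contMDiffAt.smul_section hWx).mdifferentiableAt ne
    · exact (hf.contMDiffAt.smul_section (hbr (hB x) hWx)).mdifferentiableAt ne
  have hWx := hWs.self_of_nhds
  have hfW : ContMDiffAt J J.tangent ∞ (fun y => (⟨y, (f • W) y⟩ : TangentBundle J N)) x :=
    hf.contMDiffAt.smul_section hWx
  have j1 := leibniz_identity_mlieBracket_apply (hms (hU x)) (hms (hV x)) (hms hfW)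
  have j2 := leibniz_identity_mlieBracket_apply (hms (hU x)) (hms (hV x)) (hms hWx)
  rw [expand hU hV, expand hV hU, hsm _ hf hWx, j2] at j1
  have key : (mvfderiv J f x (mlieBracket J U V x) - (fieldDeriv J U (fieldDeriv J V f) x -
      fieldDeriv J V (fieldDeriv J U f) x)) • W x = 0 := by
    change (fieldDeriv J (mlieBracket J U V) f x - _) • W x = 0
    rw [smul_add] at j1
    have j3 := sub_eq_zero.2 j1.symm
    rw [← j3]
    module
  exact sub_eq_zero.1 ((smul_eq_zero.1 key).resolve_right hW0)

end CommutatorOfFields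

section LocalBases
set_option linter.unusedSectionVars false
variable {EM HM : Type*} [NormedAddCommGroup EM] [NormedSpace ℝ EM] [FiniteDimensional ℝ EM]
  [TopologicalSpace HM] {I : ModelWithCorners ℝ EM HM} {M : Type*} [TopologicalSpace M] [T2Space M]
  [ChartedSpace HM M] [IsManifold I ∞ M]
  {F : Type*} [NormedAddCommGroup F] [NormedSpace ℝ F] [FiniteDimensional ℝ F]
  {V : M → Type*} [TopologicalSpace (TotalSpace F V)] [∀ m, AddCommGroup (V m)]
  [∀ m, Module ℝ (V m)] [∀ m, TopologicalSpace (V m)] [FiberBundle F V] [VectorBundle ℝ F V]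
  [ContMDiffVectorBundle ∞ F V I]

theorem sec_sum_apply {ι : Type*} (t : Finset ι) (s : ι → Sec I F V) (m : M) :
    (∑ i ∈ t, s i) m = ∑ i ∈ t, s i m :=
  map_sum (AddMonoidHom.mk' (fun s : Sec I F V => s m) fun _ _ => rfl) s t

/-- The pullback of a function on the base to the total space. -/
def pull (g : Fun I M) : Fun (I.prod 𝓘(ℝ, F)) (TotalSpace F V) := g.comp (projMap I F V)

@[simp] theorem pull_apply (g : Fun I M) (x : TotalSpace F V) : pull g x = g x.proj := rfl

/-- The function `m ↦ f (s m)`. -/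
def pairing (f : Fun (I.prod 𝓘(ℝ, F)) (TotalSpace F V)) (s : Sec I F V) : Fun I M :=
  ⟨fun m => f ⟨m, s m⟩, f.contMDiff.comp s.contMDiff⟩

variable (I F V) in
/-- Smooth sections and fibrewise linear functions that are dual bases near `m₀`, multiplied by
cutoff functions. -/
structure LocalBasis (m₀ : M) where
  n : ℕ
  cutoff : Fun I M
  fn : Fin n → Fun (I.prod 𝓘(ℝ, F)) (TotalSpace F V)
  sec : Fin n → Sec I F V
  cutoff_eq : ∀ᶠ m in nhds m₀, cutoff m = 1
  linear : ∀ i, IsFiberLinear (fn i)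
  expand : ∀ m (v : V m), cutoff m • v = ∑ i, fn i ⟨m, v⟩ • sec i m

theorem contMDiff_mul_trivialization (e : Trivialization F (TotalSpace.proj : TotalSpace F V → M))
    [MemTrivializationAtlas e] {ψ : M → ℝ} (hψ : ContMDiff I 𝓘(ℝ) ∞ ψ)
    (h : tsupport ψ ⊆ e.baseSet) (c : F →L[ℝ] ℝ) :
    ContMDiff (I.prod 𝓘(ℝ, F)) 𝓘(ℝ) ∞ (fun x : TotalSpace F V => ψ x.proj * c (e x).2) := by
  intro x
  by_cases hx : x.proj ∈ e.baseSet
  · have h1 : ContMDiffAt (I.prod 𝓘(ℝ, F)) 𝓘(ℝ, F) ∞ (fun x : TotalSpace F V => (e x).2) x :=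
      contMDiffAt_snd.comp x (e.contMDiffOn.contMDiffAt (e.open_source.mem_nhds (e.mem_source.2 hx)))
    exact ((hψ.comp (contMDiff_proj V)).contMDiffAt).mul
      ((c.contDiff.contMDiff.contMDiffAt).comp x h1)
  · have h0 : x.proj ∉ tsupport ψ := fun h' => hx (h h')
    have h1 : ∀ᶠ y : TotalSpace F V in nhds x, ψ y.proj = 0 :=
      (FiberBundle.continuous_proj F V).continuousAt.eventually
        (notMem_tsupport_iff_eventuallyEq.1 h0)
    refine (contMDiffAt_const (c := (0 : ℝ))).congr_of_eventuallyEq ?_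
    filter_upwards [h1] with y hy
    rw [hy, zero_mul]

variable (I F V) in
theorem nonempty_localBasis (m₀ : M) : Nonempty (LocalBasis I F V m₀) := by
  let e := trivializationAt F V m₀
  have hm : m₀ ∈ e.baseSet := mem_baseSet_trivializationAt _ _ _
  let b := Module.finBasis ℝ F
  obtain ⟨ψ, -, hψ⟩ := (SmoothBumpFunction.nhds_basis_tsupport (I := I) m₀).mem_iff.1
    (e.open_baseSet.mem_nhds hm)
  let ψ' : Fun I M := ⟨ψ, ψ.contMDiff⟩
  exact ⟨{
    n := Module.finrank ℝ F
    cutoff := ψ' * ψ'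
    fn := fun i => ⟨_, contMDiff_mul_trivialization e ψ.contMDiff hψ
      (LinearMap.toContinuousLinearMap (b.coord i))⟩
    sec := fun i => ⟨⇑ψ • e.localFrame b i, ContMDiffOn.smul_section_of_tsupport
      ψ.contMDiff.contMDiffOn e.open_baseSet hψ (e.contMDiffOn_localFrame_baseSet ∞ b i)⟩
    cutoff_eq := by
      filter_upwards [ψ.eventuallyEq_one] with m hm
      change ψ m * ψ m = 1
      rw [hm, Pi.one_apply, mul_one]
    linear := fun i m => by
      change IsLinearMap ℝ fun u : V m => ψ m * b.coord i (e ⟨m, u⟩).2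
      by_cases hm : m ∈ e.baseSet
      · have h1 := e.linear ℝ hm
        exact ⟨fun u v => by rw [h1.map_add, map_add, mul_add],
          fun c u => by rw [h1.map_smul, map_smul, smul_eq_mul, smul_eq_mul]; ring⟩
      · have : ψ m = 0 := image_eq_zero_of_notMem_tsupport fun h => hm (hψ h)
        simp only [this, zero_mul]
        exact ⟨fun _ _ => (add_zero _).symm, fun _ _ => (smul_zero _).symm⟩
    expand := fun m v => by
      change (ψ m * ψ m) • v = ∑ i, (ψ m * b.coord i (e ⟨m, v⟩).2) • (ψ m • e.localFrame b i m)
      by_cases hm : m ∈ e.baseSet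
      · have h2 : v = ∑ i, b.coord i (e ⟨m, v⟩).2 • e.localFrame b i m := by
          have h3 := (e.basisAt b hm).sum_repr v
          conv_lhs => rw [← h3]
          refine Finset.sum_congr rfl fun i _ => ?_
          rw [e.localFrame_apply_of_mem_baseSet b hm]
          simp [Trivialization.basisAt]
        conv_lhs => rw [h2]
        rw [Finset.smul_sum]
        refine Finset.sum_congr rfl fun i _ => ?_
        rw [smul_smul, smul_smul]
        congr 1
        ring
      · have : ψ m = 0 := image_eq_zero_of_notMem_tsupport fun h => hm (hψ h)
        simp [this] }⟩

variable (I F V) in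
/-- A choice of local bases. -/
def localBasis (m₀ : M) : LocalBasis I F V m₀ := Classical.choice (nonempty_localBasis I F V m₀)

namespace LocalBasis
variable {m₀ : M} (B : LocalBasis I F V m₀)

theorem cutoff_self : B.cutoff m₀ = 1 := B.cutoff_eq.self_of_nhds

theorem expand_self (v : V m₀) : ∑ i, B.fn i ⟨m₀, v⟩ • B.sec i m₀ = v := by
  rw [← B.expand, B.cutoff_self, one_smul]

theorem mvfderiv_cutoff (w : TangentSpace I m₀) : mvfderiv I B.cutoff m₀ w = 0 := by
  have h : (⇑B.cutoff) =ᶠ[nhds m₀] fun _ => (1 : ℝ) := B.cutoff_eq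
  have h2 : mfderiv I 𝓘(ℝ) B.cutoff m₀ = 0 := by
    rw [h.mfderiv_eq]; exact mfderiv_const
  rw [mvfderiv]
  change mfderiv I 𝓘(ℝ) B.cutoff m₀ w = 0
  rw [h2]
  rfl

/-- The coordinates of a point of the total space. -/
def coords (x : TotalSpace F V) : M × (Fin B.n → ℝ) := (x.proj, fun i => B.fn i x)

/-- The point of the total space with given coordinates. -/
def synth (p : M × (Fin B.n → ℝ)) : TotalSpace F V := ⟨p.1, ∑ i, p.2 i • B.sec i p.1⟩

theorem contMDiff_coords :
    ContMDiff (I.prod 𝓘(ℝ, F)) (I.prod 𝓘(ℝ, Fin B.n → ℝ)) ∞ B.coords :=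
  (contMDiff_proj V).prodMk (contMDiff_pi_space.2 fun i => (B.fn i).contMDiff)

theorem contMDiff_synth :
    ContMDiff (I.prod 𝓘(ℝ, Fin B.n → ℝ)) (I.prod 𝓘(ℝ, F)) ∞ B.synth := by
  intro p
  rw [contMDiffAt_totalSpace]
  refine ⟨contMDiffAt_fst, ?_⟩
  let e := trivializationAt F V p.1
  have hm : p.1 ∈ e.baseSet := mem_baseSet_trivializationAt _ _ _
  have h1 : ∀ᶠ q : M × (Fin B.n → ℝ) in nhds p,
      (e (B.synth q)).2 = ∑ i, q.2 i • (e ⟨q.1, B.sec i q.1⟩).2 := by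
    filter_upwards [continuousAt_fst.eventually (e.open_baseSet.mem_nhds hm)] with q hq
    have h2 := e.linear ℝ hq
    let l : V q.1 →ₗ[ℝ] F := h2.mk' _
    change l (∑ i, q.2 i • B.sec i q.1) = ∑ i, q.2 i • l (B.sec i q.1)
    rw [map_sum]
    exact Finset.sum_congr rfl fun i _ => map_smul l _ _
  refine ContMDiffAt.congr_of_eventuallyEq ?_ h1
  refine contMDiffAt_finsetSum fun i _ => ?_
  have a1 : ContMDiffAt (I.prod 𝓘(ℝ, Fin B.n → ℝ)) 𝓘(ℝ) ∞
      (fun q : M × (Fin B.n → ℝ) => q.2 i) p := contMDiffAt_pi_space.1 contMDiffAt_snd i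
  have a2 := (e.contMDiffAt_section_iff (n := ∞) (IB := I) hm).1 (B.sec i).contMDiff.contMDiffAt
  have a3 : ContMDiffAt (I.prod 𝓘(ℝ, Fin B.n → ℝ)) 𝓘(ℝ, F) ∞
      (fun q : M × (Fin B.n → ℝ) => (e ⟨q.1, B.sec i q.1⟩).2) p :=
    ContMDiffAt.comp (I' := I) (g := fun x => (e ⟨x, B.sec i x⟩).2) (f := Prod.fst) p a2
      contMDiffAt_fst
  exact a1.smul a3

theorem synth_coords {x : TotalSpace F V} (h : B.cutoff x.proj = 1) : B.synth (B.coords x) = x := by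
  have := B.expand x.proj x.snd
  rw [h, one_smul] at this
  exact congrArg (TotalSpace.mk x.proj) this.symm

end LocalBasis

/-- The value of a tensorial map at a section depends only on the value of the section. -/
theorem eq_of_tensorial {Y : Type*} [AddCommGroup Y] [Module ℝ Y] {m : M} (T : Sec I F V → Y)
    (hadd : ∀ s t, T (s + t) = T s + T t) (hsmul : ∀ (f : Fun I M) s, T (f • s) = f m • T s)
    {s t : Sec I F V} (h : s m = t m) : T s = T t := by
  let T' := AddMonoidHom.mk' T hadd
  let B := localBasis I F V m
  have key : ∀ s : Sec I F V, T s = ∑ i, B.fn i ⟨m, s m⟩ • T (B.sec i) := by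
    intro s
    have h1 : B.cutoff • s = ∑ i, pairing (B.fn i) s • B.sec i := by
      ext x
      rw [sec_sum_apply]
      exact B.expand x (s x)
    have h2 := hsmul B.cutoff s
    rw [h1, B.cutoff_self, one_smul] at h2
    rw [← h2]
    change T' _ = _
    rw [map_sum]
    exact Finset.sum_congr rfl fun i _ => hsmul _ _
  rw [key, key, h]

/-- A section through a given vector. -/
def extend {m : M} (v : V m) : Sec I F V :=
  ∑ i, (localBasis I F V m).fn i ⟨m, v⟩ • (localBasis I F V m).sec i

@[simp] theorem extend_apply {m : M} (v : V m) : (extend v : Sec I F V) m = v := by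
  rw [extend, sec_sum_apply]
  exact (localBasis I F V m).expand_self v

section Smooth
variable {EN HN : Type*} [NormedAddCommGroup EN] [NormedSpace ℝ EN] [TopologicalSpace HN]
  {K : ModelWithCorners ℝ EN HN} {N : Type*} [TopologicalSpace N] [ChartedSpace HN N]

/-- A map into the total space is smooth if its composites with the projection and with all
fibrewise linear functions are smooth. -/
theorem contMDiff_of_fiberLinear {c : N → TotalSpace F V}
    (hb : ContMDiff K I ∞ fun x => (c x).proj)
    (hf : ∀ f : Fun (I.prod 𝓘(ℝ, F)) (TotalSpace F V), IsFiberLinear f →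
      ContMDiff K 𝓘(ℝ) ∞ fun x => f (c x)) : ContMDiff K (I.prod 𝓘(ℝ, F)) ∞ c := by
  intro x
  let B := localBasis I F V (c x).proj
  have h1 : ContMDiff K (I.prod 𝓘(ℝ, Fin B.n → ℝ)) ∞ (fun y => B.coords (c y)) :=
    hb.prodMk (contMDiff_pi_space.2 fun i => hf _ (B.linear i))
  refine (B.contMDiff_synth.comp h1).contMDiffAt.congr_of_eventuallyEq ?_
  filter_upwards [(hb x).continuousAt.eventually B.cutoff_eq] with y hy
  exact (B.synth_coords hy).symm

/-- The projection of a tangent vector of the total space to the base. -/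
def tproj {x : TotalSpace F V} (v : TangentSpace (I.prod 𝓘(ℝ, F)) x) : TangentSpace I x.proj :=
  mfderiv (I.prod 𝓘(ℝ, F)) I TotalSpace.proj x v

theorem mdiffAt_proj (x : TotalSpace F V) :
    MDifferentiableAt (I.prod 𝓘(ℝ, F)) I (TotalSpace.proj : TotalSpace F V → M) x :=
  ((contMDiff_proj V (n := ∞)) x).mdifferentiableAt (by simp)

namespace LocalBasis
variable {m₀ : M} (B : LocalBasis I F V m₀)

theorem mfderiv_coords (x : TotalSpace F V) (v : TangentSpace (I.prod 𝓘(ℝ, F)) x) :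
    mfderiv (I.prod 𝓘(ℝ, F)) (I.prod 𝓘(ℝ, Fin B.n → ℝ)) B.coords x v =
      (tproj v, fun i => mvfderiv (I.prod 𝓘(ℝ, F)) (B.fn i) x v) := by
  have hp : ContMDiff (I.prod 𝓘(ℝ, F)) 𝓘(ℝ, Fin B.n → ℝ) ∞ (fun x i => B.fn i x) :=
    contMDiff_pi_space.2 fun i => (B.fn i).contMDiff
  have hpx := (hp x).mdifferentiableAt (by simp)
  have h := mfderiv_prodMk (mdiffAt_proj (I := I) x) hpx
  have h' : mfderiv (I.prod 𝓘(ℝ, F)) (I.prod 𝓘(ℝ, Fin B.n → ℝ)) B.coords x = _ := h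
  rw [h']
  refine Prod.ext rfl (funext fun i => ?_)
  have h2 := mfderiv_comp_apply (I' := 𝓘(ℝ, Fin B.n → ℝ)) (I'' := 𝓘(ℝ)) x
    (g := ContinuousLinearMap.proj (R := ℝ) (φ := fun _ : Fin B.n => ℝ) i)
    (ContinuousLinearMap.mdifferentiableAt _) hpx v
  rw [ContinuousLinearMap.mfderiv_eq] at h2
  exact h2.symm

end LocalBasis

theorem tangent_ext {x : TotalSpace F V} {v w : TangentSpace (I.prod 𝓘(ℝ, F)) x}
    (hq : tproj v = tproj w) (hf : ∀ f : Fun (I.prod 𝓘(ℝ, F)) (TotalSpace F V), IsFiberLinear f →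
      mvfderiv (I.prod 𝓘(ℝ, F)) f x v = mvfderiv (I.prod 𝓘(ℝ, F)) f x w) : v = w := by
  let B := localBasis I F V x.proj
  have h1 : B.synth ∘ B.coords =ᶠ[nhds x] id := by
    filter_upwards [(FiberBundle.continuous_proj F V).continuousAt.eventually B.cutoff_eq] with y hy
    exact B.synth_coords hy
  have key : ∀ u : TangentSpace (I.prod 𝓘(ℝ, F)) x, u =
      mfderiv (I.prod 𝓘(ℝ, Fin B.n → ℝ)) (I.prod 𝓘(ℝ, F)) B.synth (B.coords x)
        (mfderiv (I.prod 𝓘(ℝ, F)) (I.prod 𝓘(ℝ, Fin B.n → ℝ)) B.coords x u) := by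
    intro u
    have h2 := mfderiv_comp_apply (I' := I.prod 𝓘(ℝ, Fin B.n → ℝ)) (I'' := I.prod 𝓘(ℝ, F)) x
      ((B.contMDiff_synth (B.coords x)).mdifferentiableAt (by simp))
      ((B.contMDiff_coords x).mdifferentiableAt (by simp)) u
    refine Eq.trans ?_ h2
    rw [h1.mfderiv_eq, mfderiv_id]
    rfl
  rw [key v, key w, B.mfderiv_coords, B.mfderiv_coords, hq]
  congr 2
  funext i
  exact hf _ (B.linear i)

end Smooth

end LocalBases

section DirectionalDerivative
variable {EN HN : Type*} [NormedAddCommGroup EN] [NormedSpace ℝ EN] [TopologicalSpace HN]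
  {K : ModelWithCorners ℝ EN HN} {N : Type*} [TopologicalSpace N] [ChartedSpace HN N]

/-- The derivative of a smooth function in the direction of a tangent vector. -/
def dd {x : N} (v : TangentSpace K x) (f : Fun K N) : ℝ := mvfderiv K f x v

theorem Fun.mdiffAt (f : Fun K N) (x : N) : MDifferentiableAt K 𝓘(ℝ) f x :=
  f.contMDiff.mdifferentiableAt (by simp)

theorem dd_add {x : N} (v : TangentSpace K x) (f g : Fun K N) : dd v (f + g) = dd v f + dd v g := by
  change mvfderiv K (⇑f + ⇑g) x v = _
  rw [mvfderiv_add (f.mdiffAt x) (g.mdiffAt x)]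
  rfl

theorem dd_mul {x : N} (v : TangentSpace K x) (f g : Fun K N) :
    dd v (f * g) = f x * dd v g + dd v f * g x := by
  change mvfderiv K (⇑f * ⇑g) x v = _
  rw [mvfderiv_mul (f.mdiffAt x) (g.mdiffAt x), mul_comm (dd v f)]
  rfl

theorem dd_zero {x : N} (v : TangentSpace K x) : dd v (0 : Fun K N) = 0 := by
  simpa using dd_add v 0 0

theorem dd_sum {x : N} (v : TangentSpace K x) {ι : Type*} (s : Finset ι) (f : ι → Fun K N) :
    dd v (∑ i ∈ s, f i) = ∑ i ∈ s, dd v (f i) :=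
  map_sum (AddMonoidHom.mk' (dd v) (dd_add v)) f s

theorem dd_add_left {x : N} (v w : TangentSpace K x) (f : Fun K N) :
    dd (v + w) f = dd v f + dd w f := map_add (mvfderiv K f x) v w

theorem dd_smul_left {x : N} (c : ℝ) (v : TangentSpace K x) (f : Fun K N) :
    dd (c • v) f = c * dd v f := map_smul (mvfderiv K f x) c v

theorem dd_congr {x : N} (v : TangentSpace K x) {f g : Fun K N} (h : ⇑f =ᶠ[nhds x] ⇑g) :
    dd v f = dd v g := by
  have h2 : mfderiv K 𝓘(ℝ) f x = mfderiv K 𝓘(ℝ) g x := h.mfderiv_eq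
  exact congrArg (fun l : EN →L[ℝ] ℝ => l v) h2

theorem dd_comp {EN' HN' : Type*} [NormedAddCommGroup EN'] [NormedSpace ℝ EN'] [TopologicalSpace HN']
    {K' : ModelWithCorners ℝ EN' HN'} {N' : Type*} [TopologicalSpace N'] [ChartedSpace HN' N']
    {x : N} (v : TangentSpace K x) (f : Fun K' N') {g : N → N'} (hg : MDifferentiableAt K K' g x)
    (fg : Fun K N) (hfg : ∀ y, fg y = f (g y)) :
    dd v fg = dd (mfderiv K K' g x v) f := by
  have h : (⇑fg : N → ℝ) = ⇑f ∘ g := funext hfg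
  change mfderiv K 𝓘(ℝ) fg x v = mfderiv K' 𝓘(ℝ) f (g x) (mfderiv K K' g x v)
  rw [h]
  exact mfderiv_comp_apply x (f.mdiffAt _) hg v

theorem tangentMap_congr (K : ModelWithCorners ℝ EN HN) {EN' HN' : Type*} [NormedAddCommGroup EN']
    [NormedSpace ℝ EN'] [TopologicalSpace HN'] (K' : ModelWithCorners ℝ EN' HN') {N' : Type*}
    [TopologicalSpace N'] [ChartedSpace HN' N'] {f g : N → N'} (p : TangentBundle K N)
    (h : f =ᶠ[nhds p.proj] g) : tangentMap K K' f p = tangentMap K K' g p :=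
  TotalSpace.ext h.self_of_nhds
    (heq_of_eq (congrArg (fun l : EN →L[ℝ] EN' => l p.2) h.mfderiv_eq))

end DirectionalDerivative

section LocalBases
set_option linter.unusedSectionVars false
variable {EM HM : Type*} [NormedAddCommGroup EM] [NormedSpace ℝ EM] [FiniteDimensional ℝ EM]
  [TopologicalSpace HM] {I : ModelWithCorners ℝ EM HM} {M : Type*} [TopologicalSpace M] [T2Space M]
  [ChartedSpace HM M] [IsManifold I ∞ M]
  {F : Type*} [NormedAddCommGroup F] [NormedSpace ℝ F] [FiniteDimensional ℝ F]
  {V : M → Type*} [TopologicalSpace (TotalSpace F V)] [∀ m, AddCommGroup (V m)]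
  [∀ m, Module ℝ (V m)] [∀ m, TopologicalSpace (V m)] [FiberBundle F V] [VectorBundle ℝ F V]
  [ContMDiffVectorBundle ∞ F V I]


theorem dd_pull {x : TotalSpace F V} (v : TangentSpace (I.prod 𝓘(ℝ, F)) x) (g : Fun I M) :
    dd v (pull g) = dd (tproj v) g :=
  dd_comp v g (mdiffAt_proj x) _ fun _ => rfl

namespace LocalBasis
variable {m₀ : M} (B : LocalBasis I F V m₀)

theorem dd_cutoff (w : TangentSpace I m₀) : dd w B.cutoff = 0 := B.mvfderiv_cutoff w

theorem tproj_synth (p : M × (Fin B.n → ℝ)) (w : TangentSpace I p.1) (r : Fin B.n → ℝ) :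
    tproj (mfderiv (I.prod 𝓘(ℝ, Fin B.n → ℝ)) (I.prod 𝓘(ℝ, F)) B.synth p (w, r)) = w := by
  have h := mfderiv_comp_apply (I' := I.prod 𝓘(ℝ, F)) (I'' := I) p (mdiffAt_proj (B.synth p))
    ((B.contMDiff_synth p).mdifferentiableAt (by simp))
    ((w, r) : TangentSpace (I.prod 𝓘(ℝ, Fin B.n → ℝ)) p)
  refine Eq.trans h.symm ?_
  change mfderiv (I.prod 𝓘(ℝ, Fin B.n → ℝ)) I Prod.fst p (w, r) = w
  rw [mfderiv_fst]
  rfl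

theorem dd_synth (p : M × (Fin B.n → ℝ)) (w : TangentSpace I p.1) (r : Fin B.n → ℝ)
    {f : Fun (I.prod 𝓘(ℝ, F)) (TotalSpace F V)} (hf : IsFiberLinear f) :
    dd (mfderiv (I.prod 𝓘(ℝ, Fin B.n → ℝ)) (I.prod 𝓘(ℝ, F)) B.synth p (w, r)) f =
      ∑ i, (p.2 i * dd w (pairing f (B.sec i)) + r i * f ⟨p.1, B.sec i p.1⟩) := by
  let v : TangentSpace (I.prod 𝓘(ℝ, Fin B.n → ℝ)) p := (w, r)
  let y : Fin B.n → Fun (I.prod 𝓘(ℝ, Fin B.n → ℝ)) (M × (Fin B.n → ℝ)) := fun i =>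
    ⟨fun q => q.2 i, contMDiff_pi_space.1 contMDiff_snd i⟩
  let g : Fin B.n → Fun (I.prod 𝓘(ℝ, Fin B.n → ℝ)) (M × (Fin B.n → ℝ)) := fun i =>
    ⟨fun q => pairing f (B.sec i) q.1, (pairing f (B.sec i)).contMDiff.comp contMDiff_fst⟩
  have hy : ∀ i, dd v (y i) = r i := fun i => by
    have h2 := mfderiv_comp_apply (I := I.prod 𝓘(ℝ, Fin B.n → ℝ)) (I' := 𝓘(ℝ, Fin B.n → ℝ))
      (I'' := 𝓘(ℝ)) p (g := ContinuousLinearMap.proj (R := ℝ) (φ := fun _ : Fin B.n => ℝ) i)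
      (f := Prod.snd) (ContinuousLinearMap.mdifferentiableAt _) mdifferentiableAt_snd v
    rw [ContinuousLinearMap.mfderiv_eq, mfderiv_snd] at h2
    exact h2
  have hg : ∀ i, dd v (g i) = dd w (pairing f (B.sec i)) := fun i => by
    rw [dd_comp v (pairing f (B.sec i)) (g := Prod.fst) mdifferentiableAt_fst _ fun _ => rfl,
      mfderiv_fst]
    rfl
  have h := dd_comp v f ((B.contMDiff_synth p).mdifferentiableAt (by simp)) (∑ i, y i * g i)
    fun q => by
      have e1 : (∑ i, y i * g i) q = ∑ i, q.2 i * f ⟨q.1, B.sec i q.1⟩ :=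
        map_sum (AddMonoidHom.mk' (fun h : Fun (I.prod 𝓘(ℝ, Fin B.n → ℝ)) _ => h q)
          fun _ _ => rfl) (fun i => y i * g i) Finset.univ
      have e2 := map_sum ((hf q.1).mk' _) (fun i => q.2 i • B.sec i q.1) Finset.univ
      rw [e1]
      refine Eq.trans ?_ e2.symm
      refine Finset.sum_congr rfl fun i _ => ?_
      rw [map_smul]
      rfl
  rw [← h, dd_sum]
  refine Finset.sum_congr rfl fun i _ => ?_
  rw [dd_mul, hy, hg]
  rfl

end LocalBasis

/-- A tangent vector of the total space is given by its projection and its compatible action on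
fibrewise linear functions. -/
theorem exists_tangent (x : TotalSpace F V) (w : TangentSpace I x.proj)
    (R : Fun (I.prod 𝓘(ℝ, F)) (TotalSpace F V) → ℝ)
    (hadd : ∀ f g, IsFiberLinear f → IsFiberLinear g → R (f + g) = R f + R g)
    (hmul : ∀ (g : Fun I M) f, IsFiberLinear f → R (pull g * f) = g x.proj * R f + dd w g * f x) :
    ∃ v : TangentSpace (I.prod 𝓘(ℝ, F)) x, tproj v = w ∧ ∀ f, IsFiberLinear f → dd v f = R f := by
  let B := localBasis I F V x.proj
  have hx : B.synth (B.coords x) = x := B.synth_coords B.cutoff_self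
  have key : ∃ v : TangentSpace (I.prod 𝓘(ℝ, F)) (B.synth (B.coords x)), tproj v = w ∧
      ∀ f, IsFiberLinear f → dd v f = R f := by
    refine ⟨_, B.tproj_synth (B.coords x) w fun i => R (B.fn i), fun f hf => ?_⟩
    have hl : ∀ {ι : Type} (s : Finset ι) (g : ι → Fun I M)
        (k : ι → Fun (I.prod 𝓘(ℝ, F)) (TotalSpace F V)), (∀ i, IsFiberLinear (k i)) →
        IsFiberLinear (∑ i ∈ s, pull (g i) * k i) ∧
        R (∑ i ∈ s, pull (g i) * k i) =
          ∑ i ∈ s, (g i x.proj * R (k i) + dd w (g i) * k i x) := by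
      intro ι s g k hk
      have h1 : ∀ i, IsFiberLinear (pull (g i) * k i) := fun i m =>
        ⟨fun u v => by
          change g i m * k i ⟨m, u + v⟩ = g i m * k i ⟨m, u⟩ + g i m * k i ⟨m, v⟩
          rw [(hk i m).map_add, mul_add], fun c u => by
          change g i m * k i ⟨m, c • u⟩ = c * (g i m * k i ⟨m, u⟩)
          rw [(hk i m).map_smul, smul_eq_mul]; ring⟩
      induction s using Finset.cons_induction with
      | empty =>
        have h0 : IsFiberLinear (0 : Fun (I.prod 𝓘(ℝ, F)) (TotalSpace F V)) := fun m =>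
          ⟨fun _ _ => (add_zero _).symm, fun _ _ => (smul_zero _).symm⟩
        refine ⟨h0, ?_⟩
        have := hadd 0 0 h0 h0
        simpa using this
      | cons a s ha ih =>
        rw [Finset.sum_cons, Finset.sum_cons, hadd _ _ (h1 a) ih.1, ih.2, hmul _ _ (hk a)]
        refine ⟨fun m => ⟨fun u v => ?_, fun c u => ?_⟩, rfl⟩
        · exact (congrArg₂ (· + ·) ((h1 a m).map_add u v) ((ih.1 m).map_add u v)).trans
            (add_add_add_comm _ _ _ _)
        · exact (congrArg₂ (· + ·) ((h1 a m).map_smul c u) ((ih.1 m).map_smul c u)).trans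
            (smul_add _ _ _).symm
    have e : pull B.cutoff * f = ∑ i, pull (pairing f (B.sec i)) * B.fn i := by
      ext y
      have e1 : (∑ i, pull (pairing f (B.sec i)) * B.fn i : Fun (I.prod 𝓘(ℝ, F)) (TotalSpace F V)) y =
          ∑ i, f ⟨y.proj, B.sec i y.proj⟩ * B.fn i y :=
        map_sum (AddMonoidHom.mk' (fun h : Fun (I.prod 𝓘(ℝ, F)) (TotalSpace F V) => h y)
          fun _ _ => rfl) (fun i => pull (pairing f (B.sec i)) * B.fn i) Finset.univ
      rw [e1]
      change B.cutoff y.proj * f ⟨y.proj, y.snd⟩ = _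
      have e2 := (hf y.proj).map_smul (B.cutoff y.proj) y.snd
      rw [B.expand] at e2
      refine e2.symm.trans ((map_sum ((hf y.proj).mk' _) _ _).trans ?_)
      refine Finset.sum_congr rfl fun i _ => ?_
      rw [map_smul, mul_comm]
      rfl
    have h2 := (hl Finset.univ (fun i => pairing f (B.sec i)) B.fn B.linear).2
    rw [← e, hmul _ _ hf, B.cutoff_self, B.dd_cutoff, one_mul, zero_mul, add_zero] at h2
    rw [h2]
    refine (B.dd_synth (B.coords x) w _ hf).trans ?_
    refine Finset.sum_congr rfl fun i _ => ?_
    exact (congrArg₂ (· + ·) (mul_comm _ _) (mul_comm _ _)).trans (add_comm _ _)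
  generalize B.synth (B.coords x) = y at key hx
  subst hx
  exact key

end LocalBases

section
variable {EM HM : Type*} [NormedAddCommGroup EM] [NormedSpace ℝ EM] [CompleteSpace EM]
  [TopologicalSpace HM]
  {I : ModelWithCorners ℝ EM HM} {M : Type*} [TopologicalSpace M] [ChartedSpace HM M]
  [IsManifold I ∞ M]
  {F : Type*} [NormedAddCommGroup F] [NormedSpace ℝ F]
  {V : M → Type*} [TopologicalSpace (TotalSpace F V)] [∀ m, AddCommGroup (V m)]
  [∀ m, Module ℝ (V m)] [∀ m, TopologicalSpace (V m)] [FiberBundle F V] [VectorBundle ℝ F V]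

theorem LieAlgebroid.deriv_bracket (L : LieAlgebroid I F V) (X Y : Sec I F V) (f : Fun I M) :
    L.deriv (L.bracket X Y) f = L.deriv X (L.deriv Y f) - L.deriv Y (L.deriv X f) := by
  ext m
  change mvfderiv I f m (L.anchor m (L.bracket X Y m)) = _
  rw [L.anchor_bracket]
  exact mvfderiv_mlieBracket (L.anchor_smooth.comp X.contMDiff) (L.anchor_smooth.comp Y.contMDiff)
    f.contMDiff m

theorem LieAlgebroid.curvature_trivialConnection (L : LieAlgebroid I F V) (X Y : Sec I F V)
    (f : Fun I M) : L.trivialConnection.curvature X Y f = 0 := by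
  change L.deriv X (L.deriv Y f) - L.deriv Y (L.deriv X f) - L.deriv (L.bracket X Y) f = 0
  rw [L.deriv_bracket, sub_self]

end

section LocalBases
set_option linter.unusedSectionVars false
variable {EM HM : Type*} [NormedAddCommGroup EM] [NormedSpace ℝ EM] [FiniteDimensional ℝ EM]
  [TopologicalSpace HM] {I : ModelWithCorners ℝ EM HM} {M : Type*} [TopologicalSpace M] [T2Space M]
  [ChartedSpace HM M] [IsManifold I ∞ M]
  {F : Type*} [NormedAddCommGroup F] [NormedSpace ℝ F] [FiniteDimensional ℝ F]
  {V : M → Type*} [TopologicalSpace (TotalSpace F V)] [∀ m, AddCommGroup (V m)]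
  [∀ m, Module ℝ (V m)] [∀ m, TopologicalSpace (V m)] [FiberBundle F V] [VectorBundle ℝ F V]
  [ContMDiffVectorBundle ∞ F V I]


section
variable {EN HN : Type*} [NormedAddCommGroup EN] [NormedSpace ℝ EN] [TopologicalSpace HN]
  {K : ModelWithCorners ℝ EN HN} {N : Type*} [TopologicalSpace N] [ChartedSpace HN N]

theorem contMDiff_prodBundle_iff {F' : Type*} [NormedAddCommGroup F'] [NormedSpace ℝ F']
    {V' : M → Type*} [TopologicalSpace (TotalSpace F' V')] [∀ m, AddCommGroup (V' m)]
    [∀ m, Module ℝ (V' m)] [∀ m, TopologicalSpace (V' m)] [FiberBundle F' V'] [VectorBundle ℝ F' V']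
    [ContMDiffVectorBundle ∞ F' V' I] {f : N → TotalSpace (F × F') (V ×ᵇ V')} :
    ContMDiff K (I.prod 𝓘(ℝ, F × F')) ∞ f ↔
      ContMDiff K (I.prod 𝓘(ℝ, F)) ∞ (fun x => (⟨(f x).proj, (f x).snd.1⟩ : TotalSpace F V)) ∧
      ContMDiff K (I.prod 𝓘(ℝ, F')) ∞ (fun x => (⟨(f x).proj, (f x).snd.2⟩ : TotalSpace F' V')) := by
  have key : ∀ x₀ x, (trivializationAt (F × F') (V ×ᵇ V') (f x₀).proj (f x)).2 =
      ((trivializationAt F V (f x₀).proj ⟨(f x).proj, (f x).snd.1⟩).2,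
       (trivializationAt F' V' (f x₀).proj ⟨(f x).proj, (f x).snd.2⟩).2) := fun _ _ => rfl
  constructor
  · intro hf
    have h1 : ContMDiff K I ∞ (fun x => (f x).proj) := (contMDiff_proj (V ×ᵇ V')).comp hf
    refine ⟨fun x₀ => contMDiffAt_totalSpace.2 ⟨h1 x₀, ?_⟩,
      fun x₀ => contMDiffAt_totalSpace.2 ⟨h1 x₀, ?_⟩⟩
    · have := (contMDiffAt_totalSpace.1 (hf x₀)).2
      simp only [key] at this
      exact ((contDiff_fst (𝕜 := ℝ) (E := F) (F := F') (n := ∞)).contMDiff.contMDiffAt).comp x₀ this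
    · have := (contMDiffAt_totalSpace.1 (hf x₀)).2
      simp only [key] at this
      exact ((contDiff_snd (𝕜 := ℝ) (E := F) (F := F') (n := ∞)).contMDiff.contMDiffAt).comp x₀ this
  · rintro ⟨h1, h2⟩ x₀
    refine contMDiffAt_totalSpace.2 ⟨((contMDiff_proj V).comp h1) x₀, ?_⟩
    simp only [key]
    exact (contMDiffAt_totalSpace.1 (h1 x₀)).2.prodMk_space
      (contMDiffAt_totalSpace.1 (h2 x₀)).2

end

theorem contMDiff_fstBundle : ContMDiff (I.prod 𝓘(ℝ, F × F)) (I.prod 𝓘(ℝ, F)) ∞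
    (fun p : TotalSpace (F × F) (V ×ᵇ V) => (⟨p.proj, p.snd.1⟩ : TotalSpace F V)) :=
  (contMDiff_prodBundle_iff.1 contMDiff_id).1

theorem contMDiff_sndBundle : ContMDiff (I.prod 𝓘(ℝ, F × F)) (I.prod 𝓘(ℝ, F)) ∞
    (fun p : TotalSpace (F × F) (V ×ᵇ V) => (⟨p.proj, p.snd.2⟩ : TotalSpace F V)) :=
  (contMDiff_prodBundle_iff.1 contMDiff_id).2

theorem contMDiff_addBundle : ContMDiff (I.prod 𝓘(ℝ, F × F)) (I.prod 𝓘(ℝ, F)) ∞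
    (fun p : TotalSpace (F × F) (V ×ᵇ V) => (⟨p.proj, p.snd.1 + p.snd.2⟩ : TotalSpace F V)) := by
  refine contMDiff_of_fiberLinear (contMDiff_proj (V ×ᵇ V)) fun f hf => ?_
  have h : (fun p : TotalSpace (F × F) (V ×ᵇ V) => f ⟨p.proj, p.snd.1 + p.snd.2⟩) =
      fun p => f ⟨p.proj, p.snd.1⟩ + f ⟨p.proj, p.snd.2⟩ := funext fun p => (hf p.proj).map_add _ _
  rw [h]
  exact (f.contMDiff.comp contMDiff_fstBundle).add (f.contMDiff.comp contMDiff_sndBundle)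

theorem contMDiff_scale (c : ℝ) : ContMDiff (I.prod 𝓘(ℝ, F)) (I.prod 𝓘(ℝ, F)) ∞
    (scale c : TotalSpace F V → TotalSpace F V) := by
  refine contMDiff_of_fiberLinear (contMDiff_proj V) fun f hf => ?_
  have h : (fun x : TotalSpace F V => f (scale c x)) = fun x => c * f x :=
    funext fun x => (hf x.proj).map_smul c x.snd
  rw [h]
  exact contMDiff_const.mul f.contMDiff

/-- The composite of a function with a smooth map. -/
def Fun.compSmooth {EN HN EN' HN' : Type*} [NormedAddCommGroup EN] [NormedSpace ℝ EN]
    [TopologicalSpace HN] [NormedAddCommGroup EN'] [NormedSpace ℝ EN'] [TopologicalSpace HN']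
    {K : ModelWithCorners ℝ EN HN} {N : Type*} [TopologicalSpace N] [ChartedSpace HN N]
    {K' : ModelWithCorners ℝ EN' HN'} {N' : Type*} [TopologicalSpace N'] [ChartedSpace HN' N']
    (f : Fun K' N') {g : N → N'} (hg : ContMDiff K K' ∞ g) : Fun K N :=
  ⟨fun x => f (g x), f.contMDiff.comp hg⟩

theorem dd_compSmooth {EN HN EN' HN' : Type*} [NormedAddCommGroup EN] [NormedSpace ℝ EN]
    [TopologicalSpace HN] [NormedAddCommGroup EN'] [NormedSpace ℝ EN'] [TopologicalSpace HN']
    {K : ModelWithCorners ℝ EN HN} {N : Type*} [TopologicalSpace N] [ChartedSpace HN N]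
    {K' : ModelWithCorners ℝ EN' HN'} {N' : Type*} [TopologicalSpace N'] [ChartedSpace HN' N']
    (f : Fun K' N') {g : N → N'} (hg : ContMDiff K K' ∞ g) {x : N} (v : TangentSpace K x) :
    dd (mfderiv K K' g x v) f = dd v (f.compSmooth hg) :=
  (dd_comp v f (hg.contMDiffAt.mdifferentiableAt (by simp)) _ fun _ => rfl).symm

theorem tproj_mfderiv {F' : Type*} [NormedAddCommGroup F'] [NormedSpace ℝ F']
    {V' : M → Type*} [TopologicalSpace (TotalSpace F' V')] [∀ m, AddCommGroup (V' m)]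
    [∀ m, Module ℝ (V' m)] [∀ m, TopologicalSpace (V' m)] [FiberBundle F' V'] [VectorBundle ℝ F' V']
    [ContMDiffVectorBundle ∞ F' V' I] {g : ∀ m, V' m → V m}
    (hg : ContMDiff (I.prod 𝓘(ℝ, F')) (I.prod 𝓘(ℝ, F)) ∞
      (fun x : TotalSpace F' V' => (⟨x.proj, g x.proj x.snd⟩ : TotalSpace F V)))
    {x : TotalSpace F' V'} (v : TangentSpace (I.prod 𝓘(ℝ, F')) x) :
    tproj (mfderiv (I.prod 𝓘(ℝ, F')) (I.prod 𝓘(ℝ, F))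
      (fun x : TotalSpace F' V' => (⟨x.proj, g x.proj x.snd⟩ : TotalSpace F V)) x v) = tproj v :=
  (mfderiv_comp_apply (I' := I.prod 𝓘(ℝ, F)) (I'' := I) x (mdiffAt_proj _)
    (hg.contMDiffAt.mdifferentiableAt (by simp)) v).symm

theorem dd_scale {f : Fun (I.prod 𝓘(ℝ, F)) (TotalSpace F V)} (hf : IsFiberLinear f) (c : ℝ)
    {x : TotalSpace F V} (v : TangentSpace (I.prod 𝓘(ℝ, F)) x) :
    dd (mfderiv (I.prod 𝓘(ℝ, F)) (I.prod 𝓘(ℝ, F)) (scale c) x v) f = c * dd v f := by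
  rw [dd_compSmooth f (contMDiff_scale c)]
  have : f.compSmooth (contMDiff_scale (I := I) (V := V) c) = ContMDiffMap.const c * f := by
    ext x
    exact (hf x.proj).map_smul c x.snd
  rw [this, dd_mul]
  have h0 : dd v (ContMDiffMap.const c : Fun (I.prod 𝓘(ℝ, F)) (TotalSpace F V)) = 0 := by
    change mfderiv (I.prod 𝓘(ℝ, F)) 𝓘(ℝ) (fun _ : TotalSpace F V => c) x v = 0
    rw [mfderiv_const]
    rfl
  rw [h0, zero_mul, add_zero]
  rfl

theorem tangentMap_scale_eq {m : M} {e : V m} (c : ℝ)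
    (v : TangentSpace (I.prod 𝓘(ℝ, F)) (⟨m, e⟩ : TotalSpace F V))
    (v' : TangentSpace (I.prod 𝓘(ℝ, F)) (⟨m, c • e⟩ : TotalSpace F V)) (hq : tproj v' = tproj v)
    (h : ∀ f : Fun (I.prod 𝓘(ℝ, F)) (TotalSpace F V), IsFiberLinear f → dd v' f = c * dd v f) :
    (⟨_, v'⟩ : TangentBundle (I.prod 𝓘(ℝ, F)) (TotalSpace F V)) =
      tangentMap (I.prod 𝓘(ℝ, F)) (I.prod 𝓘(ℝ, F)) (scale c) ⟨_, v⟩ :=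
  congrArg (TotalSpace.mk (⟨m, c • e⟩ : TotalSpace F V)) (tangent_ext
    (hq.trans (tproj_mfderiv (g := fun _ u => c • u) (contMDiff_scale (I := I) (V := V) c) v).symm)
    fun f hf => (h f hf).trans (dd_scale hf c v).symm)

theorem TangentSum.dd_eq {u v w : TangentBundle (I.prod 𝓘(ℝ, F)) (TotalSpace F V)}
    (h : TangentSum I F V u v w) :
    IsSum u.proj v.proj w.proj ∧
    ∀ f : Fun (I.prod 𝓘(ℝ, F)) (TotalSpace F V), IsFiberLinear f →
      dd w.2 f = dd u.2 f + dd v.2 f := by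
  obtain ⟨⟨p, z⟩, rfl, rfl, rfl⟩ := h
  refine ⟨⟨p.proj, _, _, rfl, rfl, rfl⟩, fun f hf => ?_⟩
  refine (dd_compSmooth f contMDiff_addBundle z).trans ?_
  refine Eq.trans ?_ (congrArg₂ (· + ·) (dd_compSmooth f contMDiff_fstBundle z)
    (dd_compSmooth f contMDiff_sndBundle z)).symm
  rw [← dd_add]
  congr 1
  ext x
  exact (hf x.proj).map_add _ _

theorem tangentSum_of_dd {m : M} {e₁ e₂ : V m}
    (v₁ : TangentSpace (I.prod 𝓘(ℝ, F)) (⟨m, e₁⟩ : TotalSpace F V))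
    (v₂ : TangentSpace (I.prod 𝓘(ℝ, F)) (⟨m, e₂⟩ : TotalSpace F V))
    (v₃ : TangentSpace (I.prod 𝓘(ℝ, F)) (⟨m, e₁ + e₂⟩ : TotalSpace F V))
    (h₁ : tproj v₁ = tproj v₃) (h₂ : tproj v₂ = tproj v₃)
    (h : ∀ f : Fun (I.prod 𝓘(ℝ, F)) (TotalSpace F V), IsFiberLinear f →
      dd v₃ f = dd v₁ f + dd v₂ f) :
    TangentSum I F V ⟨_, v₁⟩ ⟨_, v₂⟩ ⟨_, v₃⟩ := by
  have s0 : ContMDiff (I.prod 𝓘(ℝ, F)) (I.prod 𝓘(ℝ, F)) ∞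
      (fun x : TotalSpace F V => (⟨x.proj, 0⟩ : TotalSpace F V)) :=
    (contMDiff_zeroSection ℝ V).comp (contMDiff_proj V)
  have s1 : ContMDiff (I.prod 𝓘(ℝ, F)) (I.prod 𝓘(ℝ, F × F)) ∞
      (fun x : TotalSpace F V => (⟨x.proj, (x.snd, 0)⟩ : TotalSpace (F × F) (V ×ᵇ V))) :=
    contMDiff_prodBundle_iff.2 ⟨contMDiff_id, s0⟩
  have s2 : ContMDiff (I.prod 𝓘(ℝ, F)) (I.prod 𝓘(ℝ, F × F)) ∞
      (fun x : TotalSpace F V => (⟨x.proj, (0, x.snd)⟩ : TotalSpace (F × F) (V ×ᵇ V))) :=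
    contMDiff_prodBundle_iff.2 ⟨s0, contMDiff_id⟩
  obtain ⟨z, hz, hd⟩ := exists_tangent (⟨m, (e₁, e₂)⟩ : TotalSpace (F × F) (V ×ᵇ V))
    (tproj (x := (⟨m, e₁ + e₂⟩ : TotalSpace F V)) v₃)
    (fun f => dd v₁ (f.compSmooth s1) + dd v₂ (f.compSmooth s2))
    (fun f g _ _ => by
      have a1 : (f + g).compSmooth s1 = f.compSmooth s1 + g.compSmooth s1 := rfl
      have a2 : (f + g).compSmooth s2 = f.compSmooth s2 + g.compSmooth s2 := rfl
      rw [a1, a2, dd_add, dd_add, add_add_add_comm])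
    (fun g f hf => by
      have a1 : (pull g * f).compSmooth s1 = pull g * f.compSmooth s1 := rfl
      have a2 : (pull g * f).compSmooth s2 = pull g * f.compSmooth s2 := rfl
      have a3 : f ⟨m, (e₁, e₂)⟩ = f.compSmooth s1 ⟨m, e₁⟩ + f.compSmooth s2 ⟨m, e₂⟩ := by
        have := (hf m).map_add (e₁, 0) (0, e₂)
        refine Eq.trans ?_ this
        congr 2
        exact Prod.ext (add_zero e₁).symm (zero_add e₂).symm
      rw [a1, a2, dd_mul, dd_mul, a3, dd_pull, dd_pull, h₁, h₂]
      simp only [pull_apply]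
      ring)
  have p1 : ∀ f : Fun (I.prod 𝓘(ℝ, F)) (TotalSpace F V), IsFiberLinear f →
      IsFiberLinear (f.compSmooth contMDiff_fstBundle) := fun f hf m =>
    ⟨fun a b => (hf m).map_add a.1 b.1, fun c a => (hf m).map_smul c a.1⟩
  have p2 : ∀ f : Fun (I.prod 𝓘(ℝ, F)) (TotalSpace F V), IsFiberLinear f →
      IsFiberLinear (f.compSmooth contMDiff_sndBundle) := fun f hf m =>
    ⟨fun a b => (hf m).map_add a.2 b.2, fun c a => (hf m).map_smul c a.2⟩
  have z0 : ∀ f : Fun (I.prod 𝓘(ℝ, F)) (TotalSpace F V), IsFiberLinear f →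
      f.compSmooth s0 = 0 := fun f hf => by
    ext x
    exact (hf x.proj).map_zero
  have d1 : ∀ f : Fun (I.prod 𝓘(ℝ, F)) (TotalSpace F V), IsFiberLinear f →
      dd z (f.compSmooth contMDiff_fstBundle) = dd v₁ f := fun f hf => by
    rw [hd _ (p1 f hf)]
    have a1 : (f.compSmooth contMDiff_fstBundle).compSmooth s1 = f := rfl
    have a2 : (f.compSmooth contMDiff_fstBundle).compSmooth s2 = f.compSmooth s0 := rfl
    rw [a1, a2, z0 f hf, dd_zero, add_zero]
  have d2 : ∀ f : Fun (I.prod 𝓘(ℝ, F)) (TotalSpace F V), IsFiberLinear f →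
      dd z (f.compSmooth contMDiff_sndBundle) = dd v₂ f := fun f hf => by
    rw [hd _ (p2 f hf)]
    have a1 : (f.compSmooth contMDiff_sndBundle).compSmooth s2 = f := rfl
    have a2 : (f.compSmooth contMDiff_sndBundle).compSmooth s1 = f.compSmooth s0 := rfl
    rw [a1, a2, z0 f hf, dd_zero, zero_add]
  refine ⟨⟨_, z⟩, ?_, ?_, ?_⟩
  · refine congrArg (TotalSpace.mk (⟨m, e₁⟩ : TotalSpace F V)) (tangent_ext ?_ fun f hf => ?_)
    · exact (tproj_mfderiv (V := V) (V' := V ×ᵇ V) (g := fun _ u => u.1)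
        contMDiff_fstBundle z).trans (hz.trans h₁.symm)
    · exact (dd_compSmooth f contMDiff_fstBundle z).trans (d1 f hf)
  · refine congrArg (TotalSpace.mk (⟨m, e₂⟩ : TotalSpace F V)) (tangent_ext ?_ fun f hf => ?_)
    · exact (tproj_mfderiv (V := V) (V' := V ×ᵇ V) (g := fun _ u => u.2)
        contMDiff_sndBundle z).trans (hz.trans h₂.symm)
    · exact (dd_compSmooth f contMDiff_sndBundle z).trans (d2 f hf)
  · refine congrArg (TotalSpace.mk (⟨m, e₁ + e₂⟩ : TotalSpace F V)) (tangent_ext ?_ fun f hf => ?_)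
    · exact (tproj_mfderiv (V := V) (V' := V ×ᵇ V) (g := fun _ u => u.1 + u.2)
        contMDiff_addBundle z).trans hz
    · refine (dd_compSmooth f contMDiff_addBundle z).trans (Eq.trans ?_ (h f hf).symm)
      rw [← d1 f hf, ← d2 f hf, ← dd_add]
      congr 1
      ext x
      exact (hf x.proj).map_add _ _

end LocalBases

section Fibers
set_option linter.unusedSectionVars false
variable {B F : Type*} [TopologicalSpace B] [NormedAddCommGroup F] [NormedSpace ℝ F]
  {V : B → Type*} [TopologicalSpace (TotalSpace F V)] [∀ b, AddCommGroup (V b)]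
  [∀ b, Module ℝ (V b)] [∀ b, TopologicalSpace (V b)] [FiberBundle F V] [VectorBundle ℝ F V]

theorem isSum_iff {b : B} {u v w : V b} :
    IsSum (⟨b, u⟩ : TotalSpace F V) ⟨b, v⟩ ⟨b, w⟩ ↔ w = u + v := by
  constructor
  · rintro ⟨b', u', v', h₁, h₂, h₃⟩
    cases h₁
    cases h₂
    cases h₃
    rfl
  · rintro rfl
    exact ⟨b, u, v, rfl, rfl, rfl⟩

theorem IsSum.unique {x y z z' : TotalSpace F V} (h : IsSum x y z) (h' : IsSum x y z') : z = z' := by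
  obtain ⟨b, u, v, rfl, rfl, rfl⟩ := h
  obtain ⟨b', u', v', h₁, h₂, rfl⟩ := h'
  cases h₁
  cases h₂
  rfl

theorem IsSum.proj_eq {x y z : TotalSpace F V} (h : IsSum x y z) :
    y.proj = x.proj ∧ z.proj = x.proj := by
  obtain ⟨b, u, v, rfl, rfl, rfl⟩ := h
  exact ⟨rfl, rfl⟩

theorem continuous_mk_smul {b : B} (v : V b) :
    Continuous fun t : ℝ => (⟨b, t • v⟩ : TotalSpace F V) := by
  let e := trivializationAt F V b
  have hb : b ∈ e.baseSet := mem_baseSet_trivializationAt _ _ _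
  let L := e.continuousLinearEquivAt ℝ b hb
  have h : (fun t : ℝ => t • v) = fun t => L.symm (t • L v) := by
    funext t
    rw [← map_smul, L.symm_apply_apply]
  refine (FiberBundle.continuous_totalSpaceMk F V b).comp ?_
  rw [h]
  exact L.symm.continuous.comp (continuous_id.smul continuous_const)

theorem continuous_snd_of_mk {X : Type*} [TopologicalSpace X] {b : B} {y : X → V b} :
    Continuous (fun t => (⟨b, y t⟩ : TotalSpace F V)) ↔ Continuous y :=
  (FiberBundle.totalSpaceMk_isInducing F V b).continuous_iff.symm

theorem isTopologicalAddGroup_fiber (F : Type*) [NormedAddCommGroup F] [NormedSpace ℝ F]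
    {V : B → Type*} [TopologicalSpace (TotalSpace F V)] [∀ b, AddCommGroup (V b)]
    [∀ b, Module ℝ (V b)] [∀ b, TopologicalSpace (V b)] [FiberBundle F V] [VectorBundle ℝ F V]
    (b : B) : IsTopologicalAddGroup (V b) ∧ ContinuousSMul ℝ (V b) ∧ T2Space (V b) := by
  let e := trivializationAt F V b
  have hb : b ∈ e.baseSet := mem_baseSet_trivializationAt _ _ _
  let L := e.continuousLinearEquivAt ℝ b hb
  have hi : Topology.IsInducing L := L.toHomeomorph.isInducing
  refine ⟨?_, ?_, L.toHomeomorph.symm.t2Space⟩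
  · exact hi.topologicalAddGroup (L : V b →ₗ[ℝ] F)
  · refine ⟨hi.continuous_iff.2 ?_⟩
    have : (⇑L ∘ fun p : ℝ × V b => p.1 • p.2) = fun p : ℝ × V b => p.1 • L p.2 :=
      funext fun p => map_smul L _ _
    rw [this]
    exact continuous_fst.smul (L.continuous.comp continuous_snd)

end Fibers

section SmoothFibers
set_option linter.unusedSectionVars false
variable {EM HM : Type*} [NormedAddCommGroup EM] [NormedSpace ℝ EM]
  [TopologicalSpace HM] {I : ModelWithCorners ℝ EM HM} {M : Type*} [TopologicalSpace M]
  [ChartedSpace HM M] [IsManifold I ∞ M]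
  {F : Type*} [NormedAddCommGroup F] [NormedSpace ℝ F]
  {V : M → Type*} [TopologicalSpace (TotalSpace F V)] [∀ m, AddCommGroup (V m)]
  [∀ m, Module ℝ (V m)] [∀ m, TopologicalSpace (V m)] [FiberBundle F V] [VectorBundle ℝ F V]
  [ContMDiffVectorBundle ∞ F V I]
  {F' : Type*} [NormedAddCommGroup F'] [NormedSpace ℝ F']
  {V' : M → Type*} [TopologicalSpace (TotalSpace F' V')] [∀ m, AddCommGroup (V' m)]
  [∀ m, Module ℝ (V' m)] [∀ m, TopologicalSpace (V' m)] [FiberBundle F' V'] [VectorBundle ℝ F' V']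
  [ContMDiffVectorBundle ∞ F' V' I]
  {EN HN : Type*} [NormedAddCommGroup EN] [NormedSpace ℝ EN] [TopologicalSpace HN]
  {K : ModelWithCorners ℝ EN HN} {N : Type*} [TopologicalSpace N] [ChartedSpace HN N]

theorem contMDiff_isSum {x y z : N → TotalSpace F V} (hx : ContMDiff K (I.prod 𝓘(ℝ, F)) ∞ x)
    (hy : ContMDiff K (I.prod 𝓘(ℝ, F)) ∞ y) (h : ∀ n, IsSum (x n) (y n) (z n)) :
    ContMDiff K (I.prod 𝓘(ℝ, F)) ∞ z := by
  intro n
  let e := trivializationAt F V (z n).proj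
  have hp : ∀ n, (x n).proj = (z n).proj ∧ (y n).proj = (z n).proj := fun n =>
    ⟨(h n).proj_eq.2.symm, (h n).proj_eq.1.trans (h n).proj_eq.2.symm⟩
  have hn : (z n).proj ∈ e.baseSet := mem_baseSet_trivializationAt _ _ _
  have hxn : x n ∈ e.source := e.mem_source.2 ((hp n).1 ▸ hn)
  have hyn : y n ∈ e.source := e.mem_source.2 ((hp n).2 ▸ hn)
  have hz : ∀ n, (z n).proj = (x n).proj := fun n => (hp n).1.symm
  rw [contMDiffAt_totalSpace]
  have h1 := (e.contMDiffAt_iff (IB := I) (n := ∞) hxn).1 (hx n)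
  have h2 := (e.contMDiffAt_iff (IB := I) (n := ∞) hyn).1 (hy n)
  refine ⟨by simpa only [hz] using h1.1, (h1.2.add h2.2).congr_of_eventuallyEq ?_⟩
  filter_upwards [h1.1.continuousAt.eventually
    (e.open_baseSet.mem_nhds (by change (x n).proj ∈ _; rw [(hp n).1]; exact hn))] with k hk
  obtain ⟨b, u, v, h₁, h₂, h₃⟩ := h k
  rw [h₁] at hk
  change (e (z k)).2 = (e (x k)).2 + (e (y k)).2
  rw [h₁, h₂, h₃]
  exact (e.linear ℝ hk).map_add u v

theorem contMDiffAt_sum_smul {n : ℕ} {b : N → M} {c : Fin n → N → ℝ} {x : N}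
    (hb : ContMDiffAt K I ∞ b x) (hc : ∀ i, ContMDiffAt K 𝓘(ℝ) ∞ (c i) x) (s : Fin n → Sec I F V) :
    ContMDiffAt K (I.prod 𝓘(ℝ, F)) ∞
      (fun y => (⟨b y, ∑ i, c i y • s i (b y)⟩ : TotalSpace F V)) x := by
  rw [contMDiffAt_totalSpace]
  refine ⟨hb, ?_⟩
  let e := trivializationAt F V (b x)
  have hm : b x ∈ e.baseSet := mem_baseSet_trivializationAt _ _ _
  have h1 : ∀ᶠ y in nhds x, (e ⟨b y, ∑ i, c i y • s i (b y)⟩).2 =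
      ∑ i, c i y • (e ⟨b y, s i (b y)⟩).2 := by
    filter_upwards [hb.continuousAt.eventually (e.open_baseSet.mem_nhds hm)] with y hy
    let l : V (b y) →ₗ[ℝ] F := (e.linear ℝ hy).mk' _
    change l (∑ i, c i y • s i (b y)) = ∑ i, c i y • l (s i (b y))
    rw [map_sum]
    exact Finset.sum_congr rfl fun i _ => map_smul l _ _
  refine ContMDiffAt.congr_of_eventuallyEq ?_ h1
  refine contMDiffAt_finsetSum fun i _ => ?_
  have a2 := (e.contMDiffAt_section_iff (n := ∞) (IB := I) hm).1 (s i).contMDiff.contMDiffAt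
  have a3 : ContMDiffAt K 𝓘(ℝ, F) ∞ (fun y => (e ⟨b y, s i (b y)⟩).2) x :=
    ContMDiffAt.comp (I' := I) (g := fun x => (e ⟨x, s i x⟩).2) (f := b) x a2 hb
  exact (hc i).smul a3

theorem contMDiffAt_clm_of_apply {G : Type*} [NormedAddCommGroup G] [NormedSpace ℝ G]
    [FiniteDimensional ℝ F] {g : N → F →L[ℝ] G} {x : N}
    (h : ∀ v, ContMDiffAt K 𝓘(ℝ, G) ∞ (fun y => g y v) x) :
    ContMDiffAt K 𝓘(ℝ, F →L[ℝ] G) ∞ g x := by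
  let b := Module.finBasis ℝ F
  let l : Fin _ → F →L[ℝ] ℝ := fun i => LinearMap.toContinuousLinearMap (b.coord i)
  have e : g = fun y => ∑ i, ContinuousLinearMap.smulRightL ℝ F G (l i) (g y (b i)) := by
    funext y
    ext v
    have h1 := b.sum_repr v
    conv_lhs => rw [← h1]
    rw [map_sum, sum_apply]
    refine Finset.sum_congr rfl fun i _ => ?_
    rw [map_smul]
    rfl
  rw [e]
  refine contMDiffAt_finsetSum fun i _ => ?_
  exact ((ContinuousLinearMap.smulRightL ℝ F G (l i)).contDiff.contMDiff.contMDiffAt).comp x (h (b i))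

/-- The inverse of a smooth isomorphism of vector bundles is smooth. -/
theorem contMDiff_bundle_symm [FiniteDimensional ℝ F] [FiniteDimensional ℝ F']
    (g : ∀ m, V m ≃ₗ[ℝ] V' m) (hg : ContMDiff (I.prod 𝓘(ℝ, F)) (I.prod 𝓘(ℝ, F')) ∞
      (fun x : TotalSpace F V => (⟨x.proj, g x.proj x.snd⟩ : TotalSpace F' V'))) :
    ContMDiff (I.prod 𝓘(ℝ, F')) (I.prod 𝓘(ℝ, F)) ∞
      (fun x : TotalSpace F' V' => (⟨x.proj, (g x.proj).symm x.snd⟩ : TotalSpace F V)) := by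
  intro x₀
  let e := trivializationAt F V x₀.proj
  let e' := trivializationAt F' V' x₀.proj
  have hm : x₀.proj ∈ e.baseSet := mem_baseSet_trivializationAt _ _ _
  have hm' : x₀.proj ∈ e'.baseSet := mem_baseSet_trivializationAt _ _ _
  have hU : ∀ᶠ m in nhds x₀.proj, m ∈ e.baseSet ∧ m ∈ e'.baseSet :=
    Filter.Eventually.and (e.open_baseSet.mem_nhds hm) (e'.open_baseSet.mem_nhds hm')
  let G₀ : M → F →ₗ[ℝ] F' := fun m => e'.linearMapAt ℝ m ∘ₗ (g m : V m →ₗ[ℝ] V' m) ∘ₗ e.symmₗ ℝ m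
  let G : M → F →L[ℝ] F' := fun m => LinearMap.toContinuousLinearMap (G₀ m)
  have hGv : ∀ m, m ∈ e.baseSet → ∀ v, G m v = e'.linearMapAt ℝ m (g m (e.symm m v)) := by
    intro m hm v
    change e'.linearMapAt ℝ m (g m (e.symmₗ ℝ m v)) = _
    rw [e.symmₗ_apply hm]
  have hG : ContMDiffAt I 𝓘(ℝ, F →L[ℝ] F') ∞ G x₀.proj := by
    refine contMDiffAt_clm_of_apply fun v => ?_
    have h1 : ContMDiffAt I (I.prod 𝓘(ℝ, F)) ∞ (fun m => (⟨m, e.symm m v⟩ : TotalSpace F V))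
        x₀.proj := by
      refine (e.contMDiffAt_section_iff hm).2 ((contMDiffAt_const (c := v)).congr_of_eventuallyEq ?_)
      filter_upwards [e.open_baseSet.mem_nhds hm] with z hz
      rw [e.apply_mk_symm hz]
    have h2 : ContMDiffAt I (I.prod 𝓘(ℝ, F')) ∞
        (fun m => (⟨m, g m (e.symm m v)⟩ : TotalSpace F' V')) x₀.proj :=
      (hg _).comp x₀.proj h1
    refine ((e'.contMDiffAt_section_iff hm').1 h2).congr_of_eventuallyEq ?_
    filter_upwards [hU] with m hm
    rw [hGv m hm.1, e'.linearMapAt_apply, if_pos hm.2]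
  have key : ∀ m, m ∈ e.baseSet → m ∈ e'.baseSet → ∀ v : V m, G m (e ⟨m, v⟩).2 =
      (e' ⟨m, g m v⟩).2 := by
    intro m h h' v
    rw [hGv m h, e.symm_apply_apply_mk h, e'.linearMapAt_apply, if_pos h']
  have hequiv : ∀ m, m ∈ e.baseSet → m ∈ e'.baseSet → ∃ L : F ≃L[ℝ] F', (L : F →L[ℝ] F') = G m := by
    intro m h h'
    refine ⟨((e.linearEquivAt ℝ m h).symm.trans ((g m).trans
      (e'.linearEquivAt ℝ m h'))).toContinuousLinearEquiv, ?_⟩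
    ext v
    rw [hGv m h, e'.linearMapAt_apply, if_pos h']
    rfl
  rw [contMDiffAt_totalSpace]
  have hp : ContMDiffAt (I.prod 𝓘(ℝ, F')) I ∞ (fun x : TotalSpace F' V' => x.proj) x₀ :=
    (contMDiff_proj V') x₀
  refine ⟨hp, ?_⟩
  obtain ⟨L, hL⟩ := hequiv _ hm hm'
  have h3 : ContMDiffAt (I.prod 𝓘(ℝ, F')) 𝓘(ℝ, F' →L[ℝ] F) ∞
      (fun x : TotalSpace F' V' => ContinuousLinearMap.inverse (G x.proj)) x₀ := by
    have h4 : ContDiffAt ℝ ∞ (ContinuousLinearMap.inverse : (F →L[ℝ] F') → F' →L[ℝ] F)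
        (G x₀.proj) := by
      rw [← hL]
      exact contDiffAt_map_inverse L
    exact h4.contMDiffAt.comp x₀ (hG.comp x₀ hp)
  have h5 : ContMDiffAt (I.prod 𝓘(ℝ, F')) 𝓘(ℝ, F') ∞ (fun x : TotalSpace F' V' => (e' x).2) x₀ :=
    (contMDiffAt_totalSpace.1 (contMDiffAt_id (x := x₀))).2
  refine (h3.clm_apply h5).congr_of_eventuallyEq ?_
  filter_upwards [hp.continuousAt.eventually hU] with x hx
  obtain ⟨L', hL'⟩ := hequiv _ hx.1 hx.2
  have h6 := key _ hx.1 hx.2 ((g x.proj).symm x.snd)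
  rw [LinearEquiv.apply_symm_apply] at h6
  change (e ⟨x.proj, (g x.proj).symm x.snd⟩).2 = _
  rw [← hL', ContinuousLinearMap.inverse_equiv]
  rw [← hL'] at h6
  exact (L'.symm_apply_eq.2 h6.symm).symm

end SmoothFibers

section DVB
set_option linter.unusedSectionVars false
variable {EM : Type*} [NormedAddCommGroup EM] [NormedSpace ℝ EM] [FiniteDimensional ℝ EM]
  {HM : Type*} [TopologicalSpace HM] {I : ModelWithCorners ℝ EM HM}
  {M : Type*} [TopologicalSpace M] [T2Space M] [ChartedSpace HM M] [IsManifold I ∞ M]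
  {FA : Type*} [NormedAddCommGroup FA] [NormedSpace ℝ FA] [FiniteDimensional ℝ FA]
  {A : M → Type*} [TopologicalSpace (TotalSpace FA A)] [∀ m, AddCommGroup (A m)]
  [∀ m, Module ℝ (A m)] [∀ m, TopologicalSpace (A m)] [FiberBundle FA A] [VectorBundle ℝ FA A]
  [ContMDiffVectorBundle ∞ FA A I]
  {FE : Type*} [NormedAddCommGroup FE] [NormedSpace ℝ FE] [FiniteDimensional ℝ FE]
  {E : M → Type*} [TopologicalSpace (TotalSpace FE E)] [∀ m, AddCommGroup (E m)]
  [∀ m, Module ℝ (E m)] [∀ m, TopologicalSpace (E m)] [FiberBundle FE E] [VectorBundle ℝ FE E]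
  [ContMDiffVectorBundle ∞ FE E I]
  {FC : Type*} [NormedAddCommGroup FC] [NormedSpace ℝ FC] [FiniteDimensional ℝ FC]
  {C : M → Type*} [TopologicalSpace (TotalSpace FC C)] [∀ m, AddCommGroup (C m)]
  [∀ m, Module ℝ (C m)] [∀ m, TopologicalSpace (C m)] [FiberBundle FC C] [VectorBundle ℝ FC C]
  [ContMDiffVectorBundle ∞ FC C I]
  {FDE : Type*} [NormedAddCommGroup FDE] [NormedSpace ℝ FDE] [FiniteDimensional ℝ FDE]
  {DE : TotalSpace FE E → Type*} [TopologicalSpace (TotalSpace FDE DE)]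
  [∀ e, AddCommGroup (DE e)] [∀ e, Module ℝ (DE e)] [∀ e, TopologicalSpace (DE e)]
  [FiberBundle FDE DE] [VectorBundle ℝ FDE DE] [ContMDiffVectorBundle ∞ FDE DE (I.prod 𝓘(ℝ, FE))]
  {FDA : Type*} [NormedAddCommGroup FDA] [NormedSpace ℝ FDA] [FiniteDimensional ℝ FDA]
  {DA : TotalSpace FA A → Type*} [TopologicalSpace (TotalSpace FDA DA)]
  [∀ a, AddCommGroup (DA a)] [∀ a, Module ℝ (DA a)] [∀ a, TopologicalSpace (DA a)]
  [FiberBundle FDA DA] [VectorBundle ℝ FDA DA] [ContMDiffVectorBundle ∞ FDA DA (I.prod 𝓘(ℝ, FA))]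

theorem exists_eq_mk {B F : Type*} {V : B → Type*} (d : TotalSpace F V) {b : B} (h : d.proj = b) :
    ∃ y : V b, d = ⟨b, y⟩ := by
  subst h
  exact ⟨d.snd, rfl⟩

theorem map_smul_of_continuous {B F : Type*} [TopologicalSpace B] [NormedAddCommGroup F]
    [NormedSpace ℝ F] {V : B → Type*} [TopologicalSpace (TotalSpace F V)] [∀ b, AddCommGroup (V b)]
    [∀ b, Module ℝ (V b)] [∀ b, TopologicalSpace (V b)] [FiberBundle F V] [VectorBundle ℝ F V]
    {W : Type*} [AddCommGroup W] [Module ℝ W] {b : B} (g : W →+ V b) (w : W)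
    (h : Continuous fun t : ℝ => (⟨b, g (t • w)⟩ : TotalSpace F V)) (t : ℝ) :
    g (t • w) = t • g w := by
  obtain ⟨h1, h2, h3⟩ := isTopologicalAddGroup_fiber F (V := V) b
  let a : ℝ →+ V b := g.comp (AddMonoidHom.mk' (fun t : ℝ => t • w) fun s t => add_smul s t w)
  have ha : Continuous a := continuous_snd_of_mk.1 h
  have := map_real_smul a ha t 1
  change g ((t • (1 : ℝ)) • w) = t • g ((1 : ℝ) • w) at this
  simpa using this

namespace DoubleVectorBundle
variable (D : DoubleVectorBundle I FA A FE E FDE DE FDA DA)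

theorem exists_projA (e : TotalSpace FE E) (v : DE e) :
    ∃ a : A e.proj, (D.toA ⟨e, v⟩).proj = ⟨e.proj, a⟩ :=
  exists_eq_mk _ (D.square ⟨e, v⟩)

/-- The component in `A` of a point of `D`. -/
def pA (e : TotalSpace FE E) : DE e →ₗ[ℝ] A e.proj :=
  let g : DE e →+ A e.proj := AddMonoidHom.mk' (fun v => (D.exists_projA e v).choose) fun u v => by
    have h := D.projA_add ⟨e, u⟩ ⟨e, v⟩ ⟨e, u + v⟩ (isSum_iff.2 rfl)
    rw [(D.exists_projA e u).choose_spec, (D.exists_projA e v).choose_spec,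
      (D.exists_projA e (u + v)).choose_spec] at h
    exact isSum_iff.1 h
  { g with
    map_smul' := fun t v => by
      refine map_smul_of_continuous (F := FA) g v ?_ t
      have h : (fun t : ℝ => (⟨e.proj, g (t • v)⟩ : TotalSpace FA A)) =
          fun t : ℝ => (D.toA ⟨e, t • v⟩).proj :=
        funext fun t => (D.exists_projA e (t • v)).choose_spec.symm
      rw [h]
      exact (FiberBundle.continuous_proj FDA DA).comp
        (D.toA.continuous.comp (continuous_mk_smul v)) }

theorem projA_eq (e : TotalSpace FE E) (v : DE e) : (D.toA ⟨e, v⟩).proj = ⟨e.proj, D.pA e v⟩ :=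
  (D.exists_projA e v).choose_spec

theorem exists_zeroA (m : M) (e : E m) :
    ∃ y : DA ⟨m, 0⟩, D.toA (⟨⟨m, e⟩, 0⟩ : TotalSpace FDE DE) = ⟨⟨m, 0⟩, y⟩ :=
  exists_eq_mk _ ((D.projA_eq ⟨m, e⟩ 0).trans (by rw [map_zero]))

/-- The zero vector of `D → E` over `e`, as a vector of `D → A`. -/
def zeroA (m : M) : E m →+ DA ⟨m, 0⟩ := AddMonoidHom.mk' (fun e => (D.exists_zeroA m e).choose) <| by
  intro e₁ e₂
  have s₁ := (D.exists_zeroA m e₁).choose_spec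
  have s₂ := (D.exists_zeroA m e₂).choose_spec
  have s₃ := (D.exists_zeroA m (e₁ + e₂)).choose_spec
  set y₁ := (D.exists_zeroA m e₁).choose
  set y₂ := (D.exists_zeroA m e₂).choose
  set y₃ := (D.exists_zeroA m (e₁ + e₂)).choose
  obtain ⟨z, hz⟩ : ∃ z, D.toA z = ⟨⟨m, 0⟩, y₁ + y₂⟩ := D.toA.surjective _
  have h : IsSum (D.toA (⟨⟨m, e₁⟩, 0⟩ : TotalSpace FDE DE)) (D.toA ⟨⟨m, e₂⟩, 0⟩) (D.toA z) := by
    rw [s₁, s₂, hz]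
    exact isSum_iff.2 rfl
  obtain ⟨w, rfl⟩ := exists_eq_mk z ((D.projE_add _ _ _ h).unique
    (isSum_iff.2 rfl : IsSum _ _ (⟨m, e₁ + e₂⟩ : TotalSpace FE E)))
  obtain ⟨d, hd, hs⟩ := D.interchange _ _ _ _ _ _ _ _
    (isSum_iff.2 (add_zero 0).symm : IsSum (⟨⟨m, e₁⟩, 0⟩ : TotalSpace FDE DE) _ _)
    (isSum_iff.2 (add_zero 0).symm : IsSum (⟨⟨m, e₂⟩, 0⟩ : TotalSpace FDE DE) _ _) h h
  have hdz := D.toA.injective (hd.unique h)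
  rw [hdz] at hs
  have hw : w = 0 := by simpa using isSum_iff.1 hs
  rw [hw, s₃] at hz
  exact eq_of_heq (TotalSpace.mk.inj hz).2

theorem toA_zero (m : M) (e : E m) :
    D.toA (⟨⟨m, e⟩, 0⟩ : TotalSpace FDE DE) = ⟨⟨m, 0⟩, D.zeroA m e⟩ :=
  (D.exists_zeroA m e).choose_spec

namespace Core
variable {D} (κ : D.Core FC C)

theorem exists_ι (m : M) (c : C m) : ∃ v : DE ⟨m, 0⟩, κ.ι ⟨m, c⟩ = ⟨⟨m, 0⟩, v⟩ := by
  have h := ((κ.range (κ.ι ⟨m, c⟩)).1 ⟨_, rfl⟩).1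
  rw [κ.overBase] at h
  exact exists_eq_mk _ h

theorem exists_ιA (m : M) (c : C m) : ∃ v : DA ⟨m, 0⟩, D.toA (κ.ι ⟨m, c⟩) = ⟨⟨m, 0⟩, v⟩ := by
  have h := ((κ.range (κ.ι ⟨m, c⟩)).1 ⟨_, rfl⟩).2
  rw [κ.overBase] at h
  exact exists_eq_mk _ h

theorem isSum_ι (m : M) (c₁ c₂ : C m) : IsSum (κ.ι ⟨m, c₁⟩) (κ.ι ⟨m, c₂⟩) (κ.ι ⟨m, c₁ + c₂⟩) := by
  obtain ⟨b, l, hl⟩ := κ.linear m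
  rw [hl, hl, hl]
  exact isSum_iff.2 (map_add l c₁ c₂)

/-- A core element as a vector of `D → A`. -/
def ιA (m : M) : C m →+ DA ⟨m, 0⟩ := AddMonoidHom.mk' (fun c => (κ.exists_ιA m c).choose) <| by
  intro c₁ c₂
  have s₁ := (κ.exists_ιA m c₁).choose_spec
  have s₂ := (κ.exists_ιA m c₂).choose_spec
  have s₃ := (κ.exists_ιA m (c₁ + c₂)).choose_spec
  set y₁ := (κ.exists_ιA m c₁).choose
  set y₂ := (κ.exists_ιA m c₂).choose
  set y₃ := (κ.exists_ιA m (c₁ + c₂)).choose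
  have z0 : D.toA (⟨⟨m, 0⟩, 0⟩ : TotalSpace FDE DE) = ⟨⟨m, 0⟩, 0⟩ := by
    rw [D.toA_zero, map_zero]
  obtain ⟨v₁, h₁⟩ := κ.exists_ι m c₁
  obtain ⟨v₂, h₂⟩ := κ.exists_ι m c₂
  obtain ⟨d, hd, hs⟩ := D.interchange (κ.ι ⟨m, c₁⟩) ⟨⟨m, 0⟩, 0⟩ ⟨⟨m, 0⟩, 0⟩ (κ.ι ⟨m, c₂⟩)
    (κ.ι ⟨m, c₁⟩) (κ.ι ⟨m, c₂⟩) (κ.ι ⟨m, c₁⟩) (κ.ι ⟨m, c₂⟩)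
    (by rw [h₁]; exact isSum_iff.2 (add_zero _).symm)
    (by rw [h₂]; exact isSum_iff.2 (zero_add _).symm)
    (by rw [s₁, z0]; exact isSum_iff.2 (add_zero _).symm)
    (by rw [s₂, z0]; exact isSum_iff.2 (zero_add _).symm)
  rw [hs.unique (κ.isSum_ι m c₁ c₂), s₁, s₂, s₃] at hd
  exact isSum_iff.1 hd

theorem toA_ι (m : M) (c : C m) : D.toA (κ.ι ⟨m, c⟩) = ⟨⟨m, 0⟩, κ.ιA m c⟩ :=
  (κ.exists_ιA m c).choose_spec

theorem isPoint_iff {e : TotalSpace FE E} {c : C e.proj} {d : TotalSpace FDE DE} :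
    κ.IsPoint ⟨e.proj, c⟩ e d ↔
      D.toA d = ⟨⟨e.proj, 0⟩, κ.ιA e.proj c + D.zeroA e.proj e.snd⟩ := by
  have h := D.toA_zero e.proj e.snd
  change D.toA (⟨e, 0⟩ : TotalSpace FDE DE) = _ at h
  rw [IsPoint, κ.toA_ι, h]
  constructor
  · exact fun h => h.unique (isSum_iff.2 rfl)
  · intro h
    rw [h]
    exact isSum_iff.2 rfl

theorem exists_point (e : TotalSpace FE E) (c : C e.proj) :
    ∃ v : DE e, κ.IsPoint ⟨e.proj, c⟩ e ⟨e, v⟩ := by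
  obtain ⟨d, hd⟩ : ∃ d, D.toA d = ⟨⟨e.proj, 0⟩, κ.ιA e.proj c + D.zeroA e.proj e.snd⟩ :=
    D.toA.surjective _
  have h := κ.isPoint_iff.2 hd
  have h1 := D.projE_add _ _ _ h
  obtain ⟨v, hv⟩ := κ.exists_ι e.proj c
  rw [hv] at h1
  obtain ⟨w, rfl⟩ := exists_eq_mk d (h1.unique (isSum_iff.2 (zero_add e.snd).symm))
  exact ⟨w, h⟩

/-- The point `c +_A 0_e`, as a function of the core element `c`. -/
def point (e : TotalSpace FE E) : C e.proj →ₗ[ℝ] DE e :=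
  let g : C e.proj →+ DE e := AddMonoidHom.mk' (fun c => (κ.exists_point e c).choose) fun c₁ c₂ => by
    have s₁ := (κ.exists_point e c₁).choose_spec
    have s₂ := (κ.exists_point e c₂).choose_spec
    have s₃ := (κ.exists_point e (c₁ + c₂)).choose_spec
    set y₁ := (κ.exists_point e c₁).choose
    set y₂ := (κ.exists_point e c₂).choose
    set y₃ := (κ.exists_point e (c₁ + c₂)).choose
    obtain ⟨d, hd, hs⟩ := D.interchange _ _ _ _ _ _ _ _ (κ.isSum_ι e.proj c₁ c₂)
      (isSum_iff.2 (add_zero 0).symm : IsSum (⟨e, 0⟩ : TotalSpace FDE DE) ⟨e, 0⟩ ⟨e, 0⟩) s₁ s₂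
    rw [D.toA.injective (hd.unique s₃)] at hs
    exact isSum_iff.1 hs
  { g with
    map_smul' := fun t c => by
      refine map_smul_of_continuous (F := FDE) g c ?_ t
      have h : (fun t : ℝ => (⟨e, g (t • c)⟩ : TotalSpace FDE DE)) = fun t : ℝ =>
          D.toA.symm ⟨⟨e.proj, 0⟩, κ.ιA e.proj (t • c) + D.zeroA e.proj e.snd⟩ := funext fun t => by
        rw [← κ.isPoint_iff.1 (κ.exists_point e (t • c)).choose_spec, D.toA.symm_apply_apply]
        rfl
      rw [h]
      refine D.toA.symm.continuous.comp (continuous_snd_of_mk.2 ?_)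
      obtain ⟨h1, h2, h3⟩ := isTopologicalAddGroup_fiber FDA (V := DA) ⟨e.proj, 0⟩
      refine Continuous.add ((continuous_snd_of_mk (F := FDA)).1 ?_) continuous_const
      have h4 : (fun t : ℝ => (⟨⟨e.proj, 0⟩, κ.ιA e.proj (t • c)⟩ : TotalSpace FDA DA)) =
          fun t => D.toA (κ.ι ⟨e.proj, t • c⟩) := funext fun t => (κ.toA_ι _ _).symm
      rw [h4]
      exact D.toA.continuous.comp (κ.smooth.continuous.comp (continuous_mk_smul c)) }

theorem toA_point (e : TotalSpace FE E) (c : C e.proj) :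
    D.toA ⟨e, κ.point e c⟩ = ⟨⟨e.proj, 0⟩, κ.ιA e.proj c + D.zeroA e.proj e.snd⟩ :=
  κ.isPoint_iff.1 (κ.exists_point e c).choose_spec

theorem isPoint_iff_eq {e : TotalSpace FE E} {c : C e.proj} {v : DE e} :
    κ.IsPoint ⟨e.proj, c⟩ e ⟨e, v⟩ ↔ v = κ.point e c := by
  rw [κ.isPoint_iff, ← κ.toA_point]
  refine ⟨fun h => ?_, fun h => by rw [h]⟩
  have := D.toA.injective h
  cases this
  rfl

theorem pA_point (e : TotalSpace FE E) (c : C e.proj) : D.pA e (κ.point e c) = 0 := by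
  have h := D.projA_eq e (κ.point e c)
  rw [κ.toA_point] at h
  exact (eq_of_heq (TotalSpace.mk.inj h).2).symm

theorem ιA_injective (m : M) : Function.Injective (κ.ιA m) := fun c c' h => by
  have : D.toA (κ.ι ⟨m, c⟩) = D.toA (κ.ι ⟨m, c'⟩) := by rw [κ.toA_ι, κ.toA_ι, h]
  have := κ.injective (D.toA.injective this)
  cases this
  rfl

theorem point_injective (e : TotalSpace FE E) : Function.Injective (κ.point e) := fun c c' h => by
  have h1 := κ.toA_point e c
  rw [h, κ.toA_point] at h1
  have h2 := eq_of_heq (TotalSpace.mk.inj h1).2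
  exact (κ.ιA_injective _ (add_right_cancel h2)).symm

theorem exists_point_eq (e : TotalSpace FE E) (v : DE e) (h : D.pA e v = 0) :
    ∃ c, κ.point e c = v := by
  obtain ⟨y, hy⟩ := exists_eq_mk (D.toA ⟨e, v⟩) ((D.projA_eq e v).trans (by rw [h]))
  obtain ⟨d, hd⟩ : ∃ d, D.toA d = ⟨⟨e.proj, 0⟩, y - D.zeroA e.proj e.snd⟩ := D.toA.surjective _
  have hz := D.toA_zero e.proj e.snd
  change D.toA (⟨e, 0⟩ : TotalSpace FDE DE) = _ at hz
  have hs : IsSum (D.toA d) (D.toA (⟨e, 0⟩ : TotalSpace FDE DE)) (D.toA ⟨e, v⟩) := by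
    rw [hd, hy, hz]
    exact isSum_iff.2 (sub_add_cancel _ _).symm
  obtain ⟨m, e₁, e₂, g₁, g₂, g₃⟩ := D.projE_add _ _ _ hs
  change e = _ at g₂
  change e = _ at g₃
  subst g₂
  have h0 : e₁ = 0 := by
    have := eq_of_heq (TotalSpace.mk.inj g₃).2
    simpa using this
  subst h0
  have hr : d ∈ Set.range κ.ι := by
    refine (κ.range d).2 ⟨by rw [g₁], ?_⟩
    rw [hd, g₁]
  obtain ⟨⟨m', c⟩, rfl⟩ := hr
  have hm := κ.overBase ⟨m', c⟩
  rw [g₁] at hm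
  change m = m' at hm
  subst hm
  refine ⟨c, (κ.isPoint_iff_eq.1 ?_).symm⟩
  exact hs

end Core

end DoubleVectorBundle

end DVB

section DVB
set_option linter.unusedSectionVars false
variable {EM : Type*} [NormedAddCommGroup EM] [NormedSpace ℝ EM] [FiniteDimensional ℝ EM]
  {HM : Type*} [TopologicalSpace HM] {I : ModelWithCorners ℝ EM HM}
  {M : Type*} [TopologicalSpace M] [T2Space M] [ChartedSpace HM M] [IsManifold I ∞ M]
  {FA : Type*} [NormedAddCommGroup FA] [NormedSpace ℝ FA] [FiniteDimensional ℝ FA]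
  {A : M → Type*} [TopologicalSpace (TotalSpace FA A)] [∀ m, AddCommGroup (A m)]
  [∀ m, Module ℝ (A m)] [∀ m, TopologicalSpace (A m)] [FiberBundle FA A] [VectorBundle ℝ FA A]
  [ContMDiffVectorBundle ∞ FA A I]
  {FE : Type*} [NormedAddCommGroup FE] [NormedSpace ℝ FE] [FiniteDimensional ℝ FE]
  {E : M → Type*} [TopologicalSpace (TotalSpace FE E)] [∀ m, AddCommGroup (E m)]
  [∀ m, Module ℝ (E m)] [∀ m, TopologicalSpace (E m)] [FiberBundle FE E] [VectorBundle ℝ FE E]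
  [ContMDiffVectorBundle ∞ FE E I]
  {FC : Type*} [NormedAddCommGroup FC] [NormedSpace ℝ FC] [FiniteDimensional ℝ FC]
  {C : M → Type*} [TopologicalSpace (TotalSpace FC C)] [∀ m, AddCommGroup (C m)]
  [∀ m, Module ℝ (C m)] [∀ m, TopologicalSpace (C m)] [FiberBundle FC C] [VectorBundle ℝ FC C]
  [ContMDiffVectorBundle ∞ FC C I]
  {FDE : Type*} [NormedAddCommGroup FDE] [NormedSpace ℝ FDE] [FiniteDimensional ℝ FDE]
  {DE : TotalSpace FE E → Type*} [TopologicalSpace (TotalSpace FDE DE)]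
  [∀ e, AddCommGroup (DE e)] [∀ e, Module ℝ (DE e)] [∀ e, TopologicalSpace (DE e)]
  [FiberBundle FDE DE] [VectorBundle ℝ FDE DE] [ContMDiffVectorBundle ∞ FDE DE (I.prod 𝓘(ℝ, FE))]
  {FDA : Type*} [NormedAddCommGroup FDA] [NormedSpace ℝ FDA] [FiniteDimensional ℝ FDA]
  {DA : TotalSpace FA A → Type*} [TopologicalSpace (TotalSpace FDA DA)]
  [∀ a, AddCommGroup (DA a)] [∀ a, Module ℝ (DA a)] [∀ a, TopologicalSpace (DA a)]
  [FiberBundle FDA DA] [VectorBundle ℝ FDA DA] [ContMDiffVectorBundle ∞ FDA DA (I.prod 𝓘(ℝ, FA))]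

theorem contMDiff_mk_smul {m : M} (v : E m) :
    ContMDiff 𝓘(ℝ) (I.prod 𝓘(ℝ, FE)) ∞ fun t : ℝ => (⟨m, t • v⟩ : TotalSpace FE E) := by
  refine contMDiff_of_fiberLinear contMDiff_const fun f hf => ?_
  have h : (fun t : ℝ => f (⟨m, t • v⟩ : TotalSpace FE E)) = fun t => t * f ⟨m, v⟩ :=
    funext fun t => (hf m).map_smul t v
  rw [h]
  exact (contDiff_id.mul contDiff_const).contMDiff

namespace DoubleVectorBundle
variable {D : DoubleVectorBundle I FA A FE E FDE DE FDA DA}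

theorem contMDiff_zero :
    ContMDiff (I.prod 𝓘(ℝ, FE)) ((I.prod 𝓘(ℝ, FE)).prod 𝓘(ℝ, FDE)) ∞
      fun e : TotalSpace FE E => (⟨e, 0⟩ : TotalSpace FDE DE) :=
  (0 : Sec (I.prod 𝓘(ℝ, FE)) FDE DE).contMDiff

theorem Core.contMDiff_point (κ : D.Core FC C) {EN HN : Type*} [NormedAddCommGroup EN]
    [NormedSpace ℝ EN] [TopologicalSpace HN] {K : ModelWithCorners ℝ EN HN} {N : Type*}
    [TopologicalSpace N] [ChartedSpace HN N] {e : N → TotalSpace FE E} {c : ∀ n, C (e n).proj}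
    (he : ContMDiff K (I.prod 𝓘(ℝ, FE)) ∞ e)
    (hc : ContMDiff K (I.prod 𝓘(ℝ, FC)) ∞ fun n => (⟨(e n).proj, c n⟩ : TotalSpace FC C)) :
    ContMDiff K ((I.prod 𝓘(ℝ, FE)).prod 𝓘(ℝ, FDE)) ∞
      fun n => (⟨e n, κ.point (e n) (c n)⟩ : TotalSpace FDE DE) := by
  have h1 := D.toA.contMDiff.comp (κ.smooth.comp hc)
  have h2 := D.toA.contMDiff.comp ((contMDiff_zero (DE := DE)).comp he)
  have h3 := contMDiff_isSum (z := fun n => D.toA ⟨e n, κ.point (e n) (c n)⟩) h1 h2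
    fun n => κ.isPoint_iff_eq.2 rfl
  have h4 := D.toA.symm.contMDiff.comp h3
  refine h4.congr fun n => ?_
  exact (D.toA.symm_apply_apply _).symm

/-- The core section of `D → E` given by a section of `C`. -/
def Core.section (κ : D.Core FC C) (α : Sec I FC C) : Sec (I.prod 𝓘(ℝ, FE)) FDE DE :=
  ⟨fun e => κ.point e (α e.proj), κ.contMDiff_point contMDiff_id
    (α.contMDiff.comp (contMDiff_proj E))⟩

theorem Core.section_apply (κ : D.Core FC C) (α : Sec I FC C) (e : TotalSpace FE E) :
    κ.section α e = κ.point e (α e.proj) := rfl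

theorem Core.isCoreSection_iff (κ : D.Core FC C) {α : Sec I FC C}
    {Y : Sec (I.prod 𝓘(ℝ, FE)) FDE DE} : κ.IsCoreSection α Y ↔ Y = κ.section α :=
  ⟨fun h => ContMDiffSection.ext fun e => κ.isPoint_iff_eq.1 (h e),
    fun h e => h ▸ κ.isPoint_iff_eq.2 rfl⟩

namespace HorizontalLift
variable (h : D.HorizontalLift) (κ : D.Core FC C)

/-- The horizontal lift of a vector of `A`. -/
def lin (e : TotalSpace FE E) : A e.proj →ₗ[ℝ] DE e where
  toFun a := h.lift (extend a) e
  map_add' a b := by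
    have := eq_of_tensorial (I := I) (F := FA) (V := A) (m := e.proj) (fun X => h.lift X e)
      (fun X Y => by rw [h.map_add]; rfl) (fun f X => h.map_smul f X e)
      (s := extend (a + b)) (t := extend a + extend b)
      (by simp [ContMDiffSection.coe_add])
    rw [this, h.map_add]
    rfl
  map_smul' t a := by
    have := eq_of_tensorial (I := I) (F := FA) (V := A) (m := e.proj) (fun X => h.lift X e)
      (fun X Y => by rw [h.map_add]; rfl) (fun f X => h.map_smul f X e)
      (s := extend (t • a)) (t := (ContMDiffMap.const t : Fun I M) • extend a)
      (by rw [extend_apply, smul_sec_apply, extend_apply]; rfl)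
    rw [this, h.map_smul]
    rfl

theorem lift_apply (X : Sec I FA A) (e : TotalSpace FE E) : h.lift X e = h.lin e (X e.proj) :=
  eq_of_tensorial (I := I) (F := FA) (V := A) (m := e.proj) (fun X => h.lift X e)
      (fun X Y => by rw [h.map_add]; rfl) (fun f X => h.map_smul f X e) (by simp)

theorem pA_lin (e : TotalSpace FE E) (a : A e.proj) : D.pA e (h.lin e a) = a := by
  have h1 := h.projects (extend a) e
  rw [D.projA_eq, extend_apply] at h1
  exact eq_of_heq (TotalSpace.mk.inj h1).2

/-- The vector of `D` with components `a` and `c`. -/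
def phiLin (e : TotalSpace FE E) : (A e.proj × C e.proj) →ₗ[ℝ] DE e :=
  (h.lin e).coprod (κ.point e)

theorem phiLin_bijective (e : TotalSpace FE E) : Function.Bijective (h.phiLin κ e) := by
  constructor
  · refine (injective_iff_map_eq_zero _).2 ?_
    rintro ⟨a, c⟩ h0
    change h.lin e a + κ.point e c = 0 at h0
    have h1 := congrArg (D.pA e) h0
    rw [_root_.map_add, h.pA_lin, κ.pA_point, add_zero, map_zero] at h1
    subst h1
    rw [map_zero, zero_add] at h0
    have := κ.point_injective e (h0.trans (map_zero _).symm)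
    rw [this]
    rfl
  · intro v
    obtain ⟨c, hc⟩ := κ.exists_point_eq e (v - h.lin e (D.pA e v))
      (by rw [map_sub, h.pA_lin, sub_self])
    refine ⟨(D.pA e v, c), ?_⟩
    change h.lin e _ + κ.point e c = v
    rw [hc]
    exact add_sub_cancel _ _

/-- The isomorphism `A ⊕ C ≅ D` over `E`. -/
def phi (e : TotalSpace FE E) : (A e.proj × C e.proj) ≃ₗ[ℝ] DE e :=
  LinearEquiv.ofBijective (h.phiLin κ e) (h.phiLin_bijective κ e)

theorem phi_apply (e : TotalSpace FE E) (a : A e.proj) (c : C e.proj) :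
    h.phi κ e (a, c) = h.lin e a + κ.point e c := rfl

theorem contMDiff_lin {EN HN : Type*} [NormedAddCommGroup EN]
    [NormedSpace ℝ EN] [TopologicalSpace HN] {K : ModelWithCorners ℝ EN HN} {N : Type*}
    [TopologicalSpace N] [ChartedSpace HN N] {e : N → TotalSpace FE E} {a : ∀ n, A (e n).proj}
    (he : ContMDiff K (I.prod 𝓘(ℝ, FE)) ∞ e)
    (ha : ContMDiff K (I.prod 𝓘(ℝ, FA)) ∞ fun n => (⟨(e n).proj, a n⟩ : TotalSpace FA A)) :
    ContMDiff K ((I.prod 𝓘(ℝ, FE)).prod 𝓘(ℝ, FDE)) ∞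
      fun n => (⟨e n, h.lin (e n) (a n)⟩ : TotalSpace FDE DE) := by
  intro n
  let B := localBasis I FA A (e n).proj
  have h1 := contMDiffAt_sum_smul (x := n) (he n) (fun i => ((B.fn i).contMDiff.comp ha) n)
    (fun i => h.lift (B.sec i))
  refine h1.congr_of_eventuallyEq ?_
  have hp : ContinuousAt (fun n => (e n).proj) n :=
    ((contMDiff_proj (n := ∞) (IB := I) E).comp he).continuous.continuousAt
  filter_upwards [hp.eventually B.cutoff_eq] with k hk
  have h2 := B.expand (e k).proj (a k)
  rw [hk, one_smul] at h2
  conv_lhs => rw [h2]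
  rw [map_sum]
  simp only [_root_.map_smul, h.lift_apply]
  rfl

theorem contMDiff_phi :
    ContMDiff ((I.prod 𝓘(ℝ, FE)).prod 𝓘(ℝ, FA × FC)) ((I.prod 𝓘(ℝ, FE)).prod 𝓘(ℝ, FDE)) ∞
      fun d : TotalSpace (FA × FC) (PullbackSum I A FE E C) =>
        (⟨d.proj, h.phi κ d.proj d.snd⟩ : TotalSpace FDE DE) := by
  have h0 := contMDiff_pullbackSum_iff.1
    (contMDiff_id (I := (I.prod 𝓘(ℝ, FE)).prod 𝓘(ℝ, FA × FC)) (n := ∞)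
      (M := TotalSpace (FA × FC) (PullbackSum I A FE E C)))
  exact contMDiff_isSum (h.contMDiff_lin h0.1 h0.2.1) (κ.contMDiff_point h0.1 h0.2.2)
    fun d => isSum_iff.2 rfl

theorem contMDiff_phi_symm :
    ContMDiff ((I.prod 𝓘(ℝ, FE)).prod 𝓘(ℝ, FDE)) ((I.prod 𝓘(ℝ, FE)).prod 𝓘(ℝ, FA × FC)) ∞
      fun d : TotalSpace FDE DE =>
        (⟨d.proj, (h.phi κ d.proj).symm d.snd⟩ : TotalSpace (FA × FC) (PullbackSum I A FE E C)) :=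
  contMDiff_bundle_symm (V := PullbackSum I A FE E C) (V' := DE) (fun e => h.phi κ e)
    (h.contMDiff_phi κ)

theorem pA_phi (e : TotalSpace FE E) (x : A e.proj × C e.proj) : D.pA e (h.phi κ e x) = x.1 := by
  obtain ⟨a, c⟩ := x
  rw [h.phi_apply, _root_.map_add, h.pA_lin, κ.pA_point, add_zero]

theorem exists_lamAux (m : M) (a : A m) (e : E m) (c : C m) :
    ∃ y : DA ⟨m, a⟩, D.toA ⟨⟨m, e⟩, h.phi κ ⟨m, e⟩ (a, c)⟩ = ⟨⟨m, a⟩, y⟩ :=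
  exists_eq_mk _ ((D.projA_eq ⟨m, e⟩ _).trans (by rw [h.pA_phi]))

theorem isSum_lin (m : M) (a : A m) (e₁ e₂ : E m) :
    IsSum (D.toA ⟨⟨m, e₁⟩, h.lin ⟨m, e₁⟩ a⟩) (D.toA ⟨⟨m, e₂⟩, h.lin ⟨m, e₂⟩ a⟩)
      (D.toA ⟨⟨m, e₁ + e₂⟩, h.lin ⟨m, e₁ + e₂⟩ a⟩) := by
  obtain ⟨b, l, hl⟩ := h.linear (extend a) m
  have hl' : ∀ e : E m, D.toA ⟨⟨m, e⟩, h.lin ⟨m, e⟩ a⟩ = ⟨b, l e⟩ := hl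
  rw [hl', hl', hl', _root_.map_add]
  exact isSum_iff.2 rfl

theorem isSum_point (m : M) (e₁ e₂ : E m) (c₁ c₂ : C m) :
    IsSum (D.toA ⟨⟨m, e₁⟩, κ.point ⟨m, e₁⟩ c₁⟩) (D.toA ⟨⟨m, e₂⟩, κ.point ⟨m, e₂⟩ c₂⟩)
      (D.toA ⟨⟨m, e₁ + e₂⟩, κ.point ⟨m, e₁ + e₂⟩ (c₁ + c₂)⟩) := by
  rw [κ.toA_point, κ.toA_point, κ.toA_point]
  refine isSum_iff.2 ?_
  change κ.ιA m (c₁ + c₂) + D.zeroA m (e₁ + e₂) = κ.ιA m c₁ + D.zeroA m e₁ +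
    (κ.ιA m c₂ + D.zeroA m e₂)
  rw [_root_.map_add, _root_.map_add]
  abel

theorem isSum_phi (m : M) (a : A m) (e₁ e₂ : E m) (c₁ c₂ : C m) :
    IsSum (D.toA ⟨⟨m, e₁⟩, h.phi κ ⟨m, e₁⟩ (a, c₁)⟩) (D.toA ⟨⟨m, e₂⟩, h.phi κ ⟨m, e₂⟩ (a, c₂)⟩)
      (D.toA ⟨⟨m, e₁ + e₂⟩, h.phi κ ⟨m, e₁ + e₂⟩ (a, c₁ + c₂)⟩) := by
  obtain ⟨d, hd, hs⟩ := D.interchange _ _ _ _ _ _ _ _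
    (isSum_iff.2 (h.phi_apply κ ⟨m, e₁⟩ a c₁)) (isSum_iff.2 (h.phi_apply κ ⟨m, e₂⟩ a c₂))
    (h.isSum_lin m a e₁ e₂) (isSum_point κ m e₁ e₂ c₁ c₂)
  rwa [hs.unique (isSum_iff.2 (h.phi_apply κ ⟨m, e₁ + e₂⟩ a (c₁ + c₂)))] at hd

/-- The isomorphism `E ⊕ C ≅ D` over a point of `A`, as an additive map. -/
def lamAdd (m : M) (a : A m) : E m × C m →+ DA ⟨m, a⟩ :=
  AddMonoidHom.mk' (fun x => (h.exists_lamAux κ m a x.1 x.2).choose) fun x y => by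
    have hs := h.isSum_phi κ m a x.1 y.1 x.2 y.2
    rw [(h.exists_lamAux κ m a x.1 x.2).choose_spec, (h.exists_lamAux κ m a y.1 y.2).choose_spec,
      (h.exists_lamAux κ m a (x.1 + y.1) (x.2 + y.2)).choose_spec] at hs
    exact isSum_iff.1 hs

theorem toA_lamAdd (m : M) (a : A m) (x : E m × C m) :
    D.toA ⟨⟨m, x.1⟩, h.phi κ ⟨m, x.1⟩ (a, x.2)⟩ = ⟨⟨m, a⟩, h.lamAdd κ m a x⟩ :=
  (h.exists_lamAux κ m a x.1 x.2).choose_spec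

/-- The linear map `E ⊕ C → D` over a point of `A`. -/
def lam (m : M) (a : A m) : E m × C m →ₗ[ℝ] DA ⟨m, a⟩ :=
  { h.lamAdd κ m a with
    map_smul' := fun t x => by
      refine map_smul_of_continuous (F := FDA) (h.lamAdd κ m a) x ?_ t
      have h1 : (fun t : ℝ => (⟨⟨m, a⟩, h.lamAdd κ m a (t • x)⟩ : TotalSpace FDA DA)) =
          fun t : ℝ => D.toA ⟨⟨m, t • x.1⟩, h.phi κ ⟨m, t • x.1⟩ (a, t • x.2)⟩ :=
        funext fun t => (h.toA_lamAdd κ m a (t • x)).symm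
      rw [h1]
      have h2 : ContMDiff 𝓘(ℝ) ((I.prod 𝓘(ℝ, FE)).prod 𝓘(ℝ, FA × FC)) ∞ fun t : ℝ =>
          (⟨⟨m, t • x.1⟩, (a, t • x.2)⟩ : TotalSpace (FA × FC) (PullbackSum I A FE E C)) :=
        contMDiff_pullbackSum_iff.2
          ⟨contMDiff_mk_smul x.1,
            contMDiff_const (c := (⟨m, a⟩ : TotalSpace FA A)), contMDiff_mk_smul x.2⟩
      exact D.toA.continuous.comp ((h.contMDiff_phi κ).comp h2).continuous }

theorem toA_phi (m : M) (a : A m) (e : E m) (c : C m) :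
    D.toA ⟨⟨m, e⟩, h.phi κ ⟨m, e⟩ (a, c)⟩ = ⟨⟨m, a⟩, h.lam κ m a (e, c)⟩ :=
  h.toA_lamAdd κ m a (e, c)

theorem phi_eq_of_mk {e e' : TotalSpace FE E} {x : A e.proj × C e.proj} {x' : A e'.proj × C e'.proj}
    (hx : (⟨e, h.phi κ e x⟩ : TotalSpace FDE DE) = ⟨e', h.phi κ e' x'⟩) :
    (⟨e, x⟩ : TotalSpace (FA × FC) (PullbackSum I A FE E C)) = ⟨e', x'⟩ := by
  obtain ⟨h1, h2⟩ := TotalSpace.mk.inj hx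
  subst h1
  rw [(h.phi κ e).injective (eq_of_heq h2)]

theorem lam_bijective (m : M) (a : A m) : Function.Bijective (h.lam κ m a) := by
  constructor
  · rintro ⟨e, c⟩ ⟨e', c'⟩ hx
    have h1 := h.toA_phi κ m a e c
    rw [hx, ← h.toA_phi] at h1
    have h2 := h.phi_eq_of_mk κ (D.toA.injective h1)
    cases h2
    rfl
  · intro y
    obtain ⟨⟨⟨m', e⟩, v⟩, hd⟩ : ∃ d, D.toA d = ⟨⟨m, a⟩, y⟩ := D.toA.surjective _
    obtain ⟨⟨a', c⟩, rfl⟩ := (h.phi κ ⟨m', e⟩).surjective v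
    rw [h.toA_phi κ m' a' e c] at hd
    cases hd
    exact ⟨_, rfl⟩

/-- The isomorphism `E ⊕ C ≅ D` over a point of `A`. -/
def lamEquiv (m : M) (a : A m) : (E m × C m) ≃ₗ[ℝ] DA ⟨m, a⟩ :=
  LinearEquiv.ofBijective (h.lam κ m a) (h.lam_bijective κ m a)

/-- The decomposition determined by a horizontal lift. -/
def decomposition : Decomposition κ where
  iso :=
    { toFun := fun d => ⟨d.proj, (h.phi κ d.proj).symm d.snd⟩
      invFun := fun d => ⟨d.proj, h.phi κ d.proj d.snd⟩
      left_inv := fun d => congrArg (TotalSpace.mk d.proj) ((h.phi κ d.proj).apply_symm_apply _)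
      right_inv := fun d => congrArg (TotalSpace.mk d.proj) ((h.phi κ d.proj).symm_apply_apply _)
      contMDiff_toFun := h.contMDiff_phi_symm κ
      contMDiff_invFun := h.contMDiff_phi κ }
  projE _ := rfl
  projA := by
    rintro ⟨e, v⟩
    obtain ⟨x, rfl⟩ := (h.phi κ e).surjective v
    rw [D.projA_eq, h.pA_phi]
    change (⟨e.proj, ((h.phi κ e).symm (h.phi κ e x)).1⟩ : TotalSpace FA A) = _
    rw [LinearEquiv.symm_apply_apply]
  linearE e := ⟨e, (h.phi κ e).symm.toLinearMap, fun _ => rfl⟩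
  linearA := by
    rintro ⟨m, a⟩
    refine ⟨⟨m, a⟩, (h.lamEquiv κ m a).symm.toLinearMap, fun v => ?_⟩
    obtain ⟨⟨e, c⟩, rfl⟩ := (h.lamEquiv κ m a).surjective v
    have h1 : D.toA.symm ⟨⟨m, a⟩, h.lamEquiv κ m a (e, c)⟩ =
        ⟨⟨m, e⟩, h.phi κ ⟨m, e⟩ (a, c)⟩ := by
      rw [← D.toA.symm_apply_apply ⟨⟨m, e⟩, h.phi κ ⟨m, e⟩ (a, c)⟩, h.toA_phi]
      rfl
    change (decomposed I FA A FE E FC C).toA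
      ⟨(D.toA.symm ⟨⟨m, a⟩, h.lamEquiv κ m a (e, c)⟩).proj, (h.phi κ _).symm
        (D.toA.symm ⟨⟨m, a⟩, h.lamEquiv κ m a (e, c)⟩).snd⟩ = _
    rw [h1]
    rw [LinearEquiv.symm_apply_apply]
    change _ = (⟨⟨m, a⟩, (h.lamEquiv κ m a).symm (h.lamEquiv κ m a (e, c))⟩ :
      TotalSpace (FE × FC) (PullbackSum I E FA A C))
    rw [LinearEquiv.symm_apply_apply]
    rfl
  core := by
    rintro ⟨m, c⟩
    obtain ⟨v, hv⟩ := κ.exists_ι m c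
    have h1 : v = h.phi κ ⟨m, 0⟩ (0, c) := by
      rw [h.phi_apply, map_zero, zero_add]
      refine κ.isPoint_iff_eq.1 ?_
      rw [κ.isPoint_iff, ← hv, κ.toA_ι, map_zero, add_zero]
    rw [hv, h1]
    change (⟨⟨m, 0⟩, (h.phi κ ⟨m, 0⟩).symm (h.phi κ ⟨m, 0⟩ (0, c))⟩ :
      TotalSpace (FA × FC) (PullbackSum I A FE E C)) = _
    rw [LinearEquiv.symm_apply_apply]
    rfl

theorem decomposition_apply (e : TotalSpace FE E) (v : DE e) :
    (h.decomposition κ).iso ⟨e, v⟩ = ⟨e, (h.phi κ e).symm v⟩ := rfl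

theorem decomposition_induces : (h.decomposition κ).Induces h := by
  intro X e
  change (⟨e, (h.phi κ e).symm (h.lift X e)⟩ : TotalSpace (FA × FC) (PullbackSum I A FE E C)) = _
  have h1 : h.lift X e = h.phi κ e (X e.proj, 0) := by
    rw [h.phi_apply, map_zero, add_zero, h.lift_apply]
  rw [h1, LinearEquiv.symm_apply_apply]
  rfl

end HorizontalLift

end DoubleVectorBundle

end DVB

section DVB
set_option linter.unusedSectionVars false
variable {EM : Type*} [NormedAddCommGroup EM] [NormedSpace ℝ EM] [FiniteDimensional ℝ EM]
  {HM : Type*} [TopologicalSpace HM] {I : ModelWithCorners ℝ EM HM}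
  {M : Type*} [TopologicalSpace M] [T2Space M] [ChartedSpace HM M] [IsManifold I ∞ M]
  {FA : Type*} [NormedAddCommGroup FA] [NormedSpace ℝ FA] [FiniteDimensional ℝ FA]
  {A : M → Type*} [TopologicalSpace (TotalSpace FA A)] [∀ m, AddCommGroup (A m)]
  [∀ m, Module ℝ (A m)] [∀ m, TopologicalSpace (A m)] [FiberBundle FA A] [VectorBundle ℝ FA A]
  [ContMDiffVectorBundle ∞ FA A I]
  {FE : Type*} [NormedAddCommGroup FE] [NormedSpace ℝ FE] [FiniteDimensional ℝ FE]
  {E : M → Type*} [TopologicalSpace (TotalSpace FE E)] [∀ m, AddCommGroup (E m)]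
  [∀ m, Module ℝ (E m)] [∀ m, TopologicalSpace (E m)] [FiberBundle FE E] [VectorBundle ℝ FE E]
  [ContMDiffVectorBundle ∞ FE E I]
  {FC : Type*} [NormedAddCommGroup FC] [NormedSpace ℝ FC] [FiniteDimensional ℝ FC]
  {C : M → Type*} [TopologicalSpace (TotalSpace FC C)] [∀ m, AddCommGroup (C m)]
  [∀ m, Module ℝ (C m)] [∀ m, TopologicalSpace (C m)] [FiberBundle FC C] [VectorBundle ℝ FC C]
  [ContMDiffVectorBundle ∞ FC C I]
  {FDE : Type*} [NormedAddCommGroup FDE] [NormedSpace ℝ FDE] [FiniteDimensional ℝ FDE]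
  {DE : TotalSpace FE E → Type*} [TopologicalSpace (TotalSpace FDE DE)]
  [∀ e, AddCommGroup (DE e)] [∀ e, Module ℝ (DE e)] [∀ e, TopologicalSpace (DE e)]
  [FiberBundle FDE DE] [VectorBundle ℝ FDE DE] [ContMDiffVectorBundle ∞ FDE DE (I.prod 𝓘(ℝ, FE))]
  {FDA : Type*} [NormedAddCommGroup FDA] [NormedSpace ℝ FDA] [FiniteDimensional ℝ FDA]
  {DA : TotalSpace FA A → Type*} [TopologicalSpace (TotalSpace FDA DA)]
  [∀ a, AddCommGroup (DA a)] [∀ a, Module ℝ (DA a)] [∀ a, TopologicalSpace (DA a)]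
  [FiberBundle FDA DA] [VectorBundle ℝ FDA DA] [ContMDiffVectorBundle ∞ FDA DA (I.prod 𝓘(ℝ, FA))]

namespace Decomposition
variable {D : DoubleVectorBundle I FA A FE E FDE DE FDA DA} {κ : D.Core FC C}

theorem ext_iso {Ψ Ψ' : Decomposition κ} (h : ∀ d, Ψ.iso d = Ψ'.iso d) : Ψ = Ψ' := by
  obtain ⟨i, h1, h2, h3, h4, h5⟩ := Ψ
  obtain ⟨i', h1', h2', h3', h4', h5'⟩ := Ψ'
  obtain rfl : i = i' := Diffeomorph.ext h
  rfl

theorem exists_linear (Ψ : Decomposition κ) (e : TotalSpace FE E) :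
    ∃ l : DE e ≃ₗ[ℝ] A e.proj × C e.proj,
      ∀ v, Ψ.iso ⟨e, v⟩ = (⟨e, l v⟩ : TotalSpace (FA × FC) (PullbackSum I A FE E C)) := by
  obtain ⟨b, l, hl⟩ := Ψ.linearE e
  obtain rfl : b = e := by
    have h1 := Ψ.projE ⟨e, 0⟩
    rw [hl] at h1
    exact h1
  refine ⟨LinearEquiv.ofBijective l ⟨fun v w hvw => ?_, fun x => ?_⟩, hl⟩
  · have h1 := hl v
    rw [hvw, ← hl w] at h1
    have h2 := Ψ.iso.injective h1
    cases h2
    rfl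
  · obtain ⟨⟨e', v⟩, hd⟩ : ∃ d, Ψ.iso d =
        (⟨b, x⟩ : TotalSpace (FA × FC) (PullbackSum I A FE E C)) := Ψ.iso.surjective _
    have h1 := Ψ.projE ⟨e', v⟩
    rw [hd] at h1
    change b = e' at h1
    subst h1
    refine ⟨v, ?_⟩
    rw [hl] at hd
    exact eq_of_heq (TotalSpace.mk.inj hd).2

theorem exists_linearA (Ψ : Decomposition κ) (m : M) (a : A m) :
    ∃ l : DA ⟨m, a⟩ ≃ₗ[ℝ] E m × C m, ∀ v,
      (decomposed I FA A FE E FC C).toA (Ψ.iso (D.toA.symm ⟨⟨m, a⟩, v⟩)) =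
        (⟨⟨m, a⟩, l v⟩ : TotalSpace (FE × FC) (PullbackSum I E FA A C)) := by
  obtain ⟨b, l, hl⟩ := Ψ.linearA ⟨m, a⟩
  obtain rfl : b = ⟨m, a⟩ := by
    have h1 := Ψ.projA (D.toA.symm ⟨⟨m, a⟩, 0⟩)
    have h2 := hl 0
    rw [D.toA.apply_symm_apply] at h1
    dsimp only at h2
    rw [h2] at h1
    exact h1
  refine ⟨LinearEquiv.ofBijective l ⟨fun v w hvw => ?_, fun x => ?_⟩, hl⟩
  · have h1 := hl v
    rw [hvw, ← hl w] at h1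
    have h2 := D.toA.symm.injective (Ψ.iso.injective
      ((decomposed I FA A FE E FC C).toA.injective h1))
    cases h2
    rfl
  · obtain ⟨d, hd⟩ : ∃ d, (decomposed I FA A FE E FC C).toA d =
        (⟨⟨m, a⟩, x⟩ : TotalSpace (FE × FC) (PullbackSum I E FA A C)) :=
      (decomposed I FA A FE E FC C).toA.surjective _
    obtain ⟨d', rfl⟩ : ∃ d', Ψ.iso d' = d := Ψ.iso.surjective _
    obtain ⟨⟨b', v⟩, rfl⟩ : ∃ d'', D.toA.symm d'' = d' := D.toA.symm.surjective _
    have h1 := Ψ.projA (D.toA.symm ⟨b', v⟩)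
    rw [hd, D.toA.apply_symm_apply] at h1
    change (⟨m, a⟩ : TotalSpace FA A) = b' at h1
    subst h1
    refine ⟨v, ?_⟩
    have h2 := hl v
    dsimp only at h2
    rw [hd] at h2
    exact (eq_of_heq (TotalSpace.mk.inj h2).2).symm

theorem iso_point (Ψ : Decomposition κ) (e : TotalSpace FE E) (c : C e.proj) :
    Ψ.iso ⟨e, κ.point e c⟩ =
      (⟨e, ((0 : A e.proj), c)⟩ : TotalSpace (FA × FC) (PullbackSum I A FE E C)) := by
  obtain ⟨l, hl⟩ := Ψ.exists_linearA e.proj 0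
  obtain ⟨k, hk⟩ := Ψ.exists_linear e
  have h0 := hl (D.zeroA e.proj e.snd)
  rw [← D.toA_zero, D.toA.symm_apply_apply] at h0
  change (decomposed I FA A FE E FC C).toA (Ψ.iso ⟨e, 0⟩) = _ at h0
  rw [hk, map_zero] at h0
  have h1 := hl (κ.ιA e.proj c)
  rw [← κ.toA_ι, D.toA.symm_apply_apply, Ψ.core] at h1
  have h2 := hl (κ.ιA e.proj c + D.zeroA e.proj e.snd)
  rw [← κ.toA_point, D.toA.symm_apply_apply, map_add] at h2
  have h3 : l (D.zeroA e.proj e.snd) = (e.snd, 0) := (eq_of_heq (TotalSpace.mk.inj h0).2).symm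
  have h4 : l (κ.ιA e.proj c) = (0, c) := (eq_of_heq (TotalSpace.mk.inj h1).2).symm
  rw [h3, h4] at h2
  apply (decomposed I FA A FE E FC C).toA.injective
  refine h2.trans ?_
  refine congrArg (TotalSpace.mk (⟨e.proj, 0⟩ : TotalSpace FA A)) ?_
  exact Prod.ext (zero_add e.snd) (add_zero c)

theorem eq_decomposition {Ψ : Decomposition κ} {h : D.HorizontalLift} (hΨ : Ψ.Induces h) :
    Ψ = h.decomposition κ := by
  refine ext_iso ?_
  rintro ⟨e, v⟩
  obtain ⟨⟨a, c⟩, rfl⟩ := (h.phi κ e).surjective v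
  rw [h.decomposition_apply, LinearEquiv.symm_apply_apply, h.phi_apply]
  obtain ⟨k, hk⟩ := Ψ.exists_linear e
  have h1 := hΨ (extend a) e
  rw [hk, h.lift_apply, extend_apply] at h1
  have h2 := Ψ.iso_point e c
  rw [hk] at h2
  have h3 : k (h.lin e a) = (a, 0) := (eq_of_heq (TotalSpace.mk.inj h1).2).trans
    (Prod.ext (extend_apply (I := I) (F := FA) a) rfl)
  have h4 : k (κ.point e c) = (0, c) := eq_of_heq (TotalSpace.mk.inj h2).2
  rw [hk, map_add, h3, h4, Prod.mk_add_mk, add_zero, zero_add]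

/-- The horizontal lift determined by a decomposition. -/
def horizontalLift (Ψ : Decomposition κ) : D.HorizontalLift where
  lift X := ⟨fun e => (Ψ.exists_linear e).choose.symm (X e.proj, 0), by
    have h1 := Ψ.iso.symm.contMDiff.comp ((decomposedLift I FA A FE E FC C).lift X).contMDiff
    refine h1.congr fun e => Ψ.iso.injective (((Ψ.exists_linear e).choose_spec _).trans ?_)
    rw [LinearEquiv.apply_symm_apply]
    exact (Ψ.iso.apply_symm_apply _).symm⟩
  map_add X Y := by
    refine ContMDiffSection.ext fun e => ?_
    change (Ψ.exists_linear e).choose.symm (X e.proj + Y e.proj, 0) =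
      (Ψ.exists_linear e).choose.symm (X e.proj, 0) + (Ψ.exists_linear e).choose.symm (Y e.proj, 0)
    rw [← map_add, Prod.mk_add_mk, add_zero]
  map_smul f X e := by
    change (Ψ.exists_linear e).choose.symm (f e.proj • X e.proj, 0) =
      f e.proj • (Ψ.exists_linear e).choose.symm (X e.proj, 0)
    rw [← map_smul, Prod.smul_mk, smul_zero]
  linear X m := by
    obtain ⟨l, hl⟩ := Ψ.exists_linearA m (X m)
    refine ⟨⟨m, X m⟩, l.symm.toLinearMap ∘ₗ LinearMap.inl ℝ (E m) (C m), fun e => ?_⟩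
    change D.toA ⟨⟨m, e⟩, (Ψ.exists_linear ⟨m, e⟩).choose.symm (X m, 0)⟩ = ⟨_, l.symm (e, 0)⟩
    have h1 := hl (l.symm (e, 0))
    rw [l.apply_symm_apply] at h1
    have h2 := (Ψ.exists_linear ⟨m, e⟩).choose_spec
      ((Ψ.exists_linear ⟨m, e⟩).choose.symm (X m, 0))
    rw [LinearEquiv.apply_symm_apply] at h2
    rw [← D.toA.apply_symm_apply ⟨⟨m, X m⟩, l.symm (e, 0)⟩]
    refine congrArg D.toA (Ψ.iso.injective ((decomposed I FA A FE E FC C).toA.injective ?_))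
    exact (congrArg (decomposed I FA A FE E FC C).toA h2).trans h1.symm
  projects X e := by
    rw [← Ψ.projA]
    change ((decomposed I FA A FE E FC C).toA (Ψ.iso ⟨e,
      (Ψ.exists_linear e).choose.symm (X e.proj, 0)⟩)).proj = _
    rw [(Ψ.exists_linear e).choose_spec, LinearEquiv.apply_symm_apply]
    rfl

theorem induces_horizontalLift (Ψ : Decomposition κ) : Ψ.Induces Ψ.horizontalLift := fun X e => by
  change Ψ.iso ⟨e, (Ψ.exists_linear e).choose.symm (X e.proj, 0)⟩ = _
  rw [(Ψ.exists_linear e).choose_spec, LinearEquiv.apply_symm_apply]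
  rfl

theorem Induces.unique {Ψ : Decomposition κ} {h h' : D.HorizontalLift} (hΨ : Ψ.Induces h)
    (hΨ' : Ψ.Induces h') : h = h' := by
  refine DoubleVectorBundle.HorizontalLift.ext (funext fun X => ContMDiffSection.ext fun e => ?_)
  have h1 := Ψ.iso.injective ((hΨ X e).trans (hΨ' X e).symm)
  exact eq_of_heq (TotalSpace.mk.inj h1).2

variable (κ) in
theorem existsUnique_induces :
    (∀ h : D.HorizontalLift, ∃! Ψ : Decomposition κ, Ψ.Induces h) ∧
      ∀ Ψ : Decomposition κ, ∃! h : D.HorizontalLift, Ψ.Induces h :=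
  ⟨fun h => ⟨h.decomposition κ, h.decomposition_induces κ, fun _ hΨ => eq_decomposition hΨ⟩,
    fun Ψ => ⟨Ψ.horizontalLift, Ψ.induces_horizontalLift,
      fun _ hΨ => hΨ.unique Ψ.induces_horizontalLift⟩⟩

end Decomposition

end DVB

section LocalBases
set_option linter.unusedSectionVars false
variable {EM HM : Type*} [NormedAddCommGroup EM] [NormedSpace ℝ EM] [FiniteDimensional ℝ EM]
  [TopologicalSpace HM] {I : ModelWithCorners ℝ EM HM} {M : Type*} [TopologicalSpace M] [T2Space M]
  [ChartedSpace HM M] [IsManifold I ∞ M]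
  {F : Type*} [NormedAddCommGroup F] [NormedSpace ℝ F] [FiniteDimensional ℝ F]
  {V : M → Type*} [TopologicalSpace (TotalSpace F V)] [∀ m, AddCommGroup (V m)]
  [∀ m, Module ℝ (V m)] [∀ m, TopologicalSpace (V m)] [FiberBundle F V] [VectorBundle ℝ F V]
  [ContMDiffVectorBundle ∞ F V I]


namespace IsFiberLinear
variable {f g : Fun (I.prod 𝓘(ℝ, F)) (TotalSpace F V)}

theorem zero : IsFiberLinear (0 : Fun (I.prod 𝓘(ℝ, F)) (TotalSpace F V)) := fun _ =>
  ⟨fun _ _ => (add_zero _).symm, fun _ _ => (smul_zero _).symm⟩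

theorem add (hf : IsFiberLinear f) (hg : IsFiberLinear g) : IsFiberLinear (f + g) := fun m =>
  ⟨fun u v => (congrArg₂ (· + ·) ((hf m).map_add u v) ((hg m).map_add u v)).trans
    (add_add_add_comm _ _ _ _), fun c u =>
    (congrArg₂ (· + ·) ((hf m).map_smul c u) ((hg m).map_smul c u)).trans (smul_add _ _ _).symm⟩

theorem pull_mul (hf : IsFiberLinear f) (k : Fun I M) : IsFiberLinear (pull k * f) := fun m =>
  ⟨fun u v => by
    change k m * f ⟨m, u + v⟩ = k m * f ⟨m, u⟩ + k m * f ⟨m, v⟩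
    rw [(hf m).map_add, mul_add], fun c u => by
    change k m * f ⟨m, c • u⟩ = c * (k m * f ⟨m, u⟩)
    rw [(hf m).map_smul, smul_eq_mul]; ring⟩

theorem neg (hf : IsFiberLinear f) : IsFiberLinear (-f) := fun m =>
  ⟨fun u v => (congrArg Neg.neg ((hf m).map_add u v)).trans (neg_add _ _), fun c u =>
    (congrArg Neg.neg ((hf m).map_smul c u)).trans (smul_neg _ _).symm⟩

theorem pairing_add (hf : IsFiberLinear f) (s t : Sec I F V) :
    pairing f (s + t) = pairing f s + pairing f t := by
  ext m
  exact (hf m).map_add _ _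

theorem pairing_smul (hf : IsFiberLinear f) (k : Fun I M) (s : Sec I F V) :
    pairing f (k • s) = k * pairing f s := by
  ext m
  exact (hf m).map_smul _ _

theorem pairing_zero (hf : IsFiberLinear f) : pairing f (0 : Sec I F V) = 0 := by
  ext m
  exact (hf m).map_zero

theorem pairing_neg (hf : IsFiberLinear f) (s : Sec I F V) :
    pairing f (-s) = -pairing f s := by
  ext m
  exact (hf m).map_neg _

theorem pairing_sub (hf : IsFiberLinear f) (s t : Sec I F V) :
    pairing f (s - t) = pairing f s - pairing f t := by
  ext m
  exact (hf m).map_sub _ _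

end IsFiberLinear

theorem add_pairing (f g : Fun (I.prod 𝓘(ℝ, F)) (TotalSpace F V)) (s : Sec I F V) :
    pairing (f + g) s = pairing f s + pairing g s := rfl

theorem sub_pairing (f g : Fun (I.prod 𝓘(ℝ, F)) (TotalSpace F V)) (s : Sec I F V) :
    pairing (f - g) s = pairing f s - pairing g s := rfl

theorem pull_mul_pairing (k : Fun I M) (f : Fun (I.prod 𝓘(ℝ, F)) (TotalSpace F V)) (s : Sec I F V) :
    pairing (pull k * f) s = k * pairing f s := rfl

theorem fun_sum_apply {EN HN : Type*} [NormedAddCommGroup EN] [NormedSpace ℝ EN]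
    [TopologicalSpace HN] {K : ModelWithCorners ℝ EN HN} {N : Type*} [TopologicalSpace N]
    [ChartedSpace HN N] {ι : Type*} (t : Finset ι) (f : ι → Fun K N) (x : N) :
    (∑ i ∈ t, f i) x = ∑ i ∈ t, f i x :=
  map_sum (AddMonoidHom.mk' (fun f : Fun K N => f x) fun _ _ => rfl) f t

variable (I F V) in
/-- The fibrewise linear functions. -/
def fiberLinear : AddSubgroup (Fun (I.prod 𝓘(ℝ, F)) (TotalSpace F V)) where
  carrier := {f | IsFiberLinear f}
  zero_mem' := .zero
  add_mem' := .add
  neg_mem' := .neg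

namespace LocalBasis
variable {m₀ : M} (B : LocalBasis I F V m₀)

theorem expand_sec (s : Sec I F V) : B.cutoff • s = ∑ i, pairing (B.fn i) s • B.sec i := by
  ext x
  rw [sec_sum_apply]
  exact B.expand x (s x)

theorem expand_fn {f : Fun (I.prod 𝓘(ℝ, F)) (TotalSpace F V)} (hf : IsFiberLinear f) :
    pull B.cutoff * f = ∑ i, pull (pairing f (B.sec i)) * B.fn i := by
  ext y
  rw [fun_sum_apply]
  change B.cutoff y.proj * f ⟨y.proj, y.snd⟩ = _
  have e2 := (hf y.proj).map_smul (B.cutoff y.proj) y.snd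
  rw [B.expand] at e2
  refine e2.symm.trans ((map_sum ((hf y.proj).mk' _) _ _).trans ?_)
  refine Finset.sum_congr rfl fun i _ => ?_
  rw [map_smul, mul_comm]
  rfl

/-- The coordinates of a section. -/
def coord (i : Fin B.n) : Sec I F V →ₗ[Fun I M] Fun I M where
  toFun := pairing (B.fn i)
  map_add' := (B.linear i).pairing_add
  map_smul' := (B.linear i).pairing_smul

end LocalBasis

theorem sec_ext_pairing {s t : Sec I F V}
    (h : ∀ f : Fun (I.prod 𝓘(ℝ, F)) (TotalSpace F V), IsFiberLinear f → pairing f s = pairing f t) :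
    s = t := by
  ext m
  let B := localBasis I F V m
  rw [← B.expand_self (s m), ← B.expand_self (t m)]
  exact Finset.sum_congr rfl fun i _ =>
    congrArg (fun k : Fun I M => k m • B.sec i m) (h _ (B.linear i))

/-- A section is the same as a `C^∞(M)`-linear functional on fibrewise linear functions. -/
theorem exists_sec_pairing (R : Fun (I.prod 𝓘(ℝ, F)) (TotalSpace F V) → Fun I M)
    (hadd : ∀ f g, IsFiberLinear f → IsFiberLinear g → R (f + g) = R f + R g)
    (hmul : ∀ (g : Fun I M) f, IsFiberLinear f → R (pull g * f) = g * R f) :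
    ∃ s : Sec I F V, ∀ f, IsFiberLinear f → pairing f s = R f := by
  let R' : fiberLinear I F V →+ Fun I M :=
    AddMonoidHom.mk' (fun f => R f.1) fun f g => hadd _ _ f.2 g.2
  let s : ∀ m, V m := fun m =>
    ∑ i, R ((localBasis I F V m).fn i) m • (localBasis I F V m).sec i m
  have hs : ∀ f, IsFiberLinear f → ∀ m, f ⟨m, s m⟩ = R f m := fun f hf m => by
    let B := localBasis I F V m
    let k : Fin B.n → fiberLinear I F V := fun i =>
      ⟨pull (pairing f (B.sec i)) * B.fn i, (B.linear i).pull_mul _⟩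
    have h1 : (∑ i, k i).1 = pull B.cutoff * f := by
      rw [B.expand_fn hf]
      exact map_sum (fiberLinear I F V).subtype k Finset.univ
    have h2 : R (pull B.cutoff * f) = ∑ i, pairing f (B.sec i) * R (B.fn i) := by
      rw [← h1]
      exact (map_sum R' k Finset.univ).trans
        (Finset.sum_congr rfl fun i _ => hmul _ _ (B.linear i))
    rw [hmul _ _ hf] at h2
    have h3 := congrArg (fun g : Fun I M => g m) h2
    rw [fun_sum_apply] at h3
    change B.cutoff m * R f m = _ at h3
    rw [B.cutoff_self, one_mul] at h3
    rw [h3]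
    refine (map_sum ((hf m).mk' _) _ _).trans (Finset.sum_congr rfl fun i _ => ?_)
    rw [map_smul]
    exact mul_comm _ _
  refine ⟨⟨s, contMDiff_of_fiberLinear contMDiff_id fun f hf => ?_⟩, fun f hf => ?_⟩
  · have h : (fun x => f ⟨x, s x⟩) = R f := funext (hs f hf)
    rw [h]
    exact (R f).contMDiff
  · ext m
    exact hs f hf m

section Hom
variable {F' : Type*} [NormedAddCommGroup F'] [NormedSpace ℝ F']
  {V' : M → Type*} [TopologicalSpace (TotalSpace F' V')] [∀ m, AddCommGroup (V' m)]
  [∀ m, Module ℝ (V' m)] [∀ m, TopologicalSpace (V' m)] [FiberBundle F' V'] [VectorBundle ℝ F' V']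
  [ContMDiffVectorBundle ∞ F' V' I]

/-- The bundle map given by a `C^∞(M)`-linear map of sections. -/
def homMap (Φ : Sec I F V →ₗ[Fun I M] Sec I F' V') (m : M) (v : V m) : V' m := Φ (extend v) m

theorem homMap_apply (Φ : Sec I F V →ₗ[Fun I M] Sec I F' V') (m : M) (s : Sec I F V) :
    homMap Φ m (s m) = Φ s m :=
  eq_of_tensorial (fun s => Φ s m) (fun s t => by rw [map_add]; rfl)
    (fun f s => by rw [map_smul]; rfl) (by simp)

theorem isLinearMap_homMap (Φ : Sec I F V →ₗ[Fun I M] Sec I F' V') (m : M) :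
    IsLinearMap ℝ (homMap Φ m) where
  map_add u v := by
    have h := homMap_apply Φ m (extend u + extend v)
    rw [map_add] at h
    change homMap Φ m ((extend u : Sec I F V) m + (extend v : Sec I F V) m) = _ at h
    rw [extend_apply, extend_apply] at h
    exact h
  map_smul c u := by
    have h := homMap_apply Φ m ((ContMDiffMap.const c : Fun I M) • extend u)
    rw [map_smul, smul_sec_apply, extend_apply] at h
    exact h

theorem contMDiff_homMap (Φ : Sec I F V →ₗ[Fun I M] Sec I F' V') :
    ContMDiff (I.prod 𝓘(ℝ, F)) (I.prod 𝓘(ℝ, F')) ∞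
      (fun x : TotalSpace F V => (⟨x.proj, homMap Φ x.proj x.snd⟩ : TotalSpace F' V')) := by
  intro x
  let B := localBasis I F V x.proj
  have h1 := contMDiffAt_sum_smul (x := x) (contMDiff_proj V x) (fun i => (B.fn i).contMDiff x)
    (fun i => Φ (B.sec i))
  refine h1.congr_of_eventuallyEq ?_
  filter_upwards [(FiberBundle.continuous_proj F V).continuousAt.eventually B.cutoff_eq] with y hy
  have h2 := B.expand y.proj y.snd
  rw [hy, one_smul] at h2
  have h3 := map_sum ((isLinearMap_homMap Φ y.proj).mk' _)
    (fun i => B.fn i ⟨y.proj, y.snd⟩ • B.sec i y.proj) Finset.univ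
  rw [← h2] at h3
  refine congrArg (TotalSpace.mk y.proj) (h3.trans (Finset.sum_congr rfl fun i _ => ?_))
  rw [map_smul]
  exact congrArg _ (homMap_apply Φ y.proj (B.sec i))

/-- The `C^∞(M)`-linear map of sections given by a smooth bundle map. -/
def homOf (g : ∀ m, V m →ₗ[ℝ] V' m) (hg : ContMDiff (I.prod 𝓘(ℝ, F)) (I.prod 𝓘(ℝ, F')) ∞
      (fun x : TotalSpace F V => (⟨x.proj, g x.proj x.snd⟩ : TotalSpace F' V'))) :
    Sec I F V →ₗ[Fun I M] Sec I F' V' where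
  toFun s := ⟨fun m => g m (s m), hg.comp s.contMDiff⟩
  map_add' s t := by
    ext m
    exact map_add (g m) (s m) (t m)
  map_smul' f s := by
    ext m
    exact map_smul (g m) (f m) (s m)

variable (I F V F' V') in
/-- A pair of sections as a section of the direct sum. -/
def secProd : (Sec I F V × Sec I F' V') ≃ Sec I (F × F') (V ×ᵇ V') where
  toFun p := ⟨fun m => (p.1 m, p.2 m), contMDiff_prodBundle_iff.2 ⟨p.1.contMDiff, p.2.contMDiff⟩⟩
  invFun s := (⟨fun m => (s m).1, (contMDiff_prodBundle_iff.1 s.contMDiff).1⟩,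
    ⟨fun m => (s m).2, (contMDiff_prodBundle_iff.1 s.contMDiff).2⟩)
  left_inv _ := rfl
  right_inv _ := rfl

end Hom

end LocalBases

section Bracket
set_option linter.unusedSectionVars false
variable {EM HM : Type*} [NormedAddCommGroup EM] [NormedSpace ℝ EM] [TopologicalSpace HM]
  (I : ModelWithCorners ℝ EM HM) {M : Type*} [TopologicalSpace M] [ChartedSpace HM M]
  [IsManifold I ∞ M]
  (F : Type*) [NormedAddCommGroup F] [NormedSpace ℝ F]
  (V : M → Type*) [TopologicalSpace (TotalSpace F V)] [∀ m, AddCommGroup (V m)]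
  [∀ m, Module ℝ (V m)] [∀ m, TopologicalSpace (V m)] [FiberBundle F V] [VectorBundle ℝ F V]

variable {I F V} in
theorem sum_sec_apply {ι : Type*} (t : Finset ι) (s : ι → Sec I F V) (m : M) :
    (∑ i ∈ t, s i) m = ∑ i ∈ t, s i m :=
  map_sum (AddMonoidHom.mk' (fun s : Sec I F V => s m) fun _ _ => rfl) s t

/-- An anchor and a bracket that satisfy the Leibniz rule. -/
structure AnchoredBracket where
  anchor : ∀ m, V m →ₗ[ℝ] TangentSpace I m
  anchor_smooth : ContMDiff (I.prod 𝓘(ℝ, F)) I.tangent ∞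
    (fun v : TotalSpace F V => (⟨v.proj, anchor v.proj v.snd⟩ : TangentBundle I M))
  bracket : Sec I F V → Sec I F V → Sec I F V
  bracket_add_left : ∀ X Y Z, bracket (X + Y) Z = bracket X Z + bracket Y Z
  bracket_skew : ∀ X Y, bracket X Y = - bracket Y X
  leibniz : ∀ X (f : Fun I M) Y m, bracket X (f • Y) m =
    f m • bracket X Y m + dd (anchor m (X m)) f • Y m

variable {I F V}

/-- The anchor and the bracket of a Lie algebroid. -/
def LieAlgebroid.toAnchoredBracket (S : LieAlgebroid I F V) : AnchoredBracket I F V where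
  anchor := S.anchor
  anchor_smooth := S.anchor_smooth
  bracket := S.bracket
  bracket_add_left := S.bracket_add_left
  bracket_skew := S.bracket_skew
  leibniz := S.leibniz

namespace AnchoredBracket
variable (S : AnchoredBracket I F V)

theorem smooth_anchor (X : Sec I F V) :
    ContMDiff I I.tangent ∞ fun m => (⟨m, S.anchor m (X m)⟩ : TangentBundle I M) :=
  S.anchor_smooth.comp X.contMDiff

/-- The derivative of a function along the anchor of a section. -/
def deriv (X : Sec I F V) (f : Fun I M) : Fun I M :=
  ⟨fun m => dd (S.anchor m (X m)) f, contMDiff_fieldDeriv (S.smooth_anchor X) f.contMDiff⟩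

theorem deriv_apply (X : Sec I F V) (f : Fun I M) (m : M) :
    S.deriv X f m = dd (S.anchor m (X m)) f := rfl

theorem deriv_add_left (X Y : Sec I F V) (f : Fun I M) :
    S.deriv (X + Y) f = S.deriv X f + S.deriv Y f := by
  ext m
  change dd (S.anchor m (X m + Y m)) f = _
  rw [map_add, dd_add_left]
  rfl

theorem deriv_smul_left (g : Fun I M) (X : Sec I F V) (f : Fun I M) :
    S.deriv (g • X) f = g * S.deriv X f := by
  ext m
  change dd (S.anchor m (g m • X m)) f = _
  rw [map_smul, dd_smul_left]
  rfl

theorem deriv_add_right (X : Sec I F V) (f g : Fun I M) :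
    S.deriv X (f + g) = S.deriv X f + S.deriv X g := by
  ext m
  exact dd_add _ f g

theorem deriv_mul (X : Sec I F V) (f g : Fun I M) :
    S.deriv X (f * g) = f * S.deriv X g + S.deriv X f * g := by
  ext m
  exact dd_mul _ f g

theorem bracket_add_right (X Y Z : Sec I F V) :
    S.bracket X (Y + Z) = S.bracket X Y + S.bracket X Z := by
  rw [S.bracket_skew, S.bracket_add_left, S.bracket_skew X Y, S.bracket_skew X Z]; abel

theorem bracket_smul_right (X : Sec I F V) (f : Fun I M) (Y : Sec I F V) :
    S.bracket X (f • Y) = f • S.bracket X Y + S.deriv X f • Y := by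
  ext m; exact S.leibniz X f Y m

theorem bracket_smul_left (f : Fun I M) (X Y : Sec I F V) :
    S.bracket (f • X) Y = f • S.bracket X Y - S.deriv Y f • X := by
  rw [S.bracket_skew, S.bracket_smul_right, S.bracket_skew Y X, smul_neg]; abel

/-- The bracket as a biadditive map. -/
def bracketHom : Sec I F V →+ Sec I F V →+ Sec I F V :=
  AddMonoidHom.mk' (fun X => AddMonoidHom.mk' (S.bracket X) (S.bracket_add_right X)) fun X Y =>
    AddMonoidHom.ext fun Z => S.bracket_add_left X Y Z

theorem bracket_sum_left {ι : Type*} (t : Finset ι) (s : ι → Sec I F V) (Y : Sec I F V) :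
    S.bracket (∑ i ∈ t, s i) Y = ∑ i ∈ t, S.bracket (s i) Y :=
  map_sum (S.bracketHom.flip Y) s t

theorem bracket_sum_right {ι : Type*} (t : Finset ι) (s : ι → Sec I F V) (X : Sec I F V) :
    S.bracket X (∑ i ∈ t, s i) = ∑ i ∈ t, S.bracket X (s i) :=
  map_sum (S.bracketHom X) s t

theorem bracket_sub_left (X Y Z : Sec I F V) :
    S.bracket (X - Y) Z = S.bracket X Z - S.bracket Y Z := map_sub (S.bracketHom.flip Z) X Y

theorem bracket_sub_right (X Y Z : Sec I F V) :
    S.bracket X (Y - Z) = S.bracket X Y - S.bracket X Z := map_sub (S.bracketHom X) Y Z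

theorem bracket_neg_right (X Y : Sec I F V) : S.bracket X (-Y) = -S.bracket X Y :=
  map_neg (S.bracketHom X) Y

theorem bracket_zero_right (X : Sec I F V) : S.bracket X 0 = 0 := map_zero (S.bracketHom X)

variable [CompleteSpace EM]

/-- An anchored bracket satisfying the Jacobi identity and compatible with its anchor is a
Lie algebroid. -/
def toLieAlgebroid (hJ : ∀ X Y Z, S.bracket X (S.bracket Y Z) + S.bracket Y (S.bracket Z X)
      + S.bracket Z (S.bracket X Y) = 0)
    (hA : ∀ X Y m, S.anchor m (S.bracket X Y m) =
      VectorField.mlieBracket I (fun x => S.anchor x (X x)) (fun x => S.anchor x (Y x)) m) :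
    LieAlgebroid I F V where
  anchor := S.anchor
  anchor_smooth := S.anchor_smooth
  bracket := S.bracket
  bracket_add_left := S.bracket_add_left
  bracket_smul_left c X Y := by
    have h := S.bracket_smul_left (ContMDiffMap.const c) X Y
    have h0 : S.deriv Y (ContMDiffMap.const c) = 0 := by
      ext m
      change mfderiv I 𝓘(ℝ) (fun _ => c) m (S.anchor m (Y m)) = 0
      rw [mfderiv_const]
      rfl
    rw [h0, zero_smul, sub_zero] at h
    exact h
  bracket_skew := S.bracket_skew
  jacobi := hJ
  leibniz := S.leibniz
  anchor_bracket := hA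

theorem dd_mlieBracket (X Y : Sec I F V) (f : Fun I M) (m : M) :
    dd (VectorField.mlieBracket I (fun x => S.anchor x (X x)) (fun x => S.anchor x (Y x)) m) f =
      (S.deriv X (S.deriv Y f) - S.deriv Y (S.deriv X f)) m :=
  mvfderiv_mlieBracket (S.smooth_anchor X) (S.smooth_anchor Y) f.contMDiff m

end AnchoredBracket
end Bracket

section Frames
set_option linter.unusedSectionVars false
variable {EM HM : Type*} [NormedAddCommGroup EM] [NormedSpace ℝ EM] [FiniteDimensional ℝ EM]
  [TopologicalSpace HM] {I : ModelWithCorners ℝ EM HM} {M : Type*} [TopologicalSpace M] [T2Space M]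
  [ChartedSpace HM M] [IsManifold I ∞ M]
  {FE : Type*} [NormedAddCommGroup FE] [NormedSpace ℝ FE] [FiniteDimensional ℝ FE]
  {E : M → Type*} [TopologicalSpace (TotalSpace FE E)] [∀ m, AddCommGroup (E m)]
  [∀ m, Module ℝ (E m)] [∀ m, TopologicalSpace (E m)] [FiberBundle FE E] [VectorBundle ℝ FE E]
  [ContMDiffVectorBundle ∞ FE E I]
  {FW : Type*} [NormedAddCommGroup FW] [NormedSpace ℝ FW] [FiniteDimensional ℝ FW]
  {W : M → Type*} [TopologicalSpace (TotalSpace FW W)] [∀ m, AddCommGroup (W m)]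
  [∀ m, Module ℝ (W m)] [∀ m, TopologicalSpace (W m)] [FiberBundle FW W] [VectorBundle ℝ FW W]
  [ContMDiffVectorBundle ∞ FW W I]
  {FD : Type*} [NormedAddCommGroup FD] [NormedSpace ℝ FD] [FiniteDimensional ℝ FD]
  {DE : TotalSpace FE E → Type*} [TopologicalSpace (TotalSpace FD DE)]
  [∀ e, AddCommGroup (DE e)] [∀ e, Module ℝ (DE e)] [∀ e, TopologicalSpace (DE e)]
  [FiberBundle FD DE] [VectorBundle ℝ FD DE] [ContMDiffVectorBundle ∞ FD DE (I.prod 𝓘(ℝ, FE))]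

variable (I FE E FW W FD DE) in
/-- An identification of a vector bundle `DE` over the total space of `E → M` with the pullback of
the vector bundle `W → M`. -/
structure Framing where
  toEquiv : ∀ e : TotalSpace FE E, W e.proj ≃ₗ[ℝ] DE e
  sec : Sec I FW W → Sec (I.prod 𝓘(ℝ, FE)) FD DE
  sec_apply : ∀ p e, sec p e = toEquiv e (p e.proj)
  smooth_symm : ∀ σ : Sec (I.prod 𝓘(ℝ, FE)) FD DE, ContMDiff (I.prod 𝓘(ℝ, FE)) (I.prod 𝓘(ℝ, FW)) ∞
    fun e => (⟨e.proj, (toEquiv e).symm (σ e)⟩ : TotalSpace FW W)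

namespace Framing
variable (Φ : Framing I FE E FW W FD DE)

theorem sec_add (p q : Sec I FW W) : Φ.sec (p + q) = Φ.sec p + Φ.sec q := by
  ext e
  change _ = Φ.sec p e + Φ.sec q e
  rw [Φ.sec_apply, Φ.sec_apply, Φ.sec_apply, ← map_add]
  rfl

theorem sec_smul (f : Fun I M) (p : Sec I FW W) :
    Φ.sec (f • p) = (pull f : Fun (I.prod 𝓘(ℝ, FE)) (TotalSpace FE E)) • Φ.sec p := by
  ext e
  rw [smul_sec_apply, Φ.sec_apply, Φ.sec_apply, smul_sec_apply, map_smul]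
  rfl

/-- The coordinate of a section given by a fibrewise linear function on `W`. -/
def coord (l : Fun (I.prod 𝓘(ℝ, FW)) (TotalSpace FW W)) (σ : Sec (I.prod 𝓘(ℝ, FE)) FD DE) :
    Fun (I.prod 𝓘(ℝ, FE)) (TotalSpace FE E) :=
  ⟨fun e => l ⟨e.proj, (Φ.toEquiv e).symm (σ e)⟩, l.contMDiff.comp (Φ.smooth_symm σ)⟩

variable {l : Fun (I.prod 𝓘(ℝ, FW)) (TotalSpace FW W)}

theorem coord_add (hl : IsFiberLinear l) (σ τ : Sec (I.prod 𝓘(ℝ, FE)) FD DE) :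
    Φ.coord l (σ + τ) = Φ.coord l σ + Φ.coord l τ := by
  ext e
  change l ⟨e.proj, (Φ.toEquiv e).symm (σ e + τ e)⟩ = _
  rw [map_add, (hl e.proj).map_add]
  rfl

theorem coord_smul (hl : IsFiberLinear l) (g : Fun (I.prod 𝓘(ℝ, FE)) (TotalSpace FE E))
    (σ : Sec (I.prod 𝓘(ℝ, FE)) FD DE) : Φ.coord l (g • σ) = g * Φ.coord l σ := by
  ext e
  change l ⟨e.proj, (Φ.toEquiv e).symm (g e • σ e)⟩ = _
  rw [map_smul, (hl e.proj).map_smul]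
  rfl

theorem coord_sec (p : Sec I FW W) : Φ.coord l (Φ.sec p) = pull (pairing l p) := by
  ext e
  change l ⟨e.proj, (Φ.toEquiv e).symm (Φ.sec p e)⟩ = _
  rw [Φ.sec_apply, LinearEquiv.symm_apply_apply]
  rfl

theorem expand {m₀ : M} (B : LocalBasis I FW W m₀) (σ : Sec (I.prod 𝓘(ℝ, FE)) FD DE) :
    (pull B.cutoff : Fun (I.prod 𝓘(ℝ, FE)) (TotalSpace FE E)) • σ =
      ∑ i, Φ.coord (B.fn i) σ • Φ.sec (B.sec i) := by
  ext e
  rw [sum_sec_apply, smul_sec_apply]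
  have h := congrArg (Φ.toEquiv e) (B.expand e.proj ((Φ.toEquiv e).symm (σ e)))
  rw [map_smul, LinearEquiv.apply_symm_apply, map_sum] at h
  refine h.trans (Finset.sum_congr rfl fun i _ => ?_)
  rw [map_smul, smul_sec_apply, Φ.sec_apply]
  rfl

theorem expand_apply (e : TotalSpace FE E) (σ : Sec (I.prod 𝓘(ℝ, FE)) FD DE) :
    σ e = ∑ i, Φ.coord ((localBasis I FW W e.proj).fn i) σ e •
      Φ.sec ((localBasis I FW W e.proj).sec i) e := by
  have h := congrArg (fun s : Sec (I.prod 𝓘(ℝ, FE)) FD DE => s e)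
    (Φ.expand (localBasis I FW W e.proj) σ)
  simp only [sum_sec_apply, smul_sec_apply, pull_apply, LocalBasis.cutoff_self, one_smul] at h
  exact h

/-- A tensorial map that vanishes on generators vanishes. -/
theorem eq_zero_of_tensorial {Y : Type*} [AddCommGroup Y] [Module ℝ Y] {e : TotalSpace FE E}
    (R : Sec (I.prod 𝓘(ℝ, FE)) FD DE → Y) (hadd : ∀ σ τ, R (σ + τ) = R σ + R τ)
    (hsmul : ∀ (g : Fun (I.prod 𝓘(ℝ, FE)) (TotalSpace FE E)) σ, R (g • σ) = g e • R σ)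
    (h : ∀ p, R (Φ.sec p) = 0) (σ : Sec (I.prod 𝓘(ℝ, FE)) FD DE) : R σ = 0 := by
  have h1 := congrArg R (Φ.expand (localBasis I FW W e.proj) σ)
  rw [hsmul, pull_apply, LocalBasis.cutoff_self, one_smul] at h1
  rw [h1]
  refine (map_sum (AddMonoidHom.mk' R hadd) _ _).trans (Finset.sum_eq_zero fun i _ => ?_)
  change R _ = 0
  rw [hsmul, h, smul_zero]

theorem sec_eq_zero_of_tensorial
    (R : Sec (I.prod 𝓘(ℝ, FE)) FD DE → Sec (I.prod 𝓘(ℝ, FE)) FD DE)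
    (hadd : ∀ σ τ, R (σ + τ) = R σ + R τ)
    (hsmul : ∀ (g : Fun (I.prod 𝓘(ℝ, FE)) (TotalSpace FE E)) σ, R (g • σ) = g • R σ)
    (h : ∀ p, R (Φ.sec p) = 0) (σ : Sec (I.prod 𝓘(ℝ, FE)) FD DE) : R σ = 0 := by
  ext e
  exact Φ.eq_zero_of_tensorial (e := e) (fun σ => R σ e) (fun σ τ => by rw [hadd]; rfl)
    (fun g σ => by rw [hsmul]; rfl) (fun p => by rw [h]; rfl) σ

theorem dd_pull_cutoff {m₀ : M} (B : LocalBasis I FW W m₀) {e : TotalSpace FE E}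
    (he : ∀ᶠ m in nhds e.proj, B.cutoff m = 1) (v : TangentSpace (I.prod 𝓘(ℝ, FE)) e) :
    dd v (pull B.cutoff) = 0 := by
  have h1 : ⇑(pull B.cutoff : Fun (I.prod 𝓘(ℝ, FE)) (TotalSpace FE E)) =ᶠ[nhds e]
      ⇑(1 : Fun (I.prod 𝓘(ℝ, FE)) (TotalSpace FE E)) :=
    (FiberBundle.continuous_proj FE E).continuousAt.eventually he
  rw [dd_congr v h1]
  have h2 := dd_mul v (1 : Fun (I.prod 𝓘(ℝ, FE)) (TotalSpace FE E)) 1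
  have h3 : (1 : Fun (I.prod 𝓘(ℝ, FE)) (TotalSpace FE E)) e = 1 := rfl
  rw [mul_one, h3] at h2
  linarith

/-- A derivation of `Γ(DE)` is determined by its values on generators, which can be prescribed. -/
theorem exists_derivation (v : Fun (I.prod 𝓘(ℝ, FE)) (TotalSpace FE E) →
      Fun (I.prod 𝓘(ℝ, FE)) (TotalSpace FE E))
    (U : ∀ e : TotalSpace FE E, TangentSpace (I.prod 𝓘(ℝ, FE)) e) (hv : ∀ g e, v g e = dd (U e) g)
    (T : Sec I FW W → Sec (I.prod 𝓘(ℝ, FE)) FD DE) (hadd : ∀ p q, T (p + q) = T p + T q)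
    (hT : ∀ (f : Fun I M) p, T (f • p) =
      (pull f : Fun (I.prod 𝓘(ℝ, FE)) (TotalSpace FE E)) • T p + v (pull f) • Φ.sec p) :
    ∃ T' : Sec (I.prod 𝓘(ℝ, FE)) FD DE → Sec (I.prod 𝓘(ℝ, FE)) FD DE,
      (∀ σ τ, T' (σ + τ) = T' σ + T' τ) ∧ (∀ g σ, T' (g • σ) = g • T' σ + v g • σ) ∧
      ∀ p, T' (Φ.sec p) = T p := by
  let B := fun m : M => localBasis I FW W m
  let t : Sec (I.prod 𝓘(ℝ, FE)) FD DE → ∀ e, DE e := fun σ e =>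
    ∑ i, (Φ.coord ((B e.proj).fn i) σ e • T ((B e.proj).sec i) e +
      v (Φ.coord ((B e.proj).fn i) σ) e • Φ.sec ((B e.proj).sec i) e)
  have t_add : ∀ σ τ e, t (σ + τ) e = t σ e + t τ e := fun σ τ e => by
    simp only [t]
    rw [← Finset.sum_add_distrib]
    refine Finset.sum_congr rfl fun i _ => ?_
    rw [Φ.coord_add ((B e.proj).linear i), hv, hv, hv, dd_add, ContMDiffMap.coe_add, Pi.add_apply,
      add_smul, add_smul]
    abel
  have t_smul : ∀ g σ e, t (g • σ) e = g e • t σ e + v g e • σ e := fun g σ e => by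
    simp only [t]
    have h := Φ.expand_apply e σ
    conv_rhs => rw [h]
    rw [Finset.smul_sum, Finset.smul_sum, ← Finset.sum_add_distrib]
    refine Finset.sum_congr rfl fun i _ => ?_
    rw [Φ.coord_smul ((B e.proj).linear i), hv, hv, hv, dd_mul, ContMDiffMap.coe_mul, Pi.mul_apply]
    rw [add_smul, mul_smul, mul_smul, mul_smul, smul_add]
    abel
  have t_sec : ∀ p e, t (Φ.sec p) e = T p e := fun p e => by
    have h1 : T ((B e.proj).cutoff • p) = ∑ i, T (pairing ((B e.proj).fn i) p • (B e.proj).sec i) := by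
      rw [(B e.proj).expand_sec]
      exact map_sum (AddMonoidHom.mk' T hadd) _ _
    have h2 := congrArg (fun s : Sec (I.prod 𝓘(ℝ, FE)) FD DE => s e) h1
    simp only [hT, sum_sec_apply] at h2
    change (B e.proj).cutoff e.proj • T p e + v (pull (B e.proj).cutoff) e • Φ.sec p e = _ at h2
    rw [(B e.proj).cutoff_self, one_smul, hv, dd_pull_cutoff _ (B e.proj).cutoff_eq, zero_smul,
      add_zero] at h2
    rw [h2]
    simp only [t]
    refine Finset.sum_congr rfl fun i _ => ?_
    rw [Φ.coord_sec]
    rfl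
  have t_smooth : ∀ σ, ContMDiff (I.prod 𝓘(ℝ, FE)) ((I.prod 𝓘(ℝ, FE)).prod 𝓘(ℝ, FD)) ∞
      fun e => (⟨e, t σ e⟩ : TotalSpace FD DE) := fun σ e₀ => by
    let B₀ := B e₀.proj
    let s : Sec (I.prod 𝓘(ℝ, FE)) FD DE := ∑ i, (Φ.coord (B₀.fn i) σ • T (B₀.sec i) +
      v (Φ.coord (B₀.fn i) σ) • Φ.sec (B₀.sec i))
    refine (s.contMDiff e₀).congr_of_eventuallyEq ?_
    filter_upwards [((FiberBundle.continuous_proj FE E).continuousAt.eventually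
      B₀.cutoff_eq.eventually_nhds)] with e he
    refine congrArg (TotalSpace.mk e) ?_
    have h1 := t_smul (pull B₀.cutoff) σ e
    rw [hv, dd_pull_cutoff B₀ he, zero_smul, add_zero, pull_apply, he.self_of_nhds, one_smul,
      Φ.expand B₀] at h1
    rw [← h1]
    refine (map_sum (AddMonoidHom.mk' (fun σ => t σ e) fun σ τ => t_add σ τ e) _ _).trans ?_
    simp only [s]
    rw [sum_sec_apply]
    refine Finset.sum_congr rfl fun i _ => ?_
    change t _ e = _
    rw [t_smul, t_sec]
    rfl
  refine ⟨fun σ => ⟨t σ, t_smooth σ⟩, fun σ τ => ?_, fun g σ => ?_, fun p => ?_⟩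
  · ext e
    exact t_add σ τ e
  · ext e
    exact t_smul g σ e
  · ext e
    exact t_sec p e

end Framing
end Frames

section DVB
set_option linter.unusedSectionVars false
variable {EM : Type*} [NormedAddCommGroup EM] [NormedSpace ℝ EM] [FiniteDimensional ℝ EM]
  {HM : Type*} [TopologicalSpace HM] {I : ModelWithCorners ℝ EM HM}
  {M : Type*} [TopologicalSpace M] [T2Space M] [ChartedSpace HM M] [IsManifold I ∞ M]
  {FA : Type*} [NormedAddCommGroup FA] [NormedSpace ℝ FA] [FiniteDimensional ℝ FA]
  {A : M → Type*} [TopologicalSpace (TotalSpace FA A)] [∀ m, AddCommGroup (A m)]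
  [∀ m, Module ℝ (A m)] [∀ m, TopologicalSpace (A m)] [FiberBundle FA A] [VectorBundle ℝ FA A]
  [ContMDiffVectorBundle ∞ FA A I]
  {FE : Type*} [NormedAddCommGroup FE] [NormedSpace ℝ FE] [FiniteDimensional ℝ FE]
  {E : M → Type*} [TopologicalSpace (TotalSpace FE E)] [∀ m, AddCommGroup (E m)]
  [∀ m, Module ℝ (E m)] [∀ m, TopologicalSpace (E m)] [FiberBundle FE E] [VectorBundle ℝ FE E]
  [ContMDiffVectorBundle ∞ FE E I]
  {FC : Type*} [NormedAddCommGroup FC] [NormedSpace ℝ FC] [FiniteDimensional ℝ FC]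
  {C : M → Type*} [TopologicalSpace (TotalSpace FC C)] [∀ m, AddCommGroup (C m)]
  [∀ m, Module ℝ (C m)] [∀ m, TopologicalSpace (C m)] [FiberBundle FC C] [VectorBundle ℝ FC C]
  [ContMDiffVectorBundle ∞ FC C I]
  {FDE : Type*} [NormedAddCommGroup FDE] [NormedSpace ℝ FDE] [FiniteDimensional ℝ FDE]
  {DE : TotalSpace FE E → Type*} [TopologicalSpace (TotalSpace FDE DE)]
  [∀ e, AddCommGroup (DE e)] [∀ e, Module ℝ (DE e)] [∀ e, TopologicalSpace (DE e)]
  [FiberBundle FDE DE] [VectorBundle ℝ FDE DE] [ContMDiffVectorBundle ∞ FDE DE (I.prod 𝓘(ℝ, FE))]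
  {FDA : Type*} [NormedAddCommGroup FDA] [NormedSpace ℝ FDA] [FiniteDimensional ℝ FDA]
  {DA : TotalSpace FA A → Type*} [TopologicalSpace (TotalSpace FDA DA)]
  [∀ a, AddCommGroup (DA a)] [∀ a, Module ℝ (DA a)] [∀ a, TopologicalSpace (DA a)]
  [FiberBundle FDA DA] [VectorBundle ℝ FDA DA] [ContMDiffVectorBundle ∞ FDA DA (I.prod 𝓘(ℝ, FA))]

namespace DoubleVectorBundle
variable {D : DoubleVectorBundle I FA A FE E FDE DE FDA DA}

theorem projectsTo_iff {σ : Sec (I.prod 𝓘(ℝ, FE)) FDE DE} {X : Sec I FA A} :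
    D.ProjectsTo σ X ↔ ∀ e, D.pA e (σ e) = X e.proj := by
  refine forall_congr' fun e => ?_
  rw [D.projA_eq]
  exact ⟨fun h => eq_of_heq (TotalSpace.mk.inj h).2, fun h => by rw [h]⟩

/-- The section of `A` to which a section of `D → E` projects along the zero section. -/
def projSec (σ : Sec (I.prod 𝓘(ℝ, FE)) FDE DE) : Sec I FA A :=
  ⟨fun m => D.pA ⟨m, 0⟩ (σ ⟨m, 0⟩), by
    have h1 := (contMDiff_proj DA (n := ∞) (IB := I.prod 𝓘(ℝ, FA))).comp
      (D.toA.contMDiff.comp (σ.contMDiff.comp (contMDiff_zeroSection ℝ E (IB := I) (n := ∞))))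
    refine h1.congr fun m => ?_
    exact (D.projA_eq ⟨m, 0⟩ (σ ⟨m, 0⟩)).symm⟩

namespace Core
variable (κ : D.Core FC C)

theorem section_add (α β : Sec I FC C) : κ.section (α + β) = κ.section α + κ.section β := by
  ext e
  exact map_add (κ.point e) (α e.proj) (β e.proj)

theorem section_smul (f : Fun I M) (α : Sec I FC C) :
    κ.section (f • α) = (pull f : Fun (I.prod 𝓘(ℝ, FE)) (TotalSpace FE E)) • κ.section α := by
  ext e
  exact map_smul (κ.point e) (f e.proj) (α e.proj)

theorem section_injective : Function.Injective κ.section := fun α β h => by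
  ext m
  exact κ.point_injective ⟨m, 0⟩
    (congrArg (fun s : Sec (I.prod 𝓘(ℝ, FE)) FDE DE => s ⟨m, 0⟩) h)

theorem section_zero : κ.section (0 : Sec I FC C) = 0 := by
  ext e
  exact map_zero (κ.point e)

theorem section_sub (α β : Sec I FC C) : κ.section (α - β) = κ.section α - κ.section β := by
  ext e
  exact map_sub (κ.point e) (α e.proj) (β e.proj)

/-- The linear section of `D → E` given by a bundle map `E → C`. -/
def homSec (Φ : Sec I FE E →ₗ[Fun I M] Sec I FC C) : Sec (I.prod 𝓘(ℝ, FE)) FDE DE :=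
  ⟨fun e => κ.point e (homMap Φ e.proj e.snd), κ.contMDiff_point contMDiff_id
    (contMDiff_homMap Φ)⟩

theorem homSec_apply (Φ : Sec I FE E →ₗ[Fun I M] Sec I FC C) (m : M) (ε : Sec I FE E) :
    κ.homSec Φ ⟨m, ε m⟩ = κ.point ⟨m, ε m⟩ (Φ ε m) :=
  congrArg (κ.point ⟨m, ε m⟩) (homMap_apply Φ m ε)

theorem ext_mk_sec {σ τ : Sec (I.prod 𝓘(ℝ, FE)) FDE DE}
    (h : ∀ (m : M) (ε : Sec I FE E), σ ⟨m, ε m⟩ = τ ⟨m, ε m⟩) : σ = τ := by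
  refine ContMDiffSection.ext ?_
  rintro ⟨m, e⟩
  have h1 := h m (extend e)
  rwa [extend_apply] at h1

theorem homSec_add (Φ Ψ : Sec I FE E →ₗ[Fun I M] Sec I FC C) :
    κ.homSec (Φ + Ψ) = κ.homSec Φ + κ.homSec Ψ := by
  refine ContMDiffSection.ext fun e => ?_
  exact map_add (κ.point e) (homMap Φ e.proj e.snd) (homMap Ψ e.proj e.snd)

theorem homSec_neg (Φ : Sec I FE E →ₗ[Fun I M] Sec I FC C) : κ.homSec (-Φ) = -κ.homSec Φ := by
  refine ContMDiffSection.ext fun e => ?_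
  exact map_neg (κ.point e) (homMap Φ e.proj e.snd)

theorem homSec_sub (Φ Ψ : Sec I FE E →ₗ[Fun I M] Sec I FC C) :
    κ.homSec (Φ - Ψ) = κ.homSec Φ - κ.homSec Ψ := by
  rw [sub_eq_add_neg, homSec_add, homSec_neg, sub_eq_add_neg]

theorem homSec_zero : κ.homSec (0 : Sec I FE E →ₗ[Fun I M] Sec I FC C) = 0 := by
  refine ContMDiffSection.ext fun e => ?_
  exact map_zero (κ.point e)

theorem homSec_smul (f : Fun I M) (Φ : Sec I FE E →ₗ[Fun I M] Sec I FC C) :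
    κ.homSec (f • Φ) = (pull f : Fun (I.prod 𝓘(ℝ, FE)) (TotalSpace FE E)) • κ.homSec Φ := by
  refine ContMDiffSection.ext fun e => ?_
  exact map_smul (κ.point e) (f e.proj) (homMap Φ e.proj e.snd)

theorem homSec_injective :
    Function.Injective (κ.homSec : (Sec I FE E →ₗ[Fun I M] Sec I FC C) → _) := fun Φ Ψ h => by
  refine LinearMap.ext fun ε => ContMDiffSection.ext fun m => ?_
  refine κ.point_injective ⟨m, ε m⟩ ?_
  rw [← κ.homSec_apply, ← κ.homSec_apply, h]

theorem expand_homSec {m₀ : M} (B : LocalBasis I FE E m₀)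
    (Φ : Sec I FE E →ₗ[Fun I M] Sec I FC C) :
    (pull B.cutoff : Fun (I.prod 𝓘(ℝ, FE)) (TotalSpace FE E)) • κ.homSec Φ =
      ∑ i, B.fn i • κ.section (Φ (B.sec i)) := by
  refine ext_mk_sec fun m ε => ?_
  rw [sum_sec_apply, smul_sec_apply, κ.homSec_apply, ← map_smul]
  have h1 := congrArg Φ (B.expand_sec ε)
  rw [map_smul, map_sum] at h1
  have h2 := congrArg (fun s : Sec I FC C => s m) h1
  rw [sum_sec_apply, smul_sec_apply] at h2
  rw [pull_apply, h2, map_sum]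
  refine Finset.sum_congr rfl fun i _ => ?_
  rw [map_smul, smul_sec_apply, map_smul]
  rfl

end Core

theorem sec_ext_pull {σ τ : Sec (I.prod 𝓘(ℝ, FE)) FDE DE}
    (h : ∀ m₀ : M, ∃ k : Fun I M, k m₀ = 1 ∧
      (pull k : Fun (I.prod 𝓘(ℝ, FE)) (TotalSpace FE E)) • σ =
        (pull k : Fun (I.prod 𝓘(ℝ, FE)) (TotalSpace FE E)) • τ) : σ = τ := by
  ext e
  obtain ⟨k, hk, h⟩ := h e.proj
  have h1 := congrArg (fun s : Sec (I.prod 𝓘(ℝ, FE)) FDE DE => s e) h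
  simp only [smul_sec_apply, pull_apply, hk, one_smul] at h1
  exact h1

namespace HorizontalLift
variable (h : D.HorizontalLift) (κ : D.Core FC C)

theorem lift_smul (f : Fun I M) (X : Sec I FA A) :
    h.lift (f • X) = (pull f : Fun (I.prod 𝓘(ℝ, FE)) (TotalSpace FE E)) • h.lift X := by
  ext e
  exact h.map_smul f X e

theorem lift_zero : h.lift 0 = 0 :=
  _root_.map_zero (AddMonoidHom.mk' h.lift h.map_add)

theorem lift_neg (X : Sec I FA A) : h.lift (-X) = -h.lift X :=
  _root_.map_neg (AddMonoidHom.mk' h.lift h.map_add) X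

/-- The core component of a vector of `D`. -/
def pC (e : TotalSpace FE E) : DE e →ₗ[ℝ] C e.proj :=
  LinearMap.snd ℝ (A e.proj) (C e.proj) ∘ₗ (h.phi κ e).symm.toLinearMap

theorem phi_symm (e : TotalSpace FE E) (v : DE e) :
    (h.phi κ e).symm v = (D.pA e v, h.pC κ e v) := by
  refine Prod.ext ?_ rfl
  rw [← h.pA_phi κ e, LinearEquiv.apply_symm_apply]

theorem phi_pA_pC (e : TotalSpace FE E) (v : DE e) :
    h.phi κ e (D.pA e v, h.pC κ e v) = v := by
  rw [← h.phi_symm, LinearEquiv.apply_symm_apply]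

theorem lin_add_point (e : TotalSpace FE E) (v : DE e) :
    h.lin e (D.pA e v) + κ.point e (h.pC κ e v) = v := h.phi_pA_pC κ e v

theorem contMDiff_components (σ : Sec (I.prod 𝓘(ℝ, FE)) FDE DE) :
    ContMDiff (I.prod 𝓘(ℝ, FE)) (I.prod 𝓘(ℝ, FA)) ∞
      (fun e : TotalSpace FE E => (⟨e.proj, D.pA e (σ e)⟩ : TotalSpace FA A)) ∧
    ContMDiff (I.prod 𝓘(ℝ, FE)) (I.prod 𝓘(ℝ, FC)) ∞
      (fun e : TotalSpace FE E => (⟨e.proj, h.pC κ e (σ e)⟩ : TotalSpace FC C)) := by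
  have h1 := contMDiff_pullbackSum_iff.1 ((h.contMDiff_phi_symm κ).comp σ.contMDiff)
  refine ⟨h1.2.1.congr fun e => ?_, h1.2.2⟩
  change (⟨e.proj, D.pA e (σ e)⟩ : TotalSpace FA A) = ⟨e.proj, ((h.phi κ e).symm (σ e)).1⟩
  rw [h.phi_symm]

/-- The identification of `D → E` with the pullback of `A ⊕ C` determined by a horizontal lift. -/
def framing : Framing I FE E (FA × FC) (A ×ᵇ C) FDE DE where
  toEquiv e := h.phi κ e
  sec p := h.lift ((secProd I FA A FC C).symm p).1 + κ.section ((secProd I FA A FC C).symm p).2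
  sec_apply p e := by
    change h.lift _ e + κ.point e _ = _
    rw [h.lift_apply]
    rfl
  smooth_symm σ := by
    have h1 := h.contMDiff_components κ σ
    refine contMDiff_prodBundle_iff.2 ⟨h1.1.congr fun e => ?_, h1.2⟩
    change (⟨e.proj, ((h.phi κ e).symm (σ e)).1⟩ : TotalSpace FA A) = ⟨e.proj, D.pA e (σ e)⟩
    rw [h.phi_symm]

theorem framing_sec (X : Sec I FA A) (α : Sec I FC C) :
    (h.framing κ).sec (secProd I FA A FC C (X, α)) = h.lift X + κ.section α := rfl

theorem pA_lift_add_homSec (X : Sec I FA A) (Φ : Sec I FE E →ₗ[Fun I M] Sec I FC C)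
    (e : TotalSpace FE E) : D.pA e ((h.lift X + κ.homSec Φ) e) = X e.proj := by
  change D.pA e (h.lift X e + κ.point e _) = _
  rw [h.lift_apply, _root_.map_add, h.pA_lin, κ.pA_point, add_zero]

theorem isLinear_lift_add_homSec (X : Sec I FA A) (Φ : Sec I FE E →ₗ[Fun I M] Sec I FC C) :
    D.IsLinear (h.lift X + κ.homSec Φ) := fun m => by
  refine ⟨⟨m, X m⟩, h.lam κ m (X m) ∘ₗ
    (LinearMap.id.prod ((isLinearMap_homMap Φ m).mk' _)), fun e => ?_⟩
  refine Eq.trans ?_ (h.toA_phi κ m (X m) e (homMap Φ m e))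
  change D.toA ⟨⟨m, e⟩, h.lift X ⟨m, e⟩ + κ.point ⟨m, e⟩ (homMap Φ m e)⟩ = _
  rw [h.lift_apply]
  rfl

/-- A linear section is the sum of a horizontal lift and a bundle map `E → C`. -/
theorem exists_eq_of_isLinear {σ : Sec (I.prod 𝓘(ℝ, FE)) FDE DE} (hσ : D.IsLinear σ) :
    ∃ X Φ, σ = h.lift X + κ.homSec Φ := by
  have key : ∀ m, (∀ e, D.pA ⟨m, e⟩ (σ ⟨m, e⟩) = D.projSec σ m) ∧
      IsLinearMap ℝ (fun e : E m => h.pC κ ⟨m, e⟩ (σ ⟨m, e⟩)) := fun m => by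
    obtain ⟨b, l, hl'⟩ := hσ m
    have hl : ∀ e : E m, D.toA ⟨⟨m, e⟩, σ ⟨m, e⟩⟩ = ⟨b, l e⟩ := hl'
    have h1 : ∀ e : E m, b = ⟨m, D.pA ⟨m, e⟩ (σ ⟨m, e⟩)⟩ := fun e => by
      have h2 := D.projA_eq ⟨m, e⟩ (σ ⟨m, e⟩)
      rw [hl e] at h2
      exact h2
    have h2 : ∀ e, D.pA ⟨m, e⟩ (σ ⟨m, e⟩) = D.projSec σ m := fun e =>
      eq_of_heq (TotalSpace.mk.inj ((h1 e).symm.trans (h1 0))).2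
    obtain rfl : b = ⟨m, D.projSec σ m⟩ := h1 0
    refine ⟨h2, ?_⟩
    have h3 : ∀ e : E m, h.pC κ ⟨m, e⟩ (σ ⟨m, e⟩) = ((h.lamEquiv κ m _).symm (l e)).2 := fun e => by
      have h4 := h.toA_phi κ m (D.projSec σ m) e (h.pC κ ⟨m, e⟩ (σ ⟨m, e⟩))
      have h5 := h.phi_pA_pC κ ⟨m, e⟩ (σ ⟨m, e⟩)
      rw [h2] at h5
      rw [h5] at h4
      have h6 := eq_of_heq (TotalSpace.mk.inj ((hl e).symm.trans h4)).2
      rw [h6]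
      change _ = ((h.lamEquiv κ m _).symm (h.lamEquiv κ m _ (e, _))).2
      rw [LinearEquiv.symm_apply_apply]
    exact ⟨fun u v => by rw [h3, h3, h3, _root_.map_add, _root_.map_add]; rfl,
      fun c u => by rw [h3, h3, _root_.map_smul, _root_.map_smul]; rfl⟩
  refine ⟨D.projSec σ, homOf (fun m => (key m).2.mk' _) (h.contMDiff_components κ σ).2, ?_⟩
  refine Core.ext_mk_sec fun m ε => ?_
  change _ = h.lift (D.projSec σ) ⟨m, ε m⟩ + κ.homSec _ ⟨m, ε m⟩
  rw [κ.homSec_apply, h.lift_apply, ← (key m).1 (ε m)]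
  exact (h.lin_add_point κ ⟨m, ε m⟩ (σ ⟨m, ε m⟩)).symm

end HorizontalLift
end DoubleVectorBundle

end DVB

section DVB
set_option linter.unusedSectionVars false
variable {EM : Type*} [NormedAddCommGroup EM] [NormedSpace ℝ EM] [FiniteDimensional ℝ EM]
  {HM : Type*} [TopologicalSpace HM] {I : ModelWithCorners ℝ EM HM}
  {M : Type*} [TopologicalSpace M] [T2Space M] [ChartedSpace HM M] [IsManifold I ∞ M]
  {FA : Type*} [NormedAddCommGroup FA] [NormedSpace ℝ FA] [FiniteDimensional ℝ FA]
  {A : M → Type*} [TopologicalSpace (TotalSpace FA A)] [∀ m, AddCommGroup (A m)]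
  [∀ m, Module ℝ (A m)] [∀ m, TopologicalSpace (A m)] [FiberBundle FA A] [VectorBundle ℝ FA A]
  [ContMDiffVectorBundle ∞ FA A I]
  {FE : Type*} [NormedAddCommGroup FE] [NormedSpace ℝ FE] [FiniteDimensional ℝ FE]
  {E : M → Type*} [TopologicalSpace (TotalSpace FE E)] [∀ m, AddCommGroup (E m)]
  [∀ m, Module ℝ (E m)] [∀ m, TopologicalSpace (E m)] [FiberBundle FE E] [VectorBundle ℝ FE E]
  [ContMDiffVectorBundle ∞ FE E I]
  {FC : Type*} [NormedAddCommGroup FC] [NormedSpace ℝ FC] [FiniteDimensional ℝ FC]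
  {C : M → Type*} [TopologicalSpace (TotalSpace FC C)] [∀ m, AddCommGroup (C m)]
  [∀ m, Module ℝ (C m)] [∀ m, TopologicalSpace (C m)] [FiberBundle FC C] [VectorBundle ℝ FC C]
  [ContMDiffVectorBundle ∞ FC C I]
  {FDE : Type*} [NormedAddCommGroup FDE] [NormedSpace ℝ FDE] [FiniteDimensional ℝ FDE]
  {DE : TotalSpace FE E → Type*} [TopologicalSpace (TotalSpace FDE DE)]
  [∀ e, AddCommGroup (DE e)] [∀ e, Module ℝ (DE e)] [∀ e, TopologicalSpace (DE e)]
  [FiberBundle FDE DE] [VectorBundle ℝ FDE DE] [ContMDiffVectorBundle ∞ FDE DE (I.prod 𝓘(ℝ, FE))]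
  {FDA : Type*} [NormedAddCommGroup FDA] [NormedSpace ℝ FDA] [FiniteDimensional ℝ FDA]
  {DA : TotalSpace FA A → Type*} [TopologicalSpace (TotalSpace FDA DA)]
  [∀ a, AddCommGroup (DA a)] [∀ a, Module ℝ (DA a)] [∀ a, TopologicalSpace (DA a)]
  [FiberBundle FDA DA] [VectorBundle ℝ FDA DA] [ContMDiffVectorBundle ∞ FDA DA (I.prod 𝓘(ℝ, FA))]

namespace SuperData
variable {L : LieAlgebroid I FA A} {NC NE : Type*} [AddCommGroup NC] [Module (Fun I M) NC]
  [AddCommGroup NE] [Module (Fun I M) NE] (Q : SuperData L NC NE)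

/-- The connection on `Hom(E, C)` induced by `∇^s` and `∇^c`. -/
def nablaHom (X : Sec I FA A) (Φ : NE →ₗ[Fun I M] NC) : NE →ₗ[Fun I M] NC where
  toFun ε := Q.nablaC.nabla X (Φ ε) - Φ (Q.nablaE.nabla X ε)
  map_add' ε ε' := by
    rw [map_add, Q.nablaC.add_right, Q.nablaE.add_right, map_add]
    abel
  map_smul' f ε := by
    rw [map_smul, Q.nablaC.leibniz, Q.nablaE.leibniz, map_add, map_smul, map_smul, RingHom.id_apply,
      smul_sub]
    abel

theorem nablaHom_apply (X : Sec I FA A) (Φ : NE →ₗ[Fun I M] NC) (ε : NE) :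
    Q.nablaHom X Φ ε = Q.nablaC.nabla X (Φ ε) - Φ (Q.nablaE.nabla X ε) := rfl

end SuperData

open DoubleVectorBundle

/-- The anchored bracket on `D → E` is given on horizontal lifts and core sections by the data
`Q`. -/
structure IsModel {D : DoubleVectorBundle I FA A FE E FDE DE FDA DA} (κ : D.Core FC C)
    (h : D.HorizontalLift) {L : LieAlgebroid I FA A} (Q : SuperData L (Sec I FC C) (Sec I FE E))
    (S : AnchoredBracket (I.prod 𝓘(ℝ, FE)) FDE DE) : Prop where
  tproj_anchor : ∀ e v, tproj (S.anchor e v) = L.anchor e.proj (D.pA e v)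
  deriv_section : ∀ α f, IsFiberLinear f →
    S.deriv (κ.section α) f = -pull (pairing f (Q.bd α))
  isFiberLinear_deriv_lift : ∀ X f, IsFiberLinear f → IsFiberLinear (S.deriv (h.lift X) f)
  pairing_deriv_lift : ∀ X f, IsFiberLinear f → ∀ ε : Sec I FE E,
    pairing (S.deriv (h.lift X) f) ε =
      L.deriv X (pairing f ε) - pairing f (Q.nablaE.nabla X ε)
  bracket_lift_section : ∀ X α,
    S.bracket (h.lift X) (κ.section α) = κ.section (Q.nablaC.nabla X α)
  bracket_lift_lift : ∀ X Y, S.bracket (h.lift X) (h.lift Y) =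
    h.lift (L.bracket X Y) - κ.homSec (Q.curv ![X, Y])
  bracket_section_section : ∀ α β, S.bracket (κ.section α) (κ.section β) = 0

namespace IsModel
variable {D : DoubleVectorBundle I FA A FE E FDE DE FDA DA} {κ : D.Core FC C}
  {h : D.HorizontalLift} {L : LieAlgebroid I FA A} {Q : SuperData L (Sec I FC C) (Sec I FE E)}
  {S : AnchoredBracket (I.prod 𝓘(ℝ, FE)) FDE DE} (hS : IsModel κ h Q S)
include hS

theorem deriv_pull_apply (σ : Sec (I.prod 𝓘(ℝ, FE)) FDE DE) (g : Fun I M) (e : TotalSpace FE E) :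
    S.deriv σ (pull g) e = dd (L.anchor e.proj (D.pA e (σ e))) g := by
  rw [S.deriv_apply, dd_pull, hS.tproj_anchor]

theorem deriv_pull {σ : Sec (I.prod 𝓘(ℝ, FE)) FDE DE} {X : Sec I FA A}
    (hσ : ∀ e, D.pA e (σ e) = X e.proj) (g : Fun I M) :
    S.deriv σ (pull g) = pull (L.deriv X g) := by
  ext e
  rw [hS.deriv_pull_apply, hσ]
  rfl

theorem deriv_lift_pull (X : Sec I FA A) (g : Fun I M) :
    S.deriv (h.lift X) (pull g) = pull (L.deriv X g) :=
  hS.deriv_pull (fun e => by rw [h.lift_apply, h.pA_lin]) g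

theorem deriv_section_pull (α : Sec I FC C) (g : Fun I M) :
    S.deriv (κ.section α) (pull g) = 0 := by
  ext e
  rw [hS.deriv_pull_apply, κ.section_apply, κ.pA_point, map_zero]
  exact map_zero (mvfderiv I g e.proj)

theorem deriv_homSec_pull (Φ : Sec I FE E →ₗ[Fun I M] Sec I FC C) (g : Fun I M) :
    S.deriv (κ.homSec Φ) (pull g) = 0 := by
  ext e
  rw [hS.deriv_pull_apply]
  change dd (L.anchor e.proj (D.pA e (κ.point e _))) g = 0
  rw [κ.pA_point, map_zero]
  exact map_zero (mvfderiv I g e.proj)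

theorem pairing_deriv_homSec (Φ : Sec I FE E →ₗ[Fun I M] Sec I FC C)
    {f : Fun (I.prod 𝓘(ℝ, FE)) (TotalSpace FE E)} (hf : IsFiberLinear f) (ε : Sec I FE E) :
    pairing (S.deriv (κ.homSec Φ) f) ε = -pairing f (Q.bd (Φ ε)) := by
  ext m
  change dd (S.anchor _ (κ.homSec Φ ⟨m, ε m⟩)) f = _
  rw [κ.homSec_apply]
  exact congrArg (fun g : Fun (I.prod 𝓘(ℝ, FE)) (TotalSpace FE E) => g ⟨m, ε m⟩)
    (hS.deriv_section (Φ ε) f hf)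

theorem bracket_homSec_section (Φ : Sec I FE E →ₗ[Fun I M] Sec I FC C) (α : Sec I FC C) :
    S.bracket (κ.homSec Φ) (κ.section α) = κ.section (Φ (Q.bd α)) := by
  refine sec_ext_pull fun m₀ => ⟨(localBasis I FE E m₀).cutoff, LocalBasis.cutoff_self _, ?_⟩
  let B := localBasis I FE E m₀
  have h1 := S.bracket_smul_left (pull B.cutoff) (κ.homSec Φ) (κ.section α)
  rw [hS.deriv_section_pull, zero_smul, sub_zero, κ.expand_homSec, S.bracket_sum_left] at h1
  refine h1.symm.trans ?_
  rw [← κ.section_smul, ← map_smul, B.expand_sec, map_sum]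
  refine Eq.trans ?_ (map_sum (AddMonoidHom.mk' κ.section κ.section_add) _ _).symm
  refine Finset.sum_congr rfl fun i _ => ?_
  change _ = κ.section _
  rw [S.bracket_smul_left, hS.bracket_section_section, smul_zero, hS.deriv_section _ _ (B.linear i),
    neg_smul, zero_sub, neg_neg, map_smul, κ.section_smul]

theorem bracket_lift_homSec (X : Sec I FA A) (Φ : Sec I FE E →ₗ[Fun I M] Sec I FC C) :
    S.bracket (h.lift X) (κ.homSec Φ) = κ.homSec (Q.nablaHom X Φ) := by
  refine Core.ext_mk_sec fun m ε => ?_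
  let B := localBasis I FE E m
  have h1 := S.bracket_smul_right (h.lift X) (pull B.cutoff) (κ.homSec Φ)
  rw [κ.expand_homSec, S.bracket_sum_right] at h1
  have h2 := congrArg (fun s : Sec (I.prod 𝓘(ℝ, FE)) FDE DE => s ⟨m, ε m⟩) h1
  rw [hS.deriv_lift_pull] at h2
  have h3 : L.deriv X B.cutoff m = 0 := B.dd_cutoff _
  have h4 : B.cutoff m = 1 := B.cutoff_self
  change _ = B.cutoff m • S.bracket (h.lift X) (κ.homSec Φ) ⟨m, ε m⟩ +
    L.deriv X B.cutoff m • κ.homSec Φ ⟨m, ε m⟩ at h2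
  rw [h3, h4, zero_smul, add_zero, one_smul] at h2
  rw [← h2, κ.homSec_apply]
  have h5 : ∀ i, S.bracket (h.lift X) (B.fn i • κ.section (Φ (B.sec i))) ⟨m, ε m⟩ =
      κ.point ⟨m, ε m⟩ ((pairing (B.fn i) ε • Q.nablaC.nabla X (Φ (B.sec i)) +
        (L.deriv X (pairing (B.fn i) ε) - pairing (B.fn i) (Q.nablaE.nabla X ε)) •
          Φ (B.sec i)) m) := fun i => by
    rw [S.bracket_smul_right, hS.bracket_lift_section, ← hS.pairing_deriv_lift X _ (B.linear i)]
    exact ((map_add (κ.point ⟨m, ε m⟩) _ _).trans (congrArg₂ (· + ·)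
      (map_smul (κ.point ⟨m, ε m⟩) _ _) (map_smul (κ.point ⟨m, ε m⟩) _ _))).symm
  have h6 : (∑ i, (pairing (B.fn i) ε • Q.nablaC.nabla X (Φ (B.sec i)) +
        (L.deriv X (pairing (B.fn i) ε) - pairing (B.fn i) (Q.nablaE.nabla X ε)) •
          Φ (B.sec i))) =
      Q.nablaC.nabla X (Φ (B.cutoff • ε)) - Φ (B.cutoff • Q.nablaE.nabla X ε) := by
    rw [B.expand_sec, B.expand_sec, map_sum, map_sum]
    have h7 : ∀ (s : Fin B.n → Sec I FC C), Q.nablaC.nabla X (∑ i, s i) =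
        ∑ i, Q.nablaC.nabla X (s i) := fun s =>
      map_sum (AddMonoidHom.mk' (Q.nablaC.nabla X) (Q.nablaC.add_right X)) s Finset.univ
    rw [h7, ← Finset.sum_sub_distrib]
    refine Finset.sum_congr rfl fun i _ => ?_
    rw [map_smul, map_smul, Q.nablaC.leibniz, sub_smul]
    abel
  have h8 : (Q.nablaC.nabla X (Φ (B.cutoff • ε)) - Φ (B.cutoff • Q.nablaE.nabla X ε)) m =
      Q.nablaHom X Φ ε m := by
    rw [map_smul, map_smul, Q.nablaC.leibniz]
    change B.cutoff m • Q.nablaC.nabla X (Φ ε) m + L.deriv X B.cutoff m • Φ ε m -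
      B.cutoff m • Φ (Q.nablaE.nabla X ε) m = _
    rw [h3, h4, zero_smul, add_zero, one_smul, one_smul]
    rfl
  dsimp only
  rw [sum_sec_apply, Finset.sum_congr rfl fun i _ => h5 i, ← map_sum, ← sum_sec_apply, h6, h8]

variable [CompleteSpace EM]

/-- The failure of the anchor to be compatible with the bracket of a horizontal lift and a core
section. -/
theorem commutator_lift_section (X : Sec I FA A) (α : Sec I FC C)
    {f : Fun (I.prod 𝓘(ℝ, FE)) (TotalSpace FE E)} (hf : IsFiberLinear f) :
    S.deriv (S.bracket (h.lift X) (κ.section α)) f -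
      (S.deriv (h.lift X) (S.deriv (κ.section α) f) -
        S.deriv (κ.section α) (S.deriv (h.lift X) f)) =
      pull (pairing f (Q.nablaE.nabla X (Q.bd α) - Q.bd (Q.nablaC.nabla X α))) := by
  have hn : S.deriv (h.lift X) (-pull (pairing f (Q.bd α))) =
      -pull (L.deriv X (pairing f (Q.bd α))) := by
    rw [← hS.deriv_lift_pull]
    exact map_neg (AddMonoidHom.mk' (S.deriv (h.lift X)) (S.deriv_add_right _)) _
  rw [hS.bracket_lift_section, hS.deriv_section _ _ hf, hS.deriv_section _ _ hf, hn,
    hS.deriv_section _ _ (hS.isFiberLinear_deriv_lift X f hf), hS.pairing_deriv_lift X f hf,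
    hf.pairing_sub]
  ext e
  change -(pairing f (Q.bd (Q.nablaC.nabla X α)) e.proj) - (-(L.deriv X (pairing f (Q.bd α)) e.proj) -
    -(L.deriv X (pairing f (Q.bd α)) e.proj - pairing f (Q.nablaE.nabla X (Q.bd α)) e.proj)) =
    pairing f (Q.nablaE.nabla X (Q.bd α)) e.proj - pairing f (Q.bd (Q.nablaC.nabla X α)) e.proj
  ring

theorem commutator_lift_lift (X Y : Sec I FA A)
    {f : Fun (I.prod 𝓘(ℝ, FE)) (TotalSpace FE E)} (hf : IsFiberLinear f) (ε : Sec I FE E) :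
    pairing (S.deriv (S.bracket (h.lift X) (h.lift Y)) f -
      (S.deriv (h.lift X) (S.deriv (h.lift Y) f) - S.deriv (h.lift Y) (S.deriv (h.lift X) f))) ε =
      pairing f (Q.nablaE.curvature X Y ε + Q.bd (Q.curv ![X, Y] ε)) := by
  have hX := hS.isFiberLinear_deriv_lift X f hf
  have hY := hS.isFiberLinear_deriv_lift Y f hf
  have hsub : ∀ g k : Fun I M, ∀ X, L.deriv X (g - k) = L.deriv X g - L.deriv X k := fun g k X =>
    map_sub (AddMonoidHom.mk' (L.deriv X) (L.deriv_add_right X)) g k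
  have hb : S.deriv (S.bracket (h.lift X) (h.lift Y)) f =
      S.deriv (h.lift (L.bracket X Y)) f - S.deriv (κ.homSec (Q.curv ![X, Y])) f := by
    rw [hS.bracket_lift_lift]
    exact map_sub (AddMonoidHom.mk' (fun σ => S.deriv σ f) fun σ τ => S.deriv_add_left σ τ f) _ _
  rw [hb, sub_pairing, sub_pairing, sub_pairing, hS.pairing_deriv_lift _ _ hf,
    hS.pairing_deriv_homSec _ hf, hS.pairing_deriv_lift _ _ hY, hS.pairing_deriv_lift _ _ hX,
    hS.pairing_deriv_lift _ _ hf, hS.pairing_deriv_lift _ _ hf, hS.pairing_deriv_lift _ _ hf,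
    hS.pairing_deriv_lift _ _ hf, L.deriv_bracket, hsub, hsub, hf.pairing_add,
    Connection.curvature, hf.pairing_sub, hf.pairing_sub]
  ring

theorem jacobi_lift_lift_section (X Y : Sec I FA A) (γ : Sec I FC C) :
    S.bracket (h.lift X) (S.bracket (h.lift Y) (κ.section γ)) +
      S.bracket (h.lift Y) (S.bracket (κ.section γ) (h.lift X)) +
      S.bracket (κ.section γ) (S.bracket (h.lift X) (h.lift Y)) =
      κ.section (Q.nablaC.curvature X Y γ + Q.curv ![X, Y] (Q.bd γ)) := by
  rw [S.bracket_skew (κ.section γ) (h.lift X), S.bracket_skew (κ.section γ) (S.bracket _ _),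
    hS.bracket_lift_section, hS.bracket_lift_section, hS.bracket_lift_section, S.bracket_neg_right,
    hS.bracket_lift_section, hS.bracket_lift_lift, S.bracket_sub_left, hS.bracket_lift_section,
    hS.bracket_homSec_section, κ.section_add, Connection.curvature, κ.section_sub, κ.section_sub]
  abel

theorem jacobi_lift_lift_lift (X Y Z : Sec I FA A) :
    S.bracket (h.lift X) (S.bracket (h.lift Y) (h.lift Z)) +
      S.bracket (h.lift Y) (S.bracket (h.lift Z) (h.lift X)) +
      S.bracket (h.lift Z) (S.bracket (h.lift X) (h.lift Y)) =
      -κ.homSec ((Q.curv ![X, L.bracket Y Z] + Q.nablaHom X (Q.curv ![Y, Z])) +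
        (Q.curv ![Y, L.bracket Z X] + Q.nablaHom Y (Q.curv ![Z, X])) +
        (Q.curv ![Z, L.bracket X Y] + Q.nablaHom Z (Q.curv ![X, Y]))) := by
  have hj := congrArg h.lift (L.jacobi X Y Z)
  rw [h.map_add, h.map_add, h.lift_zero] at hj
  rw [hS.bracket_lift_lift, hS.bracket_lift_lift, hS.bracket_lift_lift, S.bracket_sub_right,
    S.bracket_sub_right, S.bracket_sub_right, hS.bracket_lift_lift, hS.bracket_lift_lift,
    hS.bracket_lift_lift, hS.bracket_lift_homSec, hS.bracket_lift_homSec, hS.bracket_lift_homSec,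
    κ.homSec_add, κ.homSec_add, κ.homSec_add, κ.homSec_add, κ.homSec_add, ← sub_eq_zero]
  rw [← sub_eq_zero] at hj
  rw [← hj]
  abel

end IsModel

end DVB

section DVB
set_option linter.unusedSectionVars false
variable {EM : Type*} [NormedAddCommGroup EM] [NormedSpace ℝ EM] [FiniteDimensional ℝ EM]
  {HM : Type*} [TopologicalSpace HM] {I : ModelWithCorners ℝ EM HM}
  {M : Type*} [TopologicalSpace M] [T2Space M] [ChartedSpace HM M] [IsManifold I ∞ M]
  {FA : Type*} [NormedAddCommGroup FA] [NormedSpace ℝ FA] [FiniteDimensional ℝ FA]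
  {A : M → Type*} [TopologicalSpace (TotalSpace FA A)] [∀ m, AddCommGroup (A m)]
  [∀ m, Module ℝ (A m)] [∀ m, TopologicalSpace (A m)] [FiberBundle FA A] [VectorBundle ℝ FA A]
  [ContMDiffVectorBundle ∞ FA A I]
  {FE : Type*} [NormedAddCommGroup FE] [NormedSpace ℝ FE] [FiniteDimensional ℝ FE]
  {E : M → Type*} [TopologicalSpace (TotalSpace FE E)] [∀ m, AddCommGroup (E m)]
  [∀ m, Module ℝ (E m)] [∀ m, TopologicalSpace (E m)] [FiberBundle FE E] [VectorBundle ℝ FE E]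
  [ContMDiffVectorBundle ∞ FE E I]
  {FC : Type*} [NormedAddCommGroup FC] [NormedSpace ℝ FC] [FiniteDimensional ℝ FC]
  {C : M → Type*} [TopologicalSpace (TotalSpace FC C)] [∀ m, AddCommGroup (C m)]
  [∀ m, Module ℝ (C m)] [∀ m, TopologicalSpace (C m)] [FiberBundle FC C] [VectorBundle ℝ FC C]
  [ContMDiffVectorBundle ∞ FC C I]
  {FDE : Type*} [NormedAddCommGroup FDE] [NormedSpace ℝ FDE] [FiniteDimensional ℝ FDE]
  {DE : TotalSpace FE E → Type*} [TopologicalSpace (TotalSpace FDE DE)]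
  [∀ e, AddCommGroup (DE e)] [∀ e, Module ℝ (DE e)] [∀ e, TopologicalSpace (DE e)]
  [FiberBundle FDE DE] [VectorBundle ℝ FDE DE] [ContMDiffVectorBundle ∞ FDE DE (I.prod 𝓘(ℝ, FE))]
  {FDA : Type*} [NormedAddCommGroup FDA] [NormedSpace ℝ FDA] [FiniteDimensional ℝ FDA]
  {DA : TotalSpace FA A → Type*} [TopologicalSpace (TotalSpace FDA DA)]
  [∀ a, AddCommGroup (DA a)] [∀ a, Module ℝ (DA a)] [∀ a, TopologicalSpace (DA a)]
  [FiberBundle FDA DA] [VectorBundle ℝ FDA DA] [ContMDiffVectorBundle ∞ FDA DA (I.prod 𝓘(ℝ, FA))]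

theorem hasLocalBases_sec : HasLocalBases I M (Sec I FE E) where
  basis m₀ :=
    let B := localBasis I FE E m₀
    ⟨B.cutoff, B.n, B.coord, B.sec, B.cutoff_self, B.expand_sec⟩
  eq_zero s hs := by
    ext m
    obtain ⟨φ, hφ, h⟩ := hs m
    have h1 := congrArg (fun s : Sec I FE E => s m) h
    simp only [smul_sec_apply, hφ, one_smul] at h1
    exact h1

/-- An alternating biadditive tensorial map is a `2`-form. -/
theorem exists_form_two {N : Type*} [AddCommGroup N] [Module (Fun I M) N]
    (b : Sec I FA A → Sec I FA A → N) (hadd : ∀ X Y Z, b (X + Y) Z = b X Z + b Y Z)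
    (hsmul : ∀ (f : Fun I M) X Y, b (f • X) Y = f • b X Y) (hskew : ∀ X Y, b X Y = -b Y X)
    (hself : ∀ X, b X X = 0) : ∃ η : Form I FA A N 2, ∀ X Y, η ![X, Y] = b X Y := by
  refine ⟨
    { toFun := fun v => b (v 0) (v 1)
      map_update_add' := fun v i X Y => ?_
      map_update_smul' := fun v i f X => ?_
      map_eq_zero_of_eq' := fun v i j h hij => ?_ }, fun X Y => rfl⟩
  · have hadd' : ∀ X Y Z, b Z (X + Y) = b Z X + b Z Y := fun X Y Z => by
      rw [hskew, hadd, hskew X, hskew Y, neg_add, neg_neg, neg_neg]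
    fin_cases i
    · simp [hadd]
    · simp [hadd']
  · have hsmul' : ∀ (f : Fun I M) X Y, b Y (f • X) = f • b Y X := fun f X Y => by
      rw [hskew, hsmul, hskew X, smul_neg, neg_neg]
    fin_cases i
    · simp [hsmul]
    · simp [hsmul']
  · have h01 : v 0 = v 1 := by
      fin_cases i <;> fin_cases j
      · exact absurd rfl hij
      · exact h
      · exact h.symm
      · exact absurd rfl hij
    change b (v 0) (v 1) = 0
    rw [h01, hself]

namespace SuperData
variable {L : LieAlgebroid I FA A} {NC NE : Type*} [AddCommGroup NC] [Module (Fun I M) NC]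
  [AddCommGroup NE] [Module (Fun I M) NE] (Q : SuperData L NC NE)

theorem curv_swap (X Y : Sec I FA A) : Q.curv ![Y, X] = -Q.curv ![X, Y] := by
  have h := Q.curv.map_swap ![X, Y] (i := 0) (j := 1) (by simp)
  rw [← h]
  congr 1
  funext i
  fin_cases i <;> rfl

theorem curv_neg_right (X Y : Sec I FA A) : Q.curv ![X, -Y] = -Q.curv ![X, Y] := by
  have h := Q.curv.map_update_neg ![X, Y] 1 Y
  have e : ∀ Z, Function.update ![X, Y] 1 Z = ![X, Z] := fun Z => by
    funext i
    fin_cases i <;> rfl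
  rwa [e, e] at h

theorem closedSum_eq (X Y Z : Sec I FA A) (ε : NE) : Q.closedSum X Y Z ε =
    ((Q.curv ![X, L.bracket Y Z] + Q.nablaHom X (Q.curv ![Y, Z])) +
        (Q.curv ![Y, L.bracket Z X] + Q.nablaHom Y (Q.curv ![Z, X])) +
        (Q.curv ![Z, L.bracket X Y] + Q.nablaHom Z (Q.curv ![X, Y]))) ε := by
  have hn : ∀ X (s : NC), Q.nablaC.nabla X (-s) = -Q.nablaC.nabla X s := fun X s =>
    map_neg (AddMonoidHom.mk' (Q.nablaC.nabla X) (Q.nablaC.add_right X)) s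
  simp only [closedSum, LinearMap.add_apply, nablaHom_apply]
  rw [Q.curv_swap Z (L.bracket Y X), L.bracket_skew Y X, Q.curv_neg_right, L.bracket_skew Z Y,
    Q.curv_neg_right, Q.curv_swap X Z]
  simp only [LinearMap.neg_apply, hn]
  abel

end SuperData

open DoubleVectorBundle

namespace IsModel
variable {D : DoubleVectorBundle I FA A FE E FDE DE FDA DA} {κ : D.Core FC C}
  {h : D.HorizontalLift} {L : LieAlgebroid I FA A} {Q : SuperData L (Sec I FC C) (Sec I FE E)}
  {S : AnchoredBracket (I.prod 𝓘(ℝ, FE)) FDE DE} (hS : IsModel κ h Q S)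
include hS

theorem unique {Q' : SuperData L (Sec I FC C) (Sec I FE E)} (hS' : IsModel κ h Q' S) : Q = Q' := by
  refine SuperData.ext_curv (fun α => sec_ext_pairing fun f hf => ?_) (fun X α => ?_)
    (fun X ε => sec_ext_pairing fun f hf => ?_) (fun X Y ε => ?_)
  · have h1 := (hS.deriv_section α f hf).symm.trans (hS'.deriv_section α f hf)
    exact congrArg (fun g => pairing g (0 : Sec I FE E)) (neg_injective h1)
  · exact κ.section_injective
      ((hS.bracket_lift_section X α).symm.trans (hS'.bracket_lift_section X α))
  · have h1 := (hS.pairing_deriv_lift X f hf ε).symm.trans (hS'.pairing_deriv_lift X f hf ε)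
    exact sub_right_injective h1
  · have h1 := (hS.bracket_lift_lift X Y).symm.trans (hS'.bracket_lift_lift X Y)
    rw [κ.homSec_injective (sub_right_injective h1)]

theorem compatible (hA : ∀ σ τ f, S.deriv (S.bracket σ τ) f =
      S.deriv σ (S.deriv τ f) - S.deriv τ (S.deriv σ f))
    (hJ : ∀ X Y Z, S.bracket X (S.bracket Y Z) + S.bracket Y (S.bracket Z X)
      + S.bracket Z (S.bracket X Y) = 0) : Q.Compatible where
  bd_nabla X α := sec_ext_pairing fun f hf => by
    have h1 := hS.commutator_lift_section X α hf
    rw [hA, sub_self, hf.pairing_sub] at h1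
    have h2 := congrArg (fun g => pairing g (0 : Sec I FE E)) h1
    exact (sub_eq_zero.1 h2.symm).symm
  curvature_C X Y α := by
    have h1 := hS.jacobi_lift_lift_section X Y α
    rw [hJ, ← κ.section_zero] at h1
    exact eq_neg_of_add_eq_zero_left (κ.section_injective h1).symm
  curvature_E X Y ε := sec_ext_pairing fun f hf => by
    have h1 := hS.commutator_lift_lift X Y hf ε
    rw [hA, sub_self, hf.pairing_add] at h1
    rw [hf.pairing_neg]
    exact eq_neg_of_add_eq_zero_left h1.symm
  closed := by
    rw [Q.closed_iff (hasLocalBases_sec.prod hasLocalBases_sec) L.curvature_trivialConnection]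
    intro X Y Z ε
    have h1 := hS.jacobi_lift_lift_lift X Y Z
    rw [hJ, ← κ.homSec_neg, ← κ.homSec_zero] at h1
    rw [Q.closedSum_eq, neg_eq_zero.1 (κ.homSec_injective h1).symm]
    rfl

end IsModel

end DVB

section TangentExt
variable {EM HM : Type*} [NormedAddCommGroup EM] [NormedSpace ℝ EM] [FiniteDimensional ℝ EM]
  [TopologicalSpace HM] {I : ModelWithCorners ℝ EM HM} {M : Type*} [TopologicalSpace M] [T2Space M]
  [ChartedSpace HM M] [IsManifold I ∞ M]

/-- A tangent vector is determined by its action on smooth functions. -/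
theorem tangent_ext_dd {m : M} {v w : TangentSpace I m} (h : ∀ g : Fun I M, dd v g = dd w g) :
    v = w := by
  obtain ⟨ψ⟩ : Nonempty (SmoothBumpFunction I m) := inferInstance
  have hm : m ∈ (chartAt HM m).source := mem_chart_source HM m
  have hinv := isInvertible_mfderiv_extChartAt (I := I) (mem_extChartAt_source (I := I) m)
  refine hinv.injective ?_
  let b := Module.finBasis ℝ EM
  refine b.ext_elem fun i => ?_
  let l : EM →L[ℝ] ℝ := LinearMap.toContinuousLinearMap (b.coord i)
  have hl : ContMDiffOn I 𝓘(ℝ) ∞ (fun x => l (extChartAt I m x)) (chartAt HM m).source :=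
    l.contMDiff.comp_contMDiffOn contMDiffOn_extChartAt
  let g : Fun I M := ⟨fun x => ψ x • l (extChartAt I m x), ψ.contMDiff_smul hl⟩
  have hg : ⇑g =ᶠ[nhds m] fun x => l (extChartAt I m x) := by
    filter_upwards [ψ.eventuallyEq_one] with x hx
    change ψ x • l (extChartAt I m x) = _
    rw [hx]
    exact one_smul _ _
  have key : ∀ u : TangentSpace I m, dd u g = l (mfderiv I 𝓘(ℝ, EM) (extChartAt I m) m u) :=
    fun u => by
      change mfderiv I 𝓘(ℝ) g m u = _
      have h1 := hg.mfderiv_eq (I := I) (I' := 𝓘(ℝ))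
      refine (congrArg (fun l : EM →L[ℝ] ℝ => l u) h1).trans ?_
      have h2 := mfderiv_comp_apply (I := I) (I' := 𝓘(ℝ, EM)) (I'' := 𝓘(ℝ)) m
        (l.mdifferentiableAt (x := extChartAt I m m)) (mdifferentiableAt_extChartAt hm) u
      refine h2.trans ?_
      rw [ContinuousLinearMap.mfderiv_eq]
      rfl
  have h1 := h g
  rw [key, key] at h1
  exact h1

end TangentExt

section Bracket
set_option linter.unusedSectionVars false
variable {EM HM : Type*} [NormedAddCommGroup EM] [NormedSpace ℝ EM] [TopologicalSpace HM]
  {I : ModelWithCorners ℝ EM HM} {M : Type*} [TopologicalSpace M] [ChartedSpace HM M]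
  [IsManifold I ∞ M]
  {F : Type*} [NormedAddCommGroup F] [NormedSpace ℝ F]
  {V : M → Type*} [TopologicalSpace (TotalSpace F V)] [∀ m, AddCommGroup (V m)]
  [∀ m, Module ℝ (V m)] [∀ m, TopologicalSpace (V m)] [FiberBundle F V] [VectorBundle ℝ F V]

namespace AnchoredBracket
variable (S : AnchoredBracket I F V)

/-- The failure of the anchor to be compatible with the bracket. -/
def anchorDefect (f : Fun I M) (X Y : Sec I F V) : Fun I M :=
  S.deriv (S.bracket X Y) f - (S.deriv X (S.deriv Y f) - S.deriv Y (S.deriv X f))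

theorem deriv_neg_left (X : Sec I F V) (f : Fun I M) : S.deriv (-X) f = -S.deriv X f :=
  map_neg (AddMonoidHom.mk' (fun X => S.deriv X f) fun X Y => S.deriv_add_left X Y f) X

theorem deriv_sub_left (X Y : Sec I F V) (f : Fun I M) :
    S.deriv (X - Y) f = S.deriv X f - S.deriv Y f :=
  map_sub (AddMonoidHom.mk' (fun X => S.deriv X f) fun X Y => S.deriv_add_left X Y f) X Y

theorem deriv_neg_right (X : Sec I F V) (f : Fun I M) : S.deriv X (-f) = -S.deriv X f :=
  map_neg (AddMonoidHom.mk' (S.deriv X) (S.deriv_add_right X)) f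

theorem deriv_zero_left (f : Fun I M) : S.deriv 0 f = 0 :=
  map_zero (AddMonoidHom.mk' (fun X => S.deriv X f) fun X Y => S.deriv_add_left X Y f)

theorem deriv_zero_right (X : Sec I F V) : S.deriv X 0 = 0 :=
  map_zero (AddMonoidHom.mk' (S.deriv X) (S.deriv_add_right X))

theorem anchorDefect_skew (f : Fun I M) (X Y : Sec I F V) :
    S.anchorDefect f Y X = -S.anchorDefect f X Y := by
  rw [anchorDefect, anchorDefect, S.bracket_skew, S.deriv_neg_left]
  ring

theorem anchorDefect_add_right (f : Fun I M) (X Y Z : Sec I F V) :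
    S.anchorDefect f X (Y + Z) = S.anchorDefect f X Y + S.anchorDefect f X Z := by
  simp only [anchorDefect, bracket_add_right, deriv_add_left, deriv_add_right]
  ring

theorem anchorDefect_smul_right (f g : Fun I M) (X Y : Sec I F V) :
    S.anchorDefect f X (g • Y) = g * S.anchorDefect f X Y := by
  simp only [anchorDefect, bracket_smul_right, deriv_add_left, deriv_smul_left, deriv_mul]
  ring

/-- The cyclic sum in the Jacobi identity. -/
def jacobiDefect (X Y Z : Sec I F V) : Sec I F V :=
  S.bracket X (S.bracket Y Z) + S.bracket Y (S.bracket Z X) + S.bracket Z (S.bracket X Y)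

theorem jacobiDefect_rotate (X Y Z : Sec I F V) : S.jacobiDefect Y Z X = S.jacobiDefect X Y Z := by
  rw [jacobiDefect, jacobiDefect]
  abel

theorem jacobiDefect_add_right (X Y Z W : Sec I F V) :
    S.jacobiDefect X Y (Z + W) = S.jacobiDefect X Y Z + S.jacobiDefect X Y W := by
  simp only [jacobiDefect, bracket_add_right, bracket_add_left]
  abel

theorem jacobiDefect_smul_right (hA : ∀ X Y f, S.anchorDefect f X Y = 0) (X Y Z : Sec I F V)
    (g : Fun I M) : S.jacobiDefect X Y (g • Z) = g • S.jacobiDefect X Y Z := by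
  have h1 := hA X Y g
  rw [anchorDefect, sub_eq_zero] at h1
  simp only [jacobiDefect, bracket_smul_right, bracket_smul_left, bracket_add_right,
    bracket_sub_right, h1, smul_add, sub_smul]
  rw [S.bracket_skew Z X]
  simp only [smul_neg]
  abel

end AnchoredBracket
end Bracket
section DVB
set_option linter.unusedSectionVars false
variable {EM : Type*} [NormedAddCommGroup EM] [NormedSpace ℝ EM] [FiniteDimensional ℝ EM]
  {HM : Type*} [TopologicalSpace HM] {I : ModelWithCorners ℝ EM HM}
  {M : Type*} [TopologicalSpace M] [T2Space M] [ChartedSpace HM M] [IsManifold I ∞ M]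
  {FA : Type*} [NormedAddCommGroup FA] [NormedSpace ℝ FA] [FiniteDimensional ℝ FA]
  {A : M → Type*} [TopologicalSpace (TotalSpace FA A)] [∀ m, AddCommGroup (A m)]
  [∀ m, Module ℝ (A m)] [∀ m, TopologicalSpace (A m)] [FiberBundle FA A] [VectorBundle ℝ FA A]
  [ContMDiffVectorBundle ∞ FA A I]
  {FE : Type*} [NormedAddCommGroup FE] [NormedSpace ℝ FE] [FiniteDimensional ℝ FE]
  {E : M → Type*} [TopologicalSpace (TotalSpace FE E)] [∀ m, AddCommGroup (E m)]
  [∀ m, Module ℝ (E m)] [∀ m, TopologicalSpace (E m)] [FiberBundle FE E] [VectorBundle ℝ FE E]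
  [ContMDiffVectorBundle ∞ FE E I]
  {FC : Type*} [NormedAddCommGroup FC] [NormedSpace ℝ FC] [FiniteDimensional ℝ FC]
  {C : M → Type*} [TopologicalSpace (TotalSpace FC C)] [∀ m, AddCommGroup (C m)]
  [∀ m, Module ℝ (C m)] [∀ m, TopologicalSpace (C m)] [FiberBundle FC C] [VectorBundle ℝ FC C]
  [ContMDiffVectorBundle ∞ FC C I]
  {FDE : Type*} [NormedAddCommGroup FDE] [NormedSpace ℝ FDE] [FiniteDimensional ℝ FDE]
  {DE : TotalSpace FE E → Type*} [TopologicalSpace (TotalSpace FDE DE)]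
  [∀ e, AddCommGroup (DE e)] [∀ e, Module ℝ (DE e)] [∀ e, TopologicalSpace (DE e)]
  [FiberBundle FDE DE] [VectorBundle ℝ FDE DE] [ContMDiffVectorBundle ∞ FDE DE (I.prod 𝓘(ℝ, FE))]
  {FDA : Type*} [NormedAddCommGroup FDA] [NormedSpace ℝ FDA] [FiniteDimensional ℝ FDA]
  {DA : TotalSpace FA A → Type*} [TopologicalSpace (TotalSpace FDA DA)]
  [∀ a, AddCommGroup (DA a)] [∀ a, Module ℝ (DA a)] [∀ a, TopologicalSpace (DA a)]
  [FiberBundle FDA DA] [VectorBundle ℝ FDA DA] [ContMDiffVectorBundle ∞ FDA DA (I.prod 𝓘(ℝ, FA))]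

open DoubleVectorBundle

theorem DoubleVectorBundle.HorizontalLift.eq_zero_of_generators
    {D : DoubleVectorBundle I FA A FE E FDE DE FDA DA} (κ : D.Core FC C) (h : D.HorizontalLift)
    {Y : Type*} [AddCommGroup Y] [Module ℝ Y] {e : TotalSpace FE E}
    (R : Sec (I.prod 𝓘(ℝ, FE)) FDE DE → Y) (hadd : ∀ σ τ, R (σ + τ) = R σ + R τ)
    (hsmul : ∀ (g : Fun (I.prod 𝓘(ℝ, FE)) (TotalSpace FE E)) σ, R (g • σ) = g e • R σ)
    (hl : ∀ X, R (h.lift X) = 0) (hs : ∀ α, R (κ.section α) = 0)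
    (σ : Sec (I.prod 𝓘(ℝ, FE)) FDE DE) : R σ = 0 := by
  refine (h.framing κ).eq_zero_of_tensorial R hadd hsmul (fun p => ?_) σ
  obtain ⟨⟨X, α⟩, rfl⟩ := (secProd I FA A FC C).surjective p
  rw [h.framing_sec, hadd, hl, hs, add_zero]

namespace IsModel
variable {D : DoubleVectorBundle I FA A FE E FDE DE FDA DA} {κ : D.Core FC C}
  {h : D.HorizontalLift} {L : LieAlgebroid I FA A} {Q : SuperData L (Sec I FC C) (Sec I FE E)}
  {S : AnchoredBracket (I.prod 𝓘(ℝ, FE)) FDE DE} (hS : IsModel κ h Q S)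
include hS

theorem anchorDefect_eq_zero_of_generators (f : Fun (I.prod 𝓘(ℝ, FE)) (TotalSpace FE E))
    (hll : ∀ X Y, S.anchorDefect f (h.lift X) (h.lift Y) = 0)
    (hls : ∀ X α, S.anchorDefect f (h.lift X) (κ.section α) = 0)
    (hss : ∀ α β, S.anchorDefect f (κ.section α) (κ.section β) = 0)
    (σ τ : Sec (I.prod 𝓘(ℝ, FE)) FDE DE) : S.anchorDefect f σ τ = 0 := by
  have gen : ∀ σ, (∀ X, S.anchorDefect f σ (h.lift X) = 0) →
      (∀ α, S.anchorDefect f σ (κ.section α) = 0) → ∀ τ, S.anchorDefect f σ τ = 0 := by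
    intro σ h1 h2 τ
    ext e
    refine h.eq_zero_of_generators κ (e := e) (fun τ => S.anchorDefect f σ τ e)
      (fun σ' τ => ?_) (fun g τ => ?_) (fun X => ?_) (fun α => ?_) τ
    · rw [S.anchorDefect_add_right]; rfl
    · rw [S.anchorDefect_smul_right]; rfl
    · rw [h1]; rfl
    · rw [h2]; rfl
  have hsl : ∀ α X, S.anchorDefect f (κ.section α) (h.lift X) = 0 := fun α X => by
    rw [S.anchorDefect_skew, hls, neg_zero]
  refine gen σ (fun X => ?_) (fun α => ?_) τ
  · rw [S.anchorDefect_skew, gen _ (hll X) (hls X), neg_zero]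
  · rw [S.anchorDefect_skew, gen _ (hsl α) (hss α), neg_zero]

theorem anchorDefect_pull (g : Fun I M) (σ τ : Sec (I.prod 𝓘(ℝ, FE)) FDE DE) :
    S.anchorDefect (pull g) σ τ = 0 := by
  refine hS.anchorDefect_eq_zero_of_generators _ (fun X Y => ?_) (fun X α => ?_) (fun α β => ?_) σ τ
  · rw [AnchoredBracket.anchorDefect, hS.bracket_lift_lift, S.deriv_sub_left]
    simp only [hS.deriv_lift_pull, hS.deriv_homSec_pull, L.deriv_bracket]
    ext e
    change (_ - _ - 0) - (_ - _) = (0 : ℝ)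
    rw [sub_zero]
    exact sub_self _
  · rw [AnchoredBracket.anchorDefect, hS.bracket_lift_section]
    simp only [hS.deriv_lift_pull, hS.deriv_section_pull, S.deriv_zero_right, sub_zero]
  · rw [AnchoredBracket.anchorDefect, hS.bracket_section_section]
    simp only [hS.deriv_section_pull, S.deriv_zero_right, S.deriv_zero_left, sub_zero]

theorem anchorDefect_of_isFiberLinear (hQ : Q.Compatible)
    {f : Fun (I.prod 𝓘(ℝ, FE)) (TotalSpace FE E)} (hf : IsFiberLinear f)
    (σ τ : Sec (I.prod 𝓘(ℝ, FE)) FDE DE) : S.anchorDefect f σ τ = 0 := by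
  refine hS.anchorDefect_eq_zero_of_generators _ (fun X Y => ?_) (fun X α => ?_) (fun α β => ?_) σ τ
  · have h1 : ∀ ε, pairing (S.anchorDefect f (h.lift X) (h.lift Y)) ε = 0 := fun ε => by
      refine (hS.commutator_lift_lift X Y hf ε).trans ?_
      rw [hQ.curvature_E, neg_add_cancel, hf.pairing_zero]
    ext ⟨m, e⟩
    have h2 := congrArg (fun g : Fun I M => g m) (h1 (extend e))
    rw [← extend_apply (I := I) (F := FE) e]
    exact h2
  · refine (hS.commutator_lift_section X α hf).trans ?_
    rw [hQ.bd_nabla, sub_self, hf.pairing_zero]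
    rfl
  · rw [AnchoredBracket.anchorDefect, hS.bracket_section_section, hS.deriv_section _ _ hf,
      hS.deriv_section _ _ hf, S.deriv_neg_right, S.deriv_neg_right]
    simp only [hS.deriv_section_pull, S.deriv_zero_left, neg_zero, sub_zero]

theorem anchor_bracket (hQ : Q.Compatible) (σ τ : Sec (I.prod 𝓘(ℝ, FE)) FDE DE)
    (e : TotalSpace FE E) : S.anchor e (S.bracket σ τ e) =
      VectorField.mlieBracket (I.prod 𝓘(ℝ, FE)) (fun x => S.anchor x (σ x))
        (fun x => S.anchor x (τ x)) e := by
  have key : ∀ f, S.anchorDefect f σ τ = 0 → dd (S.anchor e (S.bracket σ τ e)) f =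
      dd (VectorField.mlieBracket (I.prod 𝓘(ℝ, FE)) (fun x => S.anchor x (σ x))
        (fun x => S.anchor x (τ x)) e) f := fun f hf => by
    rw [S.dd_mlieBracket]
    exact congrArg (fun g : Fun (I.prod 𝓘(ℝ, FE)) (TotalSpace FE E) => g e) (sub_eq_zero.1 hf)
  refine tangent_ext (tangent_ext_dd fun g => ?_)
    fun f hf => key f (hS.anchorDefect_of_isFiberLinear hQ hf σ τ)
  rw [← dd_pull, ← dd_pull]
  exact key _ (hS.anchorDefect_pull g σ τ)

theorem anchorDefect_eq_zero (hQ : Q.Compatible) (σ τ : Sec (I.prod 𝓘(ℝ, FE)) FDE DE)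
    (f : Fun (I.prod 𝓘(ℝ, FE)) (TotalSpace FE E)) : S.anchorDefect f σ τ = 0 := by
  refine sub_eq_zero.2 ?_
  ext e
  rw [← S.dd_mlieBracket, ← hS.anchor_bracket hQ]
  rfl

theorem jacobi (hQ : Q.Compatible) (σ τ υ : Sec (I.prod 𝓘(ℝ, FE)) FDE DE) :
    S.jacobiDefect σ τ υ = 0 := by
  have gen : ∀ σ τ, (∀ X, S.jacobiDefect σ τ (h.lift X) = 0) →
      (∀ α, S.jacobiDefect σ τ (κ.section α) = 0) → ∀ υ, S.jacobiDefect σ τ υ = 0 := by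
    intro σ τ h1 h2 υ
    ext e
    refine h.eq_zero_of_generators κ (e := e) (fun υ => S.jacobiDefect σ τ υ e)
      (fun υ υ' => ?_) (fun g υ => ?_) (fun X => ?_) (fun α => ?_) υ
    · rw [AnchoredBracket.jacobiDefect_add_right]; rfl
    · rw [AnchoredBracket.jacobiDefect_smul_right _ (hS.anchorDefect_eq_zero hQ)]; rfl
    · rw [h1]; rfl
    · rw [h2]; rfl
  have lll : ∀ X Y Z, S.jacobiDefect (h.lift X) (h.lift Y) (h.lift Z) = 0 := fun X Y Z => by
    have h0 := (Q.closed_iff (hasLocalBases_sec.prod hasLocalBases_sec)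
      L.curvature_trivialConnection).1 hQ.closed X Y Z
    have h1 : (Q.curv ![X, L.bracket Y Z] + Q.nablaHom X (Q.curv ![Y, Z])) +
        (Q.curv ![Y, L.bracket Z X] + Q.nablaHom Y (Q.curv ![Z, X])) +
        (Q.curv ![Z, L.bracket X Y] + Q.nablaHom Z (Q.curv ![X, Y])) = 0 :=
      LinearMap.ext fun ε => (Q.closedSum_eq X Y Z ε).symm.trans (h0 ε)
    refine (hS.jacobi_lift_lift_lift X Y Z).trans ?_
    rw [h1, κ.homSec_zero, neg_zero]
  have lls : ∀ X Y α, S.jacobiDefect (h.lift X) (h.lift Y) (κ.section α) = 0 := fun X Y α => by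
    refine (hS.jacobi_lift_lift_section X Y α).trans ?_
    rw [hQ.curvature_C, neg_add_cancel, κ.section_zero]
  have lss : ∀ X α β, S.jacobiDefect (h.lift X) (κ.section α) (κ.section β) = 0 := fun X α β => by
    rw [AnchoredBracket.jacobiDefect, S.bracket_skew (κ.section β) (h.lift X)]
    simp only [hS.bracket_section_section, hS.bracket_lift_section, S.bracket_zero_right,
      S.bracket_neg_right, neg_zero, add_zero]
  have sss : ∀ α β γ, S.jacobiDefect (κ.section α) (κ.section β) (κ.section γ) = 0 :=
    fun α β γ => by
      rw [AnchoredBracket.jacobiDefect]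
      simp only [hS.bracket_section_section, S.bracket_zero_right, add_zero]
  have rot := S.jacobiDefect_rotate
  have h1 : ∀ X Y υ, S.jacobiDefect (h.lift X) (h.lift Y) υ = 0 := fun X Y =>
    gen _ _ (lll X Y) (lls X Y)
  have h2 : ∀ X α υ, S.jacobiDefect (h.lift X) (κ.section α) υ = 0 := fun X α =>
    gen _ _ (fun Y => (rot _ _ _).trans (lls Y X α)) (lss X α)
  have h3 : ∀ α X υ, S.jacobiDefect (κ.section α) (h.lift X) υ = 0 := fun α X =>
    gen _ _ (fun Y => (rot _ _ _).symm.trans (lls X Y α))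
      (fun β => (rot _ _ _).symm.trans (lss X β α))
  have h4 : ∀ α β υ, S.jacobiDefect (κ.section α) (κ.section β) υ = 0 := fun α β =>
    gen _ _ (fun X => (rot _ _ _).trans (lss X α β)) (sss α β)
  have h5 : ∀ υ X ζ, S.jacobiDefect υ (h.lift X) ζ = 0 := fun υ X =>
    gen _ _ (fun Y => (rot _ _ _).symm.trans (h1 X Y υ)) (fun α => (rot _ _ _).symm.trans (h2 X α υ))
  have h6 : ∀ υ α ζ, S.jacobiDefect υ (κ.section α) ζ = 0 := fun υ α =>
    gen _ _ (fun X => (rot _ _ _).symm.trans (h3 α X υ)) (fun β => (rot _ _ _).symm.trans (h4 α β υ))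
  exact gen σ τ (fun X => (rot _ _ _).symm.trans (h5 τ X σ))
    (fun α => (rot _ _ _).symm.trans (h6 τ α σ)) υ

end IsModel

end DVB

section DVB
set_option linter.unusedSectionVars false
variable {EM : Type*} [NormedAddCommGroup EM] [NormedSpace ℝ EM] [FiniteDimensional ℝ EM]
  {HM : Type*} [TopologicalSpace HM] {I : ModelWithCorners ℝ EM HM}
  {M : Type*} [TopologicalSpace M] [T2Space M] [ChartedSpace HM M] [IsManifold I ∞ M]
  {FA : Type*} [NormedAddCommGroup FA] [NormedSpace ℝ FA] [FiniteDimensional ℝ FA]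
  {A : M → Type*} [TopologicalSpace (TotalSpace FA A)] [∀ m, AddCommGroup (A m)]
  [∀ m, Module ℝ (A m)] [∀ m, TopologicalSpace (A m)] [FiberBundle FA A] [VectorBundle ℝ FA A]
  [ContMDiffVectorBundle ∞ FA A I]
  {FE : Type*} [NormedAddCommGroup FE] [NormedSpace ℝ FE] [FiniteDimensional ℝ FE]
  {E : M → Type*} [TopologicalSpace (TotalSpace FE E)] [∀ m, AddCommGroup (E m)]
  [∀ m, Module ℝ (E m)] [∀ m, TopologicalSpace (E m)] [FiberBundle FE E] [VectorBundle ℝ FE E]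
  [ContMDiffVectorBundle ∞ FE E I]
  {FC : Type*} [NormedAddCommGroup FC] [NormedSpace ℝ FC] [FiniteDimensional ℝ FC]
  {C : M → Type*} [TopologicalSpace (TotalSpace FC C)] [∀ m, AddCommGroup (C m)]
  [∀ m, Module ℝ (C m)] [∀ m, TopologicalSpace (C m)] [FiberBundle FC C] [VectorBundle ℝ FC C]
  [ContMDiffVectorBundle ∞ FC C I]
  {FDE : Type*} [NormedAddCommGroup FDE] [NormedSpace ℝ FDE] [FiniteDimensional ℝ FDE]
  {DE : TotalSpace FE E → Type*} [TopologicalSpace (TotalSpace FDE DE)]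
  [∀ e, AddCommGroup (DE e)] [∀ e, Module ℝ (DE e)] [∀ e, TopologicalSpace (DE e)]
  [FiberBundle FDE DE] [VectorBundle ℝ FDE DE] [ContMDiffVectorBundle ∞ FDE DE (I.prod 𝓘(ℝ, FE))]
  {FDA : Type*} [NormedAddCommGroup FDA] [NormedSpace ℝ FDA] [FiniteDimensional ℝ FDA]
  {DA : TotalSpace FA A → Type*} [TopologicalSpace (TotalSpace FDA DA)]
  [∀ a, AddCommGroup (DA a)] [∀ a, Module ℝ (DA a)] [∀ a, TopologicalSpace (DA a)]
  [FiberBundle FDA DA] [VectorBundle ℝ FDA DA] [ContMDiffVectorBundle ∞ FDA DA (I.prod 𝓘(ℝ, FA))]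

open DoubleVectorBundle

namespace VBAlgebroid
variable {D : DoubleVectorBundle I FA A FE E FDE DE FDA DA} {κ : D.Core FC C}
  (S : VBAlgebroid κ) (h : D.HorizontalLift) {L : LieAlgebroid I FA A}

variable {S} in
theorem Induces.tproj_anchor (hI : S.Induces L) (e : TotalSpace FE E) (v : DE e) :
    tproj (S.anchor e v) = L.anchor e.proj (D.pA e v) := by
  have h1 := hI.anchor ⟨e, v⟩
  rw [D.projA_eq] at h1
  exact eq_of_heq (TotalSpace.mk.inj h1).2

theorem isLinearMap_dd_anchor (m : M) (a : A m) {f : Fun (I.prod 𝓘(ℝ, FE)) (TotalSpace FE E)}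
    (hf : IsFiberLinear f) : IsLinearMap ℝ fun x : E m × C m =>
      dd (S.anchor ⟨m, x.1⟩ (h.phi κ ⟨m, x.1⟩ (a, x.2))) f where
  map_add x y := (S.anchor_add _ _ _ (h.isSum_phi κ m a x.1 y.1 x.2 y.2)).dd_eq.2 f hf
  map_smul c x := by
    have h1 := S.anchor_scale c ⟨⟨m, x.1⟩, h.phi κ ⟨m, x.1⟩ (a, x.2)⟩
      ⟨⟨m, c • x.1⟩, h.phi κ ⟨m, c • x.1⟩ (a, c • x.2)⟩ (by
        rw [h.toA_phi, h.toA_phi]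
        exact congrArg (fun z => (⟨⟨m, a⟩, z⟩ : TotalSpace FDA DA)) ((h.lam κ m a).map_smul c x))
    refine (congrArg (fun z : TangentBundle (I.prod 𝓘(ℝ, FE)) (TotalSpace FE E) => dd z.2 f)
      h1).trans ?_
    exact dd_scale hf c _

theorem deriv_section_eq_pull (h : D.HorizontalLift) (α : Sec I FC C) {f : Fun (I.prod 𝓘(ℝ, FE)) (TotalSpace FE E)}
    (hf : IsFiberLinear f) : S.toAnchoredBracket.deriv (κ.section α) f =
      pull (pairing (S.toAnchoredBracket.deriv (κ.section α) f) (0 : Sec I FE E)) := by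
  ext ⟨m, e⟩
  have hl := S.isLinearMap_dd_anchor h m 0 hf
  have hp : ∀ (e : E m) (c : C m), dd (S.anchor ⟨m, e⟩ (h.phi κ ⟨m, e⟩ (0, c))) f =
      dd (S.anchor ⟨m, e⟩ (κ.point ⟨m, e⟩ c)) f := fun e c => by
    rw [h.phi_apply, map_zero, zero_add]
  have h1 := hl.map_add (e, 0) (0, α m)
  have h2 : dd (S.anchor ⟨m, e⟩ (h.phi κ ⟨m, e⟩ (0, 0))) f = 0 := by
    rw [hp, map_zero, map_zero]
    exact map_zero (mvfderiv (I.prod 𝓘(ℝ, FE)) f _)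
  dsimp only at h1
  rw [Prod.mk_add_mk, add_zero, zero_add, h2, zero_add] at h1
  exact ((hp e (α m)).symm.trans h1).trans (hp 0 (α m))

theorem isFiberLinear_deriv_lift (X : Sec I FA A)
    {f : Fun (I.prod 𝓘(ℝ, FE)) (TotalSpace FE E)} (hf : IsFiberLinear f) :
    IsFiberLinear (S.toAnchoredBracket.deriv (h.lift X) f) := fun m => by
  have hl := S.isLinearMap_dd_anchor h m (X m) hf
  have hp : ∀ e : E m, S.toAnchoredBracket.deriv (h.lift X) f ⟨m, e⟩ =
      dd (S.anchor ⟨m, e⟩ (h.phi κ ⟨m, e⟩ (X m, 0))) f := fun e => by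
    rw [h.phi_apply, map_zero, add_zero]
    exact congrArg (fun v => dd (S.anchor ⟨m, e⟩ v) f) (h.lift_apply X ⟨m, e⟩)
  constructor
  · intro e e'
    rw [hp, hp, hp]
    have := hl.map_add (e, 0) (e', 0)
    rwa [Prod.mk_add_mk, add_zero] at this
  · intro c e
    rw [hp, hp]
    have := hl.map_smul c (e, 0)
    rwa [Prod.smul_mk, smul_zero] at this

variable {S}

theorem Induces.deriv_pull (hI : S.Induces L) {σ : Sec (I.prod 𝓘(ℝ, FE)) FDE DE} {X : Sec I FA A}
    (hσ : ∀ e, D.pA e (σ e) = X e.proj) (g : Fun I M) :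
    S.toAnchoredBracket.deriv σ (pull g) = pull (L.deriv X g) := by
  ext e
  refine (dd_pull _ g).trans ?_
  change dd (tproj (S.anchor e (σ e))) g = _
  rw [hI.tproj_anchor, hσ]
  rfl

theorem Induces.deriv_lift_pull (hI : S.Induces L) (X : Sec I FA A) (g : Fun I M) :
    S.toAnchoredBracket.deriv (h.lift X) (pull g) = pull (L.deriv X g) :=
  hI.deriv_pull (fun e => by rw [h.lift_apply, h.pA_lin]) g

theorem Induces.deriv_section_pull (hI : S.Induces L) (α : Sec I FC C) (g : Fun I M) :
    S.toAnchoredBracket.deriv (κ.section α) (pull g) = 0 := by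
  rw [hI.deriv_pull (X := 0) (fun e => by rw [κ.section_apply, κ.pA_point]; rfl)]
  ext e
  change dd (L.anchor _ 0) g = 0
  rw [map_zero]
  exact map_zero (mvfderiv I g e.proj)

variable (S) in
/-- The map `∂` of a VB-algebroid. -/
theorem exists_bd (h : D.HorizontalLift) : ∃ b : Sec I FC C →ₗ[Fun I M] Sec I FE E, ∀ α f, IsFiberLinear f →
    S.toAnchoredBracket.deriv (κ.section α) f = -pull (pairing f (b α)) := by
  have h1 : ∀ α : Sec I FC C, ∃ s : Sec I FE E, ∀ f, IsFiberLinear f → pairing f s =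
      -pairing (S.toAnchoredBracket.deriv (κ.section α) f) (0 : Sec I FE E) := fun α => by
    refine exists_sec_pairing _ (fun f g _ _ => ?_) (fun g f hf => ?_)
    · rw [S.toAnchoredBracket.deriv_add_right, add_pairing, neg_add]
    · rw [S.toAnchoredBracket.deriv_mul, add_pairing, pull_mul_pairing]
      have : pairing (S.toAnchoredBracket.deriv (κ.section α) (pull g) * f) (0 : Sec I FE E) = 0 := by
        ext m
        have h2 : f ⟨m, 0⟩ = 0 := (hf m).map_zero
        change _ * f ⟨m, 0⟩ = 0
        rw [h2, mul_zero]
      rw [this, add_zero, mul_neg]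
  choose b hb using h1
  refine ⟨⟨⟨b, fun α β => sec_ext_pairing fun f hf => ?_⟩, fun g α =>
    sec_ext_pairing fun f hf => ?_⟩, fun α f hf => ?_⟩
  · rw [hf.pairing_add, hb _ f hf, hb _ f hf, hb _ f hf, κ.section_add,
      S.toAnchoredBracket.deriv_add_left, add_pairing, neg_add]
  · change pairing f (b (g • α)) = pairing f (g • b α)
    rw [hf.pairing_smul, hb _ f hf, hb _ f hf, κ.section_smul,
      S.toAnchoredBracket.deriv_smul_left, pull_mul_pairing, mul_neg]
  · change _ = -pull (pairing f (b α))
    rw [hb α f hf]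
    refine (S.deriv_section_eq_pull h α hf).trans ?_
    ext e
    exact (neg_neg _).symm

/-- The connection `∇^s` of a VB-algebroid. -/
theorem Induces.exists_nablaE (hI : S.Induces L) : ∃ D' : Connection L (Sec I FE E),
    ∀ X f, IsFiberLinear f → ∀ ε : Sec I FE E,
      pairing (S.toAnchoredBracket.deriv (h.lift X) f) ε =
        L.deriv X (pairing f ε) - pairing f (D'.nabla X ε) := by
  let T := S.toAnchoredBracket
  have h1 : ∀ (X : Sec I FA A) (ε : Sec I FE E), ∃ s : Sec I FE E, ∀ f, IsFiberLinear f →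
      pairing f s = L.deriv X (pairing f ε) - pairing (T.deriv (h.lift X) f) ε := fun X ε => by
    refine exists_sec_pairing _ (fun f g _ _ => ?_) (fun g f hf => ?_)
    · rw [T.deriv_add_right, add_pairing, add_pairing, L.deriv_add_right]
      abel
    · rw [T.deriv_mul, add_pairing, pull_mul_pairing, pull_mul_pairing,
        hI.deriv_lift_pull, pull_mul_pairing, L.deriv_mul]
      ring
  choose n hn using h1
  refine ⟨⟨n, fun X Y s => sec_ext_pairing fun f hf => ?_, fun g X s => sec_ext_pairing fun f hf => ?_,
    fun X s t => sec_ext_pairing fun f hf => ?_, fun X g s => sec_ext_pairing fun f hf => ?_⟩,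
    fun X f hf ε => ?_⟩
  · rw [hf.pairing_add, hn _ _ f hf, hn _ _ f hf, hn _ _ f hf, h.map_add, T.deriv_add_left,
      add_pairing, L.deriv_add_left]
    abel
  · rw [hf.pairing_smul, hn _ _ f hf, hn _ _ f hf, h.lift_smul, T.deriv_smul_left,
      pull_mul_pairing, L.deriv_smul_left]
    ring
  · rw [hf.pairing_add, hn _ _ f hf, hn _ _ f hf, hn _ _ f hf, hf.pairing_add,
      (S.isFiberLinear_deriv_lift h X hf).pairing_add, L.deriv_add_right]
    abel
  · rw [hf.pairing_add, hf.pairing_smul, hf.pairing_smul, hn _ _ f hf, hn _ _ f hf,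
      hf.pairing_smul, (S.isFiberLinear_deriv_lift h X hf).pairing_smul, L.deriv_mul]
    ring
  · change _ = L.deriv X (pairing f ε) - pairing f (n X ε)
    rw [hn X ε f hf, sub_sub_cancel]

/-- The connection `∇^c` of a VB-algebroid. -/
theorem Induces.exists_nablaC (hI : S.Induces L) : ∃ D' : Connection L (Sec I FC C),
    ∀ X α, S.bracket (h.lift X) (κ.section α) = κ.section (D'.nabla X α) := by
  let T := S.toAnchoredBracket
  have h1 : ∀ X α, ∃ β, T.bracket (h.lift X) (κ.section α) = κ.section β := fun X α => by
    obtain ⟨β, hβ⟩ := S.bracket_linear_core (h.lift X) (κ.section α) α (h.linear X)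
      (κ.isCoreSection_iff.2 rfl)
    exact ⟨β, κ.isCoreSection_iff.1 hβ⟩
  choose n hn using h1
  refine ⟨⟨n, fun X Y s => κ.section_injective ?_, fun g X s => κ.section_injective ?_,
    fun X s t => κ.section_injective ?_, fun X g s => κ.section_injective ?_⟩, hn⟩
  · rw [κ.section_add, ← hn, ← hn, ← hn, h.map_add, T.bracket_add_left]
  · rw [κ.section_smul, ← hn, ← hn, h.lift_smul, T.bracket_smul_left, hI.deriv_section_pull,
      zero_smul, sub_zero]
  · rw [κ.section_add, ← hn, ← hn, ← hn, κ.section_add, T.bracket_add_right]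
  · rw [κ.section_add, κ.section_smul, κ.section_smul, ← hn, ← hn, κ.section_smul,
      T.bracket_smul_right, hI.deriv_lift_pull]

/-- The curvature form `Ω` of a VB-algebroid. -/
theorem Induces.exists_curv (hI : S.Induces L) :
    ∃ η : Form I FA A (Sec I FE E →ₗ[Fun I M] Sec I FC C) 2, ∀ X Y,
      S.bracket (h.lift X) (h.lift Y) = h.lift (L.bracket X Y) - κ.homSec (η ![X, Y]) := by
  let T := S.toAnchoredBracket
  have h1 : ∀ X Y, ∃ Φ, κ.homSec Φ = h.lift (L.bracket X Y) - T.bracket (h.lift X) (h.lift Y) :=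
    fun X Y => by
      obtain ⟨Z, Ψ, hZ⟩ := h.exists_eq_of_isLinear κ
        (S.bracket_linear_linear _ _ (h.linear X) (h.linear Y))
      have h2 := projectsTo_iff.1 (hI.bracket _ _ X Y (h.linear X) (h.linear Y) (h.projects X)
        (h.projects Y))
      have h3 : Z = L.bracket X Y := by
        ext m
        have h4 := h2 ⟨m, 0⟩
        rw [hZ, h.pA_lift_add_homSec κ] at h4
        exact h4
      refine ⟨-Ψ, ?_⟩
      rw [κ.homSec_neg, ← h3]
      change _ = _ - S.bracket _ _
      rw [hZ]
      abel
  choose b hb using h1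
  have hskew : ∀ X Y, b X Y = -b Y X := fun X Y => κ.homSec_injective (by
    rw [κ.homSec_neg, hb, hb, L.bracket_skew X Y, h.lift_neg, T.bracket_skew]
    abel)
  have hadd : ∀ X Y Z, b (X + Y) Z = b X Z + b Y Z := fun X Y Z => κ.homSec_injective (by
    rw [κ.homSec_add, hb, hb, hb, L.bracket_add_left, h.map_add, h.map_add, T.bracket_add_left]
    abel)
  have hsmul : ∀ (f : Fun I M) X Y, b (f • X) Y = f • b X Y := fun f X Y => κ.homSec_injective (by
    have h2 : L.bracket (f • X) Y = f • L.bracket X Y + -(L.deriv Y f • X) := by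
      rw [L.bracket_skew, L.bracket_smul_right, L.bracket_skew Y X, smul_neg, neg_add, neg_neg]
    rw [κ.homSec_smul, hb, hb, h2, h.map_add, h.lift_neg, h.lift_smul, h.lift_smul, h.lift_smul,
      T.bracket_smul_left, hI.deriv_lift_pull, smul_sub]
    abel)
  have hself : ∀ X, b X X = 0 := fun X => by
    have h3 : b X X + b X X = 0 := by
      nth_rw 1 [hskew]
      exact neg_add_cancel _
    calc b X X = ((half : Fun I M) + half) • b X X := by rw [half_add_half, one_smul]
      _ = (half : Fun I M) • (b X X + b X X) := by rw [add_smul, smul_add]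
      _ = 0 := by rw [h3, smul_zero]
  obtain ⟨η, hη⟩ := exists_form_two b hadd hsmul hskew hself
  refine ⟨η, fun X Y => ?_⟩
  rw [hη, hb, sub_sub_cancel]
  rfl

theorem Induces.exists_isModel (hI : S.Induces L) :
    ∃ Q : SuperData L (Sec I FC C) (Sec I FE E), IsModel κ h Q S.toAnchoredBracket := by
  obtain ⟨b, hb⟩ := S.exists_bd h
  obtain ⟨nE, hE⟩ := hI.exists_nablaE h
  obtain ⟨nC, hC⟩ := hI.exists_nablaC h
  obtain ⟨η, hη⟩ := hI.exists_curv h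
  exact ⟨⟨b, nC, nE, η⟩, hI.tproj_anchor, hb, fun X f hf => S.isFiberLinear_deriv_lift h X hf, hE,
    hC, hη, fun α β => S.bracket_core_core _ _ α β (κ.isCoreSection_iff.2 rfl)
      (κ.isCoreSection_iff.2 rfl)⟩

theorem Induces.hasData_iff (hI : S.Induces L) {Q : SuperData L (Sec I FC C) (Sec I FE E)} :
    S.HasData h Q ↔ IsModel κ h Q S.toAnchoredBracket := by
  constructor
  · intro hD
    refine ⟨hI.tproj_anchor, fun α f hf => ?_, fun X f hf => S.isFiberLinear_deriv_lift h X hf,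
      fun X f hf ε => ?_, fun X α => ?_, fun X Y => ?_, fun α β => S.bracket_core_core _ _ α β
        (κ.isCoreSection_iff.2 rfl) (κ.isCoreSection_iff.2 rfl)⟩
    · ext e
      exact (neg_eq_iff_eq_neg.2 (hD.bd α _ (κ.isCoreSection_iff.2 rfl) f hf e)).symm
    · ext m
      have h1 := hD.nablaE X ε f hf m
      change _ = L.deriv X (pairing f ε) m - f ⟨m, Q.nablaE.nabla X ε m⟩
      rw [h1]
      exact (sub_sub_cancel _ _).symm
    · exact κ.isCoreSection_iff.1 (hD.nablaC X α _ (κ.isCoreSection_iff.2 rfl))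
    · refine Core.ext_mk_sec fun m ε => ?_
      have h1 := (κ.isPoint_iff_eq (e := ⟨m, ε m⟩)).1 (hD.curv X Y ε m)
      change _ = h.lift (L.bracket X Y) ⟨m, ε m⟩ - κ.homSec (Q.curv ![X, Y]) ⟨m, ε m⟩
      rw [κ.homSec_apply, ← h1]
      exact (sub_sub_cancel _ _).symm
  · intro hS
    refine ⟨fun α Y hY f hf e => ?_, fun X α Y hY => ?_, fun X ε f hf m => ?_, fun X Y ε m => ?_⟩
    · rw [κ.isCoreSection_iff] at hY
      subst hY
      have h1 := congrArg (fun g : Fun (I.prod 𝓘(ℝ, FE)) (TotalSpace FE E) => g e)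
        (hS.deriv_section α f hf)
      exact (neg_eq_iff_eq_neg.2 h1).symm
    · rw [κ.isCoreSection_iff] at hY ⊢
      subst hY
      exact hS.bracket_lift_section X α
    · have h1 := congrArg (fun g : Fun I M => g m) (hS.pairing_deriv_lift X f hf ε)
      change S.deriv (h.lift X) f ⟨m, ε m⟩ = L.deriv X (pairing f ε) m -
        f ⟨m, Q.nablaE.nabla X ε m⟩ at h1
      rw [h1]
      exact (sub_sub_cancel _ _).symm
    · refine (κ.isPoint_iff_eq (e := ⟨m, ε m⟩)).2 ?_
      have h1 := congrArg (fun s : Sec (I.prod 𝓘(ℝ, FE)) FDE DE => s ⟨m, ε m⟩)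
        (hS.bracket_lift_lift X Y)
      change S.bracket (h.lift X) (h.lift Y) ⟨m, ε m⟩ = h.lift (L.bracket X Y) ⟨m, ε m⟩ -
        κ.homSec (Q.curv ![X, Y]) ⟨m, ε m⟩ at h1
      rw [h1, κ.homSec_apply]
      exact sub_sub_cancel _ _

end VBAlgebroid

end DVB

section LocalBases
set_option linter.unusedSectionVars false
variable {EM HM : Type*} [NormedAddCommGroup EM] [NormedSpace ℝ EM] [FiniteDimensional ℝ EM]
  [TopologicalSpace HM] {I : ModelWithCorners ℝ EM HM} {M : Type*} [TopologicalSpace M] [T2Space M]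
  [ChartedSpace HM M] [IsManifold I ∞ M]
  {F : Type*} [NormedAddCommGroup F] [NormedSpace ℝ F] [FiniteDimensional ℝ F]
  {V : M → Type*} [TopologicalSpace (TotalSpace F V)] [∀ m, AddCommGroup (V m)]
  [∀ m, Module ℝ (V m)] [∀ m, TopologicalSpace (V m)] [FiberBundle F V] [VectorBundle ℝ F V]
  [ContMDiffVectorBundle ∞ F V I]


/-- A family of tangent vectors along a smooth map to the total space is smooth if its projection is
smooth and it maps fibrewise linear functions to smooth functions. -/
theorem contMDiff_tangent_along {EN HN : Type*} [NormedAddCommGroup EN] [NormedSpace ℝ EN]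
    [TopologicalSpace HN] {K : ModelWithCorners ℝ EN HN} {N : Type*} [TopologicalSpace N]
    [ChartedSpace HN N] {x : N → TotalSpace F V} (hx : ContMDiff K (I.prod 𝓘(ℝ, F)) ∞ x)
    {U : ∀ n, TangentSpace (I.prod 𝓘(ℝ, F)) (x n)}
    (hq : ContMDiff K I.tangent ∞ (fun n => (⟨(x n).proj, tproj (U n)⟩ : TangentBundle I M)))
    (hf : ∀ f : Fun (I.prod 𝓘(ℝ, F)) (TotalSpace F V), IsFiberLinear f →
      ContMDiff K 𝓘(ℝ) ∞ fun n => dd (U n) f) :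
    ContMDiff K (I.prod 𝓘(ℝ, F)).tangent ∞
      (fun n => (⟨x n, U n⟩ : TangentBundle (I.prod 𝓘(ℝ, F)) (TotalSpace F V))) := by
  intro n₀
  let B := localBasis I F V (x n₀).proj
  let c : N → TangentBundle 𝓘(ℝ, Fin B.n → ℝ) (Fin B.n → ℝ) := fun n =>
    ⟨fun i => B.fn i (x n), fun i => dd (U n) (B.fn i)⟩
  have hc : ContMDiff K 𝓘(ℝ, Fin B.n → ℝ).tangent ∞ c := by
    intro n
    rw [contMDiffAt_totalSpace]
    refine ⟨contMDiff_pi_space.2 (fun i => (B.fn i).contMDiff.comp hx) n, ?_⟩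
    simp only [TangentBundle.trivializationAt_apply, chartAt_self_eq]
    simp
    change ContMDiffAt K 𝓘(ℝ, Fin B.n → ℝ) ∞ (fun n i => dd (U n) (B.fn i)) n
    exact contMDiff_pi_space.2 (fun i => hf _ (B.linear i)) n
  have h1 := (B.contMDiff_synth.contMDiff_tangentMap (m := ∞) (by simp)).comp
    ((contMDiff_equivTangentBundleProd_symm (n := ∞)).comp (hq.prodMk hc))
  refine h1.contMDiffAt.congr_of_eventuallyEq ?_
  filter_upwards [hx.continuous.continuousAt.eventually
    ((FiberBundle.continuous_proj F V).continuousAt.eventually B.cutoff_eq).eventually_nhds]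
    with n hn
  have h2 : B.synth ∘ B.coords =ᶠ[nhds (x n)] id := by
    filter_upwards [hn] with z hz
    exact B.synth_coords hz
  have h3 := tangentMap_congr (I.prod 𝓘(ℝ, F)) (I.prod 𝓘(ℝ, F))
    (⟨x n, U n⟩ : TangentBundle (I.prod 𝓘(ℝ, F)) (TotalSpace F V)) h2
  rw [tangentMap_id, tangentMap_comp_at _ ((B.contMDiff_synth _).mdifferentiableAt (by simp))
    ((B.contMDiff_coords _).mdifferentiableAt (by simp))] at h3
  refine h3.symm.trans (congrArg (tangentMap _ _ B.synth) ?_)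
  exact congrArg (TotalSpace.mk (B.coords (x n))) (B.mfderiv_coords (x n) (U n))

/-- A `C^∞(M)`-linear functional on sections is a fibrewise linear function on the total space. -/
theorem exists_fn_pairing (Φ : Sec I F V →ₗ[Fun I M] Fun I M) :
    ∃ g : Fun (I.prod 𝓘(ℝ, F)) (TotalSpace F V), IsFiberLinear g ∧ ∀ s, pairing g s = Φ s := by
  have hΦ : ∀ {m : M} {s t : Sec I F V}, s m = t m → Φ s m = Φ t m := fun {m s t} h =>
    eq_of_tensorial (fun s => Φ s m) (fun s t => by rw [map_add]; rfl)
      (fun f s => by rw [map_smul]; rfl) h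
  let g : TotalSpace F V → ℝ := fun x => Φ (extend x.snd) x.proj
  have hg : ContMDiff (I.prod 𝓘(ℝ, F)) 𝓘(ℝ) ∞ g := by
    intro x
    let B := localBasis I F V x.proj
    have h1 : ContMDiffAt (I.prod 𝓘(ℝ, F)) 𝓘(ℝ) ∞
        (fun y => ∑ i, B.fn i y * (pull (Φ (B.sec i)) : Fun (I.prod 𝓘(ℝ, F)) (TotalSpace F V)) y) x :=
      contMDiffAt_finsetSum fun i _ => (B.fn i).contMDiff.contMDiffAt.smul
        (ContMDiffMap.contMDiff _).contMDiffAt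
    refine h1.congr_of_eventuallyEq ?_
    filter_upwards [(FiberBundle.continuous_proj F V).continuousAt.eventually B.cutoff_eq] with y hy
    have h2 := congrArg (fun k : Fun I M => k y.proj)
      (congrArg Φ (B.expand_sec (extend y.snd)))
    rw [map_smul, map_sum, fun_sum_apply] at h2
    have h3 : (B.cutoff • Φ (extend y.snd)) y.proj = g y := by
      change B.cutoff y.proj * Φ (extend y.snd) y.proj = _
      rw [hy, one_mul]
    rw [← h3, h2]
    refine Finset.sum_congr rfl fun i _ => ?_
    rw [map_smul]
    change B.fn i ⟨y.proj, extend y.snd y.proj⟩ * _ = _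
    rw [extend_apply]
    rfl
  refine ⟨⟨g, hg⟩, fun m => ⟨fun u v => ?_, fun c u => ?_⟩, fun s => ?_⟩
  · have h1 : Φ (extend (u + v)) m = Φ (extend u + extend v) m := hΦ (by
      change _ = (extend u : Sec I F V) m + (extend v : Sec I F V) m
      rw [extend_apply, extend_apply, extend_apply])
    rw [map_add] at h1
    exact h1
  · have h1 : Φ (extend (c • u)) m = Φ ((ContMDiffMap.const c : Fun I M) • extend u) m := hΦ (by
      change _ = c • (extend u : Sec I F V) m
      rw [extend_apply, extend_apply])
    rw [map_smul] at h1
    exact h1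
  · ext m
    exact hΦ (extend_apply _)

theorem IsFiberLinear.ext_pairing {f g : Fun (I.prod 𝓘(ℝ, F)) (TotalSpace F V)}
    (h : ∀ s : Sec I F V, pairing f s = pairing g s) : f = g := by
  ext ⟨m, v⟩
  have h1 := congrArg (fun k : Fun I M => k m) (h (extend v))
  rw [← extend_apply (I := I) (F := F) v]
  exact h1

end LocalBases

section Frames
set_option linter.unusedSectionVars false
variable {EM HM : Type*} [NormedAddCommGroup EM] [NormedSpace ℝ EM] [FiniteDimensional ℝ EM]
  [TopologicalSpace HM] {I : ModelWithCorners ℝ EM HM} {M : Type*} [TopologicalSpace M] [T2Space M]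
  [ChartedSpace HM M] [IsManifold I ∞ M]
  {FE : Type*} [NormedAddCommGroup FE] [NormedSpace ℝ FE] [FiniteDimensional ℝ FE]
  {E : M → Type*} [TopologicalSpace (TotalSpace FE E)] [∀ m, AddCommGroup (E m)]
  [∀ m, Module ℝ (E m)] [∀ m, TopologicalSpace (E m)] [FiberBundle FE E] [VectorBundle ℝ FE E]
  [ContMDiffVectorBundle ∞ FE E I]
  {FW : Type*} [NormedAddCommGroup FW] [NormedSpace ℝ FW] [FiniteDimensional ℝ FW]
  {W : M → Type*} [TopologicalSpace (TotalSpace FW W)] [∀ m, AddCommGroup (W m)]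
  [∀ m, Module ℝ (W m)] [∀ m, TopologicalSpace (W m)] [FiberBundle FW W] [VectorBundle ℝ FW W]
  [ContMDiffVectorBundle ∞ FW W I]
  {FD : Type*} [NormedAddCommGroup FD] [NormedSpace ℝ FD] [FiniteDimensional ℝ FD]
  {DE : TotalSpace FE E → Type*} [TopologicalSpace (TotalSpace FD DE)]
  [∀ e, AddCommGroup (DE e)] [∀ e, Module ℝ (DE e)] [∀ e, TopologicalSpace (DE e)]
  [FiberBundle FD DE] [VectorBundle ℝ FD DE] [ContMDiffVectorBundle ∞ FD DE (I.prod 𝓘(ℝ, FE))]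

namespace Framing
variable (Φ : Framing I FE E FW W FD DE)

/-- A bracket on pulled back sections extends to all sections by the Leibniz rule. -/
theorem exists_bracket (U : ∀ e : TotalSpace FE E, DE e →ₗ[ℝ] TangentSpace (I.prod 𝓘(ℝ, FE)) e)
    (d : Sec (I.prod 𝓘(ℝ, FE)) FD DE → Fun (I.prod 𝓘(ℝ, FE)) (TotalSpace FE E) →
      Fun (I.prod 𝓘(ℝ, FE)) (TotalSpace FE E))
    (hd : ∀ σ g e, d σ g e = dd (U e (σ e)) g)
    (B : Sec I FW W → Sec I FW W → Sec (I.prod 𝓘(ℝ, FE)) FD DE)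
    (hadd : ∀ p q r, B (p + q) r = B p r + B q r) (hskew : ∀ p q, B p q = -B q p)
    (hB : ∀ (f : Fun I M) p q, B p (f • q) =
      (pull f : Fun (I.prod 𝓘(ℝ, FE)) (TotalSpace FE E)) • B p q + d (Φ.sec p) (pull f) • Φ.sec q) :
    ∃ T : Sec (I.prod 𝓘(ℝ, FE)) FD DE → Sec (I.prod 𝓘(ℝ, FE)) FD DE →
        Sec (I.prod 𝓘(ℝ, FE)) FD DE,
      (∀ σ τ υ, T (σ + τ) υ = T σ υ + T τ υ) ∧ (∀ σ τ, T σ τ = -T τ σ) ∧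
      (∀ σ g τ, T σ (g • τ) = g • T σ τ + d σ g • τ) ∧ ∀ p q, T (Φ.sec p) (Φ.sec q) = B p q := by
  have hdadd : ∀ σ τ g, d (σ + τ) g = d σ g + d τ g := fun σ τ g => by
    ext e
    rw [hd]
    change dd (U e (σ e + τ e)) g = d σ g e + d τ g e
    rw [hd, hd, map_add, dd_add_left]
  have hdsmul : ∀ k σ g, d (k • σ) g = k * d σ g := fun k σ g => by
    ext e
    rw [hd]
    change dd (U e (k e • σ e)) g = k e * d σ g e
    rw [hd, map_smul, dd_smul_left]
  have haddr : ∀ p q r, B p (q + r) = B p q + B p r := fun p q r => by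
    rw [hskew, hadd, hskew p q, hskew p r, neg_add]
  have h1 : ∀ p, ∃ T : Sec (I.prod 𝓘(ℝ, FE)) FD DE → Sec (I.prod 𝓘(ℝ, FE)) FD DE,
      (∀ σ τ, T (σ + τ) = T σ + T τ) ∧ (∀ g σ, T (g • σ) = g • T σ + d (Φ.sec p) g • σ) ∧
      ∀ q, T (Φ.sec q) = B p q := fun p =>
    Φ.exists_derivation (d (Φ.sec p)) (fun e => U e (Φ.sec p e)) (fun g e => hd _ g e) (B p)
      (haddr p) fun f q => hB f p q
  choose P hPadd hPsmul hP using h1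
  have hPadd' : ∀ p q σ, P (p + q) σ = P p σ + P q σ := fun p q σ => by
    refine sub_eq_zero.1 (Φ.sec_eq_zero_of_tensorial (fun σ => P (p + q) σ - (P p σ + P q σ))
      (fun σ τ => ?_) (fun g σ => ?_) (fun r => ?_) σ)
    · rw [hPadd, hPadd, hPadd]
      abel
    · rw [hPsmul, hPsmul, hPsmul, Φ.sec_add, hdadd, add_smul, smul_sub, smul_add]
      abel
    · rw [hP, hP, hP, hadd, sub_self]
  have hPsmul' : ∀ (f : Fun I M) p σ, P (f • p) σ =
      (pull f : Fun (I.prod 𝓘(ℝ, FE)) (TotalSpace FE E)) • P p σ -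
        d σ (pull f) • Φ.sec p := fun f p σ => by
    refine sub_eq_zero.1 (Φ.sec_eq_zero_of_tensorial (fun σ => P (f • p) σ -
      ((pull f : Fun (I.prod 𝓘(ℝ, FE)) (TotalSpace FE E)) • P p σ - d σ (pull f) • Φ.sec p))
      (fun σ τ => ?_) (fun g σ => ?_) (fun r => ?_) σ)
    · rw [hPadd, hPadd, hdadd, smul_add, add_smul]
      abel
    · rw [hPsmul, hPsmul, Φ.sec_smul, hdsmul, hdsmul, smul_sub, smul_sub, smul_add, smul_smul,
        smul_smul, smul_smul, smul_smul, mul_comm g (pull f)]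
      abel
    · rw [hP, hP, hskew, hB, hskew r p, smul_neg]
      abel
  have h2 : ∀ τ, ∃ T : Sec (I.prod 𝓘(ℝ, FE)) FD DE → Sec (I.prod 𝓘(ℝ, FE)) FD DE,
      (∀ σ υ, T (σ + υ) = T σ + T υ) ∧ (∀ g σ, T (g • σ) = g • T σ + d τ g • σ) ∧
      ∀ p, T (Φ.sec p) = -P p τ := fun τ =>
    Φ.exists_derivation (d τ) (fun e => U e (τ e)) (fun g e => hd _ g e) (fun p => -P p τ)
      (fun p q => by rw [hPadd', neg_add]) fun f p => by
        rw [hPsmul', smul_neg, neg_sub, sub_eq_neg_add]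
  choose T hTadd hTsmul hT using h2
  have hTadd' : ∀ σ τ υ, T (σ + τ) υ = T σ υ + T τ υ := fun σ τ υ => by
    refine sub_eq_zero.1 (Φ.sec_eq_zero_of_tensorial (fun υ => T (σ + τ) υ - (T σ υ + T τ υ))
      (fun υ υ' => ?_) (fun g υ => ?_) (fun p => ?_) υ)
    · rw [hTadd, hTadd, hTadd]
      abel
    · rw [hTsmul, hTsmul, hTsmul, hdadd, add_smul, smul_sub, smul_add]
      abel
    · rw [hT, hT, hT, hPadd, neg_add, sub_self]
  have hTsmul' : ∀ g σ τ, T (g • σ) τ = g • T σ τ - d τ g • σ := fun g σ τ => by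
    refine sub_eq_zero.1 (Φ.sec_eq_zero_of_tensorial (fun τ => T (g • σ) τ - (g • T σ τ - d τ g • σ))
      (fun υ υ' => ?_) (fun k υ => ?_) (fun p => ?_) τ)
    · rw [hTadd, hTadd, hdadd, smul_add, add_smul]
      abel
    · rw [hTsmul, hTsmul, hdsmul, hdsmul, smul_sub, smul_sub, smul_add, smul_smul,
        smul_smul, smul_smul, smul_smul, mul_comm g k]
      abel
    · rw [hT, hT, hPsmul, smul_neg]
      abel
  have hsk : ∀ σ, (∀ p, T σ (Φ.sec p) + T (Φ.sec p) σ = 0) → ∀ τ, T σ τ + T τ σ = 0 := fun σ h τ => by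
    refine Φ.sec_eq_zero_of_tensorial (fun τ => T σ τ + T τ σ) (fun υ υ' => ?_) (fun k υ => ?_) h τ
    · rw [hTadd, hTadd']
      abel
    · rw [hTsmul, hTsmul', smul_add]
      abel
  refine ⟨T, hTadd', fun σ τ => eq_neg_of_add_eq_zero_left (hsk σ (fun p => ?_) τ),
    fun σ g τ => hTsmul σ g τ, fun p q => ?_⟩
  · rw [add_comm]
    refine hsk _ (fun q => ?_) σ
    rw [hT, hT, hP, hP, hskew p q, neg_neg, neg_add_cancel]
  · rw [hT, hP, ← hskew]

end Framing
end Frames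

section DVB
set_option linter.unusedSectionVars false
variable {EM : Type*} [NormedAddCommGroup EM] [NormedSpace ℝ EM] [FiniteDimensional ℝ EM]
  {HM : Type*} [TopologicalSpace HM] {I : ModelWithCorners ℝ EM HM}
  {M : Type*} [TopologicalSpace M] [T2Space M] [ChartedSpace HM M] [IsManifold I ∞ M]
  {FA : Type*} [NormedAddCommGroup FA] [NormedSpace ℝ FA] [FiniteDimensional ℝ FA]
  {A : M → Type*} [TopologicalSpace (TotalSpace FA A)] [∀ m, AddCommGroup (A m)]
  [∀ m, Module ℝ (A m)] [∀ m, TopologicalSpace (A m)] [FiberBundle FA A] [VectorBundle ℝ FA A]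
  [ContMDiffVectorBundle ∞ FA A I]
  {FE : Type*} [NormedAddCommGroup FE] [NormedSpace ℝ FE] [FiniteDimensional ℝ FE]
  {E : M → Type*} [TopologicalSpace (TotalSpace FE E)] [∀ m, AddCommGroup (E m)]
  [∀ m, Module ℝ (E m)] [∀ m, TopologicalSpace (E m)] [FiberBundle FE E] [VectorBundle ℝ FE E]
  [ContMDiffVectorBundle ∞ FE E I]
  {FC : Type*} [NormedAddCommGroup FC] [NormedSpace ℝ FC] [FiniteDimensional ℝ FC]
  {C : M → Type*} [TopologicalSpace (TotalSpace FC C)] [∀ m, AddCommGroup (C m)]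
  [∀ m, Module ℝ (C m)] [∀ m, TopologicalSpace (C m)] [FiberBundle FC C] [VectorBundle ℝ FC C]
  [ContMDiffVectorBundle ∞ FC C I]
  {FDE : Type*} [NormedAddCommGroup FDE] [NormedSpace ℝ FDE] [FiniteDimensional ℝ FDE]
  {DE : TotalSpace FE E → Type*} [TopologicalSpace (TotalSpace FDE DE)]
  [∀ e, AddCommGroup (DE e)] [∀ e, Module ℝ (DE e)] [∀ e, TopologicalSpace (DE e)]
  [FiberBundle FDE DE] [VectorBundle ℝ FDE DE] [ContMDiffVectorBundle ∞ FDE DE (I.prod 𝓘(ℝ, FE))]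
  {FDA : Type*} [NormedAddCommGroup FDA] [NormedSpace ℝ FDA] [FiniteDimensional ℝ FDA]
  {DA : TotalSpace FA A → Type*} [TopologicalSpace (TotalSpace FDA DA)]
  [∀ a, AddCommGroup (DA a)] [∀ a, Module ℝ (DA a)] [∀ a, TopologicalSpace (DA a)]
  [FiberBundle FDA DA] [VectorBundle ℝ FDA DA] [ContMDiffVectorBundle ∞ FDA DA (I.prod 𝓘(ℝ, FA))]

namespace SuperData
variable {L : LieAlgebroid I FA A} (Q : SuperData L (Sec I FC C) (Sec I FE E))

theorem exists_liftDeriv (X : Sec I FA A) {f : Fun (I.prod 𝓘(ℝ, FE)) (TotalSpace FE E)}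
    (hf : IsFiberLinear f) : ∃ g : Fun (I.prod 𝓘(ℝ, FE)) (TotalSpace FE E), IsFiberLinear g ∧
      ∀ ε, pairing g ε = L.deriv X (pairing f ε) - pairing f (Q.nablaE.nabla X ε) :=
  exists_fn_pairing
    { toFun := fun ε => L.deriv X (pairing f ε) - pairing f (Q.nablaE.nabla X ε)
      map_add' := fun ε ε' => by
        rw [hf.pairing_add, L.deriv_add_right, Q.nablaE.add_right, hf.pairing_add]
        abel
      map_smul' := fun g ε => by
        rw [hf.pairing_smul, L.deriv_mul, Q.nablaE.leibniz, hf.pairing_add, hf.pairing_smul,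
          hf.pairing_smul, RingHom.id_apply, smul_eq_mul]
        ring }

/-- The derivative along `ρ_D(X̂)` of a fibrewise linear function. -/
def liftDeriv (X : Sec I FA A) {f : Fun (I.prod 𝓘(ℝ, FE)) (TotalSpace FE E)}
    (hf : IsFiberLinear f) : Fun (I.prod 𝓘(ℝ, FE)) (TotalSpace FE E) :=
  (Q.exists_liftDeriv X hf).choose

theorem isFiberLinear_liftDeriv (X : Sec I FA A)
    {f : Fun (I.prod 𝓘(ℝ, FE)) (TotalSpace FE E)} (hf : IsFiberLinear f) :
    IsFiberLinear (Q.liftDeriv X hf) := (Q.exists_liftDeriv X hf).choose_spec.1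

theorem pairing_liftDeriv (X : Sec I FA A) {f : Fun (I.prod 𝓘(ℝ, FE)) (TotalSpace FE E)}
    (hf : IsFiberLinear f) (ε : Sec I FE E) : pairing (Q.liftDeriv X hf) ε =
      L.deriv X (pairing f ε) - pairing f (Q.nablaE.nabla X ε) :=
  (Q.exists_liftDeriv X hf).choose_spec.2 ε

theorem liftDeriv_add_left (X Y : Sec I FA A) {f : Fun (I.prod 𝓘(ℝ, FE)) (TotalSpace FE E)}
    (hf : IsFiberLinear f) :
    Q.liftDeriv (X + Y) hf = Q.liftDeriv X hf + Q.liftDeriv Y hf :=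
  IsFiberLinear.ext_pairing fun ε => by
    rw [add_pairing, Q.pairing_liftDeriv, Q.pairing_liftDeriv, Q.pairing_liftDeriv,
      L.deriv_add_left, Q.nablaE.add_left, hf.pairing_add]
    abel

theorem liftDeriv_smul_left (k : Fun I M) (X : Sec I FA A)
    {f : Fun (I.prod 𝓘(ℝ, FE)) (TotalSpace FE E)} (hf : IsFiberLinear f) :
    Q.liftDeriv (k • X) hf = pull k * Q.liftDeriv X hf :=
  IsFiberLinear.ext_pairing fun ε => by
    rw [pull_mul_pairing, Q.pairing_liftDeriv, Q.pairing_liftDeriv,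
      L.deriv_smul_left, Q.nablaE.smul_left, hf.pairing_smul]
    ring

theorem liftDeriv_congr {X Y : Sec I FA A} {f : Fun (I.prod 𝓘(ℝ, FE)) (TotalSpace FE E)}
    (hf : IsFiberLinear f) {e : TotalSpace FE E} (hXY : X e.proj = Y e.proj) :
    Q.liftDeriv X hf e = Q.liftDeriv Y hf e :=
  eq_of_tensorial (fun X => Q.liftDeriv X hf e) (fun X Y => by rw [liftDeriv_add_left]; rfl)
    (fun k X => by rw [liftDeriv_smul_left]; rfl) hXY

/-- The derivative of a fibrewise linear function along the lift of an element of `A`. -/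
def liftDerivAt {f : Fun (I.prod 𝓘(ℝ, FE)) (TotalSpace FE E)}
    (hf : IsFiberLinear f) (e : TotalSpace FE E) : A e.proj →ₗ[ℝ] ℝ where
  toFun a := Q.liftDeriv (extend a) hf e
  map_add' a b := by
    rw [Q.liftDeriv_congr (Y := extend a + extend b) hf, Q.liftDeriv_add_left]
    · rfl
    · change _ = (extend a : Sec I FA A) _ + (extend b : Sec I FA A) _
      rw [extend_apply, extend_apply, extend_apply]
  map_smul' c a := by
    rw [Q.liftDeriv_congr (Y := (ContMDiffMap.const c : Fun I M) • extend a) hf,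
      Q.liftDeriv_smul_left]
    · rfl
    · change _ = c • (extend a : Sec I FA A) _
      rw [extend_apply, extend_apply]

theorem liftDerivAt_apply {f : Fun (I.prod 𝓘(ℝ, FE)) (TotalSpace FE E)}
    (hf : IsFiberLinear f) (e : TotalSpace FE E) (X : Sec I FA A) :
    Q.liftDerivAt hf e (X e.proj) = Q.liftDeriv X hf e :=
  Q.liftDeriv_congr hf (extend_apply _)

theorem contMDiff_liftDerivAt {f : Fun (I.prod 𝓘(ℝ, FE)) (TotalSpace FE E)}
    (hf : IsFiberLinear f) {EN HN : Type*} [NormedAddCommGroup EN]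
    [NormedSpace ℝ EN] [TopologicalSpace HN] {K : ModelWithCorners ℝ EN HN} {N : Type*}
    [TopologicalSpace N] [ChartedSpace HN N] {e : N → TotalSpace FE E} {a : ∀ n, A (e n).proj}
    (he : ContMDiff K (I.prod 𝓘(ℝ, FE)) ∞ e)
    (ha : ContMDiff K (I.prod 𝓘(ℝ, FA)) ∞ fun n => (⟨(e n).proj, a n⟩ : TotalSpace FA A)) :
    ContMDiff K 𝓘(ℝ) ∞ fun n => Q.liftDerivAt hf (e n) (a n) := by
  intro n₀
  let B := localBasis I FA A (e n₀).proj
  have h1 : ContMDiffAt K 𝓘(ℝ) ∞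
      (fun n => ∑ i, B.fn i ⟨(e n).proj, a n⟩ * Q.liftDeriv (B.sec i) hf (e n)) n₀ :=
    contMDiffAt_finsetSum fun i _ => ((B.fn i).contMDiff.comp ha).contMDiffAt.smul
      ((Q.liftDeriv (B.sec i) hf).contMDiff.comp he).contMDiffAt
  refine h1.congr_of_eventuallyEq ?_
  filter_upwards [(((FiberBundle.continuous_proj FE E).comp he.continuous).continuousAt
    (x := n₀)).eventually B.cutoff_eq] with n hn
  have h2 := congrArg (Q.liftDerivAt hf (e n)) (B.expand (e n).proj (a n))
  have h3 : B.cutoff (e n).proj = 1 := hn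
  rw [h3, one_smul, map_sum] at h2
  rw [h2]
  refine Finset.sum_congr rfl fun i _ => ?_
  rw [map_smul, Q.liftDerivAt_apply]
  rfl

open DoubleVectorBundle

variable {D : DoubleVectorBundle I FA A FE E FDE DE FDA DA} (κ : D.Core FC C) (h : D.HorizontalLift)

theorem exists_anchor_apply (e : TotalSpace FE E) (v : DE e) :
    ∃ t : TangentSpace (I.prod 𝓘(ℝ, FE)) e, tproj t = L.anchor e.proj (D.pA e v) ∧
      ∀ f (hf : IsFiberLinear f), dd t f = Q.liftDerivAt hf e (D.pA e v) -
        f ⟨e.proj, homMap Q.bd e.proj (h.pC κ e v)⟩ := by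
  let X : Sec I FA A := extend (D.pA e v)
  let ε : Sec I FE E := extend e.snd
  have hX : X e.proj = D.pA e v := extend_apply _
  let R : Fun (I.prod 𝓘(ℝ, FE)) (TotalSpace FE E) → ℝ := fun f =>
    L.deriv X (pairing f ε) e.proj - f ⟨e.proj, Q.nablaE.nabla X ε e.proj⟩ -
      f ⟨e.proj, homMap Q.bd e.proj (h.pC κ e v)⟩
  have hadd : ∀ f g, IsFiberLinear f → IsFiberLinear g → R (f + g) = R f + R g := fun f g _ _ => by
    change L.deriv X (pairing f ε + pairing g ε) e.proj - (_ + _) - (_ + _) = _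
    rw [L.deriv_add_right]
    change L.deriv X (pairing f ε) e.proj + L.deriv X (pairing g ε) e.proj -
      (f _ + g _) - (f _ + g _) = (_ - _ - _ : ℝ) + (_ - _ - _ : ℝ)
    ring
  have hmul : ∀ (k : Fun I M) f, IsFiberLinear f → R (pull k * f) =
      k e.proj * R f + dd (L.anchor e.proj (D.pA e v)) k * f e := fun k f _ => by
    change L.deriv X (k * pairing f ε) e.proj - k e.proj * _ - k e.proj * _ = _
    rw [L.deriv_mul]
    change (k e.proj * L.deriv X (pairing f ε) e.proj + dd (L.anchor e.proj (X e.proj)) k *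
      f ⟨e.proj, ε e.proj⟩) - k e.proj * f ⟨e.proj, Q.nablaE.nabla X ε e.proj⟩ -
      k e.proj * f ⟨e.proj, homMap Q.bd e.proj (h.pC κ e v)⟩ = k e.proj * (_ - _ - _) + _
    rw [hX, extend_apply]
    ring
  obtain ⟨t, ht, htf⟩ := exists_tangent e (L.anchor e.proj (D.pA e v)) R hadd hmul
  refine ⟨t, ht, fun f hf => ?_⟩
  rw [htf f hf, ← hX, Q.liftDerivAt_apply]
  have h1 := congrArg (fun g : Fun I M => g e.proj) (Q.pairing_liftDeriv X hf ε)
  change Q.liftDeriv X hf ⟨e.proj, ε e.proj⟩ = L.deriv X (pairing f ε) e.proj -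
    f ⟨e.proj, Q.nablaE.nabla X ε e.proj⟩ at h1
  have h2 : (⟨e.proj, ε e.proj⟩ : TotalSpace FE E) = e :=
    congrArg (TotalSpace.mk e.proj) (extend_apply _)
  rw [h2] at h1
  rw [h1]

/-- The anchor of `D → E` determined by the data `Q`. -/
def anchor (e : TotalSpace FE E) : DE e →ₗ[ℝ] TangentSpace (I.prod 𝓘(ℝ, FE)) e where
  toFun v := (Q.exists_anchor_apply κ h e v).choose
  map_add' v w := by
    have hv := (Q.exists_anchor_apply κ h e v).choose_spec
    have hw := (Q.exists_anchor_apply κ h e w).choose_spec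
    have hvw := (Q.exists_anchor_apply κ h e (v + w)).choose_spec
    refine tangent_ext ?_ fun f hf => ?_
    · refine hvw.1.trans ?_
      rw [map_add, map_add]
      refine (congrArg₂ (· + ·) hv.1 hw.1).symm.trans ?_
      exact (map_add (mfderiv (I.prod 𝓘(ℝ, FE)) I TotalSpace.proj e) _ _).symm
    · refine (hvw.2 f hf).trans ?_
      refine Eq.trans ?_ (dd_add_left _ _ f).symm
      rw [hv.2 f hf, hw.2 f hf, map_add (D.pA e), map_add (Q.liftDerivAt hf e),
        map_add (h.pC κ e), (isLinearMap_homMap Q.bd e.proj).map_add,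
        (hf e.proj).map_add]
      ring
  map_smul' c v := by
    have hv := (Q.exists_anchor_apply κ h e v).choose_spec
    have hcv := (Q.exists_anchor_apply κ h e (c • v)).choose_spec
    refine tangent_ext ?_ fun f hf => ?_
    · refine hcv.1.trans ?_
      rw [map_smul, map_smul]
      refine (congrArg (c • ·) hv.1).symm.trans ?_
      exact (map_smul (mfderiv (I.prod 𝓘(ℝ, FE)) I TotalSpace.proj e) _ _).symm
    · refine (hcv.2 f hf).trans ?_
      refine Eq.trans ?_ (dd_smul_left _ _ f).symm
      rw [hv.2 f hf, map_smul (D.pA e), map_smul (Q.liftDerivAt hf e), map_smul (h.pC κ e),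
        (isLinearMap_homMap Q.bd e.proj).map_smul,
        (hf e.proj).map_smul, smul_eq_mul, smul_eq_mul]
      exact (mul_sub _ _ _).symm

theorem tproj_anchor (e : TotalSpace FE E) (v : DE e) :
    tproj (Q.anchor κ h e v) = L.anchor e.proj (D.pA e v) :=
  (Q.exists_anchor_apply κ h e v).choose_spec.1

theorem dd_anchor (e : TotalSpace FE E) (v : DE e)
    {f : Fun (I.prod 𝓘(ℝ, FE)) (TotalSpace FE E)} (hf : IsFiberLinear f) :
    dd (Q.anchor κ h e v) f = Q.liftDerivAt hf e (D.pA e v) -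
      f ⟨e.proj, homMap Q.bd e.proj (h.pC κ e v)⟩ :=
  (Q.exists_anchor_apply κ h e v).choose_spec.2 f hf

theorem contMDiff_anchor : ContMDiff ((I.prod 𝓘(ℝ, FE)).prod 𝓘(ℝ, FDE)) (I.prod 𝓘(ℝ, FE)).tangent ∞
    (fun v : TotalSpace FDE DE => (⟨v.proj, Q.anchor κ h v.proj v.snd⟩ :
      TangentBundle (I.prod 𝓘(ℝ, FE)) (TotalSpace FE E))) := by
  have h0 : ContMDiff ((I.prod 𝓘(ℝ, FE)).prod 𝓘(ℝ, FDE)) (I.prod 𝓘(ℝ, FE)) ∞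
      (fun v : TotalSpace FDE DE => v.proj) := contMDiff_proj DE
  have h1 := contMDiff_pullbackSum_iff.1 (h.contMDiff_phi_symm κ)
  have hA : ContMDiff ((I.prod 𝓘(ℝ, FE)).prod 𝓘(ℝ, FDE)) (I.prod 𝓘(ℝ, FA)) ∞
      (fun v : TotalSpace FDE DE =>
        (⟨v.proj.proj, D.pA v.proj v.snd⟩ : TotalSpace FA A)) :=
    h1.2.1.congr fun v => by
      change _ = (⟨v.proj.proj, ((h.phi κ v.proj).symm v.snd).1⟩ : TotalSpace FA A)
      rw [h.phi_symm]
  have hC : ContMDiff ((I.prod 𝓘(ℝ, FE)).prod 𝓘(ℝ, FDE)) (I.prod 𝓘(ℝ, FC)) ∞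
      (fun v : TotalSpace FDE DE =>
        (⟨v.proj.proj, h.pC κ v.proj v.snd⟩ : TotalSpace FC C)) := h1.2.2
  refine contMDiff_tangent_along h0 ?_ fun f hf => ?_
  · refine (L.anchor_smooth.comp hA).congr fun v => ?_
    rw [Q.tproj_anchor]
    rfl
  · have h2 := f.contMDiff.comp ((contMDiff_homMap Q.bd).comp hC)
    refine ((Q.contMDiff_liftDerivAt hf h0 hA).sub h2).congr fun v => ?_
    exact Q.dd_anchor κ h v.proj v.snd hf

end SuperData

end DVB

section DVB
set_option linter.unusedSectionVars false
variable {EM : Type*} [NormedAddCommGroup EM] [NormedSpace ℝ EM] [FiniteDimensional ℝ EM]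
  {HM : Type*} [TopologicalSpace HM] {I : ModelWithCorners ℝ EM HM}
  {M : Type*} [TopologicalSpace M] [T2Space M] [ChartedSpace HM M] [IsManifold I ∞ M]
  {FA : Type*} [NormedAddCommGroup FA] [NormedSpace ℝ FA] [FiniteDimensional ℝ FA]
  {A : M → Type*} [TopologicalSpace (TotalSpace FA A)] [∀ m, AddCommGroup (A m)]
  [∀ m, Module ℝ (A m)] [∀ m, TopologicalSpace (A m)] [FiberBundle FA A] [VectorBundle ℝ FA A]
  [ContMDiffVectorBundle ∞ FA A I]
  {FE : Type*} [NormedAddCommGroup FE] [NormedSpace ℝ FE] [FiniteDimensional ℝ FE]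
  {E : M → Type*} [TopologicalSpace (TotalSpace FE E)] [∀ m, AddCommGroup (E m)]
  [∀ m, Module ℝ (E m)] [∀ m, TopologicalSpace (E m)] [FiberBundle FE E] [VectorBundle ℝ FE E]
  [ContMDiffVectorBundle ∞ FE E I]
  {FC : Type*} [NormedAddCommGroup FC] [NormedSpace ℝ FC] [FiniteDimensional ℝ FC]
  {C : M → Type*} [TopologicalSpace (TotalSpace FC C)] [∀ m, AddCommGroup (C m)]
  [∀ m, Module ℝ (C m)] [∀ m, TopologicalSpace (C m)] [FiberBundle FC C] [VectorBundle ℝ FC C]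
  [ContMDiffVectorBundle ∞ FC C I]
  {FDE : Type*} [NormedAddCommGroup FDE] [NormedSpace ℝ FDE] [FiniteDimensional ℝ FDE]
  {DE : TotalSpace FE E → Type*} [TopologicalSpace (TotalSpace FDE DE)]
  [∀ e, AddCommGroup (DE e)] [∀ e, Module ℝ (DE e)] [∀ e, TopologicalSpace (DE e)]
  [FiberBundle FDE DE] [VectorBundle ℝ FDE DE] [ContMDiffVectorBundle ∞ FDE DE (I.prod 𝓘(ℝ, FE))]
  {FDA : Type*} [NormedAddCommGroup FDA] [NormedSpace ℝ FDA] [FiniteDimensional ℝ FDA]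
  {DA : TotalSpace FA A → Type*} [TopologicalSpace (TotalSpace FDA DA)]
  [∀ a, AddCommGroup (DA a)] [∀ a, Module ℝ (DA a)] [∀ a, TopologicalSpace (DA a)]
  [FiberBundle FDA DA] [VectorBundle ℝ FDA DA] [ContMDiffVectorBundle ∞ FDA DA (I.prod 𝓘(ℝ, FA))]

open DoubleVectorBundle

namespace SuperData
variable {L : LieAlgebroid I FA A} (Q : SuperData L (Sec I FC C) (Sec I FE E))
  {D : DoubleVectorBundle I FA A FE E FDE DE FDA DA} (κ : D.Core FC C) (h : D.HorizontalLift)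

/-- The derivative of a function on `E` along the anchor of a section of `D → E`. -/
def anchorDeriv (σ : Sec (I.prod 𝓘(ℝ, FE)) FDE DE)
    (g : Fun (I.prod 𝓘(ℝ, FE)) (TotalSpace FE E)) : Fun (I.prod 𝓘(ℝ, FE)) (TotalSpace FE E) :=
  ⟨fun e => dd (Q.anchor κ h e (σ e)) g,
    contMDiff_fieldDeriv ((Q.contMDiff_anchor κ h).comp σ.contMDiff) g.contMDiff⟩

theorem anchorDeriv_apply (σ : Sec (I.prod 𝓘(ℝ, FE)) FDE DE)
    (g : Fun (I.prod 𝓘(ℝ, FE)) (TotalSpace FE E)) (e : TotalSpace FE E) :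
    Q.anchorDeriv κ h σ g e = dd (Q.anchor κ h e (σ e)) g := rfl

/-- The bracket of `X̂ + α` and `Ŷ + β`. -/
def bracketGen (p q : Sec I FA A × Sec I FC C) : Sec (I.prod 𝓘(ℝ, FE)) FDE DE :=
  h.lift (L.bracket p.1 q.1) - κ.homSec (Q.curv ![p.1, q.1]) +
    κ.section (Q.nablaC.nabla p.1 q.2 - Q.nablaC.nabla q.1 p.2)

theorem bracketGen_skew (p q : Sec I FA A × Sec I FC C) :
    Q.bracketGen κ h p q = -Q.bracketGen κ h q p := by
  rw [bracketGen, bracketGen, L.bracket_skew, h.lift_neg, Q.curv_swap, κ.homSec_neg, κ.section_sub,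
    κ.section_sub]
  abel

theorem bracketGen_add_left (p q r : Sec I FA A × Sec I FC C) :
    Q.bracketGen κ h (p + q) r = Q.bracketGen κ h p r + Q.bracketGen κ h q r := by
  have h1 : Q.curv ![p.1 + q.1, r.1] = Q.curv ![p.1, r.1] + Q.curv ![q.1, r.1] :=
    Q.curv.map_vecCons_add ![r.1] p.1 q.1
  rw [bracketGen, bracketGen, bracketGen, Prod.fst_add, Prod.snd_add, L.bracket_add_left, h.map_add,
    h1, κ.homSec_add, Q.nablaC.add_left, Q.nablaC.add_right, κ.section_sub, κ.section_sub,
    κ.section_sub, κ.section_add, κ.section_add]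
  abel

theorem bracketGen_smul_right (f : Fun I M) (p q : Sec I FA A × Sec I FC C) :
    Q.bracketGen κ h p (f • q) =
      (pull f : Fun (I.prod 𝓘(ℝ, FE)) (TotalSpace FE E)) • Q.bracketGen κ h p q +
        (pull (L.deriv p.1 f) : Fun (I.prod 𝓘(ℝ, FE)) (TotalSpace FE E)) •
          (h.lift q.1 + κ.section q.2) := by
  have h1 : Q.curv ![p.1, f • q.1] = f • Q.curv ![p.1, q.1] := by
    rw [Q.curv_swap (f • q.1) p.1, Q.curv_swap q.1 p.1, smul_neg]
    exact congrArg Neg.neg (Q.curv.map_vecCons_smul ![p.1] f q.1)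
  rw [bracketGen, bracketGen, Prod.smul_fst, Prod.smul_snd, L.bracket_smul_right, h.map_add,
    h.lift_smul, h.lift_smul, h1, κ.homSec_smul, Q.nablaC.leibniz, Q.nablaC.smul_left,
    κ.section_sub, κ.section_sub, κ.section_add, κ.section_smul, κ.section_smul, κ.section_smul,
    smul_add, smul_add, smul_sub, smul_sub]
  abel

/-- The data `Q` determine an anchored bracket on `D → E`. -/
theorem exists_isModel : ∃ S : AnchoredBracket (I.prod 𝓘(ℝ, FE)) FDE DE, IsModel κ h Q S := by
  let Φ := h.framing κ
  let P := secProd I FA A FC C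
  have hP : ∀ p, Φ.sec p = h.lift (P.symm p).1 + κ.section (P.symm p).2 := fun p => by
    conv_lhs => rw [← P.apply_symm_apply p]
    exact h.framing_sec κ _ _
  have hpull : ∀ (p : Sec I (FA × FC) (A ×ᵇ C)) (f : Fun I M),
      Q.anchorDeriv κ h (Φ.sec p) (pull f) = pull (L.deriv (P.symm p).1 f) := fun p f => by
    ext e
    refine (dd_pull _ f).trans ?_
    rw [Q.tproj_anchor, hP]
    change dd (L.anchor _ (D.pA e (h.lift _ e + κ.section _ e))) f = _
    rw [map_add, h.lift_apply, h.pA_lin, κ.section_apply, κ.pA_point, add_zero]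
    rfl
  obtain ⟨T, hadd, hskew, hleib, hT⟩ := Φ.exists_bracket (Q.anchor κ h) (Q.anchorDeriv κ h)
    (Q.anchorDeriv_apply κ h) (fun p q => Q.bracketGen κ h (P.symm p) (P.symm q))
    (fun p q r => Q.bracketGen_add_left κ h (P.symm p) (P.symm q) (P.symm r))
    (fun p q => Q.bracketGen_skew κ h _ _)
    (fun f p q => by
      rw [hpull, hP q]
      exact Q.bracketGen_smul_right κ h f (P.symm p) (P.symm q))
  have hgen : ∀ X α Y β, T (h.lift X + κ.section α) (h.lift Y + κ.section β) =
      Q.bracketGen κ h (X, α) (Y, β) := fun X α Y β => by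
    rw [← h.framing_sec κ, ← h.framing_sec κ, hT, P.symm_apply_apply, P.symm_apply_apply]
  have hnl : ∀ α, Q.nablaC.nabla 0 α = 0 := fun α => by
    have := Q.nablaC.smul_left 0 0 α
    rwa [zero_smul, zero_smul] at this
  have hb0 : ∀ X, L.bracket X 0 = 0 := L.toAnchoredBracket.bracket_zero_right
  have hc0 : ∀ X, Q.curv ![X, 0] = 0 := fun X => Q.curv.map_coord_zero (m := ![X, 0]) 1 rfl
  have hlift : ∀ X f (hf : IsFiberLinear f),
      Q.anchorDeriv κ h (h.lift X) f = Q.liftDeriv X hf := fun X f hf => by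
    ext e
    refine (Q.dd_anchor κ h e _ hf).trans ?_
    have h1 : h.pC κ e (h.lift X e) = 0 := by
      refine congrArg Prod.snd ((h.phi κ e).symm_apply_eq.2 ?_ :
        (h.phi κ e).symm (h.lift X e) = (X e.proj, 0))
      rw [h.phi_apply, map_zero, add_zero, h.lift_apply]
    rw [h1, h.lift_apply, h.pA_lin, (isLinearMap_homMap Q.bd e.proj).map_zero,
      (hf e.proj).map_zero, sub_zero, Q.liftDerivAt_apply]
  refine ⟨⟨Q.anchor κ h, Q.contMDiff_anchor κ h, T, hadd, hskew, fun σ g τ e => ?_⟩,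
    Q.tproj_anchor κ h, fun α f hf => ?_, fun X f hf => ?_, fun X f hf ε => ?_, fun X α => ?_,
    fun X Y => ?_, fun α β => ?_⟩
  · exact congrArg (fun s : Sec (I.prod 𝓘(ℝ, FE)) FDE DE => s e) (hleib σ g τ)
  · ext e
    refine (Q.dd_anchor κ h e _ hf).trans ?_
    have h1 : h.pC κ e (κ.section α e) = α e.proj := by
      refine congrArg Prod.snd ((h.phi κ e).symm_apply_eq.2 ?_ :
        (h.phi κ e).symm (κ.section α e) = (0, α e.proj))
      rw [h.phi_apply, map_zero, zero_add, κ.section_apply]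
    rw [h1, κ.section_apply, κ.pA_point, map_zero, zero_sub, homMap_apply]
    rfl
  · change IsFiberLinear (Q.anchorDeriv κ h (h.lift X) f)
    rw [hlift X f hf]
    exact Q.isFiberLinear_liftDeriv X hf
  · change pairing (Q.anchorDeriv κ h (h.lift X) f) ε = _
    rw [hlift X f hf]
    exact Q.pairing_liftDeriv X hf ε
  · have h1 := hgen X 0 0 α
    rw [κ.section_zero, h.lift_zero, add_zero, zero_add, bracketGen, hb0, hc0, hnl, h.lift_zero,
      κ.homSec_zero, sub_zero, sub_zero, zero_add] at h1
    exact h1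
  · have h1 := hgen X 0 Y 0
    rw [κ.section_zero, add_zero, add_zero, bracketGen, Q.nablaC.nabla_zero, Q.nablaC.nabla_zero,
      sub_zero, κ.section_zero, add_zero] at h1
    exact h1
  · have h1 := hgen 0 α 0 β
    rw [h.lift_zero, zero_add, zero_add, bracketGen, hb0, hc0, hnl, hnl, h.lift_zero,
      κ.homSec_zero, sub_zero, sub_zero, zero_add, κ.section_zero] at h1
    exact h1

end SuperData

end DVB

section DVB
set_option linter.unusedSectionVars false
variable {EM : Type*} [NormedAddCommGroup EM] [NormedSpace ℝ EM] [FiniteDimensional ℝ EM]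
  {HM : Type*} [TopologicalSpace HM] {I : ModelWithCorners ℝ EM HM}
  {M : Type*} [TopologicalSpace M] [T2Space M] [ChartedSpace HM M] [IsManifold I ∞ M]
  {FA : Type*} [NormedAddCommGroup FA] [NormedSpace ℝ FA] [FiniteDimensional ℝ FA]
  {A : M → Type*} [TopologicalSpace (TotalSpace FA A)] [∀ m, AddCommGroup (A m)]
  [∀ m, Module ℝ (A m)] [∀ m, TopologicalSpace (A m)] [FiberBundle FA A] [VectorBundle ℝ FA A]
  [ContMDiffVectorBundle ∞ FA A I]
  {FE : Type*} [NormedAddCommGroup FE] [NormedSpace ℝ FE] [FiniteDimensional ℝ FE]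
  {E : M → Type*} [TopologicalSpace (TotalSpace FE E)] [∀ m, AddCommGroup (E m)]
  [∀ m, Module ℝ (E m)] [∀ m, TopologicalSpace (E m)] [FiberBundle FE E] [VectorBundle ℝ FE E]
  [ContMDiffVectorBundle ∞ FE E I]
  {FC : Type*} [NormedAddCommGroup FC] [NormedSpace ℝ FC] [FiniteDimensional ℝ FC]
  {C : M → Type*} [TopologicalSpace (TotalSpace FC C)] [∀ m, AddCommGroup (C m)]
  [∀ m, Module ℝ (C m)] [∀ m, TopologicalSpace (C m)] [FiberBundle FC C] [VectorBundle ℝ FC C]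
  [ContMDiffVectorBundle ∞ FC C I]
  {FDE : Type*} [NormedAddCommGroup FDE] [NormedSpace ℝ FDE] [FiniteDimensional ℝ FDE]
  {DE : TotalSpace FE E → Type*} [TopologicalSpace (TotalSpace FDE DE)]
  [∀ e, AddCommGroup (DE e)] [∀ e, Module ℝ (DE e)] [∀ e, TopologicalSpace (DE e)]
  [FiberBundle FDE DE] [VectorBundle ℝ FDE DE] [ContMDiffVectorBundle ∞ FDE DE (I.prod 𝓘(ℝ, FE))]
  {FDA : Type*} [NormedAddCommGroup FDA] [NormedSpace ℝ FDA] [FiniteDimensional ℝ FDA]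
  {DA : TotalSpace FA A → Type*} [TopologicalSpace (TotalSpace FDA DA)]
  [∀ a, AddCommGroup (DA a)] [∀ a, Module ℝ (DA a)] [∀ a, TopologicalSpace (DA a)]
  [FiberBundle FDA DA] [VectorBundle ℝ FDA DA] [ContMDiffVectorBundle ∞ FDA DA (I.prod 𝓘(ℝ, FA))]

open DoubleVectorBundle

namespace IsModel
variable {D : DoubleVectorBundle I FA A FE E FDE DE FDA DA} {κ : D.Core FC C}
  {h : D.HorizontalLift} {L : LieAlgebroid I FA A} {Q : SuperData L (Sec I FC C) (Sec I FE E)}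
  {S : AnchoredBracket (I.prod 𝓘(ℝ, FE)) FDE DE} (hS : IsModel κ h Q S)
include hS

theorem bracket_homSec_homSec (Φ Ψ : Sec I FE E →ₗ[Fun I M] Sec I FC C) :
    S.bracket (κ.homSec Φ) (κ.homSec Ψ) = κ.homSec (Φ ∘ₗ Q.bd ∘ₗ Ψ - Ψ ∘ₗ Q.bd ∘ₗ Φ) := by
  refine Core.ext_mk_sec fun m ε => ?_
  let B := localBasis I FE E m
  have h1 := S.bracket_smul_right (κ.homSec Φ) (pull B.cutoff) (κ.homSec Ψ)
  rw [κ.expand_homSec, S.bracket_sum_right, hS.deriv_homSec_pull, zero_smul, add_zero] at h1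
  have h2 := congrArg (fun s : Sec (I.prod 𝓘(ℝ, FE)) FDE DE => s ⟨m, ε m⟩) h1
  have h4 : B.cutoff m = 1 := B.cutoff_self
  change _ = B.cutoff m • S.bracket (κ.homSec Φ) (κ.homSec Ψ) ⟨m, ε m⟩ at h2
  rw [h4, one_smul] at h2
  rw [← h2, κ.homSec_apply]
  have h5 : ∀ i, S.bracket (κ.homSec Φ) (B.fn i • κ.section (Ψ (B.sec i))) ⟨m, ε m⟩ =
      κ.point ⟨m, ε m⟩ ((pairing (B.fn i) ε • Φ (Q.bd (Ψ (B.sec i))) +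
        -pairing (B.fn i) (Q.bd (Φ ε)) • Ψ (B.sec i)) m) := fun i => by
    rw [S.bracket_smul_right, hS.bracket_homSec_section, ← hS.pairing_deriv_homSec Φ (B.linear i)]
    exact ((map_add (κ.point ⟨m, ε m⟩) _ _).trans (congrArg₂ (· + ·)
      (map_smul (κ.point ⟨m, ε m⟩) _ _) (map_smul (κ.point ⟨m, ε m⟩) _ _))).symm
  have h6 : (∑ i, (pairing (B.fn i) ε • Φ (Q.bd (Ψ (B.sec i))) +
        -pairing (B.fn i) (Q.bd (Φ ε)) • Ψ (B.sec i))) =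
      B.cutoff • (Φ ∘ₗ Q.bd ∘ₗ Ψ - Ψ ∘ₗ Q.bd ∘ₗ Φ) ε := by
    have h7 := congrArg (Φ ∘ₗ Q.bd ∘ₗ Ψ) (B.expand_sec ε)
    have h8 := congrArg Ψ (B.expand_sec (Q.bd (Φ ε)))
    rw [map_smul, map_sum] at h7 h8
    rw [LinearMap.sub_apply, smul_sub, h7]
    change _ = _ - B.cutoff • Ψ (Q.bd (Φ ε))
    rw [h8, ← Finset.sum_sub_distrib]
    refine Finset.sum_congr rfl fun i _ => ?_
    rw [map_smul, map_smul, neg_smul, sub_eq_add_neg]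
    rfl
  have h9 : (B.cutoff • (Φ ∘ₗ Q.bd ∘ₗ Ψ - Ψ ∘ₗ Q.bd ∘ₗ Φ) ε) m =
      (Φ ∘ₗ Q.bd ∘ₗ Ψ - Ψ ∘ₗ Q.bd ∘ₗ Φ) ε m := by
    change B.cutoff m • (Φ ∘ₗ Q.bd ∘ₗ Ψ - Ψ ∘ₗ Q.bd ∘ₗ Φ) ε m = _
    rw [h4, one_smul]
  dsimp only
  rw [sum_sec_apply, Finset.sum_congr rfl fun i _ => h5 i, ← map_sum, ← sum_sec_apply, h6, h9]

theorem bracket_linear (X Y : Sec I FA A) (Φ Ψ : Sec I FE E →ₗ[Fun I M] Sec I FC C) :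
    S.bracket (h.lift X + κ.homSec Φ) (h.lift Y + κ.homSec Ψ) = h.lift (L.bracket X Y) +
      κ.homSec (-Q.curv ![X, Y] + Q.nablaHom X Ψ - Q.nablaHom Y Φ +
        (Φ ∘ₗ Q.bd ∘ₗ Ψ - Ψ ∘ₗ Q.bd ∘ₗ Φ)) := by
  rw [S.bracket_add_left, S.bracket_add_right, S.bracket_add_right, hS.bracket_lift_lift,
    hS.bracket_lift_homSec, S.bracket_skew (κ.homSec Φ) (h.lift Y), hS.bracket_lift_homSec,
    hS.bracket_homSec_homSec, κ.homSec_add, κ.homSec_sub, κ.homSec_sub, κ.homSec_add, κ.homSec_neg]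
  abel

theorem bracket_linear_section (X : Sec I FA A) (Φ : Sec I FE E →ₗ[Fun I M] Sec I FC C)
    (α : Sec I FC C) : S.bracket (h.lift X + κ.homSec Φ) (κ.section α) =
      κ.section (Q.nablaC.nabla X α + Φ (Q.bd α)) := by
  rw [S.bracket_add_left, hS.bracket_lift_section, hS.bracket_homSec_section, κ.section_add]

theorem dd_anchor_phi (m : M) (e : E m) (a : A m) (c : C m)
    {f : Fun (I.prod 𝓘(ℝ, FE)) (TotalSpace FE E)} (hf : IsFiberLinear f) :
    dd (S.anchor ⟨m, e⟩ (h.phi κ ⟨m, e⟩ (a, c))) f =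
      S.deriv (h.lift (extend a)) f ⟨m, e⟩ - f ⟨m, homMap Q.bd m c⟩ := by
  have h1 : dd (S.anchor ⟨m, e⟩ (h.lin ⟨m, e⟩ a)) f =
      S.deriv (h.lift (extend a)) f ⟨m, e⟩ := by
    rw [S.deriv_apply, h.lift_apply, extend_apply]
  have h2 : dd (S.anchor ⟨m, e⟩ (κ.point ⟨m, e⟩ c)) f = -f ⟨m, homMap Q.bd m c⟩ := by
    have h3 := congrArg (fun g : Fun (I.prod 𝓘(ℝ, FE)) (TotalSpace FE E) => g ⟨m, e⟩)
      (hS.deriv_section (extend c) f hf)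
    change dd (S.anchor ⟨m, e⟩ (κ.point ⟨m, e⟩ ((extend c : Sec I FC C) m))) f =
      -f ⟨m, Q.bd (extend c) m⟩ at h3
    rw [extend_apply] at h3
    exact h3
  rw [h.phi_apply, map_add, sub_eq_add_neg, ← h1, ← h2]
  exact dd_add_left _ _ f

theorem tproj_anchor_phi (m : M) (e : E m) (a : A m) (c : C m) :
    tproj (S.anchor ⟨m, e⟩ (h.phi κ ⟨m, e⟩ (a, c))) = L.anchor m a := by
  rw [hS.tproj_anchor, h.pA_phi]

theorem tangentMap_proj_anchor (d : TotalSpace FDE DE) :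
    tangentMap (I.prod 𝓘(ℝ, FE)) I TotalSpace.proj
      (⟨d.proj, S.anchor d.proj d.snd⟩ : TangentBundle (I.prod 𝓘(ℝ, FE)) (TotalSpace FE E)) =
      L.anchorMap (D.toA d).proj := by
  rw [show (D.toA d).proj = ⟨d.proj.proj, D.pA d.proj d.snd⟩ from D.projA_eq d.proj d.snd]
  exact congrArg (TotalSpace.mk d.proj.proj) (hS.tproj_anchor d.proj d.snd)

end IsModel

theorem DoubleVectorBundle.HorizontalLift.exists_toA_eq
    {D : DoubleVectorBundle I FA A FE E FDE DE FDA DA} (κ : D.Core FC C) (h : D.HorizontalLift)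
    {d : TotalSpace FDE DE} {b : TotalSpace FA A} {y : DA b} (hd : D.toA d = ⟨b, y⟩) :
    ∃ x : E b.proj × C b.proj, h.lam κ b.proj b.snd x = y ∧
      d = ⟨⟨b.proj, x.1⟩, h.phi κ ⟨b.proj, x.1⟩ (b.snd, x.2)⟩ := by
  obtain ⟨x, hx⟩ := (h.lam_bijective κ b.proj b.snd).2 y
  refine ⟨x, hx, D.toA.injective (hd.trans ?_)⟩
  rw [← hx]
  exact (h.toA_phi κ b.proj b.snd x.1 x.2).symm

namespace IsModel
variable [CompleteSpace EM] {D : DoubleVectorBundle I FA A FE E FDE DE FDA DA} {κ : D.Core FC C}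
  {h : D.HorizontalLift} {L : LieAlgebroid I FA A} {Q : SuperData L (Sec I FC C) (Sec I FE E)}
  {S : AnchoredBracket (I.prod 𝓘(ℝ, FE)) FDE DE}

/-- The VB-algebroid structure determined by compatible data. -/
def toVBAlgebroid (hS : IsModel κ h Q S) (hQ : Q.Compatible) : VBAlgebroid κ where
  toLieAlgebroid := S.toLieAlgebroid (hS.jacobi hQ) (hS.anchor_bracket hQ)
  anchor_over := ⟨L.anchorMap, hS.tangentMap_proj_anchor⟩
  anchor_add d₁ d₂ d := by
    rintro ⟨⟨m, a⟩, u, v, h₁, h₂, h₃⟩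
    obtain ⟨⟨e₁, c₁⟩, hx₁, rfl⟩ := h.exists_toA_eq κ h₁
    obtain ⟨⟨e₂, c₂⟩, hx₂, rfl⟩ := h.exists_toA_eq κ h₂
    have hd : d = ⟨⟨m, e₁ + e₂⟩, h.phi κ ⟨m, e₁ + e₂⟩ (a, c₁ + c₂)⟩ := by
      refine D.toA.injective (h₃.trans ?_)
      rw [← hx₁, ← hx₂, ← _root_.map_add]
      exact (h.toA_phi κ m a _ _).symm
    subst hd
    refine tangentSum_of_dd _ _ _ ?_ ?_ fun f hf => ?_
    · exact (hS.tproj_anchor_phi m e₁ a c₁).trans (hS.tproj_anchor_phi m _ a _).symm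
    · exact (hS.tproj_anchor_phi m e₂ a c₂).trans (hS.tproj_anchor_phi m _ a _).symm
    · have h1 := (hS.isFiberLinear_deriv_lift (extend a) f hf m).map_add e₁ e₂
      have h2 := (hf m).map_add (homMap Q.bd m c₁) (homMap Q.bd m c₂)
      refine (hS.dd_anchor_phi m _ a _ hf).trans ?_
      refine Eq.trans ?_ (congrArg₂ (· + ·) (hS.dd_anchor_phi m e₁ a c₁ hf)
        (hS.dd_anchor_phi m e₂ a c₂ hf)).symm
      rw [(isLinearMap_homMap Q.bd m).map_add, h1, h2]
      exact add_sub_add_comm _ _ _ _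
  anchor_scale c d d' hd := by
    obtain ⟨⟨⟨m, a⟩, y⟩, hy⟩ : ∃ z, D.toA d = z := ⟨_, rfl⟩
    rw [hy] at hd
    obtain ⟨⟨e, x⟩, hx, rfl⟩ := h.exists_toA_eq κ hy
    have hd' : d' = ⟨⟨m, c • e⟩, h.phi κ ⟨m, c • e⟩ (a, c • x)⟩ := by
      refine D.toA.injective (hd.trans ?_)
      rw [← hx]
      refine Eq.trans ?_ (h.toA_phi κ m a _ _).symm
      exact congrArg (TotalSpace.mk (⟨m, a⟩ : TotalSpace FA A))
        ((h.lam κ m a).map_smul c (e, x)).symm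
    subst hd'
    refine tangentMap_scale_eq c _ _ ?_ fun f hf => ?_
    · exact (hS.tproj_anchor_phi m _ a _).trans (hS.tproj_anchor_phi m e a x).symm
    · have h1 := (hS.isFiberLinear_deriv_lift (extend a) f hf m).map_smul c e
      have h2 := (hf m).map_smul c (homMap Q.bd m x)
      refine (hS.dd_anchor_phi m _ a _ hf).trans ?_
      refine Eq.trans ?_ (congrArg (c * ·) (hS.dd_anchor_phi m e a x hf)).symm
      rw [(isLinearMap_homMap Q.bd m).map_smul, h1, h2]
      exact (mul_sub _ _ _).symm
  bracket_linear_linear X Y hX hY := by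
    obtain ⟨X, Φ, rfl⟩ := h.exists_eq_of_isLinear κ hX
    obtain ⟨Y, Ψ, rfl⟩ := h.exists_eq_of_isLinear κ hY
    change D.IsLinear (S.bracket _ _)
    rw [hS.bracket_linear]
    exact h.isLinear_lift_add_homSec κ _ _
  bracket_linear_core X Y α hX hY := by
    obtain ⟨X, Φ, rfl⟩ := h.exists_eq_of_isLinear κ hX
    rw [κ.isCoreSection_iff] at hY
    subst hY
    exact ⟨_, κ.isCoreSection_iff.2 (hS.bracket_linear_section X Φ α)⟩
  bracket_core_core X Y α β hX hY := by
    rw [κ.isCoreSection_iff] at hX hY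
    subst hX hY
    exact hS.bracket_section_section α β

theorem induces_toVBAlgebroid (hS : IsModel κ h Q S) (hQ : Q.Compatible) :
    (hS.toVBAlgebroid hQ).Induces L where
  anchor := hS.tangentMap_proj_anchor
  bracket X Y X₀ Y₀ hX hY hX₀ hY₀ := by
    obtain ⟨X, Φ, rfl⟩ := h.exists_eq_of_isLinear κ hX
    obtain ⟨Y, Ψ, rfl⟩ := h.exists_eq_of_isLinear κ hY
    have key : ∀ {X X₀ : Sec I FA A} {Φ : Sec I FE E →ₗ[Fun I M] Sec I FC C},
        D.ProjectsTo (h.lift X + κ.homSec Φ) X₀ → X = X₀ := fun {X X₀ Φ} hX => by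
      ext m
      have h1 := projectsTo_iff.1 hX ⟨m, 0⟩
      rwa [h.pA_lift_add_homSec κ] at h1
    rw [← key hX₀, ← key hY₀, projectsTo_iff]
    intro e
    change D.pA e (S.bracket _ _ e) = _
    rw [hS.bracket_linear, h.pA_lift_add_homSec κ]

end IsModel

end DVB

section DVB
set_option linter.unusedSectionVars false
variable {EM : Type*} [NormedAddCommGroup EM] [NormedSpace ℝ EM] [FiniteDimensional ℝ EM]
  {HM : Type*} [TopologicalSpace HM] {I : ModelWithCorners ℝ EM HM}
  {M : Type*} [TopologicalSpace M] [T2Space M] [ChartedSpace HM M] [IsManifold I ∞ M]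
  {FA : Type*} [NormedAddCommGroup FA] [NormedSpace ℝ FA] [FiniteDimensional ℝ FA]
  {A : M → Type*} [TopologicalSpace (TotalSpace FA A)] [∀ m, AddCommGroup (A m)]
  [∀ m, Module ℝ (A m)] [∀ m, TopologicalSpace (A m)] [FiberBundle FA A] [VectorBundle ℝ FA A]
  [ContMDiffVectorBundle ∞ FA A I]
  {FE : Type*} [NormedAddCommGroup FE] [NormedSpace ℝ FE] [FiniteDimensional ℝ FE]
  {E : M → Type*} [TopologicalSpace (TotalSpace FE E)] [∀ m, AddCommGroup (E m)]
  [∀ m, Module ℝ (E m)] [∀ m, TopologicalSpace (E m)] [FiberBundle FE E] [VectorBundle ℝ FE E]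
  [ContMDiffVectorBundle ∞ FE E I]
  {FC : Type*} [NormedAddCommGroup FC] [NormedSpace ℝ FC] [FiniteDimensional ℝ FC]
  {C : M → Type*} [TopologicalSpace (TotalSpace FC C)] [∀ m, AddCommGroup (C m)]
  [∀ m, Module ℝ (C m)] [∀ m, TopologicalSpace (C m)] [FiberBundle FC C] [VectorBundle ℝ FC C]
  [ContMDiffVectorBundle ∞ FC C I]
  {FDE : Type*} [NormedAddCommGroup FDE] [NormedSpace ℝ FDE] [FiniteDimensional ℝ FDE]
  {DE : TotalSpace FE E → Type*} [TopologicalSpace (TotalSpace FDE DE)]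
  [∀ e, AddCommGroup (DE e)] [∀ e, Module ℝ (DE e)] [∀ e, TopologicalSpace (DE e)]
  [FiberBundle FDE DE] [VectorBundle ℝ FDE DE] [ContMDiffVectorBundle ∞ FDE DE (I.prod 𝓘(ℝ, FE))]
  {FDA : Type*} [NormedAddCommGroup FDA] [NormedSpace ℝ FDA] [FiniteDimensional ℝ FDA]
  {DA : TotalSpace FA A → Type*} [TopologicalSpace (TotalSpace FDA DA)]
  [∀ a, AddCommGroup (DA a)] [∀ a, Module ℝ (DA a)] [∀ a, TopologicalSpace (DA a)]
  [FiberBundle FDA DA] [VectorBundle ℝ FDA DA] [ContMDiffVectorBundle ∞ FDA DA (I.prod 𝓘(ℝ, FA))]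

open DoubleVectorBundle

namespace IsModel
variable {D : DoubleVectorBundle I FA A FE E FDE DE FDA DA} {κ : D.Core FC C}
  {h : D.HorizontalLift} {L : LieAlgebroid I FA A} {Q : SuperData L (Sec I FC C) (Sec I FE E)}
  {S S' : AnchoredBracket (I.prod 𝓘(ℝ, FE)) FDE DE}

theorem anchor_eq (hS : IsModel κ h Q S) (hS' : IsModel κ h Q S') : S.anchor = S'.anchor := by
  funext ⟨m, e⟩
  refine LinearMap.ext fun v => ?_
  obtain ⟨⟨a, c⟩, rfl⟩ := (h.phi κ ⟨m, e⟩).surjective v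
  refine tangent_ext ?_ fun f hf => ?_
  · exact (hS.tproj_anchor_phi m e a c).trans (hS'.tproj_anchor_phi m e a c).symm
  · refine (hS.dd_anchor_phi m e a c hf).trans (Eq.trans ?_ (hS'.dd_anchor_phi m e a c hf).symm)
    have h1 : S.deriv (h.lift (extend a)) f = S'.deriv (h.lift (extend a)) f :=
      IsFiberLinear.ext_pairing fun ε => by
        rw [hS.pairing_deriv_lift _ f hf, hS'.pairing_deriv_lift _ f hf]
    rw [h1]

theorem bracket_eq (hS : IsModel κ h Q S) (hS' : IsModel κ h Q S') : S.bracket = S'.bracket := by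
  have hd : ∀ σ f, S.deriv σ f = S'.deriv σ f := fun σ f => by
    ext e
    rw [S.deriv_apply, S'.deriv_apply, hS.anchor_eq hS']
  have gen : ∀ σ, (∀ X, S.bracket σ (h.lift X) = S'.bracket σ (h.lift X)) →
      (∀ α, S.bracket σ (κ.section α) = S'.bracket σ (κ.section α)) →
      ∀ τ, S.bracket σ τ = S'.bracket σ τ := fun σ h1 h2 τ => by
    ext e
    refine sub_eq_zero.1 (h.eq_zero_of_generators κ (e := e)
      (fun τ => S.bracket σ τ e - S'.bracket σ τ e) (fun τ υ => ?_) (fun g τ => ?_)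
      (fun X => ?_) (fun α => ?_) τ)
    · rw [S.bracket_add_right, S'.bracket_add_right]
      exact add_sub_add_comm _ _ _ _
    · rw [S.bracket_smul_right, S'.bracket_smul_right, hd]
      change (g e • S.bracket σ τ e + S'.deriv σ g e • τ e) -
        (g e • S'.bracket σ τ e + S'.deriv σ g e • τ e) =
        g e • (S.bracket σ τ e - S'.bracket σ τ e)
      rw [add_sub_add_right_eq_sub, smul_sub]
    · rw [h1, sub_self]
    · rw [h2, sub_self]
  have hl : ∀ X τ, S.bracket (h.lift X) τ = S'.bracket (h.lift X) τ := fun X =>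
    gen _ (fun Y => by rw [hS.bracket_lift_lift, hS'.bracket_lift_lift])
      fun α => by rw [hS.bracket_lift_section, hS'.bracket_lift_section]
  have hs : ∀ α τ, S.bracket (κ.section α) τ = S'.bracket (κ.section α) τ := fun α =>
    gen _ (fun X => by rw [S.bracket_skew, S'.bracket_skew, hl])
      fun β => by rw [hS.bracket_section_section, hS'.bracket_section_section]
  funext σ τ
  exact gen σ (fun X => by rw [S.bracket_skew, S'.bracket_skew, hl])
    (fun α => by rw [S.bracket_skew, S'.bracket_skew, hs]) τ

end IsModel

section Correspondence
variable {D : DoubleVectorBundle I FA A FE E FDE DE FDA DA} {κ : D.Core FC C}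
  {L : LieAlgebroid I FA A}

theorem VBAlgebroid.eq_of_isModel {h : D.HorizontalLift}
    {Q : SuperData L (Sec I FC C) (Sec I FE E)} {S S' : VBAlgebroid κ}
    (hS : IsModel κ h Q S.toAnchoredBracket) (hS' : IsModel κ h Q S'.toAnchoredBracket) : S = S' :=
  VBAlgebroid.ext (hS.anchor_eq hS') (hS.bracket_eq hS')

variable [CompleteSpace EM]

theorem IsModel.compatible_of_vbAlgebroid {h : D.HorizontalLift}
    {Q : SuperData L (Sec I FC C) (Sec I FE E)} {S : VBAlgebroid κ}
    (hS : IsModel κ h Q S.toAnchoredBracket) : Q.Compatible :=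
  hS.compatible S.toLieAlgebroid.deriv_bracket S.jacobi

theorem SuperData.flat_iff (Q : SuperData L (Sec I FC C) (Sec I FE E)) :
    Q.op * Q.op = 0 ↔ Q.Compatible :=
  Q.flat_iff_compatible (hasLocalBases_sec.prod hasLocalBases_sec) L.curvature_trivialConnection

theorem VBAlgebroid.Induces.existsUnique_hasData {S : VBAlgebroid κ} (hI : S.Induces L)
    (h : D.HorizontalLift) :
    (∃! Q : SuperData L (Sec I FC C) (Sec I FE E), S.HasData h Q) ∧
      ∀ Q : SuperData L (Sec I FC C) (Sec I FE E), S.HasData h Q → Q.op * Q.op = 0 := by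
  refine ⟨?_, fun Q hQ => Q.flat_iff.2 ((hI.hasData_iff h).1 hQ).compatible_of_vbAlgebroid⟩
  obtain ⟨Q, hQ⟩ := hI.exists_isModel h
  exact ⟨Q, (hI.hasData_iff h).2 hQ, fun Q' hQ' => ((hI.hasData_iff h).1 hQ').unique hQ⟩

/-- VB-algebroid structures correspond to flat superconnections. -/
theorem exists_isCanonical (h : D.HorizontalLift) :
    ∃ Θ : VBAlgebroidOver L κ ≃ FlatSuperconnection L (Sec I FC C) (Sec I FE E),
      IsCanonical L h Θ := by
  let e : SuperData L (Sec I FC C) (Sec I FE E) ≃ Superconnection L (Sec I FC C) (Sec I FE E) :=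
    superEquiv (hasLocalBases_sec.prod hasLocalBases_sec)
  have heop : ∀ Q, (e Q).op = Q.op := fun Q => rfl
  choose Q hQ using fun S : VBAlgebroidOver L κ => S.2.exists_isModel h
  let Θ : VBAlgebroidOver L κ → FlatSuperconnection L (Sec I FC C) (Sec I FE E) := fun S =>
    ⟨e (Q S), (Q S).flat_iff.2 (hQ S).compatible_of_vbAlgebroid⟩
  have hΘ : Function.Bijective Θ := by
    constructor
    · intro S S' hSS'
      have h1 : Q S = Q S' := e.injective (congrArg Subtype.val hSS')
      have h2 := hQ S
      rw [h1] at h2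
      exact Subtype.ext (VBAlgebroid.eq_of_isModel h2 (hQ S'))
    · rintro ⟨𝒟, h𝒟⟩
      obtain ⟨R, rfl⟩ := e.surjective 𝒟
      have hR : R.Compatible := R.flat_iff.1 h𝒟
      obtain ⟨T, hT⟩ := R.exists_isModel κ h
      let S : VBAlgebroidOver L κ := ⟨hT.toVBAlgebroid hR, hT.induces_toVBAlgebroid hR⟩
      have hS : IsModel κ h R S.1.toAnchoredBracket := hT
      exact ⟨S, Subtype.ext (congrArg e ((hQ S).unique hS))⟩
  refine ⟨Equiv.ofBijective Θ hΘ, fun S R => ?_⟩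
  rw [S.2.hasData_iff h]
  constructor
  · intro hR
    rw [hR.unique (hQ S)]
    rfl
  · intro hR
    have h1 : Q S = R := e.injective (Superconnection.ext hR)
    rw [← h1]
    exact hQ S

end Correspondence

end DVB

end VBAlgebroids
end

/-- `A`, `E`, `C` are vector bundles over the manifold `M`, `L` is a Lie algebroid structure on `A`,
and `D` is a double vector bundle with side bundles `A` and `E` and core `C`. -/
theorem mainTheorem1
    {EM : Type*} [NormedAddCommGroup EM] [NormedSpace ℝ EM] [FiniteDimensional ℝ EM]
    {HM : Type*} [TopologicalSpace HM] {I : ModelWithCorners ℝ EM HM} [I.Boundaryless]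
    {M : Type*} [TopologicalSpace M] [T2Space M] [SigmaCompactSpace M] [ChartedSpace HM M]
    [IsManifold I ∞ M]
    {FA : Type*} [NormedAddCommGroup FA] [NormedSpace ℝ FA] [FiniteDimensional ℝ FA]
    {A : M → Type*} [TopologicalSpace (TotalSpace FA A)] [∀ m, AddCommGroup (A m)]
    [∀ m, Module ℝ (A m)] [∀ m, TopologicalSpace (A m)] [FiberBundle FA A] [VectorBundle ℝ FA A]
    [ContMDiffVectorBundle ∞ FA A I]
    {FE : Type*} [NormedAddCommGroup FE] [NormedSpace ℝ FE] [FiniteDimensional ℝ FE]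
    {E : M → Type*} [TopologicalSpace (TotalSpace FE E)] [∀ m, AddCommGroup (E m)]
    [∀ m, Module ℝ (E m)] [∀ m, TopologicalSpace (E m)] [FiberBundle FE E] [VectorBundle ℝ FE E]
    [ContMDiffVectorBundle ∞ FE E I]
    {FC : Type*} [NormedAddCommGroup FC] [NormedSpace ℝ FC] [FiniteDimensional ℝ FC]
    {C : M → Type*} [TopologicalSpace (TotalSpace FC C)] [∀ m, AddCommGroup (C m)]
    [∀ m, Module ℝ (C m)] [∀ m, TopologicalSpace (C m)] [FiberBundle FC C] [VectorBundle ℝ FC C]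
    [ContMDiffVectorBundle ∞ FC C I]
    {FDE : Type*} [NormedAddCommGroup FDE] [NormedSpace ℝ FDE] [FiniteDimensional ℝ FDE]
    {DE : TotalSpace FE E → Type*} [TopologicalSpace (TotalSpace FDE DE)]
    [∀ e, AddCommGroup (DE e)] [∀ e, Module ℝ (DE e)] [∀ e, TopologicalSpace (DE e)]
    [FiberBundle FDE DE] [VectorBundle ℝ FDE DE] [ContMDiffVectorBundle ∞ FDE DE (I.prod 𝓘(ℝ, FE))]
    {FDA : Type*} [NormedAddCommGroup FDA] [NormedSpace ℝ FDA] [FiniteDimensional ℝ FDA]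
    {DA : TotalSpace FA A → Type*} [TopologicalSpace (TotalSpace FDA DA)]
    [∀ a, AddCommGroup (DA a)] [∀ a, Module ℝ (DA a)] [∀ a, TopologicalSpace (DA a)]
    [FiberBundle FDA DA] [VectorBundle ℝ FDA DA] [ContMDiffVectorBundle ∞ FDA DA (I.prod 𝓘(ℝ, FA))]
    (L : LieAlgebroid I FA A) (D : DoubleVectorBundle I FA A FE E FDE DE FDA DA)
    (κ : D.Core FC C) :
    -- the correspondence for the decomposed double vector bundle `A ⊕ E ⊕ C`
    (∃ Θ : VBAlgebroidOver L (decomposedCore I FA A FE E FC C) ≃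
        FlatSuperconnection L (Sec I FC C) (Sec I FE E),
      IsCanonical L (decomposedLift I FA A FE E FC C) Θ) ∧
    -- horizontal lifts are equivalent to decompositions
    ((∀ h : D.HorizontalLift, ∃! Ψ : Decomposition κ, Ψ.Induces h) ∧
      (∀ Ψ : Decomposition κ, ∃! h : D.HorizontalLift, Ψ.Induces h)) ∧
    -- the data obtained from a horizontal lift form a flat superconnection
    (∀ S : VBAlgebroid κ, S.Induces L → ∀ h : D.HorizontalLift,
      (∃! Q : SuperData L (Sec I FC C) (Sec I FE E), S.HasData h Q) ∧
      ∀ Q : SuperData L (Sec I FC C) (Sec I FE E), S.HasData h Q → Q.op * Q.op = 0) ∧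
    -- the correspondence determined by a horizontal lift
    (∀ h : D.HorizontalLift,
      ∃ Θ : VBAlgebroidOver L κ ≃ FlatSuperconnection L (Sec I FC C) (Sec I FE E),
        IsCanonical L h Θ) ∧
    -- superconnections in terms of `∂`, `∇^c`, `∇^s` and `Ω`
    (∃ Θ : SuperData L (Sec I FC C) (Sec I FE E) ≃ Superconnection L (Sec I FC C) (Sec I FE E),
      ∀ Q, (Θ Q).op = Q.op ∧ ((Θ Q).IsFlat ↔ Q.Compatible)) := by
  have : CompleteSpace EM := FiniteDimensional.complete ℝ EM
  refine ⟨exists_isCanonical (decomposedLift I FA A FE E FC C),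
    Decomposition.existsUnique_induces κ, fun S hI h => hI.existsUnique_hasData h,
    fun h => exists_isCanonical h,
    superEquiv (hasLocalBases_sec.prod hasLocalBases_sec), fun Q => ⟨rfl, Q.flat_iff⟩⟩
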